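/- **Setting.** Let $\ell\ge 2$, $0<k<\ell$, $r\ge 2$ be integers and let $\mathcal M\subset\mathbb R^\ell$ be an embedded $k$-dimensional submanifold of class $C^r$. Let $\mathcal U\subset\mathbb R^\ell$ be open and $\phi:\mathcal U\to\mathcal M$ a map of class $C^{r-1}$ (a normal projection) such that $x-\phi(x)\perp T_{\phi(x)}\mathcal M$ and $\epsilon x+(1-\epsilon)\phi(x)\in\mathcal U$ for all $x\in\mathcal U$, $\epsilon\in[0,1]$, and $\phi(p)=p$ for all $p\in\mathcal M\cap\mathcal U$. Let $\Omega$ be a nonempty bounded domain (open connected set) in $\mathbb R^\ell$ with $\operatorname{Cl}\Omega\subset\mathcal U$, and suppose that $\Omega$ has connected normal sections, i.e. $\Omega_p:=\{x\in\Omega\mid\phi(x)=p\}$ is connected (possibly empty) for every $p\in\mathcal M$. Functions are identified when they agree almost everywhere, and $\mathcal H^m$ is $m$-dimensional Hausdorff measure, normalized to agree with Lebesgue measure on $\mathbb R^m$. For $x\in\mathcal U$ let $P(x)$ be the orthogonal projection of $\mathbb R^\ell$ onto $(T_{\phi(x)}\mathcal M)^\perp$, let $J_0(x):=|\det (D\phi(x)|_{T_{\phi(x)}\mathcal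 M})|$, and with $\Phi_\epsilon(x):=\epsilon x+(1-\epsilon)\phi(x)$ let $S_0(x):=\lim_{\epsilon\to0^+}\big(D\Phi_\epsilon^{-1}(\Phi_\epsilon(x))-\tfrac1\epsilon P(x)\big)$. Put $$H^1_s(\Omega):=\{u\in H^1(\Omega)\mid P(x)\nabla u(x)=0\text{ a.e. in }\Omega\},$$ let $L^2_s(\Omega)$ be the closure of $H^1_s(\Omega)$ in $L^2(\Omega)$, and $$b_0(u,w):=\int_\Omega J_0\,u\,w\,dx\quad\text{on }L^2_s(\Omega),\qquad a_0(u,w):=\int_\Omega J_0\,\langle S_0^T\nabla u,S_0^T\nabla w\rangle\,dx\quad\text{on }H^1_s(\Omega).$$ Let $\mathcal G:=\phi(\Omega)$ and $\mu(p):=\mathcal H^{\ell-k}(\Omega_p)$ for $p\in\mathcal G$. A function $v\in L^2_{\rm loc}(\mathcal G)$ belongs to $H^1_{\rm loc}(\mathcal G)$ if there is a tangent vector field $\nabla v\in L^2_{\rm loc}(\mathcal G)$ with $\int_{\mathcal G}v\operatorname{div}\Psi\,d\mathcal H^k=-\int_{\mathcal G}\langle\nabla v,\Psi\rangle\,d\mathcal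 H^k$ for all tangent vector fields $\Psi$ of class $C^{r-1}$ with compact support in $\mathcal G$. Define $$L^2(\mu,\mathcal G):=\{v\in L^2_{\rm loc}(\mathcal G)\mid\mu^{1/2}v\in L^2(\mathcal G)\},\qquad b_\mu(v_1,v_2):=\int_{\mathcal G}\mu\,v_1v_2\,d\mathcal H^k,$$ $$H^1(\mu,\mathcal G):=\{v\in H^1_{\rm loc}(\mathcal G)\mid\mu^{1/2}v\in L^2(\mathcal G),\ \mu^{1/2}\nabla v\in L^2(\mathcal G)\},\qquad a_\mu(v_1,v_2):=\int_{\mathcal G}\mu\,\langle\nabla v_1,\nabla v_2\rangle\,d\mathcal H^k.$$ **Theorem 3.4.** $(L^2(\mu,\mathcal G),b_\mu)$, $(H^1(\mu,\mathcal G),a_\mu+b_\mu)$, $(L^2_s(\Omega),b_0)$ and $(H^1_s(\Omega),a_0+b_0)$ are Hilbert spaces. For every $u\in L^2_s(\Omega)$ there is exactly one $v=:j(u)\in L^2(\mu,\mathcal G)$ with $u(x)=v(\phi(x))$ for a.e. $x\in\Omega$. The map $j$ is a linear isometry of $(L^2_s(\Omega),b_0)$ onto $(L^2(\mu,\mathcal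 G),b_\mu)$, and its restriction to $H^1_s(\Omega)$ is an isometry of $(H^1_s(\Omega),a_0+b_0)$ onto $(H^1(\mu,\mathcal G),a_\mu+b_\mu)$. The pairs $(a_0,b_0)$ and $(a_\mu,b_\mu)$ generate self-adjoint operators $A_0$ in $(L^2_s(\Omega),b_0)$ and $A_\mu$ in $(L^2(\mu,\mathcal G),b_\mu)$, given by $$A_0u=w\iff u\in H^1_s(\Omega)\text{ and }a_0(u,z)=b_0(w,z)\ \ \forall z\in H^1_s(\Omega),$$ $$A_\mu v=w\iff v\in H^1(\mu,\mathcal G)\text{ and }a_\mu(v,z)=b_\mu(w,z)\ \ \forall z\in H^1(\mu,\mathcal G),$$ where $w$ ranges over $L^2_s(\Omega)$, respectively $L^2(\mu,\mathcal G)$. Finally $j(D(A_0))=D(A_\mu)$, and $A_0=j^{-1}A_\mu j'$ with $j':=j|_{D(A_0)}$. -/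

import Mathlib

open MeasureTheory Set Filter Topology
open scoped ContDiff ENNReal

noncomputable section

namespace CurvedThin

/-- The ambient Euclidean space `ℝ^ℓ`. -/
abbrev Euc (ℓ : ℕ) : Type := EuclideanSpace ℝ (Fin ℓ)

/-! ### Geometry -/

/-- `M ⊆ ℝ^ℓ` is an embedded `k`-dimensional submanifold of class `C^r`: around each of its points
there is a `C^r` diffeomorphism between open sets carrying `M` to the slice `ℝ^k × {0}`. -/
def IsEmbeddedSubmanifold {ℓ : ℕ} (k r : ℕ) (M : Set (Euc ℓ)) : Prop :=
  ∀ p ∈ M, ∃ e : OpenPartialHomeomorph (Euc ℓ) (Euc k × Euc (ℓ - k)),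
    p ∈ e.source ∧ ContDiffOn ℝ r e e.source ∧ ContDiffOn ℝ r e.symm e.target ∧
      ∀ x ∈ e.source, (x ∈ M ↔ (e x).2 = 0)

/-- The tangent space `T_p M`, as a linear subspace of `ℝ^ℓ`: the span of the tangent directions
of `M` at `p` (which already form a linear space when `M` is an embedded submanifold). -/
def tangentSubspace {ℓ : ℕ} (M : Set (Euc ℓ)) (p : Euc ℓ) : Submodule ℝ (Euc ℓ) :=
  Submodule.span ℝ (tangentConeAt ℝ M p)

/-- The compression of a linear map `L` of `ℝ^ℓ` to a linear endomorphism of the subspace `T`. It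
is the restriction of `L` to `T` whenever `L` maps `T` into itself. -/
def compress {ℓ : ℕ} (T : Submodule ℝ (Euc ℓ)) (L : Euc ℓ →L[ℝ] Euc ℓ) : T →ₗ[ℝ] T :=
  (T.orthogonalProjectionOnto ∘L L ∘L T.subtypeL).toLinearMap

/-- `U` is an open set with a normal projection `φ : U → M` of class `C^(r-1)`: `x - φ x` is
orthogonal to `T_{φ x} M`, `φ` fixes the points of `M ∩ U`, and `U` contains the segment from
`φ x` to `x`, for every `x ∈ U`. (Values of `φ` outside `U` are irrelevant.) -/
structure IsTubularNbhd {ℓ : ℕ} (r : ℕ) (M U : Set (Euc ℓ)) (φ : Euc ℓ → Euc ℓ) : Prop where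
  isOpen : IsOpen U
  contDiffOn : ContDiffOn ℝ ((r - 1 : ℕ) : ℕ∞) φ U
  mapsTo : MapsTo φ U M
  normal : ∀ x ∈ U, x - φ x ∈ (tangentSubspace M (φ x))ᗮ
  fixed : ∀ p ∈ M ∩ U, φ p = p
  segment : ∀ x ∈ U, ∀ ε ∈ Icc (0 : ℝ) 1, ε • x + (1 - ε) • φ x ∈ U

/-- The curved squeezing map `Φ_ε x = ε x + (1 - ε) φ x`. -/
def squeeze {ℓ : ℕ} (φ : Euc ℓ → Euc ℓ) (ε : ℝ) (x : Euc ℓ) : Euc ℓ :=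
  ε • x + (1 - ε) • φ x

/-- `P x`, the orthogonal projection of `ℝ^ℓ` onto the orthogonal complement of `T_{φ x} M`. -/
def normalProj {ℓ : ℕ} (M : Set (Euc ℓ)) (φ : Euc ℓ → Euc ℓ) (x : Euc ℓ) : Euc ℓ →L[ℝ] Euc ℓ :=
  ContinuousLinearMap.id ℝ (Euc ℓ) - (tangentSubspace M (φ x)).starProjection

/-- `J₀ x`, the absolute value of the determinant of `Dφ x` restricted to `T_{φ x} M`. -/
def J₀ {ℓ : ℕ} (M : Set (Euc ℓ)) (φ : Euc ℓ → Euc ℓ) (x : Euc ℓ) : ℝ :=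
  |LinearMap.det (compress (tangentSubspace M (φ x)) (fderiv ℝ φ x))|

/-- `S₀ x`, the limit in operator norm, as `ε → 0⁺`, of `D(Φ_ε⁻¹)(Φ_ε x) - ε⁻¹ P x`, where
`Φ_ε⁻¹` is the inverse of the restriction of `Φ_ε` to `U`. -/
def S₀ {ℓ : ℕ} (M U : Set (Euc ℓ)) (φ : Euc ℓ → Euc ℓ) (x : Euc ℓ) : Euc ℓ →L[ℝ] Euc ℓ :=
  limUnder (𝓝[>] (0 : ℝ)) fun ε =>
    fderiv ℝ (Function.invFunOn (squeeze φ ε) U) (squeeze φ ε x) - ε⁻¹ • normalProj M φ x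

/-- The normal section `Ω_p`. -/
def normalSection {ℓ : ℕ} (φ : Euc ℓ → Euc ℓ) (Ω : Set (Euc ℓ)) (p : Euc ℓ) : Set (Euc ℓ) :=
  {x ∈ Ω | φ x = p}

/-- `Ω` has connected normal sections (an empty section is regarded as connected). -/
def HasConnectedNormalSections {ℓ : ℕ} (M : Set (Euc ℓ)) (φ : Euc ℓ → Euc ℓ)
    (Ω : Set (Euc ℓ)) : Prop :=
  ∀ p ∈ M, IsPreconnected (normalSection φ Ω p)

/-- `μ p`, the `(ℓ-k)`-dimensional Hausdorff measure of the normal section at `p`. -/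
def secMeas {ℓ : ℕ} (k : ℕ) (φ : Euc ℓ → Euc ℓ) (Ω : Set (Euc ℓ)) (p : Euc ℓ) : ℝ :=
  (μHE[ℓ - k] (normalSection φ Ω p)).toReal

/-- `𝓗^k` on a subset `S` of `ℝ^ℓ` (normalized so as to be Lebesgue measure on `ℝ^k`). -/
abbrev surf {ℓ : ℕ} (k : ℕ) (S : Set (Euc ℓ)) : Measure (Euc ℓ) := μHE[k].restrict S

/-! ### Sobolev functions on an open subset of `ℝ^ℓ` -/

/-- `g` is the weak gradient of `u` on `Ω` (for `u` and `g` square integrable on `Ω`). -/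
def IsWeakGradient {ℓ : ℕ} (Ω : Set (Euc ℓ)) (u : Euc ℓ → ℝ) (g : Euc ℓ → Euc ℓ) : Prop :=
  ∀ ψ : Euc ℓ → ℝ, ContDiff ℝ ∞ ψ → HasCompactSupport ψ → tsupport ψ ⊆ Ω → ∀ h : Euc ℓ,
    ∫ x in Ω, u x * fderiv ℝ ψ x h = -∫ x in Ω, ψ x * inner ℝ (g x) h

open Classical in
/-- The weak gradient `∇u` of `u ∈ H¹(Ω)`, unique almost everywhere in `Ω`. -/
def weakGradient {ℓ : ℕ} (Ω : Set (Euc ℓ)) (u : Euc ℓ → ℝ) : Euc ℓ → Euc ℓ :=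
  if h : ∃ g : Euc ℓ → Euc ℓ, MemLp g 2 (volume.restrict Ω) ∧ IsWeakGradient Ω u g
  then h.choose else 0

theorem integrable_mul_test {ℓ : ℕ} {Ω : Set (Euc ℓ)} {f ψ : Euc ℓ → ℝ}
    (hf : MemLp f 2 (volume.restrict Ω)) (hψ : Continuous ψ) (hc : HasCompactSupport ψ) :
    Integrable (fun x => f x * ψ x) (volume.restrict Ω) :=
  hf.integrable_mul (hψ.memLp_of_hasCompactSupport (p := 2) hc)

theorem integrable_mul_fderiv {ℓ : ℕ} {Ω : Set (Euc ℓ)} {f ψ : Euc ℓ → ℝ}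
    (hf : MemLp f 2 (volume.restrict Ω)) (hψ : ContDiff ℝ ∞ ψ) (hc : HasCompactSupport ψ)
    (h : Euc ℓ) : Integrable (fun x => f x * fderiv ℝ ψ x h) (volume.restrict Ω) :=
  integrable_mul_test hf ((hψ.continuous_fderiv (by simp)).clm_apply continuous_const)
    (hc.fderiv_apply (𝕜 := ℝ) h)

theorem integrable_test_mul_inner {ℓ : ℕ} {Ω : Set (Euc ℓ)} {g : Euc ℓ → Euc ℓ} {ψ : Euc ℓ → ℝ}
    (hg : MemLp g 2 (volume.restrict Ω)) (hψ : Continuous ψ) (hc : HasCompactSupport ψ)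
    (h : Euc ℓ) : Integrable (fun x => ψ x * inner ℝ (g x) h) (volume.restrict Ω) := by
  simpa only [mul_comm] using integrable_mul_test (hg.inner_const h) hψ hc

/-- The space `H¹_s(Ω)` of those `u ∈ H¹(Ω)` with `P x (∇u x) = 0` almost everywhere in `Ω`. -/
def H1s {ℓ : ℕ} (M : Set (Euc ℓ)) (φ : Euc ℓ → Euc ℓ) (Ω : Set (Euc ℓ)) :
    Submodule ℝ (Lp ℝ 2 (volume.restrict Ω : Measure (Euc ℓ))) where
  carrier := {u | ∃ g : Euc ℓ → Euc ℓ, MemLp g 2 (volume.restrict Ω) ∧ IsWeakGradient Ω u g ∧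
    ∀ᵐ x ∂(volume.restrict Ω), normalProj M φ x (g x) = 0}
  zero_mem' := by
    refine ⟨0, MemLp.zero', ?_, by simp⟩
    intro ψ _ _ _ h
    have h0 : ∀ᵐ x ∂(volume.restrict Ω),
        ((0 : Lp ℝ 2 (volume.restrict Ω : Measure (Euc ℓ))) : Euc ℓ → ℝ) x * fderiv ℝ ψ x h
          = 0 := by
      filter_upwards [Lp.coeFn_zero ℝ 2 (volume.restrict Ω : Measure (Euc ℓ))] with x hx
      rw [hx, Pi.zero_apply, zero_mul]
    rw [integral_congr_ae h0]
    simp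
  add_mem' := by
    rintro u v ⟨g, hg, hug, hgP⟩ ⟨g', hg', hvg', hgP'⟩
    refine ⟨g + g', hg.add hg', ?_, ?_⟩
    · intro ψ h1 h2 h3 h
      have e1 : ∀ᵐ x ∂(volume.restrict Ω), (u + v : Lp ℝ 2 _) x * fderiv ℝ ψ x h
          = u x * fderiv ℝ ψ x h + v x * fderiv ℝ ψ x h := by
        filter_upwards [Lp.coeFn_add u v] with x hx
        rw [hx, Pi.add_apply, add_mul]
      have e2 : ∀ x, ψ x * inner ℝ ((g + g') x) h
          = ψ x * inner ℝ (g x) h + ψ x * inner ℝ (g' x) h := by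
        intro x
        rw [Pi.add_apply, inner_add_left, mul_add]
      rw [integral_congr_ae e1, integral_add (integrable_mul_fderiv (Lp.memLp u) h1 h2 h)
        (integrable_mul_fderiv (Lp.memLp v) h1 h2 h), hug ψ h1 h2 h3 h, hvg' ψ h1 h2 h3 h]
      simp_rw [e2]
      rw [integral_add (integrable_test_mul_inner hg h1.continuous h2 h)
        (integrable_test_mul_inner hg' h1.continuous h2 h)]
      ring
    · filter_upwards [hgP, hgP'] with x h1 h2
      rw [Pi.add_apply, map_add, h1, h2, add_zero]
  smul_mem' := by
    rintro c u ⟨g, hg, hug, hgP⟩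
    refine ⟨c • g, hg.const_smul c, ?_, ?_⟩
    · intro ψ h1 h2 h3 h
      have e1 : ∀ᵐ x ∂(volume.restrict Ω), (c • u : Lp ℝ 2 _) x * fderiv ℝ ψ x h
          = c * (u x * fderiv ℝ ψ x h) := by
        filter_upwards [Lp.coeFn_smul c u] with x hx
        rw [hx, Pi.smul_apply, smul_eq_mul, mul_assoc]
      have e2 : ∀ x, ψ x * inner ℝ ((c • g) x) h = c * (ψ x * inner ℝ (g x) h) := by
        intro x
        rw [Pi.smul_apply, real_inner_smul_left]
        ring
      rw [integral_congr_ae e1, integral_const_mul, hug ψ h1 h2 h3 h]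
      simp_rw [e2]
      rw [integral_const_mul]
      ring
    · filter_upwards [hgP] with x h1
      rw [Pi.smul_apply, map_smul, h1, smul_zero]

/-- The space `L²_s(Ω)`, the closure of `H¹_s(Ω)` in `L²(Ω)`. -/
def L2s {ℓ : ℕ} (M : Set (Euc ℓ)) (φ : Euc ℓ → Euc ℓ) (Ω : Set (Euc ℓ)) :
    Submodule ℝ (Lp ℝ 2 (volume.restrict Ω : Measure (Euc ℓ))) :=
  (H1s M φ Ω).topologicalClosure

/-- The form `b₀`. -/
def b₀ {ℓ : ℕ} (M : Set (Euc ℓ)) (φ : Euc ℓ → Euc ℓ) (Ω : Set (Euc ℓ)) (u v : Euc ℓ → ℝ) : ℝ :=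
  ∫ x in Ω, J₀ M φ x * u x * v x

/-- The form `a₀`. -/
def a₀ {ℓ : ℕ} (M U : Set (Euc ℓ)) (φ : Euc ℓ → Euc ℓ) (Ω : Set (Euc ℓ))
    (u v : Euc ℓ → ℝ) : ℝ :=
  ∫ x in Ω, J₀ M φ x * inner ℝ
    (ContinuousLinearMap.adjoint (S₀ M U φ x) (weakGradient Ω u x))
    (ContinuousLinearMap.adjoint (S₀ M U φ x) (weakGradient Ω v x))

/-! ### Sobolev functions on a relatively open subset of a submanifold -/

/-- The divergence of a tangent vector field at `p ∈ M`, the field being given as the restriction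
to `M` of a `C¹` field `Ψ` on `ℝ^ℓ`: the trace of `h ↦ ∇̂_h Ψ p` on `T_p M`, where `∇̂_h Ψ p`
is the orthogonal projection of `DΨ(p) h` onto `T_p M`. -/
def surfaceDiv {ℓ : ℕ} (M : Set (Euc ℓ)) (Ψ : Euc ℓ → Euc ℓ) (p : Euc ℓ) : ℝ :=
  LinearMap.trace ℝ (tangentSubspace M p) (compress (tangentSubspace M p) (fderiv ℝ Ψ p))

/-- `Ψ` restricts to a tangent vector field on `S` (relatively open in `M`) of class `C^(r-1)` and
with compact support in `S`. Every such field on `S` has an extension `Ψ` to `ℝ^ℓ`. -/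
structure IsTestField {ℓ : ℕ} (r : ℕ) (M S : Set (Euc ℓ)) (Ψ : Euc ℓ → Euc ℓ) : Prop where
  contDiff : ContDiff ℝ ((r - 1 : ℕ) : ℕ∞) Ψ
  tangent : ∀ p ∈ S, Ψ p ∈ tangentSubspace M p
  compact : ∃ K ⊆ S, IsCompact K ∧ ∀ p ∈ S \ K, Ψ p = 0

/-- `v ∈ L²_loc(S)`, for an `𝓗^k`-measurable function or vector field `v` on `S`. -/
def IsL2Loc {ℓ : ℕ} {F : Type*} [NormedAddCommGroup F] (k : ℕ) (S : Set (Euc ℓ))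
    (v : Euc ℓ → F) : Prop :=
  AEStronglyMeasurable v (surf k S) ∧ ∀ K ⊆ S, IsCompact K → MemLp v 2 (surf k K)

/-- The tangent vector field `V ∈ L²_loc(S)` is the weak gradient of `v` on `S`. For an embedded
submanifold and `v ∈ L²_loc(S)` the integrability clauses hold automatically, because `v` and `V`
are integrated against bounded functions that vanish outside a compact subset of `S`. -/
structure IsSurfaceGradient {ℓ : ℕ} (k r : ℕ) (M S : Set (Euc ℓ)) (v : Euc ℓ → ℝ)
    (V : Euc ℓ → Euc ℓ) : Prop where
  isL2Loc : IsL2Loc k S V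
  tangent : ∀ᵐ p ∂(surf k S), V p ∈ tangentSubspace M p
  integrable_div : ∀ Ψ, IsTestField r M S Ψ →
    Integrable (fun p => v p * surfaceDiv M Ψ p) (surf k S)
  integrable_inner : ∀ Ψ, IsTestField r M S Ψ →
    Integrable (fun p => inner ℝ (V p) (Ψ p)) (surf k S)
  integral_eq : ∀ Ψ, IsTestField r M S Ψ →
    ∫ p, v p * surfaceDiv M Ψ p ∂(surf k S) = -∫ p, inner ℝ (V p) (Ψ p) ∂(surf k S)

open Classical in
/-- The weak gradient `∇v` of `v ∈ H¹_loc(S)`, unique `𝓗^k`-almost everywhere in `S`. -/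
def surfaceGradient {ℓ : ℕ} (k r : ℕ) (M S : Set (Euc ℓ)) (v : Euc ℓ → ℝ) : Euc ℓ → Euc ℓ :=
  if h : ∃ V : Euc ℓ → Euc ℓ, IsSurfaceGradient k r M S v V then h.choose else 0

/-- `L²(μ, S)`, as a space of `𝓗^k`-almost everywhere classes of functions on `S`: the functions
`v ∈ L²_loc(S)` with `μ^(1/2) v ∈ L²(S)`. -/
def L2w {ℓ : ℕ} (k : ℕ) (μ : Euc ℓ → ℝ) (S : Set (Euc ℓ)) : Submodule ℝ (Euc ℓ →ₘ[surf k S] ℝ) where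
  carrier := {v | IsL2Loc k S v ∧ MemLp (fun p => √(μ p) * v p) 2 (surf k S)}
  zero_mem' := by
    have h0 := AEEqFun.coeFn_zero (μ := surf k S) (β := ℝ)
    refine ⟨⟨AEEqFun.aestronglyMeasurable _, fun K hK _ => ?_⟩, ?_⟩
    · exact (memLp_congr_ae (ae_restrict_of_ae_restrict_of_subset hK h0)).2 MemLp.zero'
    · refine (memLp_congr_ae ?_).2 (MemLp.zero' (ε := ℝ))
      filter_upwards [h0] with p hp
      simp [hp]
  add_mem' := by
    rintro v w ⟨⟨_, hv⟩, hv'⟩ ⟨⟨_, hw⟩, hw'⟩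
    have ha := AEEqFun.coeFn_add v w
    refine ⟨⟨AEEqFun.aestronglyMeasurable _, fun K hK hKc => ?_⟩, ?_⟩
    · exact (memLp_congr_ae (ae_restrict_of_ae_restrict_of_subset hK ha)).2
        ((hv K hK hKc).add (hw K hK hKc))
    · refine (memLp_congr_ae ?_).2 (hv'.add hw')
      filter_upwards [ha] with p hp
      simp only [hp, Pi.add_apply, mul_add]
  smul_mem' := by
    rintro c v ⟨⟨_, hv⟩, hv'⟩
    have ha := AEEqFun.coeFn_smul c v
    refine ⟨⟨AEEqFun.aestronglyMeasurable _, fun K hK hKc => ?_⟩, ?_⟩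
    · exact (memLp_congr_ae (ae_restrict_of_ae_restrict_of_subset hK ha)).2
        ((hv K hK hKc).const_smul c)
    · refine (memLp_congr_ae ?_).2 (hv'.const_smul c)
      filter_upwards [ha] with p hp
      simp only [hp, Pi.smul_apply, smul_eq_mul]
      ring

theorem IsSurfaceGradient.congr {ℓ : ℕ} {k r : ℕ} {M S : Set (Euc ℓ)} {v w : Euc ℓ → ℝ}
    {V : Euc ℓ → Euc ℓ} (h : IsSurfaceGradient k r M S v V) (e : v =ᵐ[surf k S] w) :
    IsSurfaceGradient k r M S w V := by
  have e' : ∀ Ψ, (fun p => v p * surfaceDiv M Ψ p) =ᵐ[surf k S]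
      fun p => w p * surfaceDiv M Ψ p := by
    intro Ψ
    filter_upwards [e] with p hp
    rw [hp]
  refine ⟨h.isL2Loc, h.tangent, fun Ψ hΨ => ?_, h.integrable_inner, fun Ψ hΨ => ?_⟩
  · exact (h.integrable_div Ψ hΨ).congr (e' Ψ)
  · rw [← integral_congr_ae (e' Ψ)]
    exact h.integral_eq Ψ hΨ

theorem IsSurfaceGradient.add {ℓ : ℕ} {k r : ℕ} {M S : Set (Euc ℓ)} {v w : Euc ℓ → ℝ}
    {V W : Euc ℓ → Euc ℓ} (h : IsSurfaceGradient k r M S v V)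
    (h' : IsSurfaceGradient k r M S w W) : IsSurfaceGradient k r M S (v + w) (V + W) := by
  have e1 : ∀ Ψ p, (v + w) p * surfaceDiv M Ψ p
      = v p * surfaceDiv M Ψ p + w p * surfaceDiv M Ψ p := by
    intro Ψ p
    rw [Pi.add_apply, add_mul]
  have e2 : ∀ (Ψ : Euc ℓ → Euc ℓ) p, inner ℝ ((V + W) p) (Ψ p)
      = inner ℝ (V p) (Ψ p) + inner ℝ (W p) (Ψ p) := by
    intro Ψ p
    rw [Pi.add_apply, inner_add_left]
  refine ⟨⟨h.isL2Loc.1.add h'.isL2Loc.1, fun K hK hKc =>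
    (h.isL2Loc.2 K hK hKc).add (h'.isL2Loc.2 K hK hKc)⟩, ?_, fun Ψ hΨ => ?_, fun Ψ hΨ => ?_,
    fun Ψ hΨ => ?_⟩
  · filter_upwards [h.tangent, h'.tangent] with p h1 h2
    exact Submodule.add_mem _ h1 h2
  · simp_rw [e1]
    exact (h.integrable_div Ψ hΨ).add (h'.integrable_div Ψ hΨ)
  · simp_rw [e2]
    exact (h.integrable_inner Ψ hΨ).add (h'.integrable_inner Ψ hΨ)
  · simp_rw [e1, e2]
    rw [integral_add (h.integrable_div Ψ hΨ) (h'.integrable_div Ψ hΨ),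
      integral_add (h.integrable_inner Ψ hΨ) (h'.integrable_inner Ψ hΨ),
      h.integral_eq Ψ hΨ, h'.integral_eq Ψ hΨ]
    ring

theorem IsSurfaceGradient.smul {ℓ : ℕ} {k r : ℕ} {M S : Set (Euc ℓ)} {v : Euc ℓ → ℝ}
    {V : Euc ℓ → Euc ℓ} (c : ℝ) (h : IsSurfaceGradient k r M S v V) :
    IsSurfaceGradient k r M S (c • v) (c • V) := by
  have e1 : ∀ Ψ p, (c • v) p * surfaceDiv M Ψ p = c * (v p * surfaceDiv M Ψ p) := by
    intro Ψ p
    rw [Pi.smul_apply, smul_eq_mul, mul_assoc]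
  have e2 : ∀ (Ψ : Euc ℓ → Euc ℓ) p, inner ℝ ((c • V) p) (Ψ p) = c * inner ℝ (V p) (Ψ p) := by
    intro Ψ p
    rw [Pi.smul_apply, real_inner_smul_left]
  refine ⟨⟨h.isL2Loc.1.const_smul c, fun K hK hKc => (h.isL2Loc.2 K hK hKc).const_smul c⟩, ?_,
    fun Ψ hΨ => ?_, fun Ψ hΨ => ?_, fun Ψ hΨ => ?_⟩
  · filter_upwards [h.tangent] with p h1
    exact Submodule.smul_mem _ c h1
  · simp_rw [e1]
    exact (h.integrable_div Ψ hΨ).const_mul c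
  · simp_rw [e2]
    exact (h.integrable_inner Ψ hΨ).const_mul c
  · simp_rw [e1, e2]
    rw [integral_const_mul, integral_const_mul, h.integral_eq Ψ hΨ]
    ring

theorem IsSurfaceGradient.zero {ℓ : ℕ} {k r : ℕ} {M S : Set (Euc ℓ)} :
    IsSurfaceGradient k r M S (0 : Euc ℓ → ℝ) 0 := by
  refine ⟨⟨aestronglyMeasurable_zero, fun _ _ _ => MemLp.zero'⟩, ?_, ?_, ?_, ?_⟩ <;> simp

/-- `H¹(μ, S)`: the functions `v ∈ H¹_loc(S)` with `μ^(1/2) v ∈ L²(S)` and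
`μ^(1/2) ∇v ∈ L²(S)`. -/
def H1w {ℓ : ℕ} (k r : ℕ) (M : Set (Euc ℓ)) (μ : Euc ℓ → ℝ) (S : Set (Euc ℓ)) :
    Submodule ℝ (Euc ℓ →ₘ[surf k S] ℝ) where
  carrier := {v | v ∈ L2w k μ S ∧ ∃ V : Euc ℓ → Euc ℓ, IsSurfaceGradient k r M S v V ∧
    MemLp (fun p => √(μ p) • V p) 2 (surf k S)}
  zero_mem' := by
    refine ⟨Submodule.zero_mem _, 0, IsSurfaceGradient.zero.congr AEEqFun.coeFn_zero.symm, ?_⟩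
    simp
  add_mem' := by
    rintro v w ⟨hv, V, hV, hV'⟩ ⟨hw, W, hW, hW'⟩
    refine ⟨Submodule.add_mem _ hv hw, V + W, (hV.add hW).congr (AEEqFun.coeFn_add v w).symm, ?_⟩
    have e : (fun p => √(μ p) • (V + W) p)
        = (fun p => √(μ p) • V p) + fun p => √(μ p) • W p := by
      funext p
      simp
    rw [e]
    exact hV'.add hW'
  smul_mem' := by
    rintro c v ⟨hv, V, hV, hV'⟩
    refine ⟨Submodule.smul_mem _ c hv, c • V, (hV.smul c).congr (AEEqFun.coeFn_smul c v).symm, ?_⟩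
    have e : (fun p => √(μ p) • (c • V) p) = c • fun p => √(μ p) • V p := by
      funext p
      simp [smul_comm c]
    rw [e]
    exact hV'.const_smul c

/-- The form `b_μ`. -/
def bw {ℓ : ℕ} (k : ℕ) (μ : Euc ℓ → ℝ) (S : Set (Euc ℓ)) (v w : Euc ℓ → ℝ) : ℝ :=
  ∫ p, μ p * v p * w p ∂(surf k S)

/-- The form `a_μ`. -/
def aw {ℓ : ℕ} (k r : ℕ) (M : Set (Euc ℓ)) (μ : Euc ℓ → ℝ) (S : Set (Euc ℓ))
    (v w : Euc ℓ → ℝ) : ℝ :=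
  ∫ p, μ p * inner ℝ (surfaceGradient k r M S v p) (surfaceGradient k r M S w p) ∂(surf k S)

/-! ### Hilbert spaces and operators generated by pairs of forms -/

/-- `b` is a (positive definite) scalar product on the real vector space `V`, for which `V` is
complete. -/
def IsHilbertProduct {V : Type*} [AddCommGroup V] [Module ℝ V] (b : V → V → ℝ) : Prop :=
  ∃ c : InnerProductSpace.Core ℝ V, (∀ v w, c.inner v w = b v w) ∧
    @CompleteSpace V (@InnerProductSpace.Core.toNormedAddCommGroup ℝ V _ _ _
      c).toMetricSpace.toUniformSpace

/-- `A` is the operator generated by the pair of forms `(a, b)`, the form `a` having domain `D`: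
`A u = w` if and only if `u ∈ D` and `a u v = b w v` for all `v ∈ D`. -/
def IsGeneratedByForms {V : Type*} [AddCommGroup V] [Module ℝ V] (D : Set V) (a b : V → V → ℝ)
    (A : V →ₗ.[ℝ] V) : Prop :=
  ∀ u w : V, (u, w) ∈ A.graph ↔ u ∈ D ∧ ∀ v ∈ D, a u v = b w v

/-- `A` is a self-adjoint operator for the scalar product `b`: its domain is dense, and the graph
of `A` is the graph of the adjoint of `A`. -/
def IsSelfAdjointFor {V : Type*} [AddCommGroup V] [Module ℝ V] (b : V → V → ℝ)
    (A : V →ₗ.[ℝ] V) : Prop :=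
  (∀ v : V, ∀ δ > 0, ∃ d ∈ A.domain, b (v - d) (v - d) < δ) ∧
    ∀ v w : V, (v, w) ∈ A.graph ↔ ∀ x : A.domain, b (A x) v = b x w

end CurvedThin

end

open CurvedThin

/-! Geometry. Differentiating the normality relation for `φ` and using the implicit function theorem
shows that `Dφ(x)` annihilates the normal space at `φ x`, is injective on the tangent space there,
hence maps that space onto itself, and that `φ` is constant along normal segments
(`fderiv_eq_zero_iff_and_eventually`, `eq_of_segment`). Therefore the tangential coordinate of `φ x`
and the normal coordinate of `x` together form local `C¹` coordinates (`FiberChart`) in which the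
fibres of `φ` are slices of a box `A × Z`.

Functions. On such a box a function whose weak gradient has no `Z`-component is invariant under
translations in `Z`, hence depends on the `A`-coordinate only (`Split.exists_of_nor_eq_zero`). So `P
∇u = 0` makes `u` locally a function of `φ x`, and connectedness of the normal sections glues the
local functions to one `v` with `u = v ∘ φ` (`exists_comp_proj`). Conversely `∇(v ∘ φ) = Dφᵀ (∇v ∘
φ)` is tangential. As `S₀` inverts `Dφ` on the tangent space and vanishes on the normal space, `S₀ᵀ
∇u = ∇v ∘ φ`.

Measures. The coarea formula `bind_fiberMeas` says that `φ` carries `J₀ dx` on `Ω` to `μ 𝓗^k` on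
`φ(Ω)`. With the identities above this gives `b₀ = b_μ` and `a₀ = a_μ` under `u = v ∘ φ`. Area and
coarea formulas are proved by comparing two measures near each point up to factors arbitrarily close
to `1` (`measure_eq_of_local_ratio`).

Functional analysis. On the compact closure of `Ω` the density `J₀` is bounded above and away from
zero, and both `S₀` and `Dφ` are bounded. Hence `b₀` is equivalent to the `L²` product, and
completeness of `H¹_s(Ω)` follows from closedness of the graph of the weak gradient. `L²_s(Ω)` is
exactly the set of `L²` functions of the projection: such functions are stable under limits, and the
functions `f ∘ φ` with `f` smooth are dense among them. The generated operator is `A = (ι ι*)⁻¹ -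
1`, where `ι` embeds the form domain (`exists_generated_aux`). Since it is determined by the forms,
an isometry of the forms conjugates the operators.

Regularity. For `r = 2` the map `φ` is only `C¹`, so test functions transported by a fibre chart
give vector fields that are merely continuous, with a continuous weak divergence. Mollification
makes these admissible in the definition of the weak gradient (`IsWeakGradient.integral_field`). -/

namespace CurvedThin

section

/-! ### Orthogonal coordinates adapted to a subspace -/

/-- Orthogonal coordinates on `ℝ^ℓ`, split into `k` and `ℓ - k` coordinates. -/
abbrev Split (ℓ k : ℕ) : Type := WithLp 2 (Euc k × Euc (ℓ - k)) ≃ₗᵢ[ℝ] Euc ℓ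

namespace Split

variable {ℓ k : ℕ} (e : Split ℓ k)

/-- The first block of coordinates. -/
noncomputable def tan : Euc ℓ →L[ℝ] Euc k :=
  WithLp.fstL 2 ℝ (Euc k) (Euc (ℓ - k)) ∘L (e.symm.toContinuousLinearEquiv : Euc ℓ →L[ℝ] _)

/-- The second block of coordinates. -/
noncomputable def nor : Euc ℓ →L[ℝ] Euc (ℓ - k) :=
  WithLp.sndL 2 ℝ (Euc k) (Euc (ℓ - k)) ∘L (e.symm.toContinuousLinearEquiv : Euc ℓ →L[ℝ] _)

/-- The inclusion of the first coordinate plane. -/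
noncomputable def inT : Euc k →ₗᵢ[ℝ] Euc ℓ where
  toLinearMap := e.toLinearEquiv.toLinearMap ∘ₗ
    (WithLp.linearEquiv 2 ℝ (Euc k × Euc (ℓ - k))).symm.toLinearMap ∘ₗ LinearMap.inl ℝ _ _
  norm_map' y := by simp

/-- The inclusion of the second coordinate plane. -/
noncomputable def inN : Euc (ℓ - k) →ₗᵢ[ℝ] Euc ℓ where
  toLinearMap := e.toLinearEquiv.toLinearMap ∘ₗ
    (WithLp.linearEquiv 2 ℝ (Euc k × Euc (ℓ - k))).symm.toLinearMap ∘ₗ LinearMap.inr ℝ _ _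
  norm_map' y := by simp

theorem tan_apply (x : Euc ℓ) : e.tan x = (e.symm x).fst := rfl

theorem nor_apply (x : Euc ℓ) : e.nor x = (e.symm x).snd := rfl

theorem inT_apply (y : Euc k) : e.inT y = e (WithLp.toLp 2 (y, 0)) := rfl

theorem inN_apply (z : Euc (ℓ - k)) : e.inN z = e (WithLp.toLp 2 (0, z)) := rfl

@[simp] theorem tan_inT (y : Euc k) : e.tan (e.inT y) = y := by simp [tan_apply, inT_apply]

@[simp] theorem nor_inT (y : Euc k) : e.nor (e.inT y) = 0 := by simp [nor_apply, inT_apply]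

@[simp] theorem tan_inN (z : Euc (ℓ - k)) : e.tan (e.inN z) = 0 := by simp [tan_apply, inN_apply]

@[simp] theorem nor_inN (z : Euc (ℓ - k)) : e.nor (e.inN z) = z := by simp [nor_apply, inN_apply]

theorem inT_add_inN (y : Euc k) (z : Euc (ℓ - k)) :
    e.inT y + e.inN z = e (WithLp.toLp 2 (y, z)) := by
  rw [inT_apply, inN_apply, ← map_add, ← WithLp.toLp_add]
  simp

theorem inT_tan_add_inN_nor (x : Euc ℓ) : e.inT (e.tan x) + e.inN (e.nor x) = x := by
  rw [inT_add_inN, tan_apply, nor_apply]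
  exact e.apply_symm_apply x

theorem inner_inT (y : Euc k) (x : Euc ℓ) : inner ℝ (e.inT y) x = inner ℝ y (e.tan x) := by
  conv_lhs => rw [← e.apply_symm_apply x, inT_apply, e.inner_map_map]
  simp [WithLp.prod_inner_apply, tan_apply]

theorem inner_inN (z : Euc (ℓ - k)) (x : Euc ℓ) : inner ℝ (e.inN z) x = inner ℝ z (e.nor x) := by
  conv_lhs => rw [← e.apply_symm_apply x, inN_apply, e.inner_map_map]
  simp [WithLp.prod_inner_apply, nor_apply]

theorem norm_sq (x : Euc ℓ) : ‖x‖ ^ 2 = ‖e.tan x‖ ^ 2 + ‖e.nor x‖ ^ 2 := by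
  rw [← e.symm.norm_map x, WithLp.prod_norm_sq_eq_of_L2]
  rfl

theorem norm_nor_le (x : Euc ℓ) : ‖e.nor x‖ ≤ ‖x‖ := by
  have := e.norm_sq x
  exact (sq_le_sq₀ (norm_nonneg _) (norm_nonneg _)).1 (by nlinarith [sq_nonneg ‖e.tan x‖])

/-- The coordinates as a measurable equivalence with the product of the coordinate spaces. -/
noncomputable def measurableEquiv : Euc k × Euc (ℓ - k) ≃ᵐ Euc ℓ :=
  (MeasurableEquiv.toLp 2 (Euc k × Euc (ℓ - k))).trans e.toHomeomorph.toMeasurableEquiv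

theorem measurableEquiv_apply (w : Euc k × Euc (ℓ - k)) :
    e.measurableEquiv w = e.inT w.1 + e.inN w.2 := by
  rw [inT_add_inN]
  rfl

theorem measurePreserving : MeasurePreserving e.measurableEquiv (volume.prod volume) volume :=
  (LinearIsometryEquiv.measurePreserving e).comp (WithLp.volume_preserving_toLp (Euc k) (Euc (ℓ - k)))

theorem mem_orthogonal_iff {e : Split ℓ k} {T : Submodule ℝ (Euc ℓ)} (h : ∀ x, x ∈ T ↔ e.nor x = 0)
    (x : Euc ℓ) : x ∈ Tᗮ ↔ e.tan x = 0 := by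
  rw [Submodule.mem_orthogonal]
  constructor
  · intro hx
    have h1 := hx (e.inT (e.tan x)) ((h _).2 (e.nor_inT _))
    rw [inner_inT] at h1
    exact inner_self_eq_zero.1 h1
  · intro hx u hu
    rw [← e.inT_tan_add_inN_nor u, (h u).1 hu, map_zero, add_zero, inner_inT, hx, inner_zero_right]

theorem exists_adapted (T : Submodule ℝ (Euc ℓ)) (hT : Module.finrank ℝ T = k) :
    ∃ e : Split ℓ k, ∀ x, x ∈ T ↔ e.nor x = 0 := by
  have hN : Module.finrank ℝ Tᗮ = ℓ - k := by
    have := T.finrank_add_finrank_orthogonal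
    rw [hT, finrank_euclideanSpace_fin] at this
    omega
  let a : T ≃ₗᵢ[ℝ] Euc k := ((stdOrthonormalBasis ℝ T).reindex (finCongr hT)).repr
  let b : Tᗮ ≃ₗᵢ[ℝ] Euc (ℓ - k) := ((stdOrthonormalBasis ℝ Tᗮ).reindex (finCongr hN)).repr
  refine ⟨(T.orthogonalDecomposition.trans
    (LinearIsometryEquiv.withLpProdCongr 2 a b)).symm, fun x => ?_⟩
  have : Split.nor (T.orthogonalDecomposition.trans
      (LinearIsometryEquiv.withLpProdCongr 2 a b)).symm x = b (Tᗮ.orthogonalProjectionOnto x) := by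
    rw [nor_apply, LinearIsometryEquiv.symm_symm, LinearIsometryEquiv.trans_apply,
      Submodule.orthogonalDecomposition_apply]
    rfl
  rw [this, map_eq_zero_iff b b.injective]
  rw [Submodule.orthogonalProjectionOnto_eq_zero_iff, Submodule.orthogonal_orthogonal]

end Split

/-! ### Local diffeomorphisms -/

/-- The inverse function theorem gives regularity of the inverse at the image point only; shrinking
the source makes both directions `C^n` on whole open sets and places the source inside a prescribed
neighbourhood. -/
theorem exists_localDiffeo {E F : Type*} [NormedAddCommGroup E] [NormedSpace ℝ E] [CompleteSpace E]
    [NormedAddCommGroup F] [NormedSpace ℝ F] {f : E → F} {n : ℕ} (hn : 1 ≤ n) {a : E}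
    (hf : ContDiffAt ℝ n f a) {f' : E ≃L[ℝ] F} (hf' : HasFDerivAt f (f' : E →L[ℝ] F) a)
    {S : Set E} (hS : S ∈ 𝓝 a) :
    ∃ h : OpenPartialHomeomorph E F, a ∈ h.source ∧ h.source ⊆ S ∧ (⇑h = f) ∧
      ContDiffOn ℝ n f h.source ∧ ContDiffOn ℝ n h.symm h.target := by
  have hn0 : ((n : ℕ) : WithTop ℕ∞) ≠ 0 := by exact_mod_cast (by omega : n ≠ 0)
  let h0 := hf.toOpenPartialHomeomorph f hf' hn0
  have hs0 : a ∈ h0.source := hf.mem_toOpenPartialHomeomorph_source hf' hn0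
  have hinv : ContDiffAt ℝ n h0.symm (f a) := hf.to_localInverse hf' hn0
  obtain ⟨u, hu, hu'⟩ := hf.contDiffOn le_rfl (by simp)
  obtain ⟨v, hv, hv'⟩ := hinv.contDiffOn le_rfl (by simp)
  have hcont : ContinuousAt f a := hf.continuousAt
  have hW : S ∩ u ∩ f ⁻¹' v ∈ 𝓝 a := inter_mem (inter_mem hS hu) (hcont.preimage_mem_nhds hv)
  obtain ⟨W, hWs, hWo, haW⟩ := mem_nhds_iff.1 hW
  refine ⟨h0.restrOpen W hWo, ⟨hs0, haW⟩, fun x hx => (hWs hx.2).1.1, rfl,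
    hu'.mono fun x hx => (hWs hx.2).1.2, hv'.mono ?_⟩
  intro y hy
  have h1 := (h0.restrOpen W hWo).map_target hy
  have h2 := (h0.restrOpen W hWo).right_inv hy
  have h3 := (hWs h1.2).2
  rw [mem_preimage] at h3
  have h4 : f ((h0.restrOpen W hWo).symm y) = y := h2
  rwa [h4] at h3

end

section

/-! ### Tangent spaces and graph charts -/

section Tangent

variable {ℓ k r : ℕ} {M : Set (Euc ℓ)}

theorem range_le_tangentSubspace {γ : Euc k → Euc ℓ} {y : Euc k} {D : Euc k →L[ℝ] Euc ℓ}
    (hγ : HasFDerivAt γ D y) (hs : ∀ᶠ y' in 𝓝 y, γ y' ∈ M) :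
    LinearMap.range (D : Euc k →ₗ[ℝ] Euc ℓ) ≤ tangentSubspace M (γ y) := by
  rintro _ ⟨w, rfl⟩
  apply Submodule.subset_span
  have h1 := hγ.hasFDerivWithinAt (s := {y' | γ y' ∈ M}) |>.mapsTo_tangent_cone
  have h2 : w ∈ tangentConeAt ℝ {y' | γ y' ∈ M} y := by
    rw [tangentConeAt_of_mem_nhds hs]
    trivial
  exact tangentConeAt_mono (image_subset_iff.2 fun x hx => hx) (h1 h2)

/-- The second component of the chart vanishes on `M`, and a singleton has no nonzero tangent
direction, so `Dh` maps every tangent direction into `ℝ^k × {0}`; applying `Dh⁻¹` shows that it lies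
in the range. The other inclusion holds because the parametrization stays in `M`. -/
theorem tangentSubspace_eq_range (hr : 1 ≤ r) {p : Euc ℓ}
    (h : OpenPartialHomeomorph (Euc ℓ) (Euc k × Euc (ℓ - k))) (hpM : p ∈ M) (hps : p ∈ h.source)
    (h1 : ContDiffOn ℝ r h h.source) (h2 : ContDiffOn ℝ r h.symm h.target)
    (h3 : ∀ x ∈ h.source, (x ∈ M ↔ (h x).2 = 0)) :
    ∃ D : Euc k →L[ℝ] Euc ℓ, HasFDerivAt (fun y => h.symm (y, (0 : Euc (ℓ - k)))) D (h p).1 ∧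
      Function.Injective D ∧
      tangentSubspace M p = LinearMap.range (D : Euc k →ₗ[ℝ] Euc ℓ) := by
  have hr0 : ((r : ℕ) : WithTop ℕ∞) ≠ 0 := by exact_mod_cast (by omega : r ≠ 0)
  have hp2 : (h p).2 = 0 := (h3 p hps).1 hpM
  have hpe : ((h p).1, (0 : Euc (ℓ - k))) = h p := by rw [← hp2]
  have hd1 : HasFDerivAt h (fderiv ℝ h p) p :=
    ((h1.contDiffAt (h.open_source.mem_nhds hps)).differentiableAt hr0).hasFDerivAt
  have hd2 : HasFDerivAt h.symm (fderiv ℝ h.symm (h p)) (h p) :=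
    ((h2.contDiffAt (h.open_target.mem_nhds (h.map_source hps))).differentiableAt hr0).hasFDerivAt
  have hc1 : (fderiv ℝ h.symm (h p)) ∘L (fderiv ℝ h p) = ContinuousLinearMap.id ℝ _ := by
    refine (hd2.comp p hd1).unique ((hasFDerivAt_id p).congr_of_eventuallyEq ?_)
    filter_upwards [h.open_source.mem_nhds hps] with x hx using h.left_inv hx
  have hc2 : (fderiv ℝ h p) ∘L (fderiv ℝ h.symm (h p)) = ContinuousLinearMap.id ℝ _ := by
    have hd1' : HasFDerivAt h (fderiv ℝ h p) (h.symm (h p)) := by rwa [h.left_inv hps]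
    refine (hd1'.comp (h p) hd2).unique ((hasFDerivAt_id _).congr_of_eventuallyEq ?_)
    filter_upwards [h.open_target.mem_nhds (h.map_source hps)] with x hx using h.right_inv hx
  have hβ : HasFDerivAt (fun y => h.symm (y, (0 : Euc (ℓ - k))))
      ((fderiv ℝ h.symm (h p)) ∘L ContinuousLinearMap.inl ℝ _ _) (h p).1 := by
    have hd2' : HasFDerivAt h.symm (fderiv ℝ h.symm (h p)) ((h p).1, (0 : Euc (ℓ - k))) := by
      rwa [hpe]
    exact hd2'.comp (h p).1 (hasFDerivAt_prodMk_left _ _)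
  refine ⟨_, hβ, ?_, le_antisymm ?_ ?_⟩
  · intro y y' hy
    have := congrArg (fderiv ℝ h p) hy
    simp only [ContinuousLinearMap.comp_apply] at this
    have e := fun z => DFunLike.congr_fun hc2 z
    simp only [ContinuousLinearMap.comp_apply, ContinuousLinearMap.id_apply] at e
    rw [e, e] at this
    simpa using this
  · refine Submodule.span_le.2 fun v hv => ?_
    rw [← tangentConeAt_inter_nhds (h.open_source.mem_nhds hps)] at hv
    have h4 : HasFDerivWithinAt (fun x => (h x).2)
        (ContinuousLinearMap.snd ℝ _ _ ∘L fderiv ℝ h p) (M ∩ h.source) p :=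
      (hasFDerivAt_snd.comp p hd1).hasFDerivWithinAt
    have h5 := h4.mapsTo_tangent_cone hv
    have h6 : (fun x => (h x).2) '' (M ∩ h.source) ⊆ {0} := by
      rintro _ ⟨x, hx, rfl⟩
      exact (h3 x hx.2).1 hx.1
    have h7 : ¬ AccPt ((h p).2) (𝓟 ({0} : Set (Euc (ℓ - k)))) := by
      rw [accPt_iff_nhds]
      intro h7
      obtain ⟨y, ⟨-, hy⟩, hne⟩ := h7 univ univ_mem
      exact hne (hy.trans hp2.symm)
    have h8 := tangentConeAt_subset_zero (𝕜 := ℝ) h7 (tangentConeAt_mono h6 h5)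
    refine ⟨(fderiv ℝ h p v).1, ?_⟩
    have h9 : ((fderiv ℝ h p v).1, (0 : Euc (ℓ - k))) = fderiv ℝ h p v := by
      rw [← show (fderiv ℝ h p v).2 = 0 from h8]
    simp only [ContinuousLinearMap.coe_coe, ContinuousLinearMap.comp_apply,
      ContinuousLinearMap.inl_apply, h9]
    exact DFunLike.congr_fun hc1 v
  · have h10 := range_le_tangentSubspace (M := M) hβ ?_
    · simpa only [hpe, h.left_inv hps] using h10
    · have : ContinuousAt (fun y : Euc k => (y, (0 : Euc (ℓ - k)))) (h p).1 := by fun_prop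
      have h11 : h.target ∈ 𝓝 ((h p).1, (0 : Euc (ℓ - k))) := by
        rw [hpe]
        exact h.open_target.mem_nhds (h.map_source hps)
      filter_upwards [this.preimage_mem_nhds h11] with y hy
      rw [h3 _ (h.map_target hy), h.right_inv hy]

theorem IsEmbeddedSubmanifold.finrank_tangentSubspace (hr : 1 ≤ r) (hM : IsEmbeddedSubmanifold k r M)
    {p : Euc ℓ} (hp : p ∈ M) : Module.finrank ℝ (tangentSubspace M p) = k := by
  obtain ⟨h, hps, h1, h2, h3⟩ := hM p hp
  obtain ⟨D, -, hD, hT⟩ := tangentSubspace_eq_range hr h hp hps h1 h2 h3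
  rw [hT, LinearMap.finrank_range_of_inj hD, finrank_euclideanSpace_fin]

/-- A representation of `M` near `p` as a graph over its tangent space at `p`. -/
structure GraphChart (k r : ℕ) (M : Set (Euc ℓ)) (p : Euc ℓ) where
  /-- Coordinates adapted to `T_p M`. -/
  e : Split ℓ k
  /-- The neighbourhood of `p`. -/
  O : Set (Euc ℓ)
  /-- The domain of the parametrization. -/
  V : Set (Euc k)
  /-- The parametrization. -/
  γ : Euc k → Euc ℓ
  adapted : ∀ x, x ∈ tangentSubspace M p ↔ e.nor x = 0
  isOpen_O : IsOpen O
  isOpen_V : IsOpen V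
  mem : p ∈ O
  mem_base : p ∈ M
  contDiffOn : ContDiffOn ℝ r γ V
  tan_mem : ∀ q ∈ M ∩ O, e.tan q ∈ V
  γ_tan : ∀ q ∈ M ∩ O, γ (e.tan q) = q
  γ_mem : ∀ y ∈ V, γ y ∈ M ∩ O
  tan_γ : ∀ y ∈ V, e.tan (γ y) = y
  tangent : ∀ y ∈ V, tangentSubspace M (γ y) = LinearMap.range (fderiv ℝ γ y : Euc k →ₗ[ℝ] Euc ℓ)

/-- The tangential coordinate is injective on `T_p M`, so composed with the parametrization coming
from the submanifold chart it is a local diffeomorphism of `ℝ^k`; reparametrizing by its inverse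
turns the parametrization into a graph. Equality of tangent spaces at nearby points is a dimension
count. -/
theorem IsEmbeddedSubmanifold.exists_graphChart (hr : 1 ≤ r) (hM : IsEmbeddedSubmanifold k r M)
    {p : Euc ℓ} (hp : p ∈ M) : Nonempty (GraphChart k r M p) := by
  have hr0 : ((r : ℕ) : WithTop ℕ∞) ≠ 0 := by exact_mod_cast (by omega : r ≠ 0)
  obtain ⟨h, hps, h1, h2, h3⟩ := hM p hp
  obtain ⟨D, hD, hDi, hT⟩ := tangentSubspace_eq_range hr h hp hps h1 h2 h3
  obtain ⟨e, he⟩ := Split.exists_adapted (k := k) (tangentSubspace M p)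
    (hM.finrank_tangentSubspace hr hp)
  have hp2 : (h p).2 = 0 := (h3 p hps).1 hp
  have hpe : ((h p).1, (0 : Euc (ℓ - k))) = h p := by rw [← hp2]
  set β : Euc k → Euc ℓ := fun y => h.symm (y, (0 : Euc (ℓ - k))) with hβ
  have hβp : β (h p).1 = p := by simp only [hβ, hpe, h.left_inv hps]
  have hj : ContDiff ℝ r (fun y : Euc k => (y, (0 : Euc (ℓ - k)))) := by fun_prop
  have hS : {y : Euc k | (y, (0 : Euc (ℓ - k))) ∈ h.target} ∈ 𝓝 (h p).1 := by
    apply hj.continuous.continuousAt.preimage_mem_nhds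
    rw [hpe]
    exact h.open_target.mem_nhds (h.map_source hps)
  have hβc : ContDiffAt ℝ r β (h p).1 := by
    refine ContDiffAt.comp (h p).1 (f := fun y : Euc k => (y, (0 : Euc (ℓ - k)))) ?_ hj.contDiffAt
    refine h2.contDiffAt ?_
    rw [hpe]
    exact h.open_target.mem_nhds (h.map_source hps)
  have hinj : Function.Injective (e.tan ∘L D) := by
    rw [injective_iff_map_eq_zero]
    intro y hy
    have h4 : e.nor (D y) = 0 := (he _).1 (by rw [hT]; exact ⟨y, rfl⟩)
    have h5 := e.inT_tan_add_inN_nor (D y)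
    rw [h4, map_zero, add_zero, show e.tan (D y) = 0 from hy, map_zero] at h5
    exact hDi (by rw [← h5, map_zero])
  let L : Euc k ≃L[ℝ] Euc k :=
    (LinearEquiv.ofInjectiveEndo ((e.tan ∘L D : Euc k →L[ℝ] Euc k) : Euc k →ₗ[ℝ] Euc k)
      hinj).toContinuousLinearEquiv
  have hL : HasFDerivAt (fun y => e.tan (β y)) (L : Euc k →L[ℝ] Euc k) (h p).1 := by
    have h6 : (L : Euc k →L[ℝ] Euc k) = e.tan ∘L D := by ext y : 1; rfl
    rw [h6]
    exact e.tan.hasFDerivAt.comp _ hD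
  obtain ⟨τ, hτp, hτS, hτe, hτ1, hτ2⟩ := exists_localDiffeo hr
    (e.tan.contDiff.contDiffAt.comp _ hβc : ContDiffAt ℝ r (fun y => e.tan (β y)) (h p).1) hL hS
  have hβon : ContDiffOn ℝ r (fun y => β (τ.symm y)) τ.target :=
    (h2.comp hj.contDiffOn (fun y hy => hτS hy)).comp (s := τ.target) (t := τ.source) hτ2
      (fun y hy => τ.map_target hy)
  have hh : ∀ y ∈ τ.source, h (β y) = (y, 0) := fun y hy => h.right_inv (hτS hy)
  have htan : ∀ y ∈ τ.target, e.tan (β (τ.symm y)) = y := by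
    intro y hy
    have := τ.right_inv hy
    rwa [hτe] at this
  have hγM : ∀ y ∈ τ.target, β (τ.symm y) ∈ M := by
    intro y hy
    rw [h3 _ (h.map_target (hτS (τ.map_target hy))), hh _ (τ.map_target hy)]
  refine ⟨⟨e, {x ∈ h.source | (h x).1 ∈ τ.source} ∩ e.tan ⁻¹' τ.target, τ.target,
    fun y => β (τ.symm y), he, ?_, τ.open_target, ?_, hp, hβon, fun q hq => hq.2.2, ?_, ?_, htan,
    ?_⟩⟩
  · refine IsOpen.inter ?_ (τ.open_target.preimage e.tan.continuous)
    exact (continuous_fst.comp_continuousOn h.continuousOn).isOpen_inter_preimage h.open_source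
      τ.open_source
  · refine ⟨⟨hps, hτp⟩, ?_⟩
    have := τ.map_source hτp
    rwa [hτe, Function.comp_apply, hβp] at this
  · rintro q ⟨hqM, ⟨hqs, hq1⟩, hq2⟩
    have h7 : β (h q).1 = q := by
      have : ((h q).1, (0 : Euc (ℓ - k))) = h q := by rw [← (h3 q hqs).1 hqM]
      simp only [hβ, this, h.left_inv hqs]
    have h8 := τ.left_inv hq1
    rw [hτe, Function.comp_apply, h7] at h8
    simp only [h8, h7]
  · intro y hy
    refine ⟨hγM y hy, ⟨h.map_target (hτS (τ.map_target hy)), ?_⟩, ?_⟩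
    · rw [hh _ (τ.map_target hy)]
      exact τ.map_target hy
    · rw [mem_preimage, htan y hy]
      exact hy
  · intro y hy
    have hd : HasFDerivAt (fun y => β (τ.symm y)) (fderiv ℝ (fun y => β (τ.symm y)) y) y :=
      ((hβon.contDiffAt (τ.open_target.mem_nhds hy)).differentiableAt hr0).hasFDerivAt
    symm
    refine Submodule.eq_of_le_of_finrank_eq
      (range_le_tangentSubspace (γ := fun y => β (τ.symm y)) hd ?_) ?_
    · filter_upwards [τ.open_target.mem_nhds hy] with y' hy' using hγM y' hy'
    · rw [hM.finrank_tangentSubspace hr (hγM y hy), LinearMap.finrank_range_of_inj,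
        finrank_euclideanSpace_fin]
      have h9 : e.tan ∘L (fderiv ℝ (fun y => β (τ.symm y)) y) = ContinuousLinearMap.id ℝ _ := by
        refine (e.tan.hasFDerivAt.comp y hd).unique
          ((hasFDerivAt_id y).congr_of_eventuallyEq ?_)
        filter_upwards [τ.open_target.mem_nhds hy] with y' hy' using htan y' hy'
      intro a b hab
      have := congrArg e.tan hab
      have h10 := fun z => DFunLike.congr_fun h9 z
      simp only [ContinuousLinearMap.comp_apply, ContinuousLinearMap.id_apply] at h10
      rwa [ContinuousLinearMap.coe_coe, h10, h10] at this

namespace GraphChart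

variable {p : Euc ℓ} (c : GraphChart k r M p)

theorem hasFDerivAt (hr : 1 ≤ r) {y : Euc k} (hy : y ∈ c.V) :
    HasFDerivAt c.γ (fderiv ℝ c.γ y) y :=
  ((c.contDiffOn.contDiffAt (c.isOpen_V.mem_nhds hy)).differentiableAt
    (by exact_mod_cast (by omega : r ≠ 0))).hasFDerivAt

theorem tan_fderiv (hr : 1 ≤ r) {y : Euc k} (hy : y ∈ c.V) (w : Euc k) :
    c.e.tan (fderiv ℝ c.γ y w) = w := by
  have h9 : c.e.tan ∘L (fderiv ℝ c.γ y) = ContinuousLinearMap.id ℝ _ := by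
    refine (c.e.tan.hasFDerivAt.comp y (c.hasFDerivAt hr hy)).unique
      ((hasFDerivAt_id y).congr_of_eventuallyEq ?_)
    filter_upwards [c.isOpen_V.mem_nhds hy] with y' hy' using c.tan_γ y' hy'
  exact DFunLike.congr_fun h9 w

theorem fderiv_injective (hr : 1 ≤ r) {y : Euc k} (hy : y ∈ c.V) :
    Function.Injective (fderiv ℝ c.γ y) :=
  Function.LeftInverse.injective (g := c.e.tan) (c.tan_fderiv hr hy)

theorem tan_base_mem : c.e.tan p ∈ c.V := c.tan_mem p ⟨c.mem_base, c.mem⟩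

theorem γ_tan_base : c.γ (c.e.tan p) = p := c.γ_tan p ⟨c.mem_base, c.mem⟩

theorem fderiv_mem_tangent {y : Euc k} (hy : y ∈ c.V) (w : Euc k) :
    fderiv ℝ c.γ y w ∈ tangentSubspace M (c.γ y) := by
  rw [c.tangent y hy]
  exact ⟨w, rfl⟩

theorem fderiv_base (hr : 1 ≤ r) (w : Euc k) : fderiv ℝ c.γ (c.e.tan p) w = c.e.inT w := by
  have h1 := c.fderiv_mem_tangent c.tan_base_mem w
  rw [c.γ_tan_base, c.adapted] at h1
  have h2 := c.e.inT_tan_add_inN_nor (fderiv ℝ c.γ (c.e.tan p) w)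
  rw [h1, map_zero, add_zero, c.tan_fderiv hr c.tan_base_mem] at h2
  exact h2.symm

theorem fderiv_tan_of_mem (hr : 1 ≤ r) {q v : Euc ℓ} (hq : q ∈ M ∩ c.O)
    (hv : v ∈ tangentSubspace M q) : fderiv ℝ c.γ (c.e.tan q) (c.e.tan v) = v := by
  rw [← c.γ_tan q hq, c.tangent _ (c.tan_mem q hq)] at hv
  obtain ⟨w, rfl⟩ := hv
  rw [ContinuousLinearMap.coe_coe, c.tan_fderiv hr (c.tan_mem q hq)]

theorem contDiffOn_fderiv {m : ℕ} (hm : m + 1 ≤ r) : ContDiffOn ℝ m (fderiv ℝ c.γ) c.V :=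
  c.contDiffOn.fderiv_of_isOpen c.isOpen_V (by exact_mod_cast hm)

end GraphChart

end Tangent

end

section

/-! ### The normal projection -/

/-- A normal projection of class `C^(r-1)` onto a `k`-dimensional submanifold of class `C^r`. -/
structure IsNormalProjection {ℓ : ℕ} (k r : ℕ) (M U : Set (Euc ℓ)) (φ : Euc ℓ → Euc ℓ) : Prop where
  two_le : 2 ≤ r
  emb : IsEmbeddedSubmanifold k r M
  tub : IsTubularNbhd r M U φ

namespace IsNormalProjection

variable {ℓ k r : ℕ} {M U : Set (Euc ℓ)} {φ : Euc ℓ → Euc ℓ} (H : IsNormalProjection k r M U φ)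

include H

theorem one_le : 1 ≤ r := le_trans (by norm_num) H.two_le

theorem contDiffOn : ContDiffOn ℝ 1 φ U :=
  H.tub.contDiffOn.of_le (by
    have := H.two_le
    exact_mod_cast (by omega : 1 ≤ r - 1))

theorem contDiffAt {x : Euc ℓ} (hx : x ∈ U) : ContDiffAt ℝ 1 φ x :=
  H.contDiffOn.contDiffAt (H.tub.isOpen.mem_nhds hx)

theorem hasFDerivAt {x : Euc ℓ} (hx : x ∈ U) : HasFDerivAt φ (fderiv ℝ φ x) x :=
  ((H.contDiffAt hx).differentiableAt one_ne_zero).hasFDerivAt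

theorem continuousAt {x : Euc ℓ} (hx : x ∈ U) : ContinuousAt φ x := (H.contDiffAt hx).continuousAt

theorem continuousOn : ContinuousOn φ U := H.contDiffOn.continuousOn

theorem continuousOn_fderiv : ContinuousOn (fderiv ℝ φ) U :=
  H.contDiffOn.continuousOn_fderiv_of_isOpen H.tub.isOpen le_rfl

theorem mem_M {x : Euc ℓ} (hx : x ∈ U) : φ x ∈ M := H.tub.mapsTo hx

theorem proj_mem {x : Euc ℓ} (hx : x ∈ U) : φ x ∈ U := by
  simpa using H.tub.segment x hx 0 ⟨le_rfl, zero_le_one⟩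

theorem exists_chart {x : Euc ℓ} (hx : x ∈ U) : Nonempty (GraphChart k r M (φ x)) :=
  H.emb.exists_graphChart H.one_le (H.mem_M hx)

theorem eventually_mem_chart {x : Euc ℓ} (hx : x ∈ U) (c : GraphChart k r M (φ x)) :
    ∀ᶠ z in 𝓝 x, z ∈ U ∧ φ z ∈ M ∩ c.O := by
  filter_upwards [H.tub.isOpen.mem_nhds hx,
    (H.continuousAt hx).preimage_mem_nhds (c.isOpen_O.mem_nhds c.mem)] with z h1 h2
    using ⟨h1, H.mem_M h1, h2⟩

theorem fderiv_eq_comp {x : Euc ℓ} (hx : x ∈ U) (c : GraphChart k r M (φ x)) :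
    fderiv ℝ φ x = fderiv ℝ c.γ (c.e.tan (φ x)) ∘L (c.e.tan ∘L fderiv ℝ φ x) := by
  refine (H.hasFDerivAt hx).unique ?_
  refine ((c.hasFDerivAt H.one_le c.tan_base_mem).comp x
    (c.e.tan.hasFDerivAt.comp x (H.hasFDerivAt hx))).congr_of_eventuallyEq ?_
  filter_upwards [H.eventually_mem_chart hx c] with z hz using (c.γ_tan _ hz.2).symm

theorem fderiv_mem {x : Euc ℓ} (hx : x ∈ U) (v : Euc ℓ) :
    fderiv ℝ φ x v ∈ tangentSubspace M (φ x) := by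
  obtain ⟨c⟩ := H.exists_chart hx
  rw [H.fderiv_eq_comp hx c]
  have := c.fderiv_mem_tangent c.tan_base_mem (c.e.tan (fderiv ℝ φ x v))
  rwa [c.γ_tan_base] at this

/-- The point `φ z = γ y` satisfies `Dγ(y)ᵀ (z - γ y) = 0`. Differentiating this along `y = tan (φ
z)` shows that the partial derivative in `y` is onto, so its invertibility is a consequence of the
mere existence of a differentiable normal projection. The first claim is then read off from the
differentiated equation, the second from local uniqueness of its solutions. The equation is `C¹`
because `r ≥ 2`. -/
theorem fderiv_eq_zero_iff_and_eventually {x : Euc ℓ} (hx : x ∈ U) :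
    (∀ v, fderiv ℝ φ x v = 0 ↔ v ∈ (tangentSubspace M (φ x))ᗮ) ∧
      ∀ᶠ z in 𝓝 x, z - x ∈ (tangentSubspace M (φ x))ᗮ → φ z = φ x := by
  obtain ⟨c⟩ := H.exists_chart hx
  set y₀ := c.e.tan (φ x) with hy₀
  have hyV : y₀ ∈ c.V := c.tan_base_mem
  set D := fderiv ℝ c.γ y₀ with hD
  have hγy : c.γ y₀ = φ x := c.γ_tan_base
  have hDinj : Function.Injective D := c.fderiv_injective H.one_le hyV
  -- `K (z, y) = 0` expresses that `z - γ y` is normal to `M` at `γ y`.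
  let K : Euc ℓ × Euc k → Euc k := fun q =>
    ContinuousLinearMap.adjoint (fderiv ℝ c.γ q.2) (q.1 - c.γ q.2)
  have hKc : ContDiffAt ℝ 1 K (x, y₀) := by
    have h1 : ContDiffAt ℝ 1 (fderiv ℝ c.γ) y₀ :=
      ((c.contDiffOn_fderiv (m := 1) (by have := H.two_le; omega)).contDiffAt
        (c.isOpen_V.mem_nhds hyV))
    have h2 : ContDiffAt ℝ 1 c.γ y₀ :=
      ((c.contDiffOn.contDiffAt (c.isOpen_V.mem_nhds hyV)).of_le
        (by exact_mod_cast H.one_le))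
    have h1' : ContDiffAt ℝ 1 (fun q : Euc ℓ × Euc k => fderiv ℝ c.γ q.2) (x, y₀) :=
      ContDiffAt.comp (x, y₀) (f := Prod.snd) h1 contDiffAt_snd
    have h2' : ContDiffAt ℝ 1 (fun q : Euc ℓ × Euc k => c.γ q.2) (x, y₀) :=
      ContDiffAt.comp (x, y₀) (f := Prod.snd) h2 contDiffAt_snd
    refine contDiffAt_euclidean.2 fun i => ?_
    have h3 : ∀ q, K q i = inner ℝ (fderiv ℝ c.γ q.2 (EuclideanSpace.single i 1))
        (q.1 - c.γ q.2) := by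
      intro q
      rw [← ContinuousLinearMap.adjoint_inner_right, EuclideanSpace.inner_single_left]
      simp [K]
    simp_rw [h3]
    exact (h1'.clm_apply contDiffAt_const).inner ℝ (contDiffAt_fst.sub h2')
  obtain ⟨L, hL⟩ : ∃ L, HasStrictFDerivAt K L (x, y₀) :=
    ⟨_, hKc.hasStrictFDerivAt one_ne_zero⟩
  have hLv : ∀ v, L (v, 0) = ContinuousLinearMap.adjoint D v := by
    have h1 : HasFDerivAt (fun z => K (z, y₀)) (L ∘L ContinuousLinearMap.inl ℝ _ _) x :=
      HasFDerivAt.comp x (f := fun z => (z, y₀)) hL.hasFDerivAt (hasFDerivAt_prodMk_left _ _)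
    have h2 : HasFDerivAt (fun z => K (z, y₀)) (ContinuousLinearMap.adjoint D) x := by
      have h3 := (ContinuousLinearMap.adjoint D).hasFDerivAt (x := x) |>.sub_const
        (ContinuousLinearMap.adjoint D (c.γ y₀))
      refine h3.congr_of_eventuallyEq (Eventually.of_forall fun z => ?_)
      simp only [K]
      rw [map_sub]
    intro v
    exact DFunLike.congr_fun (h1.unique h2) v
  have hKzero : ∀ᶠ z in 𝓝 x, K (z, c.e.tan (φ z)) = 0 := by
    filter_upwards [H.eventually_mem_chart hx c] with z hz
    refine ext_inner_right ℝ fun w => ?_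
    simp only [K]
    rw [ContinuousLinearMap.adjoint_inner_left, inner_zero_left, c.γ_tan _ hz.2, real_inner_comm]
    refine (Submodule.mem_orthogonal _ _).1 (H.tub.normal z hz.1) _ ?_
    have := c.fderiv_mem_tangent (c.tan_mem _ hz.2) w
    rwa [c.γ_tan _ hz.2] at this
  have hchain : ∀ v, ContinuousLinearMap.adjoint D v + L (0, c.e.tan (fderiv ℝ φ x v)) = 0 := by
    have h1 : HasFDerivAt (fun z => K (z, c.e.tan (φ z)))
        (L ∘L (ContinuousLinearMap.id ℝ _).prod (c.e.tan ∘L fderiv ℝ φ x)) x :=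
      HasFDerivAt.comp x (f := fun z => (z, c.e.tan (φ z))) hL.hasFDerivAt
        ((hasFDerivAt_id x).prodMk (c.e.tan.hasFDerivAt.comp x (H.hasFDerivAt hx)))
    have h2 : HasFDerivAt (fun z => K (z, c.e.tan (φ z))) (0 : Euc ℓ →L[ℝ] Euc k) x :=
      (hasFDerivAt_const (0 : Euc k) x).congr_of_eventuallyEq hKzero
    intro v
    have h3 := DFunLike.congr_fun (h1.unique h2) v
    simp only [ContinuousLinearMap.comp_apply, ContinuousLinearMap.prod_apply,
      ContinuousLinearMap.id_apply, zero_apply] at h3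
    rw [← hLv, ← map_add]
    simpa using h3
  have hDsurj : Function.Surjective (ContinuousLinearMap.adjoint D) := by
    have h1 : Function.Injective
        ((ContinuousLinearMap.adjoint D ∘L D : Euc k →L[ℝ] Euc k) : Euc k →ₗ[ℝ] Euc k) := by
      rw [injective_iff_map_eq_zero]
      intro w hw
      apply hDinj
      rw [map_zero, ← inner_self_eq_zero (𝕜 := ℝ), ← ContinuousLinearMap.adjoint_inner_left]
      have : ContinuousLinearMap.adjoint D (D w) = 0 := hw
      rw [this, inner_zero_left]
    intro w
    obtain ⟨z, hz⟩ := LinearMap.surjective_of_injective h1 w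
    exact ⟨D z, hz⟩
  let B : Euc k →L[ℝ] Euc k := L ∘L ContinuousLinearMap.inr ℝ _ _
  -- `hchain` exhibits `-Dᵀ v` as a value of `B`, and `Dᵀ` is onto; so `B` is onto, hence injective.
  have hBinj : Function.Injective (B : Euc k →ₗ[ℝ] Euc k) := by
    refine LinearMap.injective_iff_surjective.2 fun w => ?_
    obtain ⟨v, hv⟩ := hDsurj (-w)
    refine ⟨c.e.tan (fderiv ℝ φ x v), ?_⟩
    have := hchain v
    rw [hv] at this
    exact (neg_add_eq_zero.1 this).symm
  have horth : ∀ v, ContinuousLinearMap.adjoint D v = 0 ↔ v ∈ (tangentSubspace M (φ x))ᗮ := by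
    intro v
    have hT := c.tangent y₀ hyV
    rw [hγy] at hT
    rw [hT, Submodule.mem_orthogonal]
    constructor
    · rintro hv _ ⟨w, rfl⟩
      rw [ContinuousLinearMap.coe_coe, ← ContinuousLinearMap.adjoint_inner_right, hv,
        inner_zero_right]
    · intro hv
      refine ext_inner_left ℝ fun w => ?_
      rw [ContinuousLinearMap.adjoint_inner_right, inner_zero_right]
      exact hv _ ⟨w, rfl⟩
  constructor
  · intro v
    rw [← horth]
    have h1 := hchain v
    constructor
    · intro hv
      rwa [hv, map_zero, ← Prod.zero_eq_mk, map_zero, add_zero] at h1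
    · intro hv
      rw [hv, zero_add] at h1
      have h2 : c.e.tan (fderiv ℝ φ x v) = 0 := hBinj (by rw [map_zero]; exact h1)
      rw [H.fderiv_eq_comp hx c]
      simp [h2]
  · let E : (Euc ℓ × Euc k) →L[ℝ] (Euc ℓ × Euc k) := (ContinuousLinearMap.fst ℝ _ _).prod L
    have hEinj : Function.Injective (E : (Euc ℓ × Euc k) →ₗ[ℝ] (Euc ℓ × Euc k)) := by
      rw [injective_iff_map_eq_zero]
      rintro ⟨v, w⟩ hvw
      have h1 : v = 0 := congrArg Prod.fst hvw
      have h2 : L (v, w) = 0 := congrArg Prod.snd hvw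
      subst h1
      have h3 : w = 0 := hBinj (by rw [map_zero]; exact h2)
      rw [h3]
      rfl
    let E' : (Euc ℓ × Euc k) ≃L[ℝ] (Euc ℓ × Euc k) :=
      (LinearEquiv.ofInjectiveEndo _ hEinj).toContinuousLinearEquiv
    have hE : HasStrictFDerivAt (fun q : Euc ℓ × Euc k => (q.1, K q))
        (E' : (Euc ℓ × Euc k) →L[ℝ] (Euc ℓ × Euc k)) (x, y₀) := by
      have : (E' : (Euc ℓ × Euc k) →L[ℝ] (Euc ℓ × Euc k)) = E :=
        ContinuousLinearMap.ext fun q => rfl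
      rw [this]
      exact hasStrictFDerivAt_fst.prodMk hL
    have h1 := hE.eventually_left_inverse
    have h2 : ContinuousAt (fun z : Euc ℓ => (z, y₀)) x := by fun_prop
    have h3 : ContinuousAt (fun z : Euc ℓ => (z, c.e.tan (φ z))) x :=
      continuousAt_id.prodMk (c.e.tan.continuous.continuousAt.comp (H.continuousAt hx))
    -- Both `(z, y₀)` and `(z, tan (φ z))` are zeros of `K` close to `(x, y₀)`, and `(z, y) ↦ (z, K
    -- (z, y))` is injective there.
    filter_upwards [h2.tendsto.eventually h1, h3.tendsto.eventually h1, hKzero,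
      H.eventually_mem_chart hx c] with z h4 h5 h6 h7 h8
    have h9 : K (z, y₀) = 0 := by
      simp only [K]
      rw [hγy]
      have h10 := (horth _).2 h8
      have h11 := (horth _).2 (H.tub.normal x hx)
      rw [show z - φ x = (z - x) + (x - φ x) by abel, map_add, ← hD, h10, h11, add_zero]
    rw [h9] at h4
    rw [h6] at h5
    have h12 := congrArg Prod.snd (h4.symm.trans h5)
    simp only at h12
    rw [← c.γ_tan _ h7.2, ← h12, hγy]

theorem fderiv_eq_zero_iff {x : Euc ℓ} (hx : x ∈ U) (v : Euc ℓ) :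
    fderiv ℝ φ x v = 0 ↔ v ∈ (tangentSubspace M (φ x))ᗮ :=
  (H.fderiv_eq_zero_iff_and_eventually hx).1 v

/-- `φ` is constant along segments in `U` that are normal to `M`. -/
theorem eq_of_segment {x n : Euc ℓ} (hn : n ∈ (tangentSubspace M (φ x))ᗮ)
    (h : ∀ t ∈ Icc (0 : ℝ) 1, x + t • n ∈ U) {t : ℝ} (ht : t ∈ Icc (0 : ℝ) 1) :
    φ (x + t • n) = φ x := by
  -- If `φ` takes the value `φ x` at `x + t n`, then `n` is normal for that point as well, so the
  -- value persists for nearby parameters. Since the set of good parameters is also closed, it is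
  -- all of `[0, 1]`.
  have hc : ∀ t ∈ Icc (0 : ℝ) 1, ∀ᶠ s in 𝓝 t, φ (x + t • n) = φ x → φ (x + s • n) = φ x := by
    intro t ht
    have h1 := (H.fderiv_eq_zero_iff_and_eventually (h t ht)).2
    have h2 : ContinuousAt (fun s : ℝ => x + s • n) t := by fun_prop
    filter_upwards [h2.tendsto.eventually h1] with s hs h3
    rw [← h3]
    apply hs
    rw [h3, show x + s • n - (x + t • n) = (s - t) • n by rw [sub_smul]; abel]
    exact Submodule.smul_mem _ _ hn
  have hcont : ContinuousOn (fun t : ℝ => φ (x + t • n)) (Icc 0 1) :=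
    H.continuousOn.comp (by fun_prop) h
  have hclosed : IsClosed ({t : ℝ | φ (x + t • n) = φ x} ∩ Icc 0 1) := by
    rw [inter_comm]
    exact hcont.preimage_isClosed_of_isClosed isClosed_Icc isClosed_singleton
  have := hclosed.Icc_subset_of_forall_mem_nhdsWithin (by simp) fun t ht => by
    filter_upwards [nhdsWithin_le_nhds (hc t (Ico_subset_Icc_self ht.2))] with s hs
    exact hs ht.1
  exact this ht

/-- `Φ_ε x` lies on the normal segment from `x` to `φ x`, at parameter `1 - ε`. -/
theorem proj_squeeze {x : Euc ℓ} (hx : x ∈ U) {ε : ℝ} (hε : ε ∈ Icc (0 : ℝ) 1) :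
    φ (squeeze φ ε x) = φ x := by
  have h1 : ∀ t : ℝ, x + t • (φ x - x) = (1 - t) • x + (1 - (1 - t)) • φ x := by
    intro t
    module
  have h2 := H.eq_of_segment (x := x) (n := φ x - x)
    (by rw [← neg_sub]; exact Submodule.neg_mem _ (H.tub.normal x hx))
    (fun t ht => by
      rw [h1]
      exact H.tub.segment x hx (1 - t) ⟨by linarith [ht.2], by linarith [ht.1]⟩)
    (t := 1 - ε) ⟨by linarith [hε.2], by linarith [hε.1]⟩
  rw [h1] at h2
  simpa [squeeze] using h2

theorem proj_proj {x : Euc ℓ} (hx : x ∈ U) : φ (φ x) = φ x :=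
  H.tub.fixed _ ⟨H.mem_M hx, H.proj_mem hx⟩

theorem fderiv_proj_apply {p : Euc ℓ} (hpM : p ∈ M) (hpU : p ∈ U) {v : Euc ℓ}
    (hv : v ∈ tangentSubspace M p) : fderiv ℝ φ p v = v := by
  obtain ⟨c⟩ := H.emb.exists_graphChart H.one_le hpM
  have hpφ : HasFDerivAt φ (fderiv ℝ φ p) (c.γ (c.e.tan p)) := by
    rw [c.γ_tan_base]; exact H.hasFDerivAt hpU
  have hd := c.hasFDerivAt H.one_le c.tan_base_mem
  have h1 : fderiv ℝ φ p ∘L fderiv ℝ c.γ (c.e.tan p) = fderiv ℝ c.γ (c.e.tan p) := by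
    refine (hpφ.comp _ hd).unique (hd.congr_of_eventuallyEq ?_)
    have h2 : ∀ᶠ y in 𝓝 (c.e.tan p), c.γ y ∈ U :=
      hd.continuousAt.preimage_mem_nhds (by
        rw [c.γ_tan_base]; exact H.tub.isOpen.mem_nhds hpU)
    filter_upwards [c.isOpen_V.mem_nhds c.tan_base_mem, h2] with y hy hyU
    exact H.tub.fixed _ ⟨(c.γ_mem y hy).1, hyU⟩
  have h3 := c.tangent _ c.tan_base_mem
  rw [c.γ_tan_base] at h3
  rw [h3] at hv
  obtain ⟨w, rfl⟩ := hv
  exact DFunLike.congr_fun h1 w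

theorem fderiv_proj {x : Euc ℓ} (hx : x ∈ U) :
    fderiv ℝ φ (φ x) = (tangentSubspace M (φ x)).starProjection := by
  ext1 v
  have hu := H.proj_mem hx
  set T := tangentSubspace M (φ x) with hT
  have h1 : v - T.starProjection v ∈ Tᗮ := T.sub_starProjection_mem_orthogonal v
  have h2 : fderiv ℝ φ (φ x) (v - T.starProjection v) = 0 := by
    rw [H.fderiv_eq_zero_iff hu, H.proj_proj hx]
    exact h1
  rw [map_sub, sub_eq_zero] at h2
  rw [h2, H.fderiv_proj_apply (H.mem_M hx) hu (T.starProjection_apply_mem v)]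

/-- At points of `M` the derivative of `φ` is the orthogonal projection onto the tangent space. This
writes `P` in terms of `Dφ`, so its continuity requires no separate study of how tangent spaces
vary. -/
theorem normalProj_eq {x : Euc ℓ} (hx : x ∈ U) :
    normalProj M φ x = ContinuousLinearMap.id ℝ _ - fderiv ℝ φ (φ x) := by
  rw [H.fderiv_proj hx]
  rfl

end IsNormalProjection

end

section

/-! ### The derivative of the squeezing maps, `J₀` and `S₀` -/

section LinearAlgebra

variable {ℓ : ℕ}

theorem compress_apply_coe (T : Submodule ℝ (Euc ℓ)) (L : Euc ℓ →L[ℝ] Euc ℓ) (t : T) :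
    ((compress T L t : T) : Euc ℓ) = T.starProjection (L t) := rfl

/-- The determinant of a map that preserves `T` and is a multiple of the identity on `Tᗮ`. -/
theorem det_eq_pow_mul_det_compress (T : Submodule ℝ (Euc ℓ)) (L : Euc ℓ →L[ℝ] Euc ℓ) (c : ℝ)
    (hT : ∀ t ∈ T, L t ∈ T) (hN : ∀ n ∈ Tᗮ, L n = c • n) :
    L.det = c ^ Module.finrank ℝ Tᗮ * LinearMap.det (compress T L) := by
  let E := T.prodEquivOfIsCompl Tᗮ T.isCompl_orthogonal
  have h1 : (L : Euc ℓ →ₗ[ℝ] Euc ℓ) = E.toLinearMap ∘ₗ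
      (LinearMap.prodMap (compress T L) (c • LinearMap.id : Tᗮ →ₗ[ℝ] Tᗮ)) ∘ₗ
        E.symm.toLinearMap := by
    refine LinearMap.ext fun v => ?_
    obtain ⟨⟨t, n⟩, rfl⟩ := E.surjective v
    simp only [LinearMap.comp_apply, LinearEquiv.coe_coe, LinearEquiv.symm_apply_apply]
    simp only [LinearMap.prodMap_apply, E, Submodule.coe_prodEquivOfIsCompl', LinearMap.smul_apply,
      LinearMap.id_apply, Submodule.coe_smul, compress_apply_coe, ContinuousLinearMap.coe_coe,
      map_add, hN n n.2]
    rw [Submodule.starProjection_eq_self_iff.2 (hT t t.2)]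
  rw [ContinuousLinearMap.det, h1, LinearMap.det_conj, LinearMap.det_prodMap, LinearMap.det_smul,
    LinearMap.det_id, mul_one, mul_comm]

/-- An injective endomorphism as a continuous linear equivalence. -/
theorem exists_equiv_of_injective {E : Type*} [NormedAddCommGroup E] [NormedSpace ℝ E]
    [FiniteDimensional ℝ E] {L : E →L[ℝ] E} (hL : Function.Injective L) :
    ∃ e : E ≃L[ℝ] E, (e : E →L[ℝ] E) = L :=
  ⟨(LinearEquiv.ofInjectiveEndo (L : E →ₗ[ℝ] E) hL).toContinuousLinearEquiv,
    ContinuousLinearMap.ext fun _ => rfl⟩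

theorem continuousAt_inverse_of_injective {E : Type*} [NormedAddCommGroup E] [NormedSpace ℝ E]
    [FiniteDimensional ℝ E] {L : E →L[ℝ] E} (hL : Function.Injective L) :
    ContinuousAt ContinuousLinearMap.inverse L := by
  have : CompleteSpace E := FiniteDimensional.complete ℝ E
  obtain ⟨e, rfl⟩ := exists_equiv_of_injective hL
  exact (contDiffAt_map_inverse (n := 0) e).continuousAt

end LinearAlgebra

/-- The derivative of the squeezing map, rescaled so as to be the identity in normal directions. -/
noncomputable def regDeriv {ℓ : ℕ} (φ : Euc ℓ → Euc ℓ) (ε : ℝ) (x : Euc ℓ) : Euc ℓ →L[ℝ] Euc ℓ :=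
  ε • ContinuousLinearMap.id ℝ _ +
    (1 - ε) • (fderiv ℝ φ x + (ContinuousLinearMap.id ℝ _ - fderiv ℝ φ (φ x)))

namespace IsNormalProjection

variable {ℓ k r : ℕ} {M U : Set (Euc ℓ)} {φ : Euc ℓ → Euc ℓ} (H : IsNormalProjection k r M U φ)

include H

theorem continuousOn_fderiv_proj : ContinuousOn (fun x => fderiv ℝ φ (φ x)) U :=
  H.continuousOn_fderiv.comp H.continuousOn fun _ hx => H.proj_mem hx

theorem continuousOn_normalProj : ContinuousOn (normalProj M φ) U :=
  (continuousOn_const.sub H.continuousOn_fderiv_proj).congr fun _ hx => H.normalProj_eq hx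

theorem continuousOn_regDeriv :
    ContinuousOn (fun q : ℝ × Euc ℓ => regDeriv φ q.1 q.2) (univ ×ˢ U) := by
  unfold regDeriv
  have h1 : ContinuousOn (fun q : ℝ × Euc ℓ => fderiv ℝ φ q.2) (univ ×ˢ U) :=
    H.continuousOn_fderiv.comp continuousOn_snd fun q hq => hq.2
  have h2 : ContinuousOn (fun q : ℝ × Euc ℓ => fderiv ℝ φ (φ q.2)) (univ ×ˢ U) :=
    H.continuousOn_fderiv_proj.comp continuousOn_snd fun q hq => hq.2
  fun_prop

theorem regDeriv_apply_normal {x : Euc ℓ} (hx : x ∈ U) (ε : ℝ) {n : Euc ℓ}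
    (hn : n ∈ (tangentSubspace M (φ x))ᗮ) : regDeriv φ ε x n = n := by
  have h1 : fderiv ℝ φ x n = 0 := (H.fderiv_eq_zero_iff hx n).2 hn
  have h2 : fderiv ℝ φ (φ x) n = 0 := by
    rw [H.fderiv_proj hx]
    exact (Submodule.starProjection_apply_eq_zero_iff _).2 hn
  simp only [regDeriv, add_apply, smul_apply, sub_apply,
    ContinuousLinearMap.id_apply, h1, h2]
  module

theorem fderiv_proj_apply' {x : Euc ℓ} (hx : x ∈ U) {t : Euc ℓ}
    (ht : t ∈ tangentSubspace M (φ x)) : fderiv ℝ φ (φ x) t = t :=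
  H.fderiv_proj_apply (H.mem_M hx) (H.proj_mem hx) ht

theorem regDeriv_apply_tangent {x : Euc ℓ} (hx : x ∈ U) (ε : ℝ) {t : Euc ℓ}
    (ht : t ∈ tangentSubspace M (φ x)) :
    regDeriv φ ε x t = ε • t + (1 - ε) • fderiv ℝ φ x t := by
  simp only [regDeriv, add_apply, smul_apply, sub_apply,
    ContinuousLinearMap.id_apply, H.fderiv_proj_apply' hx ht]
  module

theorem regDeriv_tangent_mem {x : Euc ℓ} (hx : x ∈ U) (ε : ℝ) {t : Euc ℓ}
    (ht : t ∈ tangentSubspace M (φ x)) : regDeriv φ ε x t ∈ tangentSubspace M (φ x) := by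
  rw [H.regDeriv_apply_tangent hx ε ht]
  exact Submodule.add_mem _ (Submodule.smul_mem _ _ ht)
    (Submodule.smul_mem _ _ (H.fderiv_mem hx t))

theorem hasStrictFDerivAt_squeeze {x : Euc ℓ} (hx : x ∈ U) (ε : ℝ) :
    HasStrictFDerivAt (squeeze φ ε) (ε • ContinuousLinearMap.id ℝ _ + (1 - ε) • fderiv ℝ φ x) x :=
  ((hasStrictFDerivAt_id x).const_smul ε).add
    (((H.contDiffAt hx).hasStrictFDerivAt one_ne_zero).const_smul (1 - ε))

/-- Differentiate `φ ∘ Φ_ε = φ`: if `DΦ_ε(x) t = 0`, then `Dφ(x) t = 0`, so `t` is normal as well as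
tangent. The value `ε = 0` is allowed and gives injectivity of `Dφ(x)` on the tangent space. -/
theorem squeeze_tangent_injective {x : Euc ℓ} (hx : x ∈ U) {ε : ℝ} (hε : ε ∈ Icc (0 : ℝ) 1)
    {t : Euc ℓ} (ht : t ∈ tangentSubspace M (φ x)) (h0 : ε • t + (1 - ε) • fderiv ℝ φ x t = 0) :
    t = 0 := by
  have hs : squeeze φ ε x ∈ U := H.tub.segment x hx ε hε
  have hev : ∀ᶠ z in 𝓝 x, φ (squeeze φ ε z) = φ z := by
    filter_upwards [H.tub.isOpen.mem_nhds hx] with z hz using H.proj_squeeze hz hε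
  have h1 := ((H.hasFDerivAt hs).comp x (H.hasStrictFDerivAt_squeeze hx ε).hasFDerivAt).unique
    ((H.hasFDerivAt hx).congr_of_eventuallyEq hev)
  have h2 := DFunLike.congr_fun h1 t
  simp only [ContinuousLinearMap.comp_apply, add_apply, smul_apply,
    ContinuousLinearMap.id_apply, h0, map_zero] at h2
  have h3 := (H.fderiv_eq_zero_iff hx t).1 h2.symm
  exact Submodule.disjoint_def.1 (Submodule.orthogonal_disjoint _) t ht h3

omit H in
theorem exists_add_eq (T : Submodule ℝ (Euc ℓ)) (v : Euc ℓ) :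
    ∃ t ∈ T, ∃ n ∈ Tᗮ, v = t + n :=
  ⟨_, T.starProjection_apply_mem v, _, T.sub_starProjection_mem_orthogonal v, by simp⟩

omit H in
theorem eq_zero_of_add_eq_zero {T : Submodule ℝ (Euc ℓ)} {t n : Euc ℓ} (ht : t ∈ T) (hn : n ∈ Tᗮ)
    (h : t + n = 0) : t = 0 ∧ n = 0 := by
  have h1 : t = 0 := by
    refine Submodule.disjoint_def.1 (Submodule.orthogonal_disjoint T) t ht ?_
    rw [eq_neg_of_add_eq_zero_left h]
    exact Submodule.neg_mem _ hn
  exact ⟨h1, by simpa [h1] using h⟩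

theorem regDeriv_injective {x : Euc ℓ} (hx : x ∈ U) {ε : ℝ} (hε : ε ∈ Icc (0 : ℝ) 1) :
    Function.Injective (regDeriv φ ε x) := by
  rw [injective_iff_map_eq_zero]
  intro v hv
  obtain ⟨t, ht, n, hn, rfl⟩ := exists_add_eq (tangentSubspace M (φ x)) v
  rw [map_add, H.regDeriv_apply_normal hx ε hn] at hv
  obtain ⟨h1, h2⟩ := eq_zero_of_add_eq_zero (H.regDeriv_tangent_mem hx ε ht) hn hv
  rw [H.regDeriv_apply_tangent hx ε ht] at h1
  rw [h2, H.squeeze_tangent_injective hx hε ht h1, add_zero]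

theorem squeeze_fderiv_injective {x : Euc ℓ} (hx : x ∈ U) {ε : ℝ} (hε : ε ∈ Ioc (0 : ℝ) 1) :
    Function.Injective (ε • ContinuousLinearMap.id ℝ (Euc ℓ) + (1 - ε) • fderiv ℝ φ x) := by
  rw [injective_iff_map_eq_zero]
  intro v hv
  obtain ⟨t, ht, n, hn, rfl⟩ := exists_add_eq (tangentSubspace M (φ x)) v
  have h0 : fderiv ℝ φ x n = 0 := (H.fderiv_eq_zero_iff hx n).2 hn
  have h1 : (ε • t + (1 - ε) • fderiv ℝ φ x t) + ε • n = 0 := by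
    simp only [add_apply, smul_apply, ContinuousLinearMap.id_apply, map_add, h0] at hv
    rw [← hv]
    module
  obtain ⟨h2, h3⟩ := eq_zero_of_add_eq_zero (Submodule.add_mem _ (Submodule.smul_mem _ _ ht)
    (Submodule.smul_mem _ _ (H.fderiv_mem hx t))) (Submodule.smul_mem _ ε hn) h1
  rw [H.squeeze_tangent_injective hx (Ioc_subset_Icc_self hε) ht h2, zero_add]
  exact (smul_eq_zero.1 h3).resolve_left hε.1.ne'

theorem squeeze_injOn {ε : ℝ} (hε : ε ∈ Ioc (0 : ℝ) 1) : InjOn (squeeze φ ε) U := by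
  intro x hx z hz h
  have h1 := H.proj_squeeze hx (Ioc_subset_Icc_self hε)
  rw [h, H.proj_squeeze hz (Ioc_subset_Icc_self hε)] at h1
  simp only [squeeze, h1, add_left_inj] at h
  exact smul_right_injective _ hε.1.ne' h

/-- `regDeriv φ 0 x` is `Dφ` on the tangent space and the identity on the normal space. A
determinant on the fixed space `ℝ^ℓ` makes continuity and positivity of `J₀` accessible. -/
theorem J₀_eq {x : Euc ℓ} (hx : x ∈ U) : J₀ M φ x = |(regDeriv φ 0 x).det| := by
  rw [det_eq_pow_mul_det_compress (tangentSubspace M (φ x)) (regDeriv φ 0 x) 1, one_pow, one_mul,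
    J₀]
  · congr 2
    refine LinearMap.ext fun t => Subtype.ext ?_
    rw [compress_apply_coe, compress_apply_coe, H.regDeriv_apply_tangent hx 0 t.2]
    simp
  · exact fun t ht => H.regDeriv_tangent_mem hx 0 ht
  · intro n hn
    rw [H.regDeriv_apply_normal hx 0 hn, one_smul]

theorem J₀_pos {x : Euc ℓ} (hx : x ∈ U) : 0 < J₀ M φ x := by
  rw [H.J₀_eq hx, abs_pos]
  obtain ⟨e, he⟩ := exists_equiv_of_injective (H.regDeriv_injective hx (ε := 0) (by simp))
  rw [← he]
  exact (LinearEquiv.isUnit_det' e.toLinearEquiv).ne_zero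

theorem continuousOn_J₀ : ContinuousOn (J₀ M φ) U := by
  have h1 : ContinuousOn (fun x => regDeriv φ 0 x) U :=
    H.continuousOn_regDeriv.comp (f := fun x => ((0 : ℝ), x)) (by fun_prop) fun x hx => ⟨trivial, hx⟩
  exact ((ContinuousLinearMap.continuous_det.comp_continuousOn h1).abs).congr fun x hx => H.J₀_eq hx

/-- For `ε > 0` the inverse of `DΦ_ε` is `(regDeriv φ ε x)⁻¹` on images of tangent vectors and `ε⁻¹`
on normal vectors. Subtracting `ε⁻¹ P` removes the singular part and leaves `(regDeriv φ ε x)⁻¹ -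
P`, which is continuous at `ε = 0` because `regDeriv φ 0 x` is invertible. -/
theorem S₀_eq {x : Euc ℓ} (hx : x ∈ U) :
    S₀ M U φ x = (regDeriv φ 0 x).inverse - normalProj M φ x := by
  refine Tendsto.limUnder_eq ?_
  have h0 : ContinuousAt (fun ε => (regDeriv φ ε x).inverse - normalProj M φ x) 0 := by
    refine ContinuousAt.sub ?_ continuousAt_const
    refine ContinuousAt.comp (f := fun ε => regDeriv φ ε x)
      (continuousAt_inverse_of_injective (H.regDeriv_injective hx (by simp))) ?_
    unfold regDeriv
    fun_prop
  refine (h0.tendsto.mono_left nhdsWithin_le_nhds).congr' ?_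
  filter_upwards [Ioc_mem_nhdsGT (zero_lt_one (α := ℝ))] with ε hε
  obtain ⟨e₁, he₁⟩ := exists_equiv_of_injective (H.squeeze_fderiv_injective hx hε)
  obtain ⟨e₂, he₂⟩ := exists_equiv_of_injective (H.regDeriv_injective hx (Ioc_subset_Icc_self hε))
  have h1 := H.hasStrictFDerivAt_squeeze hx ε
  rw [← he₁] at h1
  -- `Φ_ε` is injective on the open set `U`, so the chosen inverse is a left inverse near `x`, which
  -- is all that is needed to compute its derivative.
  have h2 := (h1.to_local_left_inverse (g := Function.invFunOn (squeeze φ ε) U) (by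
    filter_upwards [H.tub.isOpen.mem_nhds hx] with z hz
      using (H.squeeze_injOn hε).leftInvOn_invFunOn hz)).hasFDerivAt.fderiv
  rw [h2, ← he₂, ContinuousLinearMap.inverse_equiv]
  refine ContinuousLinearMap.ext fun v => ?_
  obtain ⟨w, rfl⟩ := e₂.surjective v
  obtain ⟨t, ht, n, hn, rfl⟩ := exists_add_eq (tangentSubspace M (φ x)) w
  have h3 : ∀ z, e₂ z = regDeriv φ ε x z := fun z => DFunLike.congr_fun he₂ z
  have h4 : ∀ z, e₁ z = ε • z + (1 - ε) • fderiv ℝ φ x z := fun z => DFunLike.congr_fun he₁ z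
  have h5 : e₁.symm (e₂ (t + n)) = t + ε⁻¹ • n := by
    rw [ContinuousLinearEquiv.symm_apply_eq, h3, h4, map_add, H.regDeriv_apply_normal hx ε hn,
      H.regDeriv_apply_tangent hx ε ht, map_add, map_smul, (H.fderiv_eq_zero_iff hx n).2 hn,
      smul_zero, add_zero, smul_add, smul_inv_smul₀ hε.1.ne']
    abel
  have h6 : normalProj M φ x (e₂ (t + n)) = n := by
    rw [h3, map_add, H.regDeriv_apply_normal hx ε hn, map_add, normalProj]
    simp only [sub_apply, ContinuousLinearMap.id_apply]
    rw [Submodule.starProjection_eq_self_iff.2 (H.regDeriv_tangent_mem hx ε ht),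
      (Submodule.starProjection_apply_eq_zero_iff _).2 hn]
    simp
  simp only [sub_apply, smul_apply, h6, ContinuousLinearEquiv.coe_coe, h5,
    ContinuousLinearEquiv.symm_apply_apply]
  abel

theorem continuousOn_inverse_regDeriv :
    ContinuousOn (fun q : ℝ × Euc ℓ => (regDeriv φ q.1 q.2).inverse) (Icc 0 1 ×ˢ U) := by
  intro q hq
  exact (continuousAt_inverse_of_injective (H.regDeriv_injective hq.2 hq.1)).comp_continuousWithinAt
    (f := fun q : ℝ × Euc ℓ => regDeriv φ q.1 q.2)
    ((H.continuousOn_regDeriv q ⟨trivial, hq.2⟩).mono fun q hq => ⟨trivial, hq.2⟩)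

theorem continuousOn_S₀ : ContinuousOn (S₀ M U φ) U := by
  have h1 : ContinuousOn (fun x => (regDeriv φ 0 x).inverse) U :=
    H.continuousOn_inverse_regDeriv.comp (f := fun x => ((0 : ℝ), x)) (by fun_prop)
      fun x hx => ⟨by simp, hx⟩
  exact (h1.sub H.continuousOn_normalProj).congr fun x hx => H.S₀_eq hx

theorem inverse_regDeriv_apply {x : Euc ℓ} (hx : x ∈ U) {ε : ℝ} (hε : ε ∈ Icc (0 : ℝ) 1)
    (v : Euc ℓ) : (regDeriv φ ε x).inverse (regDeriv φ ε x v) = v := by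
  obtain ⟨e, he⟩ := exists_equiv_of_injective (H.regDeriv_injective hx hε)
  rw [← he, ContinuousLinearMap.inverse_equiv]
  simp

/-- Together with `S₀_normal` and `fderiv_S₀` this is the working description of `S₀`: the inverse
of `Dφ` on the tangent space, extended by zero on the normal space. -/
theorem S₀_fderiv {x : Euc ℓ} (hx : x ∈ U) {t : Euc ℓ} (ht : t ∈ tangentSubspace M (φ x)) :
    S₀ M U φ x (fderiv ℝ φ x t) = t := by
  have h1 := H.regDeriv_apply_tangent hx 0 ht
  rw [zero_smul, zero_add, sub_zero, one_smul] at h1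
  rw [H.S₀_eq hx, sub_apply, ← h1, H.inverse_regDeriv_apply hx (by simp), h1, normalProj, sub_apply,
    Submodule.starProjection_eq_self_iff.2 (H.fderiv_mem hx t)]
  simp

theorem S₀_normal {x : Euc ℓ} (hx : x ∈ U) {n : Euc ℓ} (hn : n ∈ (tangentSubspace M (φ x))ᗮ) :
    S₀ M U φ x n = 0 := by
  have h2 := H.inverse_regDeriv_apply hx (ε := 0) (by simp) n
  rw [H.regDeriv_apply_normal hx 0 hn] at h2
  rw [H.S₀_eq hx, sub_apply, h2, normalProj, sub_apply,
    (Submodule.starProjection_apply_eq_zero_iff _).2 hn]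
  simp

theorem exists_fderiv_eq {x : Euc ℓ} (hx : x ∈ U) {t : Euc ℓ} (ht : t ∈ tangentSubspace M (φ x)) :
    ∃ s ∈ tangentSubspace M (φ x), fderiv ℝ φ x s = t := by
  let L : tangentSubspace M (φ x) →ₗ[ℝ] tangentSubspace M (φ x) :=
    (fderiv ℝ φ x : Euc ℓ →ₗ[ℝ] Euc ℓ).restrict fun v _ => H.fderiv_mem hx v
  have hL : Function.Injective L := by
    rw [injective_iff_map_eq_zero]
    intro s hs
    have h1 : fderiv ℝ φ x s = 0 := congrArg Subtype.val hs
    exact Subtype.ext (Submodule.disjoint_def.1 (Submodule.orthogonal_disjoint _) _ s.2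
      ((H.fderiv_eq_zero_iff hx _).1 h1))
  obtain ⟨s, hs⟩ := LinearMap.surjective_of_injective hL ⟨t, ht⟩
  exact ⟨s, s.2, congrArg Subtype.val hs⟩

theorem fderiv_S₀ {x : Euc ℓ} (hx : x ∈ U) {t : Euc ℓ} (ht : t ∈ tangentSubspace M (φ x)) :
    fderiv ℝ φ x (S₀ M U φ x t) = t := by
  obtain ⟨s, hs, rfl⟩ := H.exists_fderiv_eq hx ht
  rw [H.S₀_fderiv hx hs]

theorem adjoint_S₀_mem {x : Euc ℓ} (hx : x ∈ U) (g : Euc ℓ) :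
    ContinuousLinearMap.adjoint (S₀ M U φ x) g ∈ tangentSubspace M (φ x) := by
  rw [← Submodule.orthogonal_orthogonal (tangentSubspace M (φ x))]
  refine (Submodule.mem_orthogonal _ _).2 fun n hn => ?_
  rw [ContinuousLinearMap.adjoint_inner_right, H.S₀_normal hx hn, inner_zero_left]

/-- Recovers `∇v` at `φ x` from `∇(v ∘ φ) = Dφᵀ ∇v`. This is where `S₀ᵀ ∇u = ∇v ∘ φ` comes from. -/
theorem adjoint_S₀_adjoint_fderiv {x : Euc ℓ} (hx : x ∈ U) {V : Euc ℓ}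
    (hV : V ∈ tangentSubspace M (φ x)) :
    ContinuousLinearMap.adjoint (S₀ M U φ x) (ContinuousLinearMap.adjoint (fderiv ℝ φ x) V) = V := by
  refine ext_inner_right ℝ fun v => ?_
  rw [ContinuousLinearMap.adjoint_inner_left, ContinuousLinearMap.adjoint_inner_left]
  obtain ⟨t, ht, n, hn, rfl⟩ := exists_add_eq (tangentSubspace M (φ x)) v
  rw [map_add, H.S₀_normal hx hn, add_zero, H.fderiv_S₀ hx ht, inner_add_right,
    (Submodule.mem_orthogonal _ _).1 hn V hV, add_zero]

/-- The converse cancellation, valid for tangential gradients: `∇u` is controlled by `S₀ᵀ ∇u`, as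
the completeness of `H¹_s(Ω)` demands. -/
theorem adjoint_fderiv_adjoint_S₀ {x : Euc ℓ} (hx : x ∈ U) {g : Euc ℓ}
    (hg : g ∈ tangentSubspace M (φ x)) :
    ContinuousLinearMap.adjoint (fderiv ℝ φ x) (ContinuousLinearMap.adjoint (S₀ M U φ x) g) = g := by
  refine ext_inner_right ℝ fun v => ?_
  rw [ContinuousLinearMap.adjoint_inner_left, ContinuousLinearMap.adjoint_inner_left]
  obtain ⟨t, ht, n, hn, rfl⟩ := exists_add_eq (tangentSubspace M (φ x)) v
  rw [map_add, (H.fderiv_eq_zero_iff hx n).2 hn, add_zero, H.S₀_fderiv hx ht, inner_add_right,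
    (Submodule.mem_orthogonal _ _).1 hn g hg, add_zero]

theorem adjoint_fderiv_mem {x : Euc ℓ} (hx : x ∈ U) (V : Euc ℓ) :
    ContinuousLinearMap.adjoint (fderiv ℝ φ x) V ∈ tangentSubspace M (φ x) := by
  rw [← Submodule.orthogonal_orthogonal (tangentSubspace M (φ x))]
  refine (Submodule.mem_orthogonal _ _).2 fun n hn => ?_
  rw [ContinuousLinearMap.adjoint_inner_right, (H.fderiv_eq_zero_iff hx n).2 hn, inner_zero_left]

omit H in
theorem normalProj_eq_zero_iff {x g : Euc ℓ} :
    normalProj M φ x g = 0 ↔ g ∈ tangentSubspace M (φ x) := by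
  rw [normalProj, sub_apply, ContinuousLinearMap.id_apply, sub_eq_zero, eq_comm,
    Submodule.starProjection_eq_self_iff]

/-- On `M ∩ U` the surface divergence is the divergence of the field composed with `φ`. -/
theorem surfaceDiv_eq {p : Euc ℓ} (hpM : p ∈ M) (hpU : p ∈ U) (Ψ : Euc ℓ → Euc ℓ) :
    surfaceDiv M Ψ p = LinearMap.trace ℝ (Euc ℓ)
      (fderiv ℝ Ψ p ∘L fderiv ℝ φ p : Euc ℓ →L[ℝ] Euc ℓ) := by
  have hp : φ p = p := H.tub.fixed p ⟨hpM, hpU⟩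
  have h1 : fderiv ℝ φ p = (tangentSubspace M p).starProjection := by
    have := H.fderiv_proj hpU
    rwa [hp] at this
  rw [surfaceDiv, h1]
  have h2 : ((fderiv ℝ Ψ p ∘L (tangentSubspace M p).starProjection : Euc ℓ →L[ℝ] Euc ℓ) :
      Euc ℓ →ₗ[ℝ] Euc ℓ) = ((fderiv ℝ Ψ p ∘L (tangentSubspace M p).subtypeL :
        tangentSubspace M p →L[ℝ] Euc ℓ) : tangentSubspace M p →ₗ[ℝ] Euc ℓ) ∘ₗ
        ((tangentSubspace M p).orthogonalProjectionOnto : Euc ℓ →ₗ[ℝ] tangentSubspace M p) := rfl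
  rw [h2, ← LinearMap.trace_comp_comm']
  rfl

theorem continuousOn_surfaceDiv {Ψ : Euc ℓ → Euc ℓ} (hΨ : ContDiff ℝ 1 Ψ) :
    ContinuousOn (surfaceDiv M Ψ) (M ∩ U) := by
  have h1 : ContinuousOn (fun p => fderiv ℝ Ψ p ∘L fderiv ℝ φ p) (M ∩ U) :=
    (hΨ.continuous_fderiv one_ne_zero).continuousOn.clm_comp
      (H.continuousOn_fderiv.mono inter_subset_right)
  have h2 : Continuous fun L : Euc ℓ →L[ℝ] Euc ℓ => LinearMap.trace ℝ (Euc ℓ) L :=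
    (LinearMap.trace ℝ (Euc ℓ) ∘ₗ ContinuousLinearMap.coeLM ℝ).continuous_of_finiteDimensional
  exact (h2.comp_continuousOn h1).congr fun p hp => H.surfaceDiv_eq hp.1 hp.2 Ψ

end IsNormalProjection

end

section

/-! ### Cutoffs, mollification and integration by parts -/

section Mollify

open scoped Manifold

variable {n : ℕ}

/-- The indices are points of `K`, so that each function is tied to the neighbourhood `O i` chosen
at its own index. -/
theorem exists_partition {K : Set (Euc n)} (hK : IsCompact K) (O : Euc n → Set (Euc n))
    (hO : ∀ x ∈ K, IsOpen (O x)) (hx : ∀ x ∈ K, x ∈ O x) :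
    ∃ (t : Finset (Euc n)) (ζ : Euc n → Euc n → ℝ), (∀ i ∈ t, i ∈ K) ∧
      (∀ i ∈ t, ContDiff ℝ ∞ (ζ i)) ∧ (∀ i ∈ t, tsupport (ζ i) ⊆ O i) ∧
      ∀ x ∈ K, ∑ i ∈ t, ζ i x = 1 := by
  classical
  obtain ⟨t, htK⟩ := hK.elim_nhds_subcover' (fun x _ => O x)
    (fun x h => (hO x h).mem_nhds (hx x h))
  obtain ⟨f, hf⟩ := SmoothPartitionOfUnity.exists_isSubordinate 𝓘(ℝ, Euc n) hK.isClosed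
    (fun i : t => O i) (fun i => hO _ i.1.2) (fun x hxK => by
      obtain ⟨i, hi, hi'⟩ := mem_iUnion₂.1 (htK hxK)
      exact mem_iUnion.2 ⟨⟨i, hi⟩, hi'⟩)
  refine ⟨t.map (Function.Embedding.subtype _), fun x =>
    if h : ∃ hx : x ∈ K, (⟨x, hx⟩ : K) ∈ t then f ⟨⟨x, h.1⟩, h.2⟩ else 0, ?_, ?_, ?_, ?_⟩
  · simp only [Finset.mem_map, forall_exists_index, and_imp]
    rintro _ i - rfl
    exact i.2
  · simp only [Finset.mem_map, forall_exists_index, and_imp]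
    rintro _ i hi rfl
    have h : ∃ hx : (Function.Embedding.subtype _ i : Euc n) ∈ K, (⟨_, hx⟩ : K) ∈ t := ⟨i.2, hi⟩
    rw [dif_pos h]
    exact (f ⟨i, hi⟩).contMDiff.contDiff
  · simp only [Finset.mem_map, forall_exists_index, and_imp]
    rintro _ i hi rfl
    have h : ∃ hx : (Function.Embedding.subtype _ i : Euc n) ∈ K, (⟨_, hx⟩ : K) ∈ t := ⟨i.2, hi⟩
    rw [dif_pos h]
    exact hf ⟨i, hi⟩
  · intro x hxK
    rw [Finset.sum_map, ← Finset.sum_coe_sort t, ← f.sum_eq_one hxK, finsum_eq_sum_of_fintype]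
    refine Finset.sum_congr rfl fun i _ => ?_
    have h : ∃ hx : (Function.Embedding.subtype _ (i : K) : Euc n) ∈ K, (⟨_, hx⟩ : K) ∈ t :=
      ⟨i.1.2, i.2⟩
    exact congrFun (dif_pos h) x

theorem exists_cutoff {K O : Set (Euc n)} (hK : IsCompact K) (hO : IsOpen O) (hKO : K ⊆ O) :
    ∃ ζ : Euc n → ℝ, ContDiff ℝ ∞ ζ ∧ HasCompactSupport ζ ∧ tsupport ζ ⊆ O ∧
      ∀ᶠ x in 𝓝ˢ K, ζ x = 1 := by
  obtain ⟨L, hL, hKL, hLO⟩ := exists_compact_between hK hO hKO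
  obtain ⟨f, hf0, hf1, -⟩ := exists_contMDiffMap_zero_one_nhds_of_isClosed (n := ⊤)
    𝓘(ℝ, Euc n) (isOpen_interior (s := L)).isClosed_compl hK.isClosed
    (disjoint_left.2 fun x hx hxK => hx (hKL hxK))
  have hs : tsupport f ⊆ L := closure_minimal (fun x hx => by
    by_contra hxL
    exact hx (hf0.self_of_nhdsSet _ fun h => hxL (interior_subset h))) hL.isClosed
  exact ⟨f, f.contMDiff.contDiff, HasCompactSupport.of_support_subset_isCompact hL
    ((subset_tsupport _).trans hs), hs.trans hLO, hf1⟩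

/-- The divergence of a vector field on `ℝ^n`. -/
noncomputable def divergence (X : Euc n → Euc n) (x : Euc n) : ℝ :=
  LinearMap.trace ℝ (Euc n) (fderiv ℝ X x : Euc n →ₗ[ℝ] Euc n)

/-- The trace, as a continuous linear functional. -/
noncomputable def traceCLM (n : ℕ) : (Euc n →L[ℝ] Euc n) →L[ℝ] ℝ :=
  (LinearMap.trace ℝ (Euc n) ∘ₗ ContinuousLinearMap.coeLM ℝ).toContinuousLinearMap

theorem traceCLM_apply (L : Euc n →L[ℝ] Euc n) :
    traceCLM n L = LinearMap.trace ℝ (Euc n) (L : Euc n →ₗ[ℝ] Euc n) := rfl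

theorem traceCLM_eq_sum (L : Euc n →L[ℝ] Euc n) :
    traceCLM n L = ∑ i, (L (EuclideanSpace.single i 1)) i := by
  rw [traceCLM_apply, LinearMap.trace_eq_sum_inner _ (EuclideanSpace.basisFun (Fin n) ℝ)]
  simp [EuclideanSpace.inner_single_left]

theorem traceCLM_smulRight (f : Euc n →L[ℝ] ℝ) (v : Euc n) : traceCLM n (f.smulRight v) = f v :=
  LinearMap.trace_smulRight (f : Euc n →ₗ[ℝ] ℝ) v

theorem divergence_eq_traceCLM (X : Euc n → Euc n) (x : Euc n) :
    divergence X x = traceCLM n (fderiv ℝ X x) := rfl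

theorem continuous_divergence {X : Euc n → Euc n} (hX : ContDiff ℝ 1 X) :
    Continuous (divergence X) :=
  (traceCLM n).continuous.comp (hX.continuous_fderiv one_ne_zero)

theorem divergence_smul {X : Euc n → Euc n} {f : Euc n → ℝ} {x : Euc n}
    (hf : DifferentiableAt ℝ f x) (hX : DifferentiableAt ℝ X x) :
    divergence (fun x => f x • X x) x = f x * divergence X x + fderiv ℝ f x (X x) := by
  rw [divergence_eq_traceCLM, divergence_eq_traceCLM, fderiv_fun_smul hf hX, map_add, map_smul,
    traceCLM_smulRight, smul_eq_mul]

/-- The divergence theorem for compactly supported fields of class `C¹`. -/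
theorem integral_divergence_eq_zero {X : Euc n → Euc n} (hX : ContDiff ℝ 1 X)
    (hc : HasCompactSupport X) : ∫ x, divergence X x = 0 := by
  have hi : ∀ i : Fin n, ∀ x, fderiv ℝ (fun z => X z i) x (EuclideanSpace.single i 1) =
      (fderiv ℝ X x (EuclideanSpace.single i 1)) i := by
    intro i x
    have := ((EuclideanSpace.proj i : Euc n →L[ℝ] ℝ).hasFDerivAt.comp x
      (hX.differentiable one_ne_zero x).hasFDerivAt).fderiv
    exact DFunLike.congr_fun this (EuclideanSpace.single i 1)
  have hXi : ∀ i : Fin n, ContDiff ℝ 1 fun z => X z i := fun i =>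
    (EuclideanSpace.proj i : Euc n →L[ℝ] ℝ).contDiff.comp hX
  have hci : ∀ i : Fin n, HasCompactSupport fun z => X z i := fun i =>
    hc.comp_left (g := fun v : Euc n => v i) rfl
  have hint : ∀ i : Fin n,
      Integrable fun x => fderiv ℝ (fun z => X z i) x (EuclideanSpace.single i 1) := fun i =>
    (((hXi i).continuous_fderiv one_ne_zero).clm_apply continuous_const).integrable_of_hasCompactSupport
      ((hci i).fderiv_apply (𝕜 := ℝ) _)
  have h0 : ∀ i : Fin n,
      ∫ x, fderiv ℝ (fun z => X z i) x (EuclideanSpace.single i 1) = 0 := by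
    intro i
    have := integral_mul_fderiv_eq_neg_fderiv_mul_of_integrable (μ := volume)
      (f := fun _ : Euc n => (1 : ℝ)) (g := fun z => X z i) (v := EuclideanSpace.single i 1)
      (by simp) (by simpa using hint i)
      (by simpa using (hXi i).continuous.integrable_of_hasCompactSupport (hci i))
      (fun x _ => differentiableAt_const _) (fun x _ => (hXi i).differentiable one_ne_zero x)
    simpa using this
  simp_rw [divergence_eq_traceCLM, traceCLM_eq_sum, ← hi]
  rw [integral_finsetSum _ fun i _ => hint i, Finset.sum_eq_zero fun i _ => h0 i]

/-- The scalar definition summed over the coordinate directions, under local integrability in place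
of square integrability. -/
theorem IsWeakGradient.integral_smooth {Ω : Set (Euc n)} {u : Euc n → ℝ} {g : Euc n → Euc n}
    (h : IsWeakGradient Ω u g)
    (hu : LocallyIntegrableOn u Ω) (hg : LocallyIntegrableOn g Ω)
    {X : Euc n → Euc n} (hX : ContDiff ℝ ∞ X) (hc : HasCompactSupport X) (hs : tsupport X ⊆ Ω) :
    ∫ x in Ω, u x * divergence X x = -∫ x in Ω, inner ℝ (g x) (X x) := by
  have hXi : ∀ i : Fin n, ContDiff ℝ ∞ fun z => X z i := fun i =>
    (EuclideanSpace.proj i : Euc n →L[ℝ] ℝ).contDiff.comp hX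
  have hci : ∀ i : Fin n, HasCompactSupport fun z => X z i := fun i =>
    hc.comp_left (g := fun v : Euc n => v i) rfl
  have hsi : ∀ i : Fin n, tsupport (fun z => X z i) ⊆ tsupport X := fun i =>
    closure_mono fun x hx h => hx (by
      simp only [h]
      rfl)
  have hi : ∀ i : Fin n, ∀ x, fderiv ℝ (fun z => X z i) x (EuclideanSpace.single i 1) =
      (fderiv ℝ X x (EuclideanSpace.single i 1)) i := by
    intro i x
    have := ((EuclideanSpace.proj i : Euc n →L[ℝ] ℝ).hasFDerivAt.comp x
      (hX.differentiable (by simp) x).hasFDerivAt).fderiv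
    exact DFunLike.congr_fun this (EuclideanSpace.single i 1)
  have hK : IsCompact (tsupport X) := hc
  have huK : IntegrableOn u (tsupport X) := hu.integrableOn_compact_subset hs hK
  have hgK : IntegrableOn g (tsupport X) := hg.integrableOn_compact_subset hs hK
  have h1 : ∀ i : Fin n, Integrable
      (fun x => u x * fderiv ℝ (fun z => X z i) x (EuclideanSpace.single i 1))
      (volume.restrict Ω) := by
    intro i
    refine Integrable.mono_measure ?_ Measure.restrict_le_self
    have hc' : Continuous fun x => fderiv ℝ (fun z => X z i) x (EuclideanSpace.single i 1) :=
      ((hXi i).continuous_fderiv (by simp)).clm_apply continuous_const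
    refine (integrableOn_iff_integrable_of_support_subset (s := tsupport X) ?_).1
      (huK.mul_continuousOn hc'.continuousOn hK)
    intro x hx
    by_contra hxs
    apply hx
    have : fderiv ℝ (fun z => X z i) x = 0 :=
      image_eq_zero_of_notMem_tsupport fun h => hxs ((hsi i) (tsupport_fderiv_subset ℝ h))
    simp [this]
  have h2 : ∀ i : Fin n, Integrable
      (fun x => X x i * inner ℝ (g x) (EuclideanSpace.single i 1)) (volume.restrict Ω) := by
    intro i
    refine Integrable.mono_measure ?_ Measure.restrict_le_self
    refine (integrableOn_iff_integrable_of_support_subset (s := tsupport X) ?_).1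
      (IntegrableOn.continuousOn_mul (hXi i).continuous.continuousOn (hgK.inner_const _) hK)
    intro x hx
    by_contra hxs
    apply hx
    simp [image_eq_zero_of_notMem_tsupport hxs]
  calc ∫ x in Ω, u x * divergence X x
      = ∫ x in Ω, ∑ i, u x * fderiv ℝ (fun z => X z i) x (EuclideanSpace.single i 1) := by
        simp_rw [divergence_eq_traceCLM, traceCLM_eq_sum, hi, Finset.mul_sum]
    _ = ∑ i, ∫ x in Ω, u x * fderiv ℝ (fun z => X z i) x (EuclideanSpace.single i 1) :=
        integral_finsetSum _ fun i _ => h1 i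
    _ = ∑ i, -∫ x in Ω, X x i * inner ℝ (g x) (EuclideanSpace.single i 1) := by
        refine Finset.sum_congr rfl fun i _ => ?_
        exact h _ (hXi i) (hci i) ((hsi i).trans hs) _
    _ = -∫ x in Ω, ∑ i, X x i * inner ℝ (g x) (EuclideanSpace.single i 1) := by
        rw [integral_finsetSum _ fun i _ => h2 i, Finset.sum_neg_distrib]
    _ = _ := by
        congr 2
        funext x
        simp [PiLp.inner_apply, mul_comm]

/-- Mollification of a field with continuous weak divergence. -/
theorem exists_smooth_field {X : Euc n → Euc n} {D : Euc n → ℝ} (hX : Continuous X)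
    (hD : Continuous D) (hXc : HasCompactSupport X) (hDc : HasCompactSupport D)
    (hdiv : ∀ ψ : Euc n → ℝ, ContDiff ℝ ∞ ψ → HasCompactSupport ψ →
      ∫ x, D x * ψ x = -∫ x, fderiv ℝ ψ x (X x)) {δ : ℝ} (hδ : 0 < δ) :
    ∃ Y : Euc n → Euc n, ContDiff ℝ ∞ Y ∧ (∀ x, ‖Y x - X x‖ ≤ δ) ∧
      (∀ x, |divergence Y x - D x| ≤ δ) ∧ Function.support Y ⊆ Metric.thickening δ (tsupport X) := by
  obtain ⟨a, ha, haX⟩ := Metric.uniformContinuous_iff.1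
    (hXc.uniformContinuous_of_continuous hX) δ hδ
  obtain ⟨b, hb, hbD⟩ := Metric.uniformContinuous_iff.1
    (hDc.uniformContinuous_of_continuous hD) δ hδ
  have hm : 0 < min δ (min a b) := lt_min hδ (lt_min ha hb)
  -- Radius below `a` and `b` keeps the mollified `X` and `D` within `δ` of the originals; radius at
  -- most `δ` controls the support.
  let f : ContDiffBump (0 : Euc n) := ⟨min δ (min a b) / 2, min δ (min a b), by linarith, by linarith⟩
  let ρ : Euc n → ℝ := f.normed volume
  have hρ : ContDiff ℝ ∞ ρ := f.contDiff_normed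
  have hρc : HasCompactSupport ρ := f.hasCompactSupport_normed
  let Y : Euc n → Euc n := convolution ρ X (ContinuousLinearMap.lsmul ℝ ℝ) volume
  -- Testing the weak divergence with `t ↦ ρ (x - t)` shows that the divergence of `ρ * X` is `ρ *
  -- D`.
  have hYd : ∀ x, divergence Y x = ∫ t, D t * ρ (x - t) := by
    intro x
    have h1 : HasFDerivAt Y (convolution (fderiv ℝ ρ) X
        ((ContinuousLinearMap.lsmul ℝ ℝ).precompL (Euc n)) volume x) x :=
      hρc.hasFDerivAt_convolution_left (ContinuousLinearMap.lsmul ℝ ℝ) (hρ.of_le (by simp))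
        hX.locallyIntegrable x
    have h2 : Integrable (fun t => ((ContinuousLinearMap.lsmul ℝ ℝ).precompL (Euc n))
        (fderiv ℝ ρ (x - t)) (X t)) := by
      refine Continuous.integrable_of_hasCompactSupport ?_ ?_
      · have := hρ.continuous_fderiv (by simp)
        fun_prop
      · refine hXc.mono fun t ht h => ht ?_
        simp [h]
    rw [divergence_eq_traceCLM, h1.fderiv, convolution_eq_swap,
      ← ContinuousLinearMap.integral_comp_comm _ h2]
    have h3 : ∀ t, traceCLM n (((ContinuousLinearMap.lsmul ℝ ℝ).precompL (Euc n))
        (fderiv ℝ ρ (x - t)) (X t)) = fderiv ℝ ρ (x - t) (X t) := by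
      intro t
      have : ((ContinuousLinearMap.lsmul ℝ ℝ).precompL (Euc n)) (fderiv ℝ ρ (x - t)) (X t) =
          (fderiv ℝ ρ (x - t)).smulRight (X t) := by
        ext1 v
        simp [ContinuousLinearMap.precompL_apply]
      rw [this, traceCLM_smulRight]
    simp_rw [h3]
    have h4 := hdiv (fun t => ρ (x - t)) (hρ.comp (contDiff_const.sub contDiff_id))
      (hρc.comp_homeomorph (Homeomorph.subLeft x))
    rw [h4, ← integral_neg]
    refine integral_congr_ae (Eventually.of_forall fun t => ?_)
    have h5 : HasFDerivAt (fun t => ρ (x - t)) (-(fderiv ℝ ρ (x - t))) t := by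
      have := ((hρ.differentiable (by simp)) (x - t)).hasFDerivAt.comp t
        ((hasFDerivAt_id t).const_sub x)
      refine this.congr_fderiv (ContinuousLinearMap.ext fun v => ?_)
      simp
    simp [h5.fderiv]
  refine ⟨Y, hρc.contDiff_convolution_left _ hρ hX.locallyIntegrable, fun x => ?_, fun x => ?_, ?_⟩
  · rw [← dist_eq_norm]
    refine f.dist_normed_convolution_le hX.aestronglyMeasurable fun z hz => ?_
    exact (haX (lt_of_lt_of_le (Metric.mem_ball.1 hz)
      ((min_le_right _ _).trans (min_le_left _ _)))).le
  · have h1 : divergence Y x = convolution ρ D (ContinuousLinearMap.lsmul ℝ ℝ) volume x := by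
      rw [hYd, convolution_lsmul_swap]
      simp_rw [smul_eq_mul, mul_comm]
    rw [h1, ← Real.dist_eq]
    refine f.dist_normed_convolution_le hD.aestronglyMeasurable fun z hz => ?_
    exact (hbD (lt_of_lt_of_le (Metric.mem_ball.1 hz)
      ((min_le_right _ _).trans (min_le_right _ _)))).le
  · refine (support_convolution_subset_swap _).trans ?_
    rintro _ ⟨z, hz, w, hw, rfl⟩
    rw [f.support_normed_eq, mem_ball_zero_iff] at hw
    exact Metric.mem_thickening_iff.2 ⟨z, subset_tsupport _ hz, by
      rw [dist_eq_norm, add_sub_cancel_left]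
      exact lt_of_lt_of_le hw (min_le_left _ _)⟩

/-- The weak gradient may be tested against continuous fields with continuous weak divergence. -/
theorem IsWeakGradient.integral_field {Ω : Set (Euc n)} (hΩ : IsOpen Ω) {u : Euc n → ℝ}
    {g : Euc n → Euc n} (h : IsWeakGradient Ω u g)
    (hu : LocallyIntegrableOn u Ω) (hg : LocallyIntegrableOn g Ω)
    {X : Euc n → Euc n} {D : Euc n → ℝ} (hX : Continuous X) (hD : Continuous D)
    (hXc : HasCompactSupport X) (hDc : HasCompactSupport D) (hXs : tsupport X ⊆ Ω)
    (hDs : tsupport D ⊆ Ω)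
    (hdiv : ∀ ψ : Euc n → ℝ, ContDiff ℝ ∞ ψ → HasCompactSupport ψ →
      ∫ x, D x * ψ x = -∫ x, fderiv ℝ ψ x (X x)) :
    ∫ x in Ω, u x * D x = -∫ x in Ω, inner ℝ (g x) (X x) := by
  have hK : IsCompact (tsupport X ∪ tsupport D) := IsCompact.union hXc hDc
  obtain ⟨d, hd, hdΩ⟩ := hK.exists_cthickening_subset_open hΩ (union_subset hXs hDs)
  set K := Metric.cthickening d (tsupport X ∪ tsupport D) with hKdef
  have hKc : IsCompact K := hK.cthickening
  have huK : IntegrableOn u K := hu.integrableOn_compact_subset hdΩ hKc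
  have hgK : IntegrableOn g K := hg.integrableOn_compact_subset hdΩ hKc
  have hred : ∀ f : Euc n → ℝ, (∀ x ∉ K, f x = 0) → ∫ x in Ω, f x = ∫ x in K, f x := by
    intro f hf
    refine (setIntegral_eq_of_subset_of_forall_sdiff_eq_zero hΩ.measurableSet hdΩ ?_)
    exact fun x hx => hf x hx.2
  have hXK : ∀ x ∉ K, X x = 0 := fun x hx => image_eq_zero_of_notMem_tsupport fun h =>
    hx (Metric.self_subset_cthickening _ (Or.inl h))
  have hDK : ∀ x ∉ K, D x = 0 := fun x hx => image_eq_zero_of_notMem_tsupport fun h =>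
    hx (Metric.self_subset_cthickening _ (Or.inr h))
  rw [hred _ fun x hx => by rw [hDK x hx, mul_zero],
    hred _ fun x hx => by rw [hXK x hx, inner_zero_right], ← sub_eq_zero, sub_neg_eq_add]
  have iD : IntegrableOn (fun x => u x * D x) K := huK.mul_continuousOn hD.continuousOn hKc
  have iG : ∀ {Z : Euc n → Euc n}, Continuous Z → IntegrableOn (fun x => inner ℝ (g x) (Z x)) K := by
    intro Z hZ
    obtain ⟨C, hC⟩ := hKc.exists_bound_of_continuousOn hZ.continuousOn
    refine (hgK.norm.const_mul C).mono (hgK.aestronglyMeasurable.inner hZ.aestronglyMeasurable) ?_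
    filter_upwards [ae_restrict_mem hKc.measurableSet] with x hx
    calc ‖inner ℝ (g x) (Z x)‖ ≤ ‖g x‖ * ‖Z x‖ := norm_inner_le_norm _ _
      _ ≤ ‖g x‖ * C := by gcongr; exact hC x hx
      _ ≤ ‖C * ‖g x‖‖ := by rw [mul_comm]; exact le_abs_self _
  -- Replacing `X` by a smooth field that is `δ`-close to it, with divergence `δ`-close to `D`,
  -- alters the sum of the two integrals by at most `δ A`. A choice of `δ` for which this is below
  -- the supposed discrepancy is contradictory.
  by_contra hne
  set A := ∫ x in K, (|u x| + ‖g x‖) with hA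
  have hA0 : 0 ≤ A := integral_nonneg fun x => by positivity
  obtain ⟨δ, hδ, hδd, hδA⟩ : ∃ δ > 0, δ < d ∧ δ * A <
      |(∫ x in K, u x * D x) + ∫ x in K, inner ℝ (g x) (X x)| := by
    set B := |(∫ x in K, u x * D x) + ∫ x in K, inner ℝ (g x) (X x)|
    have hB : 0 < B := abs_pos.2 hne
    refine ⟨min (d / 2) (B / (A + 1)), lt_min (by linarith) (by positivity),
      (min_le_left _ _).trans_lt (by linarith), ?_⟩
    calc min (d / 2) (B / (A + 1)) * A ≤ B / (A + 1) * A := by gcongr; exact min_le_right _ _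
      _ < B := by rw [div_mul_eq_mul_div, div_lt_iff₀ (by linarith)]; nlinarith
  obtain ⟨Y, hY, hYX, hYD, hYs⟩ := exists_smooth_field hX hD hXc hDc hdiv hδ
  have hYK : tsupport Y ⊆ K := by
    refine closure_minimal (hYs.trans ?_) Metric.isClosed_cthickening
    refine (Metric.thickening_subset_cthickening _ _).trans ?_
    exact (Metric.cthickening_mono hδd.le _).trans
      (Metric.cthickening_subset_of_subset _ subset_union_left)
  have h1 := h.integral_smooth hu hg hY (HasCompactSupport.of_support_subset_isCompact hKc
    ((subset_tsupport _).trans hYK)) (hYK.trans hdΩ)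
  have hYK0 : ∀ x ∉ K, Y x = 0 := fun x hx =>
    image_eq_zero_of_notMem_tsupport fun h => hx (hYK h)
  have hdYK0 : ∀ x ∉ K, divergence Y x = 0 := fun x hx => by
    rw [divergence_eq_traceCLM, image_eq_zero_of_notMem_tsupport
      (fun h => hx (hYK (tsupport_fderiv_subset ℝ h))), map_zero]
  rw [hred _ fun x hx => by rw [hdYK0 x hx, mul_zero],
    hred _ fun x hx => by rw [hYK0 x hx, inner_zero_right]] at h1
  have hY1 : ContDiff ℝ 1 Y := hY.of_le (by simp)
  have iY : IntegrableOn (fun x => u x * divergence Y x) K :=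
    huK.mul_continuousOn (continuous_divergence hY1).continuousOn hKc
  refine absurd hδA (not_lt.2 ?_)
  calc |(∫ x in K, u x * D x) + ∫ x in K, inner ℝ (g x) (X x)|
      = |(∫ x in K, (u x * D x - u x * divergence Y x)) +
          ∫ x in K, (inner ℝ (g x) (X x) - inner ℝ (g x) (Y x))| := by
        rw [integral_sub iD iY, integral_sub (iG hX) (iG hY1.continuous), h1]
        ring_nf
    _ = |∫ x in K, ((u x * D x - u x * divergence Y x) +
          (inner ℝ (g x) (X x) - inner ℝ (g x) (Y x)))| := by
        exact congrArg abs (integral_add (iD.sub iY) ((iG hX).sub (iG hY1.continuous))).symm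
    _ ≤ ∫ x in K, δ * (|u x| + ‖g x‖) := by
        rw [← Real.norm_eq_abs]
        refine norm_integral_le_of_norm_le ((huK.norm.add hgK.norm).const_mul δ) ?_
        refine Eventually.of_forall fun x => ?_
        rw [← mul_sub, ← inner_sub_right, Real.norm_eq_abs]
        calc |u x * (D x - divergence Y x) + inner ℝ (g x) (X x - Y x)|
            ≤ |u x * (D x - divergence Y x)| + |inner ℝ (g x) (X x - Y x)| := abs_add_le _ _
          _ ≤ |u x| * δ + ‖g x‖ * δ := by
              rw [abs_mul]
              gcongr
              · rw [abs_sub_comm]; exact hYD x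
              · refine (abs_real_inner_le_norm _ _).trans ?_
                gcongr
                rw [norm_sub_rev]; exact hYX x
          _ = δ * (|u x| + ‖g x‖) := by ring
    _ = δ * A := by rw [integral_const_mul]

end Mollify

end

/-! ### Locality and uniqueness of weak gradients -/

section

section

variable {n : ℕ}

theorem setIntegral_eq_integral_of_tsupport {E : Type*} [NormedAddCommGroup E] [NormedSpace ℝ E]
    {Ω : Set (Euc n)} {ψ : Euc n → ℝ} (hs : tsupport ψ ⊆ Ω) {f : Euc n → E}
    (hf : ∀ x, x ∉ tsupport ψ → f x = 0) : ∫ x in Ω, f x = ∫ x, f x :=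
  setIntegral_eq_integral_of_forall_compl_eq_zero fun x hx => hf x fun h => hx (hs h)

theorem IsWeakGradient.mono {Ω Ω' : Set (Euc n)} {u : Euc n → ℝ} {g : Euc n → Euc n}
    (h : IsWeakGradient Ω u g) (hΩ : Ω' ⊆ Ω) : IsWeakGradient Ω' u g := by
  intro ψ h1 h2 h3 a
  have e1 : ∀ x ∉ tsupport ψ, u x * fderiv ℝ ψ x a = 0 := fun x hx => by
    rw [image_eq_zero_of_notMem_tsupport (fun h => hx (tsupport_fderiv_subset ℝ h)), zero_apply,
      mul_zero]
  have e2 : ∀ x ∉ tsupport ψ, ψ x * inner ℝ (g x) a = 0 := fun x hx => by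
    rw [image_eq_zero_of_notMem_tsupport hx, zero_mul]
  have := h ψ h1 h2 (h3.trans hΩ) a
  rwa [setIntegral_eq_integral_of_tsupport (h3.trans hΩ) e1,
    setIntegral_eq_integral_of_tsupport (h3.trans hΩ) e2,
    ← setIntegral_eq_integral_of_tsupport h3 e1,
    ← setIntegral_eq_integral_of_tsupport h3 e2] at this

theorem IsWeakGradient.congr_ae {Ω : Set (Euc n)} {u u' : Euc n → ℝ} {g g' : Euc n → Euc n}
    (h : IsWeakGradient Ω u g) (hu : u =ᵐ[volume.restrict Ω] u')
    (hg : g =ᵐ[volume.restrict Ω] g') : IsWeakGradient Ω u' g' := by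
  intro ψ h1 h2 h3 a
  have e1 : ∀ᵐ x ∂(volume.restrict Ω), u x * fderiv ℝ ψ x a = u' x * fderiv ℝ ψ x a := by
    filter_upwards [hu] with x hx
    rw [hx]
  have e2 : ∀ᵐ x ∂(volume.restrict Ω), ψ x * inner ℝ (g x) a = ψ x * inner ℝ (g' x) a := by
    filter_upwards [hg] with x hx
    rw [hx]
  rw [← integral_congr_ae e1, ← integral_congr_ae e2]
  exact h ψ h1 h2 h3 a

theorem integrable_mul_of_locallyIntegrableOn {Ω : Set (Euc n)} {u ψ : Euc n → ℝ}
    (hu : LocallyIntegrableOn u Ω) (hψ : Continuous ψ) (hc : HasCompactSupport ψ)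
    (hs : tsupport ψ ⊆ Ω) : Integrable fun x => u x * ψ x := by
  rw [← integrableOn_iff_integrable_of_support_subset (s := tsupport ψ)]
  · exact (hu.integrableOn_compact_subset hs hc.isCompact).mul_continuousOn hψ.continuousOn
      hc.isCompact
  · intro x hx
    by_contra h
    exact hx (by simp only [image_eq_zero_of_notMem_tsupport h, mul_zero])

/-- Being a weak gradient is a local property. -/
theorem IsWeakGradient.of_local {Ω : Set (Euc n)} {u : Euc n → ℝ}
    {g : Euc n → Euc n} (hu : LocallyIntegrableOn u Ω) (hg : LocallyIntegrableOn g Ω)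
    (h : ∀ x ∈ Ω, ∃ W, IsOpen W ∧ x ∈ W ∧ IsWeakGradient (W ∩ Ω) u g) :
    IsWeakGradient Ω u g := by
  choose! W hWo hWx hW using h
  intro ψ h1 h2 h3 a
  obtain ⟨t, ζ, htK, hζ, hζs, hsum⟩ := exists_partition h2.isCompact W
    (fun x hx => hWo x (h3 hx)) (fun x hx => hWx x (h3 hx))
  have hga : LocallyIntegrableOn (fun x => inner ℝ (g x) a) Ω := by
    intro x hx
    obtain ⟨s, hs, hi⟩ := hg x hx
    exact ⟨s, hs, hi.inner_const a⟩
  have hts : ∀ i ∈ t, tsupport (fun x => ζ i x * ψ x) ⊆ W i ∩ Ω := fun i hi =>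
    subset_inter (tsupport_mul_subset_left.trans (hζs i hi))
      ((tsupport_mul_subset_right (f := ζ i) (g := ψ)).trans h3)
  have hd : ∀ i ∈ t, ContDiff ℝ ∞ fun x => ζ i x * ψ x := fun i hi => (hζ i hi).mul h1
  have hcs : ∀ i, HasCompactSupport fun x => ζ i x * ψ x := fun i => h2.mul_left
  have hψs : ψ = fun x => ∑ i ∈ t, ζ i x * ψ x := by
    funext x
    rw [← Finset.sum_mul]
    by_cases hx : x ∈ tsupport ψ
    · rw [hsum x hx, one_mul]
    · rw [image_eq_zero_of_notMem_tsupport hx, mul_zero]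
  have hfd : ∀ x, fderiv ℝ ψ x a = ∑ i ∈ t, fderiv ℝ (fun x => ζ i x * ψ x) x a := by
    intro x
    conv_lhs => rw [hψs]
    rw [fderiv_fun_sum fun i hi => ((hd i hi).differentiable (by simp)) x, _root_.sum_apply]
  have i1 : ∀ i ∈ t, Integrable (fun x => u x * fderiv ℝ (fun x => ζ i x * ψ x) x a)
      (volume.restrict Ω) := fun i hi =>
    (integrable_mul_of_locallyIntegrableOn hu
      (((hd i hi).continuous_fderiv (by simp)).clm_apply continuous_const)
      ((hcs i).fderiv_apply (𝕜 := ℝ) a) ((tsupport_fderiv_apply_subset ℝ a).trans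
        ((hts i hi).trans inter_subset_right))).restrict
  have i2 : ∀ i ∈ t, Integrable (fun x => inner ℝ (g x) a * (ζ i x * ψ x))
      (volume.restrict Ω) := fun i hi =>
    (integrable_mul_of_locallyIntegrableOn hga (hd i hi).continuous (hcs i)
      ((hts i hi).trans inter_subset_right)).restrict
  have e1 : ∀ x, ψ x * inner ℝ (g x) a = ∑ i ∈ t, inner ℝ (g x) a * (ζ i x * ψ x) := by
    intro x
    conv_lhs => rw [hψs]
    rw [Finset.sum_mul]
    exact Finset.sum_congr rfl fun i _ => mul_comm _ _
  simp_rw [hfd, e1, Finset.mul_sum]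
  rw [integral_finsetSum _ i1, integral_finsetSum _ i2, ← Finset.sum_neg_distrib]
  refine Finset.sum_congr rfl fun i hi => ?_
  have h4 := hW i (h3 (htK i hi)) _ (hd i hi) (hcs i) (hts i hi) a
  have z1 : ∀ x ∉ tsupport (fun x => ζ i x * ψ x),
      u x * fderiv ℝ (fun x => ζ i x * ψ x) x a = 0 := fun x hx => by
    rw [image_eq_zero_of_notMem_tsupport (fun h => hx (tsupport_fderiv_subset ℝ h)), zero_apply,
      mul_zero]
  have z2 : ∀ x ∉ tsupport (fun x => ζ i x * ψ x),
      ζ i x * ψ x * inner ℝ (g x) a = 0 := fun x hx => by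
    rw [image_eq_zero_of_notMem_tsupport (f := fun x => ζ i x * ψ x) hx, zero_mul]
  rw [setIntegral_eq_integral_of_tsupport (hts i hi) z1,
    setIntegral_eq_integral_of_tsupport (hts i hi) z2] at h4
  rw [setIntegral_eq_integral_of_tsupport ((hts i hi).trans inter_subset_right) z1, h4, ←
    setIntegral_eq_integral_of_tsupport ((hts i hi).trans inter_subset_right) z2]
  simp_rw [mul_comm]

/-- The difference of two weak gradients integrates to zero against every test function, so the
fundamental lemma of the calculus of variations applies. -/
theorem IsWeakGradient.ae_eq {Ω : Set (Euc n)} (hΩ : IsOpen Ω) {u : Euc n → ℝ}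
    {g g' : Euc n → Euc n} (h : IsWeakGradient Ω u g) (h' : IsWeakGradient Ω u g')
    (hg : LocallyIntegrableOn g Ω) (hg' : LocallyIntegrableOn g' Ω) :
    g =ᵐ[volume.restrict Ω] g' := by
  have hd : LocallyIntegrableOn (fun x => g x - g' x) Ω := hg.sub hg'
  have h0 : ∀ᵐ x, x ∈ Ω → g x - g' x = 0 := by
    refine hΩ.ae_eq_zero_of_integral_contDiff_smul_eq_zero hd fun ψ h1 h2 h3 => ?_
    have hi : ∀ {f : Euc n → Euc n}, LocallyIntegrableOn f Ω →
        Integrable fun x => ψ x • f x := by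
      intro f hf
      rw [← integrableOn_iff_integrable_of_support_subset (s := tsupport ψ)]
      · exact (hf.integrableOn_compact_subset h3 h2.isCompact).continuousOn_smul
          h1.continuous.continuousOn h2.isCompact
      · intro x hx
        by_contra h
        exact hx (by simp only [image_eq_zero_of_notMem_tsupport h, zero_smul])
    refine ext_inner_right ℝ fun a => ?_
    rw [inner_zero_left, real_inner_comm, ← integral_inner (hi hd)]
    have key : ∀ {f : Euc n → Euc n}, ∫ x in Ω, ψ x * inner ℝ (f x) a = ∫ x, inner ℝ a (ψ x • f x) := by
      intro f
      rw [setIntegral_eq_integral_of_tsupport h3 fun x hx => by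
        rw [image_eq_zero_of_notMem_tsupport hx, zero_mul]]
      simp_rw [inner_smul_right, real_inner_comm]
    have h5 := neg_injective ((h ψ h1 h2 h3 a).symm.trans (h' ψ h1 h2 h3 a))
    rw [key, key] at h5
    simp_rw [smul_sub, inner_sub_right]
    rw [integral_sub ((hi hg).const_inner a) ((hi hg').const_inner a), h5, sub_self]
  rw [EventuallyEq, ae_restrict_iff' hΩ.measurableSet]
  filter_upwards [h0] with x hx hxΩ
  exact sub_eq_zero.1 (hx hxΩ)

end

/-! ### Change of variables -/

section

variable {n : ℕ} {F : OpenPartialHomeomorph (Euc n) (Euc n)}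

theorem fderiv_symm_comp (h1 : ContDiffOn ℝ 1 F F.source) (h2 : ContDiffOn ℝ 1 F.symm F.target)
    {x : Euc n} (hx : x ∈ F.source) :
    fderiv ℝ F.symm (F x) ∘L fderiv ℝ F x = ContinuousLinearMap.id ℝ _ := by
  have hF : HasFDerivAt F (fderiv ℝ F x) x :=
    ((h1.contDiffAt (F.open_source.mem_nhds hx)).differentiableAt one_ne_zero).hasFDerivAt
  have hG : HasFDerivAt F.symm (fderiv ℝ F.symm (F x)) (F x) :=
    ((h2.contDiffAt (F.open_target.mem_nhds (F.map_source hx))).differentiableAt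
      one_ne_zero).hasFDerivAt
  refine ((hG.comp x hF).congr_of_eventuallyEq ?_).unique (hasFDerivAt_id x)
  filter_upwards [F.open_source.mem_nhds hx] with z hz
  exact (F.left_inv hz).symm

theorem fderiv_comp_symm (h1 : ContDiffOn ℝ 1 F F.source) (h2 : ContDiffOn ℝ 1 F.symm F.target)
    {x : Euc n} (hx : x ∈ F.source) :
    fderiv ℝ F x ∘L fderiv ℝ F.symm (F x) = ContinuousLinearMap.id ℝ _ := by
  have := fderiv_symm_comp (F := F.symm) h2 (by simpa using h1) (F.map_source hx)
  simpa [F.left_inv hx] using this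

theorem integral_target_eq {E : Type*} [NormedAddCommGroup E] [NormedSpace ℝ E]
    (h1 : ContDiffOn ℝ 1 F F.source) (f : Euc n → E) :
    ∫ w in F.target, f w = ∫ x in F.source, |(fderiv ℝ F x).det| • f (F x) := by
  rw [← F.image_source_eq_target]
  refine integral_image_eq_integral_abs_det_fderiv_smul volume F.open_source.measurableSet
    (fun x hx => ?_) F.injOn f
  exact ((h1.contDiffAt (F.open_source.mem_nhds hx)).differentiableAt
    one_ne_zero).hasFDerivAt.hasFDerivWithinAt

theorem locallyIntegrableOn_comp_symm {E : Type*} [NormedAddCommGroup E] [NormedSpace ℝ E]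
    (h1 : ContDiffOn ℝ 1 F F.source) {u : Euc n → E} (hu : LocallyIntegrableOn u F.source) :
    LocallyIntegrableOn (u ∘ F.symm) F.target := by
  rw [locallyIntegrableOn_iff F.open_target.isLocallyClosed]
  intro K hK hKc
  have hKs : F.symm '' K ⊆ F.source := by
    rintro _ ⟨y, hy, rfl⟩
    exact F.map_target (hK hy)
  have hKi : F '' (F.symm '' K) = K := by
    rw [image_image]
    exact (image_congr fun y hy => F.right_inv (hK hy)).trans (image_id' K)
  have hc : IsCompact (F.symm '' K) := hKc.image_of_continuousOn (F.continuousOn_symm.mono hK)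
  rw [← hKi, integrableOn_image_iff_integrableOn_abs_det_fderiv_smul volume hc.measurableSet
    (f' := fderiv ℝ F) (fun x hx => ((h1.contDiffAt (F.open_source.mem_nhds
      (hKs hx))).differentiableAt one_ne_zero).hasFDerivAt.hasFDerivWithinAt)
    (F.injOn.mono hKs)]
  have h3 : IntegrableOn (fun x => |(fderiv ℝ F x).det| • u x) (F.symm '' K) := by
    refine (hu.integrableOn_compact_subset hKs hc).continuousOn_smul ?_ hc
    exact (ContinuousLinearMap.continuous_det.comp_continuousOn
      ((h1.continuousOn_fderiv_of_isOpen F.open_source le_rfl).mono hKs)).abs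
  refine h3.congr_fun (fun x hx => ?_) hc.measurableSet
  simp only [Function.comp_apply, F.left_inv (hKs hx)]

/-- The chain rule for weak gradients under diffeomorphisms of class `C¹`. -/
theorem IsWeakGradient.comp_symm (h1 : ContDiffOn ℝ 1 F F.source)
    (h2 : ContDiffOn ℝ 1 F.symm F.target) {u : Euc n → ℝ} {g : Euc n → Euc n}
    (h : IsWeakGradient F.source u g) (hu : LocallyIntegrableOn u F.source)
    (hg : LocallyIntegrableOn g F.source) :
    IsWeakGradient F.target (u ∘ F.symm)
      fun w => ContinuousLinearMap.adjoint (fderiv ℝ F.symm w) (g (F.symm w)) := by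
  intro ψ hψ hψc hψs a
  set K := F.symm '' tsupport ψ with hKdef
  have hKs : K ⊆ F.source := by
    rintro _ ⟨y, hy, rfl⟩
    exact F.map_target (hψs hy)
  have hKc : IsCompact K :=
    hψc.isCompact.image_of_continuousOn (F.continuousOn_symm.mono hψs)
  have hFK : ∀ x ∈ F.source, x ∉ K → F x ∉ tsupport ψ := fun x hx hxK h =>
    hxK ⟨F x, h, F.left_inv hx⟩
  let J : Euc n → ℝ := fun x => |(fderiv ℝ F x).det|
  have hJ : ContinuousOn J F.source := (ContinuousLinearMap.continuous_det.comp_continuousOn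
      (h1.continuousOn_fderiv_of_isOpen F.open_source le_rfl)).abs
  -- The change of variables converts testing with `ψ` in the direction `a` on the target into
  -- testing `u` with the field `X` on the source. As `F` is only `C¹`, the field `X` is merely
  -- continuous, but it has the continuous weak divergence `D`.
  let X : Euc n → Euc n := F.source.indicator
    fun x => (J x * ψ (F x)) • fderiv ℝ F.symm (F x) a
  let D : Euc n → ℝ := F.source.indicator fun x => J x * fderiv ℝ ψ (F x) a
  have hXv : ∀ x ∈ F.source, X x = (J x * ψ (F x)) • fderiv ℝ F.symm (F x) a :=
    fun x hx => indicator_of_mem hx _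
  have hDv : ∀ x ∈ F.source, D x = J x * fderiv ℝ ψ (F x) a := fun x hx => indicator_of_mem hx _
  have hX0 : ∀ x ∉ K, X x = 0 := by
    intro x hx
    by_cases hxs : x ∈ F.source
    · rw [hXv x hxs, image_eq_zero_of_notMem_tsupport (hFK x hxs hx), mul_zero, zero_smul]
    · exact indicator_of_notMem hxs _
  have hD0 : ∀ x ∉ K, D x = 0 := by
    intro x hx
    by_cases hxs : x ∈ F.source
    · rw [hDv x hxs, image_eq_zero_of_notMem_tsupport
        (fun h => hFK x hxs hx (tsupport_fderiv_subset ℝ h)), zero_apply, mul_zero]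
    · exact indicator_of_notMem hxs _
  have hXt : tsupport X ⊆ K :=
    closure_minimal (fun x hx => by_contra fun h => hx (hX0 x h)) hKc.isClosed
  have hDt : tsupport D ⊆ K :=
    closure_minimal (fun x hx => by_contra fun h => hx (hD0 x h)) hKc.isClosed
  have hcont : ∀ {E : Type} [NormedAddCommGroup E] {Y : Euc n → E}, (∀ x ∉ K, Y x = 0) →
      ContinuousOn Y F.source → Continuous Y := by
    intro E _ Y hY hc
    rw [continuous_iff_continuousAt]
    intro x
    by_cases hx : x ∈ K
    · exact hc.continuousAt (F.open_source.mem_nhds (hKs hx))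
    · refine (continuousAt_const (y := (0 : E))).congr ?_
      filter_upwards [hKc.isClosed.isOpen_compl.mem_nhds hx] with z hz
      exact (hY z hz).symm
  have hXc : Continuous X := by
    refine hcont hX0 (ContinuousOn.congr ?_ hXv)
    refine (hJ.mul (hψ.continuous.comp_continuousOn F.continuousOn)).smul ?_
    refine ContinuousOn.clm_apply ?_ continuousOn_const
    exact (h2.continuousOn_fderiv_of_isOpen F.open_target le_rfl).comp F.continuousOn F.mapsTo
  have hDc : Continuous D := by
    refine hcont hD0 (ContinuousOn.congr ?_ hDv)
    exact hJ.mul (((hψ.continuous_fderiv (by simp)).comp_continuousOn F.continuousOn).clm_apply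
      continuousOn_const)
  have key := h.integral_field F.open_source hu hg hXc hDc
    (HasCompactSupport.of_support_subset_isCompact hKc ((subset_tsupport _).trans hXt))
    (HasCompactSupport.of_support_subset_isCompact hKc ((subset_tsupport _).trans hDt))
    (hXt.trans hKs) (hDt.trans hKs) ?_
  · rw [integral_target_eq h1, integral_target_eq h1]
    refine Eq.trans ?_ (key.trans (congrArg Neg.neg ?_))
    · refine setIntegral_congr_fun F.open_source.measurableSet fun x hx => ?_
      simp only [Function.comp_apply, F.left_inv hx, smul_eq_mul]
      rw [hDv x hx]
      ring
    · refine setIntegral_congr_fun F.open_source.measurableSet fun x hx => ?_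
      simp only [F.left_inv hx, smul_eq_mul]
      rw [hXv x hx, inner_smul_right, ContinuousLinearMap.adjoint_inner_left, mul_assoc]
  · intro θ hθ hθc
    have e1 : ∫ x, D x * θ x = ∫ w in F.target, fderiv ℝ ψ w a * θ (F.symm w) := by
      rw [integral_target_eq h1, ← setIntegral_eq_integral_of_forall_compl_eq_zero (s := F.source)
        fun x hx => by rw [hD0 x fun h => hx (hKs h), zero_mul]]
      refine setIntegral_congr_fun F.open_source.measurableSet fun x hx => ?_
      simp only [F.left_inv hx, smul_eq_mul]
      rw [hDv x hx, mul_assoc]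
    have e2 : ∫ x, fderiv ℝ θ x (X x) =
        ∫ w in F.target, ψ w * fderiv ℝ θ (F.symm w) (fderiv ℝ F.symm w a) := by
      rw [integral_target_eq h1, ← setIntegral_eq_integral_of_forall_compl_eq_zero (s := F.source)
        fun x hx => by rw [hX0 x fun h => hx (hKs h), map_zero]]
      refine setIntegral_congr_fun F.open_source.measurableSet fun x hx => ?_
      simp only [F.left_inv hx, smul_eq_mul]
      rw [hXv x hx, map_smul, smul_eq_mul, mul_assoc]
    rw [e1, e2, eq_neg_iff_add_eq_zero]
    have hθG : ContDiffOn ℝ 1 (fun w => θ (F.symm w)) F.target :=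
      (hθ.of_le (by simp)).comp_contDiffOn h2
    have hψ1 : ContDiff ℝ 1 ψ := hψ.of_le (by simp)
    -- Transported to the target, the weak divergence identity becomes the divergence theorem for `ψ
    -- (θ ∘ F⁻¹) a`, a field of class `C¹`.
    have hY : ContDiff ℝ 1 fun w => (ψ w * θ (F.symm w)) • a := by
      suffices hs : ContDiff ℝ 1 fun w => ψ w * θ (F.symm w) from hs.smul contDiff_const
      rw [contDiff_iff_contDiffAt]
      intro w
      by_cases hw : w ∈ tsupport ψ
      · exact hψ1.contDiffAt.mul (hθG.contDiffAt (F.open_target.mem_nhds (hψs hw)))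
      · refine (contDiffAt_const (c := (0 : ℝ))).congr_of_eventuallyEq ?_
        filter_upwards [(isClosed_tsupport ψ).isOpen_compl.mem_nhds hw] with z hz
        rw [image_eq_zero_of_notMem_tsupport hz, zero_mul]
    have hYc : HasCompactSupport fun w => (ψ w * θ (F.symm w)) • a :=
      (hψc.mul_right (f' := fun w => θ (F.symm w))).smul_right (f' := fun _ : Euc n => a)
    have h0 : ∫ w, divergence (fun w => (ψ w * θ (F.symm w)) • a) w = 0 :=
      integral_divergence_eq_zero hY hYc
    have hdiv : ∀ w ∈ F.target, divergence (fun w => (ψ w * θ (F.symm w)) • a) w =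
        fderiv ℝ ψ w a * θ (F.symm w) + ψ w * fderiv ℝ θ (F.symm w) (fderiv ℝ F.symm w a) := by
      intro w hw
      have hG : HasFDerivAt F.symm (fderiv ℝ F.symm w) w :=
        ((h2.contDiffAt (F.open_target.mem_nhds hw)).differentiableAt one_ne_zero).hasFDerivAt
      have hθd := (((hθ.differentiable (by simp)) (F.symm w)).hasFDerivAt).comp w hG
      have hm := ((hψ1.differentiable one_ne_zero w).hasFDerivAt).mul hθd
      have hd := (hm.smul_const a).fderiv
      rw [divergence_eq_traceCLM]
      refine (congrArg (traceCLM n) hd).trans ?_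
      rw [traceCLM_smulRight]
      simp only [add_apply, smul_apply, ContinuousLinearMap.comp_apply, smul_eq_mul,
        Function.comp_apply]
      ring
    have hdiv0 : ∀ w ∉ tsupport ψ, divergence (fun w => (ψ w * θ (F.symm w)) • a) w = 0 := by
      intro w hw
      rw [divergence_eq_traceCLM, Filter.EventuallyEq.fderiv_eq (f := fun _ => (0 : Euc n)),
        fderiv_const_apply, map_zero]
      filter_upwards [(isClosed_tsupport ψ).isOpen_compl.mem_nhds hw] with z hz
      rw [image_eq_zero_of_notMem_tsupport hz, zero_mul, zero_smul]
    rw [← setIntegral_eq_integral_of_tsupport hψs hdiv0,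
      setIntegral_congr_fun F.open_target.measurableSet hdiv] at h0
    rw [← h0]
    symm
    have hcG : ContinuousOn (fderiv ℝ F.symm) F.target :=
      h2.continuousOn_fderiv_of_isOpen F.open_target le_rfl
    have hint : ∀ {f : Euc n → ℝ}, ContinuousOn f F.target → (∀ w ∉ tsupport ψ, f w = 0) →
        IntegrableOn f F.target := by
      intro f hf hf0
      refine (Integrable.restrict ?_)
      rw [← integrableOn_iff_integrable_of_support_subset (s := tsupport ψ)
        fun w hw => by_contra fun h => hw (hf0 w h)]
      exact (hf.mono hψs).integrableOn_compact hψc.isCompact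
    refine integral_add (hint ?_ ?_) (hint ?_ ?_)
    · exact ((hψ.continuous_fderiv (by simp)).continuousOn.clm_apply continuousOn_const).mul
        hθG.continuousOn
    · intro w hw
      rw [image_eq_zero_of_notMem_tsupport (fun h => hw (tsupport_fderiv_subset ℝ h)),
        zero_apply, zero_mul]
    · exact hψ.continuous.continuousOn.mul
        ((((hθ.continuous_fderiv (by simp))).comp_continuousOn F.continuousOn_symm).clm_apply
          (hcG.clm_apply continuousOn_const))
    · intro w hw
      rw [image_eq_zero_of_notMem_tsupport hw, zero_mul]

end

end

/-! ### Slicing into tangential and normal coordinates, and translation invariance -/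

section

theorem exists_test_integral_eq_one {n : ℕ} {Z : Set (Euc n)} (hZ : IsOpen Z) (hne : Z.Nonempty) :
    ∃ η : Euc n → ℝ, ContDiff ℝ ∞ η ∧ HasCompactSupport η ∧ tsupport η ⊆ Z ∧ ∫ z, η z = 1 := by
  obtain ⟨z, hz⟩ := hne
  obtain ⟨R, hR, hRZ⟩ := Metric.isOpen_iff.1 hZ z hz
  let f : ContDiffBump z := ⟨R / 4, R / 2, by positivity, by linarith⟩
  refine ⟨f.normed volume, f.contDiff_normed, f.hasCompactSupport_normed, ?_, f.integral_normed⟩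
  rw [f.tsupport_normed_eq]
  exact (Metric.closedBall_subset_ball (by simp [f]; linarith)).trans hRZ

namespace Split

variable {ℓ k : ℕ} (e : Split ℓ k)

/-- The set of points with tangential coordinate in `A` and normal coordinate in `Z`. -/
def box (A : Set (Euc k)) (Z : Set (Euc (ℓ - k))) : Set (Euc ℓ) := {x | e.tan x ∈ A ∧ e.nor x ∈ Z}

variable {A : Set (Euc k)} {Z : Set (Euc (ℓ - k))}

theorem isOpen_box (hA : IsOpen A) (hZ : IsOpen Z) : IsOpen (e.box A Z) :=
  (hA.preimage e.tan.continuous).inter (hZ.preimage e.nor.continuous)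

theorem mem_box (y : Euc k) (z : Euc (ℓ - k)) : e.inT y + e.inN z ∈ e.box A Z ↔ y ∈ A ∧ z ∈ Z := by
  simp [box]

theorem isCompact_box (hA : IsCompact A) (hZ : IsCompact Z) : IsCompact (e.box A Z) := by
  have : e.box A Z = (fun w : Euc k × Euc (ℓ - k) => e.inT w.1 + e.inN w.2) '' (A ×ˢ Z) := by
    ext x
    constructor
    · rintro ⟨h1, h2⟩
      exact ⟨(e.tan x, e.nor x), ⟨h1, h2⟩, e.inT_tan_add_inN_nor x⟩
    · rintro ⟨⟨y, z⟩, ⟨h1, h2⟩, rfl⟩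
      exact (e.mem_box y z).2 ⟨h1, h2⟩
  rw [this]
  exact (hA.prod hZ).image (((e.inT.continuous.comp continuous_fst)).add
    (e.inN.continuous.comp continuous_snd))

section

variable {E : Type*} [NormedAddCommGroup E]

theorem integrable_comp_iff {f : Euc ℓ → E} :
    Integrable (fun w : Euc k × Euc (ℓ - k) => f (e.inT w.1 + e.inN w.2))
      (volume.prod volume) ↔ Integrable f :=
  by simpa only [Function.comp_def, measurableEquiv_apply] using
    e.measurePreserving.integrable_comp_emb e.measurableEquiv.measurableEmbedding (g := f)

theorem integral_eq_prod [NormedSpace ℝ E] (f : Euc ℓ → E) :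
    ∫ x, f x = ∫ w : Euc k × Euc (ℓ - k), f (e.inT w.1 + e.inN w.2) ∂(volume.prod volume) :=
  by simpa only [measurableEquiv_apply] using
    (e.measurePreserving.integral_comp e.measurableEquiv.measurableEmbedding f).symm

theorem integral_eq [NormedSpace ℝ E] {f : Euc ℓ → E} (hf : Integrable f) :
    ∫ x, f x = ∫ y : Euc k, ∫ z : Euc (ℓ - k), f (e.inT y + e.inN z) := by
  rw [e.integral_eq_prod f, integral_prod _ (e.integrable_comp_iff.2 hf)]

theorem integral_eq_symm [NormedSpace ℝ E] {f : Euc ℓ → E} (hf : Integrable f) :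
    ∫ x, f x = ∫ z : Euc (ℓ - k), ∫ y : Euc k, f (e.inT y + e.inN z) := by
  rw [e.integral_eq_prod f, integral_prod_symm _ (e.integrable_comp_iff.2 hf)]

/-- A compact subset of the cylinder lies in a product of two compact sets, and on such a product
the normal variable contributes only a finite measure. -/
theorem locallyIntegrableOn_comp_tan (hA : IsOpen A) {w : Euc k → E}
    (hw : LocallyIntegrableOn w A) : LocallyIntegrableOn (fun x => w (e.tan x)) (e.box A univ) := by
  rw [locallyIntegrableOn_iff (e.isOpen_box hA isOpen_univ).isLocallyClosed]
  intro K hK hKc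
  have h1 : IsCompact (e.tan '' K) := hKc.image e.tan.continuous
  have h2 : IsCompact (e.nor '' K) := hKc.image e.nor.continuous
  have h3 : IntegrableOn w (e.tan '' K) := hw.integrableOn_compact_subset
    (by rintro _ ⟨x, hx, rfl⟩; exact (hK hx).1) h1
  have : IsFiniteMeasure (volume.restrict (e.nor '' K)) := ⟨by
    rw [Measure.restrict_apply_univ]; exact h2.measure_lt_top⟩
  have h4 := h3.comp_fst (volume.restrict (e.nor '' K))
  rw [Measure.prod_restrict] at h4
  have hKb : K ⊆ e.box (e.tan '' K) (e.nor '' K) := fun x hx =>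
    ⟨mem_image_of_mem _ hx, mem_image_of_mem _ hx⟩
  refine IntegrableOn.mono_set ?_ hKb
  have hm := (e.isCompact_box h1 h2).measurableSet
  rw [← integrable_indicator_iff hm, ← e.integrable_comp_iff]
  rw [← IntegrableOn, ← integrable_indicator_iff (h1.measurableSet.prod h2.measurableSet)] at h4
  refine h4.congr (Eventually.of_forall fun q => ?_)
  beta_reduce
  by_cases hq : q ∈ (e.tan '' K) ×ˢ (e.nor '' K)
  · rw [indicator_of_mem hq, indicator_of_mem ((e.mem_box _ _).2 hq)]
    simp
  · rw [indicator_of_notMem hq, indicator_of_notMem fun h => hq ((e.mem_box _ _).1 h)]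

end

/-- The slice of a test function. -/
theorem hasCompactSupport_slice {ψ : Euc ℓ → ℝ} (hc : HasCompactSupport ψ) (z : Euc (ℓ - k)) :
    HasCompactSupport (fun y => ψ (e.inT y + e.inN z)) :=
  hc.comp_isClosedEmbedding (((Homeomorph.addRight (e.inN z)).isClosedEmbedding).comp
    e.inT.isometry.isClosedEmbedding)

theorem hasCompactSupport_slice' {ψ : Euc ℓ → ℝ} (hc : HasCompactSupport ψ) (y : Euc k) :
    HasCompactSupport (fun z => ψ (e.inT y + e.inN z)) :=
  hc.comp_isClosedEmbedding (((Homeomorph.addLeft (e.inT y)).isClosedEmbedding).comp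
    e.inN.isometry.isClosedEmbedding)

theorem hasFDerivAt_slice {ψ : Euc ℓ → ℝ} (h : Differentiable ℝ ψ) (y : Euc k) (z : Euc (ℓ - k)) :
    HasFDerivAt (fun y => ψ (e.inT y + e.inN z))
      (fderiv ℝ ψ (e.inT y + e.inN z) ∘L e.inT.toContinuousLinearMap) y :=
  HasFDerivAt.comp (g := ψ) y (h _).hasFDerivAt
    ((e.inT.toContinuousLinearMap.hasFDerivAt).add_const (e.inN z))

theorem hasFDerivAt_slice' {ψ : Euc ℓ → ℝ} (h : Differentiable ℝ ψ) (y : Euc k)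
    (z : Euc (ℓ - k)) :
    HasFDerivAt (fun z => ψ (e.inT y + e.inN z))
      (fderiv ℝ ψ (e.inT y + e.inN z) ∘L e.inN.toContinuousLinearMap) z :=
  HasFDerivAt.comp (g := ψ) z (h _).hasFDerivAt
    ((e.inN.toContinuousLinearMap.hasFDerivAt).const_add (e.inT y))

/-- A function of the tangential coordinate has a weak gradient in the tangential direction. -/
theorem isWeakGradient_comp_tan (hA : IsOpen A) {w : Euc k → ℝ} {h : Euc k → Euc k}
    (hw : LocallyIntegrableOn w A) (hh : LocallyIntegrableOn h A) (hwh : IsWeakGradient A w h) :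
    IsWeakGradient (e.box A univ) (fun x => w (e.tan x)) fun x => e.inT (h (e.tan x)) := by
  intro ψ h1 h2 h3 a
  have hd : Differentiable ℝ ψ := h1.differentiable (by simp)
  have hz0 : ∀ (f : Euc ℓ → ℝ) (b : Euc ℓ), ∀ x ∉ tsupport ψ, f x * fderiv ℝ ψ x b = 0 :=
    fun f b x hx => by
      rw [image_eq_zero_of_notMem_tsupport (fun h => hx (tsupport_fderiv_subset ℝ h)), zero_apply,
        mul_zero]
  have hi : ∀ b, Integrable fun x => w (e.tan x) * fderiv ℝ ψ x b := fun b =>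
    integrable_mul_of_locallyIntegrableOn (e.locallyIntegrableOn_comp_tan hA hw)
      ((h1.continuous_fderiv (by simp)).clm_apply continuous_const) (h2.fderiv_apply (𝕜 := ℝ) b)
      ((tsupport_fderiv_apply_subset ℝ b).trans h3)
  have hhi : Integrable fun x => inner ℝ (h (e.tan x)) (e.tan a) * ψ x :=
    integrable_mul_of_locallyIntegrableOn (u := fun x => inner ℝ (h (e.tan x)) (e.tan a))
      (fun x hx => by
        obtain ⟨s, hs, hi⟩ := (e.locallyIntegrableOn_comp_tan hA hh) x hx
        exact ⟨s, hs, hi.inner_const _⟩) h1.continuous h2 h3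
  rw [setIntegral_eq_integral_of_tsupport h3 (hz0 _ a),
    setIntegral_eq_integral_of_tsupport h3 fun x hx => by
      rw [image_eq_zero_of_notMem_tsupport hx, zero_mul]]
  have e1 : ∀ x, w (e.tan x) * fderiv ℝ ψ x a = w (e.tan x) * fderiv ℝ ψ x (e.inT (e.tan a)) +
      w (e.tan x) * fderiv ℝ ψ x (e.inN (e.nor a)) := by
    intro x
    rw [← mul_add, ← map_add, e.inT_tan_add_inN_nor]
  have e2 : ∀ x, ψ x * inner ℝ (e.inT (h (e.tan x))) a =
      inner ℝ (h (e.tan x)) (e.tan a) * ψ x := by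
    intro x
    rw [e.inner_inT, mul_comm]
  simp_rw [e1, e2]
  rw [integral_add (hi _) (hi _), e.integral_eq (hi (e.inN (e.nor a))),
    e.integral_eq_symm (hi (e.inT (e.tan a))), e.integral_eq_symm hhi, ← integral_neg]
  -- The normal part of the direction contributes nothing: the function does not depend on `z`, and
  -- a derivative of a compactly supported function has integral zero.
  have e3 : ∀ y : Euc k, ∫ z : Euc (ℓ - k), w (e.tan (e.inT y + e.inN z)) *
      fderiv ℝ ψ (e.inT y + e.inN z) (e.inN (e.nor a)) = 0 := by
    intro y
    have hs : ContDiff ℝ 1 (fun z : Euc (ℓ - k) => ψ (e.inT y + e.inN z)) :=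
      (h1.of_le (by simp)).comp (contDiff_const.add e.inN.contDiff)
    have hX : ContDiff ℝ 1 fun z => ψ (e.inT y + e.inN z) • e.nor a := hs.smul contDiff_const
    have h0 : ∫ z, divergence (fun z => ψ (e.inT y + e.inN z) • e.nor a) z = 0 :=
      integral_divergence_eq_zero hX
        ((e.hasCompactSupport_slice' h2 y).smul_right (f' := fun _ : Euc (ℓ - k) => e.nor a))
    have h5 : ∀ z, divergence (fun z => ψ (e.inT y + e.inN z) • e.nor a) z =
        fderiv ℝ ψ (e.inT y + e.inN z) (e.inN (e.nor a)) := by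
      intro z
      rw [divergence_eq_traceCLM, ((e.hasFDerivAt_slice' hd y z).smul_const _).fderiv,
        traceCLM_smulRight]
      rfl
    simp_rw [h5] at h0
    simp [integral_const_mul, h0]
  simp_rw [e3]
  rw [integral_zero, add_zero]
  refine integral_congr_ae (Eventually.of_forall fun z => ?_)
  have hts : tsupport (fun y => ψ (e.inT y + e.inN z)) ⊆ A := by
    intro y hy
    have h6 : e.inT y + e.inN z ∈ tsupport ψ := by
      have hc : Continuous fun y => e.inT y + e.inN z := e.inT.continuous.add continuous_const
      exact tsupport_comp_subset_preimage ψ hc hy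
    simpa using (h3 h6).1
  -- For fixed `z`, the tangential part is the weak gradient relation for `w`, tested with the slice
  -- of `ψ`.
  have key := hwh _ (h1.comp (e.inT.contDiff.add contDiff_const)) (e.hasCompactSupport_slice h2 z)
    hts (e.tan a)
  have h7 : ∀ y ∉ tsupport (fun y => ψ (e.inT y + e.inN z)),
      w y * fderiv ℝ (fun y => ψ (e.inT y + e.inN z)) y (e.tan a) = 0 := fun y hy => by
    rw [image_eq_zero_of_notMem_tsupport (fun h => hy (tsupport_fderiv_subset ℝ h)), zero_apply,
      mul_zero]
  have h8 : ∀ y ∉ tsupport (fun y => ψ (e.inT y + e.inN z)),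
      ψ (e.inT y + e.inN z) * inner ℝ (h y) (e.tan a) = 0 := fun y hy => by
    rw [image_eq_zero_of_notMem_tsupport (f := fun y => ψ (e.inT y + e.inN z)) hy, zero_mul]
  rw [Function.comp_def] at key
  rw [setIntegral_eq_integral_of_tsupport hts h7, setIntegral_eq_integral_of_tsupport hts h8]
    at key
  have h9 : ∀ y, fderiv ℝ (fun y => ψ (e.inT y + e.inN z)) y (e.tan a) =
      fderiv ℝ ψ (e.inT y + e.inN z) (e.inT (e.tan a)) := fun y => by
    rw [(e.hasFDerivAt_slice hd y z).fderiv]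
    rfl
  simp_rw [h9] at key
  simp only [map_add, tan_inT, tan_inN, add_zero]
  rw [key]
  simp_rw [mul_comm]

end Split

/-- A function whose weak derivative in the direction `a` vanishes is invariant under
translation by `a`. -/
theorem IsWeakGradient.ae_eq_translate {n : ℕ} {O : Set (Euc n)} (hO : IsOpen O) {u : Euc n → ℝ}
    {g : Euc n → Euc n} (h : IsWeakGradient O u g) (hu : LocallyIntegrableOn u O) {a : Euc n}
    (ha : ∀ᵐ x ∂(volume.restrict O), inner ℝ (g x) a = 0)
    (hseg : ∀ x ∈ O, x + a ∈ O → ∀ t ∈ Icc (0 : ℝ) 1, x + t • a ∈ O) :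
    ∀ᵐ x, x ∈ O → x + a ∈ O → u (x + a) = u x := by
  have hO' : IsOpen ((fun x => x + a) ⁻¹' O) := hO.preimage (by fun_prop)
  have hua : LocallyIntegrableOn (fun x => u (x + a)) ((fun x => x + a) ⁻¹' O) := by
    rw [locallyIntegrableOn_iff hO'.isLocallyClosed]
    intro K hK hKc
    have h1 : IntegrableOn u ((fun x => x + a) '' K) := hu.integrableOn_compact_subset
      (image_subset_iff.2 hK) (hKc.image (by fun_prop))
    have h2 := ((measurePreserving_add_right volume a).integrableOn_comp_preimage
      (MeasurableEquiv.addRight a).measurableEmbedding (f := u) (s := (fun x => x + a) '' K)).2 h1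
    rwa [preimage_image_eq _ (add_left_injective a)] at h2
  have hd : LocallyIntegrableOn (fun x => u (x + a) - u x) (O ∩ (fun x => x + a) ⁻¹' O) :=
    (hua.mono_set inter_subset_right).sub (hu.mono_set inter_subset_left)
  have h0 : ∀ᵐ x, x ∈ O ∩ (fun x => x + a) ⁻¹' O → u (x + a) - u x = 0 := by
    refine (hO.inter hO').ae_eq_zero_of_integral_contDiff_smul_eq_zero hd fun θ h1 h2 h3 => ?_
    have hθd : Differentiable ℝ θ := h1.differentiable (by simp)
    -- The compact region swept by the support of `θ` while it is translated by `t a`, `0 ≤ t ≤ 1`.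
    -- Truncation to it makes `u` integrable and does not affect the integrals that matter.
    let K : Set (Euc n) := (fun q : ℝ × Euc n => q.2 + q.1 • a) '' (Icc 0 1 ×ˢ tsupport θ)
    have hK : IsCompact K := (isCompact_Icc.prod h2.isCompact).image (by fun_prop)
    have hKO : K ⊆ O := by
      rintro _ ⟨⟨t, x⟩, ⟨ht, hx⟩, rfl⟩
      exact hseg x (h3 hx).1 (h3 hx).2 t ht
    have hKt : ∀ t ∈ Icc (0 : ℝ) 1, ∀ x, x - t • a ∈ tsupport θ → x ∈ K := fun t ht x hx =>
      ⟨(t, x - t • a), ⟨ht, hx⟩, by simp⟩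
    let u₁ := K.indicator u
    have hu1 : Integrable u₁ :=
      (integrable_indicator_iff hK.measurableSet).2 (hu.integrableOn_compact_subset hKO hK)
    have hcθ : ∀ t : ℝ, Continuous fun x => θ (x - t • a) := fun t =>
      h1.continuous.comp (by fun_prop)
    have hcD : Continuous fun x => fderiv ℝ θ x a :=
      (h1.continuous_fderiv (by simp)).clm_apply continuous_const
    obtain ⟨C, hC⟩ := hcD.bounded_above_of_compact_support (h2.fderiv_apply (𝕜 := ℝ) a)
    obtain ⟨C', hC'⟩ := h1.continuous.bounded_above_of_compact_support h2
    have hint : ∀ t : ℝ, Integrable fun x => u₁ x * θ (x - t • a) := fun t =>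
      hu1.mul_bdd (c := C') (hcθ t).aestronglyMeasurable (Eventually.of_forall fun x => hC' _)
    -- The pairing of `u` with `θ(· - t a)` has derivative `-∫ u ∂_a θ(· - t a)`. For `t ∈ [0, 1]`
    -- this is zero, by the weak gradient relation and the hypothesis on `g`; hence the pairings at
    -- `t = 0` and `t = 1` agree.
    have hder : ∀ t : ℝ, HasDerivAt (fun t => ∫ x, u₁ x * θ (x - t • a))
        (∫ x, u₁ x * -fderiv ℝ θ (x - t • a) a) t := by
      intro t
      refine (hasDerivAt_integral_of_dominated_loc_of_deriv_le (s := univ)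
        (F' := fun t x => u₁ x * -fderiv ℝ θ (x - t • a) a)
        (bound := fun x => ‖u₁ x‖ * C) univ_mem
        (Eventually.of_forall fun t => (hint t).aestronglyMeasurable) (hint t) ?_ ?_
        (hu1.norm.mul_const C) ?_).2
      · exact hu1.aestronglyMeasurable.mul
          (hcD.comp (by fun_prop : Continuous fun x => x - t • a)).neg.aestronglyMeasurable
      · refine Eventually.of_forall fun x t _ => ?_
        rw [norm_mul, norm_neg]
        exact mul_le_mul_of_nonneg_left (hC _) (norm_nonneg _)
      · refine Eventually.of_forall fun x t _ => ?_
        have hl : HasDerivAt (fun t : ℝ => x - t • a) (-a) t := by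
          simpa using ((hasDerivAt_id t).smul_const a).const_sub x
        have := ((hθd (x - t • a)).hasFDerivAt.comp_hasDerivAt t hl).const_mul (u₁ x)
        rwa [map_neg] at this
    have hzero : ∀ t ∈ Icc (0 : ℝ) 1, ∫ x, u₁ x * -fderiv ℝ θ (x - t • a) a = 0 := by
      intro t ht
      have hts : tsupport (fun x => θ (x - t • a)) ⊆ K := fun x hx =>
        hKt t ht x (tsupport_comp_subset_preimage (f := fun x => x - t • a) θ (by fun_prop) hx)
      have hcs : HasCompactSupport fun x => θ (x - t • a) :=
        HasCompactSupport.of_support_subset_isCompact hK ((subset_tsupport _).trans hts)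
      have h4 := h (fun x => θ (x - t • a)) (h1.comp (contDiff_id.sub contDiff_const)) hcs
        (hts.trans hKO) a
      have h5 : ∀ x, fderiv ℝ (fun x => θ (x - t • a)) x a = fderiv ℝ θ (x - t • a) a := by
        intro x
        have h6 := (hθd (x - t • a)).hasFDerivAt.comp x ((hasFDerivAt_id x).sub_const (t • a))
        exact DFunLike.congr_fun h6.fderiv a
      simp_rw [h5] at h4
      have h6 : ∫ x in O, θ (x - t • a) * inner ℝ (g x) a = 0 := by
        rw [integral_eq_zero_of_ae]
        filter_upwards [ha] with x hx
        rw [hx, mul_zero, Pi.zero_apply]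
      have h7 : ∀ x ∉ K, fderiv ℝ θ (x - t • a) a = 0 := fun x hx => by
        rw [image_eq_zero_of_notMem_tsupport (fun h => hx (hKt t ht x
          (tsupport_fderiv_subset ℝ h))), zero_apply]
      rw [h6, neg_zero, setIntegral_eq_integral_of_forall_compl_eq_zero
        fun x hx => by rw [h7 x fun h => hx (hKO h), mul_zero]] at h4
      rw [← neg_zero, ← h4, ← integral_neg]
      refine integral_congr_ae (Eventually.of_forall fun x => ?_)
      by_cases hx : x ∈ K
      · simp only [u₁, indicator_of_mem hx, mul_neg]
      · simp only [h7 x hx, mul_zero, neg_zero]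
    have hconst := constant_of_has_deriv_right_zero (a := (0 : ℝ)) (b := 1)
      (f := fun t => ∫ x, u₁ x * θ (x - t • a))
      (fun t _ => (hder t).continuousAt.continuousWithinAt)
      (fun t ht => by
        have := (hder t).hasDerivWithinAt (s := Ici t)
        rwa [hzero t ⟨ht.1, ht.2.le⟩] at this) 1 (by simp)
    simp only [one_smul, zero_smul, sub_zero] at hconst
    rw [← integral_add_right_eq_self (fun x => u₁ x * θ (x - a)) a] at hconst
    simp only [add_sub_cancel_right] at hconst
    have i1 : Integrable fun x => u₁ (x + a) * θ x := by
      have := (hint 1).comp_add_right a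
      simpa using this
    have i0 : Integrable fun x => u₁ x * θ x := by simpa using hint 0
    rw [← sub_eq_zero, ← integral_sub i1 i0] at hconst
    rw [← hconst]
    refine integral_congr_ae (Eventually.of_forall fun x => ?_)
    by_cases hx : x ∈ tsupport θ
    · have m0 : x ∈ K := hKt 0 (by simp) x (by simpa using hx)
      have m1 : x + a ∈ K := hKt 1 (by simp) (x + a) (by simpa using hx)
      simp only [u₁, indicator_of_mem m0, indicator_of_mem m1, smul_eq_mul]
      ring
    · simp only [image_eq_zero_of_notMem_tsupport hx, zero_smul, mul_zero, sub_zero]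
  filter_upwards [h0] with x hx hx1 hx2
  exact sub_eq_zero.1 (hx ⟨hx1, hx2⟩)

end

/-! ### Averaging over the normal coordinate -/

section

namespace Split

variable {ℓ k : ℕ} (e : Split ℓ k) {A : Set (Euc k)} {Z : Set (Euc (ℓ - k))}

theorem integrableOn_comp_iff {E : Type*} [NormedAddCommGroup E] {f : Euc ℓ → E} :
    IntegrableOn (fun w : Euc k × Euc (ℓ - k) => f (e.inT w.1 + e.inN w.2)) (A ×ˢ Z)
      (volume.prod volume) ↔ IntegrableOn f (e.box A Z) := by
  have h := e.measurePreserving.integrableOn_comp_preimage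
    e.measurableEquiv.measurableEmbedding (f := f) (s := e.box A Z)
  have hs : e.measurableEquiv ⁻¹' e.box A Z = A ×ˢ Z := by
    ext q
    rw [mem_preimage, measurableEquiv_apply, e.mem_box, mem_prod]
  rwa [hs, show f ∘ e.measurableEquiv = fun w : Euc k × Euc (ℓ - k) =>
    f (e.inT w.1 + e.inN w.2) from funext fun w => by
      rw [Function.comp_apply, measurableEquiv_apply]] at h

/-- The weight has compact support in `Z`, so over a compact set of tangential coordinates only a
compact part of the box is seen. -/
theorem integrable_average {E : Type*} [NormedAddCommGroup E] [NormedSpace ℝ E]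
    {f : Euc ℓ → E} (hf : LocallyIntegrableOn f (e.box A Z))
    {η : Euc (ℓ - k) → ℝ} (hη : Continuous η) (hc : HasCompactSupport η) (hs : tsupport η ⊆ Z)
    {K : Set (Euc k)} (hK : K ⊆ A) (hKc : IsCompact K) :
    Integrable (fun w : Euc k × Euc (ℓ - k) => η w.2 • f (e.inT w.1 + e.inN w.2))
      ((volume.restrict K).prod volume) := by
  have h1 : IntegrableOn (fun x => η (e.nor x) • f x) (e.box K univ) := by
    have h2 : IntegrableOn (fun x => η (e.nor x) • f x) (e.box K (tsupport η)) := by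
      have hcK := e.isCompact_box hKc hc.isCompact
      exact (hf.integrableOn_compact_subset (fun x hx => ⟨hK hx.1, hs hx.2⟩)
        hcK).continuousOn_smul (hη.comp e.nor.continuous).continuousOn hcK
    refine h2.of_forall_sdiff_eq_zero ?_ fun x hx => ?_
    · exact (hKc.isClosed.preimage e.tan.continuous).measurableSet.inter MeasurableSet.univ
    · rw [image_eq_zero_of_notMem_tsupport fun h => hx.2 ⟨hx.1.1, h⟩, zero_smul]
  rw [← integrableOn_comp_iff, IntegrableOn, ← Measure.prod_restrict, Measure.restrict_univ] at h1
  simpa using h1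

theorem locallyIntegrableOn_average {E : Type*} [NormedAddCommGroup E] [NormedSpace ℝ E]
    (hA : IsOpen A) {f : Euc ℓ → E} (hf : LocallyIntegrableOn f (e.box A Z))
    {η : Euc (ℓ - k) → ℝ} (hη : Continuous η) (hc : HasCompactSupport η) (hs : tsupport η ⊆ Z) :
    LocallyIntegrableOn (fun y => ∫ z, η z • f (e.inT y + e.inN z)) A := by
  rw [locallyIntegrableOn_iff hA.isLocallyClosed]
  exact fun K hK hKc => (e.integrable_average hf hη hc hs hK hKc).integral_prod_left

set_option maxHeartbeats 1000000 in
/-- Averaging a weakly differentiable function over the normal coordinate. -/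
theorem isWeakGradient_average {u : Euc ℓ → ℝ} {g : Euc ℓ → Euc ℓ}
    (hu : LocallyIntegrableOn u (e.box A Z)) (hg : LocallyIntegrableOn g (e.box A Z))
    (h : IsWeakGradient (e.box A Z) u g) {η : Euc (ℓ - k) → ℝ} (hη1 : ContDiff ℝ ∞ η)
    (hη2 : HasCompactSupport η) (hη3 : tsupport η ⊆ Z) :
    IsWeakGradient A (fun y => ∫ z, η z • u (e.inT y + e.inN z))
      fun y => ∫ z, η z • e.tan (g (e.inT y + e.inN z)) := by
  have hga : LocallyIntegrableOn (fun x => e.tan (g x)) (e.box A Z) := fun x hx => by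
    obtain ⟨s, hs, hi⟩ := hg x hx
    exact ⟨s, hs, e.tan.integrable_comp hi⟩
  intro ψ h1 h2 h3 a
  have hdψ : Differentiable ℝ ψ := h1.differentiable (by simp)
  have hdη : Differentiable ℝ η := hη1.differentiable (by simp)
  have hcs : ∀ {χ : Euc k → ℝ}, tsupport χ ⊆ tsupport ψ →
      tsupport (fun x => χ (e.tan x) * η (e.nor x)) ⊆ e.box (tsupport ψ) (tsupport η) := by
    intro χ hχ
    refine closure_minimal (fun x hx => ?_) (e.isCompact_box h2.isCompact hη2.isCompact).isClosed
    exact ⟨hχ (subset_tsupport _ (left_ne_zero_of_mul hx)),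
      subset_tsupport _ (right_ne_zero_of_mul hx)⟩
  have hcc : ∀ {χ : Euc k → ℝ}, tsupport χ ⊆ tsupport ψ →
      HasCompactSupport (fun x => χ (e.tan x) * η (e.nor x)) := fun hχ =>
    HasCompactSupport.of_support_subset_isCompact (e.isCompact_box h2.isCompact hη2.isCompact)
      ((subset_tsupport _).trans (hcs hχ))
  have hbb : e.box (tsupport ψ) (tsupport η) ⊆ e.box A Z := fun x hx => ⟨h3 hx.1, hη3 hx.2⟩
  have hD : tsupport (fun y => fderiv ℝ ψ y a) ⊆ tsupport ψ := tsupport_fderiv_apply_subset ℝ a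
  -- The test function is a product, and in the direction `inT a` the factor `η` is not
  -- differentiated.
  have key := h (fun x => ψ (e.tan x) * η (e.nor x))
    ((h1.comp e.tan.contDiff).mul (hη1.comp e.nor.contDiff)) (hcc le_rfl)
    ((hcs le_rfl).trans hbb) (e.inT a)
  have hder : ∀ x, fderiv ℝ (fun x => ψ (e.tan x) * η (e.nor x)) x (e.inT a) =
      fderiv ℝ ψ (e.tan x) a * η (e.nor x) := by
    intro x
    have d1 := (hdψ (e.tan x)).hasFDerivAt.comp x e.tan.hasFDerivAt
    have d2 := (hdη (e.nor x)).hasFDerivAt.comp x e.nor.hasFDerivAt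
    rw [show fderiv ℝ (fun x => ψ (e.tan x) * η (e.nor x)) x = _ from (d1.mul d2).fderiv]
    simp only [add_apply, smul_apply, ContinuousLinearMap.comp_apply, tan_inT, nor_inT, map_zero,
      smul_eq_mul, mul_zero, zero_add, Function.comp_apply]
    ring
  simp_rw [hder] at key
  have hiL : Integrable fun x => u x * (fderiv ℝ ψ (e.tan x) a * η (e.nor x)) :=
    integrable_mul_of_locallyIntegrableOn hu
      ((((h1.continuous_fderiv (by simp)).comp e.tan.continuous).clm_apply
        continuous_const).mul (hη1.continuous.comp e.nor.continuous)) (hcc hD)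
      ((hcs hD).trans hbb)
  have hiR : Integrable fun x => inner ℝ (e.tan (g x)) a * (ψ (e.tan x) * η (e.nor x)) :=
    integrable_mul_of_locallyIntegrableOn (u := fun x => inner ℝ (e.tan (g x)) a)
      (fun x hx => by
        obtain ⟨s, hs, hi⟩ := hga x hx
        exact ⟨s, hs, hi.inner_const a⟩)
      ((h1.continuous.comp e.tan.continuous).mul (hη1.continuous.comp e.nor.continuous))
      (hcc le_rfl) ((hcs le_rfl).trans hbb)
  have eR : ∀ x, ψ (e.tan x) * η (e.nor x) * inner ℝ (g x) (e.inT a) =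
      inner ℝ (e.tan (g x)) a * (ψ (e.tan x) * η (e.nor x)) := by
    intro x
    rw [real_inner_comm, e.inner_inT, real_inner_comm, mul_comm]
  simp_rw [eR] at key
  rw [setIntegral_eq_integral_of_forall_compl_eq_zero (fun x hx => by
      rw [image_eq_zero_of_notMem_tsupport (f := fun x => fderiv ℝ ψ (e.tan x) a * η (e.nor x))
        fun h => hx (hbb (hcs hD h)), mul_zero]),
    setIntegral_eq_integral_of_forall_compl_eq_zero (fun x hx => by
      rw [image_eq_zero_of_notMem_tsupport (f := fun x => ψ (e.tan x) * η (e.nor x))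
        fun h => hx (hbb (hcs le_rfl h)), mul_zero]),
    e.integral_eq hiL, e.integral_eq hiR] at key
  rw [setIntegral_eq_integral_of_tsupport h3 fun y hy => by
      rw [image_eq_zero_of_notMem_tsupport (f := fun y => fderiv ℝ ψ y a)
        fun h => hy (hD h), mul_zero],
    setIntegral_eq_integral_of_tsupport h3 fun y hy => by
      rw [image_eq_zero_of_notMem_tsupport hy, zero_mul]]
  refine Eq.trans ?_ (key.trans (congrArg Neg.neg ?_))
  · refine integral_congr_ae (Eventually.of_forall fun y => ?_)
    simp only [map_add, tan_inT, tan_inN, nor_inT, nor_inN, add_zero, zero_add]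
    rw [← integral_mul_const]
    refine integral_congr_ae (Eventually.of_forall fun z => ?_)
    simp only [smul_eq_mul]
    ring
  · have hav := (e.integrable_average (f := fun x => e.tan (g x)) hga hη1.continuous hη2 hη3 h3
      h2.isCompact).prod_right_ae
    rw [ae_restrict_iff' h2.isCompact.measurableSet] at hav
    refine integral_congr_ae ?_
    filter_upwards [hav] with y hy
    simp only [map_add, tan_inT, tan_inN, nor_inT, nor_inN, add_zero, zero_add]
    by_cases hyK : y ∈ tsupport ψ
    · rw [real_inner_comm, ← integral_inner (hy hyK), ← integral_const_mul]
      refine integral_congr_ae (Eventually.of_forall fun z => ?_)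
      simp only [inner_smul_right]
      rw [real_inner_comm]
      ring
    · simp [image_eq_zero_of_notMem_tsupport hyK]
/-- A weakly differentiable function on a box whose weak gradient has vanishing normal part is a
function of the tangential coordinate. -/
theorem exists_of_nor_eq_zero (hA : IsOpen A) (hZ : IsOpen Z) (hZc : Convex ℝ Z)
    (hZne : Z.Nonempty) {u : Euc ℓ → ℝ} {g : Euc ℓ → Euc ℓ}
    (hu : LocallyIntegrableOn u (e.box A Z)) (hg : LocallyIntegrableOn g (e.box A Z))
    (h : IsWeakGradient (e.box A Z) u g)
    (hn : ∀ᵐ x ∂(volume.restrict (e.box A Z)), e.nor (g x) = 0) :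
    ∃ (w : Euc k → ℝ) (v : Euc k → Euc k), LocallyIntegrableOn w A ∧ LocallyIntegrableOn v A ∧
      IsWeakGradient A w v ∧ (u =ᵐ[volume.restrict (e.box A Z)] fun x => w (e.tan x)) ∧
      g =ᵐ[volume.restrict (e.box A Z)] fun x => e.inT (v (e.tan x)) := by
  have hO := e.isOpen_box hA hZ
  obtain ⟨η, hη1, hη2, hη3, hη4⟩ := exists_test_integral_eq_one hZ hZne
  have hum := hu.aestronglyMeasurable
  -- A Borel representative, needed so that the exceptional set in `hms` is measurable and Fubini's
  -- theorem applies to it.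
  set u' := hum.mk with hu'def
  have huu : u =ᵐ[volume.restrict (e.box A Z)] u' := hum.ae_eq_mk
  have hu'm : Measurable u' := hum.stronglyMeasurable_mk.measurable
  have hu' : LocallyIntegrableOn u' (e.box A Z) := by
    rw [locallyIntegrableOn_iff hO.isLocallyClosed] at hu ⊢
    exact fun K hK hKc => (hu K hK hKc).congr (ae_restrict_of_ae_restrict_of_subset hK huu)
  have h' : IsWeakGradient (e.box A Z) u' g := h.congr_ae huu EventuallyEq.rfl
  have hga : LocallyIntegrableOn (fun x => e.tan (g x)) (e.box A Z) := fun x hx => by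
    obtain ⟨s, hs, hi⟩ := hg x hx
    exact ⟨s, hs, e.tan.integrable_comp hi⟩
  let w : Euc k → ℝ := fun y => ∫ z, η z • u' (e.inT y + e.inN z)
  let v : Euc k → Euc k := fun y => ∫ z, η z • e.tan (g (e.inT y + e.inN z))
  have hw : LocallyIntegrableOn w A := e.locallyIntegrableOn_average hA hu' hη1.continuous hη2 hη3
  have hv : LocallyIntegrableOn v A :=
    e.locallyIntegrableOn_average hA (f := fun x => e.tan (g x)) hga hη1.continuous hη2 hη3
  have htr : ∀ b : Euc (ℓ - k), ∀ᵐ x, x ∈ e.box A Z → x + e.inN b ∈ e.box A Z →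
      u' (x + e.inN b) = u' x := by
    intro b
    refine h'.ae_eq_translate hO hu' ?_ ?_
    · filter_upwards [hn] with x hx
      rw [real_inner_comm, e.inner_inN, hx, inner_zero_right]
    · intro x hx hxb t ht
      refine ⟨by simpa using hx.1, ?_⟩
      have := hZc.add_smul_mem hx.2 (y := b) (by simpa using hxb.2) ht
      simpa using this
  have hms : MeasurableSet {q : Euc ℓ × Euc (ℓ - k) | q.1 ∈ e.box A Z →
      q.1 + e.inN q.2 ∈ e.box A Z → u' (q.1 + e.inN q.2) = u' q.1} := by
    have hadd : Measurable fun q : Euc ℓ × Euc (ℓ - k) => q.1 + e.inN q.2 :=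
      (continuous_fst.add (e.inN.continuous.comp continuous_snd)).measurable
    exact (measurable_fst hO.measurableSet).imp ((hadd hO.measurableSet).imp
      (measurableSet_eq_fun (hu'm.comp hadd) (hu'm.comp measurable_fst)))
  -- Exchanging the quantifiers: for almost every `x`, almost every normal translate inside the box
  -- carries the same value `u' x`. Thus the `η`-average through `x` is `u' x`, because `η` has
  -- integral `1`.
  have hae : ∀ᵐ x, ∀ᵐ b : Euc (ℓ - k), x ∈ e.box A Z → x + e.inN b ∈ e.box A Z →
      u' (x + e.inN b) = u' x :=
    (Measure.ae_ae_comm (p := fun (x : Euc ℓ) (b : Euc (ℓ - k)) => x ∈ e.box A Z →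
      x + e.inN b ∈ e.box A Z → u' (x + e.inN b) = u' x) hms).2 (Eventually.of_forall htr)
  have hwu : u' =ᵐ[volume.restrict (e.box A Z)] fun x => w (e.tan x) := by
    rw [EventuallyEq, ae_restrict_iff' hO.measurableSet]
    filter_upwards [hae] with x hx hxO
    have e1 : w (e.tan x) = ∫ b, η (b + e.nor x) • u' (e.inT (e.tan x) + e.inN (b + e.nor x)) :=
      (integral_add_right_eq_self (fun z => η z • u' (e.inT (e.tan x) + e.inN z)) (e.nor x)).symm
    have e2 : ∀ᵐ b, η (b + e.nor x) • u' (e.inT (e.tan x) + e.inN (b + e.nor x)) =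
        η (b + e.nor x) * u' x := by
      filter_upwards [hx] with b hb
      have hxb : e.inT (e.tan x) + e.inN (b + e.nor x) = x + e.inN b := by
        conv_rhs => rw [← e.inT_tan_add_inN_nor x]
        rw [map_add]
        abel
      by_cases hz : b + e.nor x ∈ tsupport η
      · rw [hxb, hb hxO ⟨by simpa using hxO.1, by simpa [add_comm] using hη3 hz⟩, smul_eq_mul]
      · rw [image_eq_zero_of_notMem_tsupport hz, zero_smul, zero_mul]
    rw [e1, integral_congr_ae e2, integral_mul_const, integral_add_right_eq_self η (e.nor x), hη4,
      one_mul]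
  have hwv : IsWeakGradient A w v := e.isWeakGradient_average hu' hg h' hη1 hη2 hη3
  refine ⟨w, v, hw, hv, hwv, huu.trans hwu, ?_⟩
  have hb : e.box A Z ⊆ e.box A univ := fun x hx => ⟨hx.1, mem_univ _⟩
  -- Both `g` and the lift of `v` are weak gradients of `u'`, so uniqueness identifies them.
  have h4 : IsWeakGradient (e.box A Z) u' fun x => e.inT (v (e.tan x)) :=
    ((e.isWeakGradient_comp_tan hA hw hv hwv).mono hb).congr_ae hwu.symm EventuallyEq.rfl
  refine h'.ae_eq hO h4 hg fun x hx => ?_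
  obtain ⟨s, hs, hi⟩ := (e.locallyIntegrableOn_comp_tan hA hv).mono_set hb x hx
  exact ⟨s, hs, e.inT.toContinuousLinearMap.integrable_comp hi⟩

end Split

end

/-! ### Comparison of measures and the area formula in graph charts -/

section

/-- Lindelöf's theorem for a local property of open sets. -/
theorem exists_seq_isOpen_cover {X : Type*} [TopologicalSpace X] [SecondCountableTopology X]
    {V : Set X} {P : Set X → Prop} (h0 : P ∅)
    (h : ∀ x ∈ V, ∃ N, IsOpen N ∧ x ∈ N ∧ P N) :
    ∃ N : ℕ → Set X, (∀ i, IsOpen (N i)) ∧ (∀ i, P (N i)) ∧ V ⊆ ⋃ i, N i := by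
  choose! N hNo hxN hP using h
  obtain ⟨t, htV, htc, ht⟩ := TopologicalSpace.countable_cover_nhdsWithin (s := V) (f := N)
    fun x hx => mem_nhdsWithin_of_mem_nhds ((hNo x hx).mem_nhds (hxN x hx))
  rcases t.eq_empty_or_nonempty with rfl | hne
  · refine ⟨fun _ => ∅, fun _ => isOpen_empty, fun _ => h0, ?_⟩
    simpa using ht
  · obtain ⟨f, rfl⟩ := htc.exists_eq_range hne
    refine ⟨fun i => N (f i), fun i => hNo _ (htV (mem_range_self i)),
      fun i => hP _ (htV (mem_range_self i)), ?_⟩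
    simpa using ht

/-- Two measures that agree locally up to factors arbitrarily close to `1` are equal. -/
theorem measure_eq_of_local_ratio {X : Type*} [TopologicalSpace X] [SecondCountableTopology X]
    [MeasurableSpace X] [OpensMeasurableSpace X] {ν₁ ν₂ : Measure X} {V : Set X}
    (hV : MeasurableSet V)
    (h : ∀ η : NNReal, 1 < η → ∀ x ∈ V, ∃ N ∈ 𝓝 x, ∀ A ⊆ N ∩ V, MeasurableSet A →
      ν₁ A ≤ η * ν₂ A ∧ ν₂ A ≤ η * ν₁ A) : ν₁.restrict V = ν₂.restrict V := by
  -- Cutting `A` into countably many disjoint pieces, each in one of the neighbourhoods, makes the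
  -- estimate global with the same factor `η`; then `η` tends to `1`.
  have key : ∀ η : NNReal, 1 < η → ∀ A ⊆ V, MeasurableSet A →
      ν₁ A ≤ η * ν₂ A ∧ ν₂ A ≤ η * ν₁ A := by
    intro η hη A hAV hA
    obtain ⟨N, hNo, hNP, hN⟩ := exists_seq_isOpen_cover (V := V)
      (P := fun N => ∀ A ⊆ N ∩ V, MeasurableSet A → ν₁ A ≤ η * ν₂ A ∧ ν₂ A ≤ η * ν₁ A)
      (fun A hA _ => by
        rw [empty_inter, subset_empty_iff] at hA
        simp [hA])
      (fun x hx => by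
        obtain ⟨N, hN, hNA⟩ := h η hη x hx
        obtain ⟨O, hON, hO, hxO⟩ := mem_nhds_iff.1 hN
        exact ⟨O, hO, hxO, fun A hA => hNA A (hA.trans (inter_subset_inter_left _ hON))⟩)
    have hAu : A = ⋃ i, A ∩ disjointed N i := by
      rw [← inter_iUnion, iUnion_disjointed, inter_eq_left.2 (hAV.trans hN)]
    have hm : ∀ i, MeasurableSet (A ∩ disjointed N i) := fun i =>
      hA.inter (MeasurableSet.disjointed (fun i => (hNo i).measurableSet) i)
    have hd : Pairwise (Function.onFun Disjoint fun i => A ∩ disjointed N i) := fun i j hij =>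
      ((disjoint_disjointed N) hij).mono inter_subset_right inter_subset_right
    have hs : ∀ i, A ∩ disjointed N i ⊆ N i ∩ V := fun i x hx =>
      ⟨disjointed_subset N i hx.2, hAV hx.1⟩
    rw [hAu, measure_iUnion hd hm, measure_iUnion hd hm, ← ENNReal.tsum_mul_left,
      ← ENNReal.tsum_mul_left]
    exact ⟨ENNReal.tsum_le_tsum fun i => (hNP i _ (hs i) (hm i)).1,
      ENNReal.tsum_le_tsum fun i => (hNP i _ (hs i) (hm i)).2⟩
  have hlim : ∀ {a b : ℝ≥0∞}, (∀ η : NNReal, 1 < η → a ≤ η * b) → a ≤ b := by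
    intro a b hab
    have ht : Tendsto (fun η : NNReal => (η : ℝ≥0∞) * b) (𝓝[>] 1) (𝓝 ((1 : NNReal) * b)) := by
      refine ENNReal.Tendsto.mul_const ?_ (Or.inl (by simp))
      exact (ENNReal.tendsto_coe.2 tendsto_id).mono_left nhdsWithin_le_nhds
    rw [ENNReal.coe_one, one_mul] at ht
    refine ge_of_tendsto ht ?_
    filter_upwards [self_mem_nhdsWithin] with η hη
    exact hab η hη
  ext A hA
  rw [Measure.restrict_apply hA, Measure.restrict_apply hA]
  exact le_antisymm (hlim fun η hη => (key η hη _ inter_subset_right (hA.inter hV)).1)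
    (hlim fun η hη => (key η hη _ inter_subset_right (hA.inter hV)).2)

theorem euclideanHausdorffMeasure_image_le {X Y : Type*} [EMetricSpace X] [MeasurableSpace X]
    [BorelSpace X] [EMetricSpace Y] [MeasurableSpace Y] [BorelSpace Y] {f : X → Y} {K : NNReal}
    {s : Set X} (h : LipschitzOnWith K f s) (d : ℕ) :
    μHE[d] (f '' s) ≤ (K : ℝ≥0∞) ^ d * μHE[d] s := by
  rw [Measure.euclideanHausdorffMeasure_def, Measure.euclideanHausdorffMeasure_def,
    Measure.smul_apply, Measure.smul_apply, ENNReal.smul_def, ENNReal.smul_def, smul_eq_mul,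
    smul_eq_mul, mul_left_comm]
  gcongr
  simpa using h.hausdorffMeasure_image_le (d := d) (by positivity)

/-- Through `normDet L = √(det (Lᵀ L))`. -/
theorem continuous_normDet {m n : ℕ} :
    Continuous fun L : Euc m →L[ℝ] Euc n => (L : Euc m →ₗ[ℝ] Euc n).normDet := by
  have h : (fun L : Euc m →L[ℝ] Euc n => (L : Euc m →ₗ[ℝ] Euc n).normDet) =
      fun L => √((ContinuousLinearMap.adjoint L ∘L L).det) := by
    funext L
    have := L.normDet_sq
    rw [← this]
    exact (Real.sqrt_sq (LinearMap.normDet_nonneg _)).symm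
  rw [h]
  refine (ContinuousLinearMap.continuous_det.comp ?_).sqrt
  exact ((ContinuousLinearMap.adjoint (𝕜 := ℝ) (E := Euc m) (F := Euc n)).continuous).clm_comp
    continuous_id

theorem normDet_pos {m n : ℕ} {L : Euc m →L[ℝ] Euc n} (hL : Function.Injective L) :
    0 < (L : Euc m →ₗ[ℝ] Euc n).normDet := by
  refine lt_of_le_of_ne (LinearMap.normDet_nonneg _) (Ne.symm ?_)
  rw [Ne, LinearMap.normDet_eq_zero_iff_ker_ne_bot, not_not, LinearMap.ker_eq_bot]
  exact hL

theorem euclideanHausdorffMeasure_image_linear {m n : ℕ} (L : Euc m →L[ℝ] Euc n) (s : Set (Euc m)) :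
    μHE[m] (L '' s) = ENNReal.ofReal (L : Euc m →ₗ[ℝ] Euc n).normDet * volume s := by
  have := (L : Euc m →ₗ[ℝ] Euc n).euclideanHausdorffMeasure_image_eq_normDet_mul_volume s
  simpa using this

theorem exists_pow_lt_of_one_lt (n : ℕ) {η : NNReal} (hη : 1 < η) :
    ∃ κ : NNReal, 1 < κ ∧ κ ^ n ≤ η := by
  have h : Tendsto (fun κ : NNReal => κ ^ n) (𝓝[>] 1) (𝓝 1) := by
    have := ((continuous_pow n).tendsto (1 : NNReal)).mono_left
      (nhdsWithin_le_nhds (s := Ioi 1))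
    rwa [one_pow] at this
  obtain ⟨κ, hκ, hκ1⟩ := ((h.eventually (eventually_lt_nhds hη)).and self_mem_nhdsWithin).exists
  exact ⟨κ, hκ1, hκ.le⟩

/-- An injective `C¹` immersion is locally bi-Lipschitz close to its derivative. -/
theorem exists_bilipschitz {m n : ℕ} {γ : Euc m → Euc n} {L : Euc m →L[ℝ] Euc n} {y : Euc m}
    (hγ : HasStrictFDerivAt γ L y) (hL : Function.Injective L) {κ : NNReal} (hκ : 1 < κ) :
    ∃ N ∈ 𝓝 y, ∀ a ∈ N, ∀ b ∈ N, ‖γ a - γ b‖ ≤ κ * ‖L (a - b)‖ ∧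
      ‖L (a - b)‖ ≤ κ * ‖γ a - γ b‖ := by
  obtain ⟨C, hC0, hC⟩ := (L : Euc m →ₗ[ℝ] Euc n).exists_antilipschitzWith
    (LinearMap.ker_eq_bot.2 hL)
  have hκ' : (1 : ℝ) < κ := by exact_mod_cast hκ
  -- With this `δ` both required bounds hold: `1 + δ ≤ κ` and `1 - δ = κ⁻¹`. The antilipschitz
  -- constant `C` of `L` converts an error relative to `‖a - b‖` into one relative to `‖L (a - b)‖`.
  set δ : ℝ := 1 - (κ : ℝ)⁻¹ with hδ
  have hinv : (κ : ℝ)⁻¹ < 1 := inv_lt_one_of_one_lt₀ hκ'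
  have hδ0 : 0 < δ := by linarith
  have hmul : (κ : ℝ) * (κ : ℝ)⁻¹ = 1 := mul_inv_cancel₀ (by positivity)
  have hδκ : 1 + δ ≤ κ := by
    have : 0 ≤ (κ - 1) * (1 - (κ : ℝ)⁻¹) := mul_nonneg (by linarith) (by linarith)
    nlinarith
  have hCpos : (0 : ℝ) < C := by exact_mod_cast hC0
  obtain ⟨N, hN, hA⟩ := hγ.approximates_deriv_on_nhds (c := (δ / C).toNNReal)
    (Or.inr (Real.toNNReal_pos.2 (div_pos hδ0 hCpos)))
  refine ⟨N, hN, fun a ha b hb => ?_⟩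
  have h1 : ‖γ a - γ b - L (a - b)‖ ≤ δ / C * ‖a - b‖ := by
    have := hA a ha b hb
    rwa [Real.coe_toNNReal _ (div_pos hδ0 hCpos).le] at this
  have h2 : ‖a - b‖ ≤ C * ‖L (a - b)‖ := by
    have := hC.le_mul_dist a b
    rw [dist_eq_norm, dist_eq_norm] at this
    simpa using this
  have h3 : ‖γ a - γ b - L (a - b)‖ ≤ δ * ‖L (a - b)‖ := by
    calc _ ≤ δ / C * ‖a - b‖ := h1
      _ ≤ δ / C * (C * ‖L (a - b)‖) := by gcongr
      _ = δ * ‖L (a - b)‖ := by field_simp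
  have h4 : ‖γ a - γ b‖ ≤ ‖γ a - γ b - L (a - b)‖ + ‖L (a - b)‖ := by
    simpa using norm_add_le (γ a - γ b - L (a - b)) (L (a - b))
  have h5 : ‖L (a - b)‖ ≤ ‖γ a - γ b - L (a - b)‖ + ‖γ a - γ b‖ := by
    have := norm_sub_le (γ a - γ b) (γ a - γ b - L (a - b))
    rw [sub_sub_cancel] at this
    linarith
  have hn := norm_nonneg (L (a - b))
  constructor
  · nlinarith
  · have : (κ : ℝ)⁻¹ * ‖L (a - b)‖ ≤ ‖γ a - γ b‖ := by
      have : δ * ‖L (a - b)‖ = ‖L (a - b)‖ - (κ : ℝ)⁻¹ * ‖L (a - b)‖ := by rw [hδ]; ring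
      linarith
    calc ‖L (a - b)‖ = κ * ((κ : ℝ)⁻¹ * ‖L (a - b)‖) := by rw [← mul_assoc, hmul, one_mul]
      _ ≤ κ * ‖γ a - γ b‖ := by gcongr

namespace GraphChart

variable {ℓ k r : ℕ} {M : Set (Euc ℓ)} {p : Euc ℓ} (c : GraphChart k r M p)

theorem continuousOn_γ : ContinuousOn c.γ c.V := c.contDiffOn.continuousOn

/-- No measurability of `M` is assumed. In a chart `M` is relatively closed in an open set, as the
zero set of the continuous function `γ ∘ tan - id`. -/
theorem measurableSet_inter : MeasurableSet (M ∩ c.O) := by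
  have hO' : IsOpen (c.O ∩ c.e.tan ⁻¹' c.V) :=
    c.isOpen_O.inter (c.isOpen_V.preimage c.e.tan.continuous)
  have hc : ContinuousOn (fun x => c.γ (c.e.tan x) - x) (c.O ∩ c.e.tan ⁻¹' c.V) :=
    (c.continuousOn_γ.comp c.e.tan.continuous.continuousOn fun x hx => hx.2).sub continuousOn_id
  have h1 := hc.isOpen_inter_preimage hO' (isOpen_compl_singleton (x := (0 : Euc ℓ)))
  have : M ∩ c.O = (c.O ∩ c.e.tan ⁻¹' c.V) \
      ((c.O ∩ c.e.tan ⁻¹' c.V) ∩ (fun x => c.γ (c.e.tan x) - x) ⁻¹' {0}ᶜ) := by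
    ext x
    constructor
    · intro hx
      refine ⟨⟨hx.2, c.tan_mem x hx⟩, fun h => h.2 ?_⟩
      simp [c.γ_tan x hx]
    · rintro ⟨hx, h⟩
      have h2 : c.γ (c.e.tan x) = x := by
        by_contra hne
        exact h ⟨hx, fun h0 => hne (sub_eq_zero.1 h0)⟩
      rw [← h2]
      exact c.γ_mem _ hx.2
  rw [this]
  exact hO'.measurableSet.diff h1.measurableSet

/-- The area density of the parametrization. -/
noncomputable def dens (y : Euc k) : ℝ := (fderiv ℝ c.γ y : Euc k →ₗ[ℝ] Euc ℓ).normDet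

theorem continuousOn_dens (hr : 1 ≤ r) : ContinuousOn c.dens c.V :=
  continuous_normDet.comp_continuousOn (c.contDiffOn_fderiv (m := 0) (by omega)).continuousOn

theorem dens_pos (hr : 1 ≤ r) {y : Euc k} (hy : y ∈ c.V) : 0 < c.dens y :=
  normDet_pos (c.fderiv_injective hr hy)

/-- The area formula for a graph chart. -/
theorem map_tan_surf (hr : 1 ≤ r) : Measure.map c.e.tan (surf k (M ∩ c.O)) =
    (volume.restrict c.V).withDensity fun y => ENNReal.ofReal (c.dens y) := by
  set ν₁ := Measure.map c.e.tan (surf k (M ∩ c.O))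
  set ν₂ := (volume.restrict c.V).withDensity fun y => ENNReal.ofReal (c.dens y)
  have h1 : ∀ A, MeasurableSet A → A ⊆ c.V → ν₁ A = μHE[k] (c.γ '' A) := by
    intro A hA hAV
    rw [Measure.map_apply c.e.tan.continuous.measurable hA,
      Measure.restrict_apply (c.e.tan.continuous.measurable hA)]
    congr 1
    ext q
    constructor
    · rintro ⟨h, hq⟩
      exact ⟨c.e.tan q, h, c.γ_tan q hq⟩
    · rintro ⟨y, hy, rfl⟩
      exact ⟨by rw [mem_preimage, c.tan_γ y (hAV hy)]; exact hy, c.γ_mem y (hAV hy)⟩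
  have h2 : ∀ A, MeasurableSet A → A ⊆ c.V →
      ν₂ A = ∫⁻ y in A, ENNReal.ofReal (c.dens y) := by
    intro A hA hAV
    rw [withDensity_apply _ hA, Measure.restrict_restrict hA, inter_eq_left.2 hAV]
  have key : ν₁.restrict c.V = ν₂.restrict c.V := by
    refine measure_eq_of_local_ratio c.isOpen_V.measurableSet fun η hη y hy => ?_
    -- Replacing `γ` by its derivative at `y` costs `κ^k` in `k`-dimensional Hausdorff measure, and
    -- freezing the density at `y` costs one more factor `κ`.
    obtain ⟨κ, hκ, hκη⟩ := exists_pow_lt_of_one_lt (k + 1) hη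
    set L := fderiv ℝ c.γ y with hLdef
    have hL := c.fderiv_injective hr hy
    have hst : HasStrictFDerivAt c.γ L y :=
      (c.contDiffOn.contDiffAt (c.isOpen_V.mem_nhds hy)).hasStrictFDerivAt
        (by exact_mod_cast (by omega : r ≠ 0))
    obtain ⟨N, hN, hb⟩ := exists_bilipschitz hst hL hκ
    have hdL : 0 < c.dens y := c.dens_pos hr hy
    have hκ' : (1 : ℝ) < κ := by exact_mod_cast hκ
    have hdc : ContinuousAt c.dens y := (c.continuousOn_dens hr).continuousAt (c.isOpen_V.mem_nhds hy)
    have hd : ∀ᶠ z in 𝓝 y, c.dens y ≤ κ * c.dens z ∧ c.dens z ≤ κ * c.dens y := by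
      refine ((continuousAt_const.mul hdc).eventually_const_lt (u := c.dens y) ?_).and
        (hdc.eventually_lt_const (u := κ * c.dens y) ?_) |>.mono fun z hz => ⟨hz.1.le, hz.2.le⟩
      · show c.dens y < κ * c.dens y
        nlinarith
      · nlinarith
    refine ⟨N ∩ {z | c.dens y ≤ κ * c.dens z ∧ c.dens z ≤ κ * c.dens y},
      inter_mem hN hd, fun A hA hAm => ?_⟩
    have hAV : A ⊆ c.V := fun z hz => (hA hz).2
    have hAN : A ⊆ N := fun z hz => (hA hz).1.1
    have hAd : ∀ z ∈ A, c.dens y ≤ κ * c.dens z ∧ c.dens z ≤ κ * c.dens y :=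
      fun z hz => (hA hz).1.2
    have hvol : μHE[k] (L '' A) = ENNReal.ofReal (c.dens y) * volume A :=
      euclideanHausdorffMeasure_image_linear L A
    have e1 : μHE[k] (c.γ '' A) ≤ (κ : ℝ≥0∞) ^ k * μHE[k] (L '' A) := by
      have hinj : ∀ z, Function.invFun L (L z) = z := Function.leftInverse_invFun hL
      have : c.γ '' A = (fun w => c.γ (Function.invFun L w)) '' (L '' A) := by
        rw [image_image]
        simp_rw [hinj]
      rw [this]
      refine euclideanHausdorffMeasure_image_le (LipschitzOnWith.of_dist_le_mul ?_) k
      rintro _ ⟨a, ha, rfl⟩ _ ⟨b, hb', rfl⟩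
      rw [hinj, hinj, dist_eq_norm, dist_eq_norm, ← map_sub]
      exact (hb a (hAN ha) b (hAN hb')).1
    have e2 : μHE[k] (L '' A) ≤ (κ : ℝ≥0∞) ^ k * μHE[k] (c.γ '' A) := by
      have : L '' A = (fun q => L (c.e.tan q)) '' (c.γ '' A) := by
        rw [image_image]
        exact image_congr fun z hz => by rw [c.tan_γ z (hAV hz)]
      rw [this]
      refine euclideanHausdorffMeasure_image_le (LipschitzOnWith.of_dist_le_mul ?_) k
      rintro _ ⟨a, ha, rfl⟩ _ ⟨b, hb', rfl⟩
      rw [c.tan_γ a (hAV ha), c.tan_γ b (hAV hb'), dist_eq_norm, dist_eq_norm, ← map_sub]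
      exact (hb a (hAN ha) b (hAN hb')).2
    have hof : ∀ {s t : ℝ}, s ≤ κ * t → ENNReal.ofReal s ≤ κ * ENNReal.ofReal t := by
      intro s t h
      calc ENNReal.ofReal s ≤ ENNReal.ofReal (κ * t) := ENNReal.ofReal_le_ofReal h
        _ = κ * ENNReal.ofReal t := by
          rw [ENNReal.ofReal_mul κ.coe_nonneg, ENNReal.ofReal_coe_nnreal]
    have e3 : ENNReal.ofReal (c.dens y) * volume A ≤ κ * ∫⁻ z in A, ENNReal.ofReal (c.dens z) := by
      rw [← setLIntegral_const, ← lintegral_const_mul' _ _ ENNReal.coe_ne_top]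
      exact setLIntegral_mono' hAm fun z hz => hof (hAd z hz).1
    have e4 : ∫⁻ z in A, ENNReal.ofReal (c.dens z) ≤
        κ * (ENNReal.ofReal (c.dens y) * volume A) := by
      rw [← setLIntegral_const, ← lintegral_const_mul' _ _ ENNReal.coe_ne_top]
      exact setLIntegral_mono' hAm fun z hz => hof (hAd z hz).2
    have hκη' : (κ : ℝ≥0∞) ^ (k + 1) ≤ η := by exact_mod_cast hκη
    rw [h1 A hAm hAV, h2 A hAm hAV]
    rw [hvol] at e1 e2
    constructor
    · calc _ ≤ (κ : ℝ≥0∞) ^ k * (κ * ∫⁻ z in A, ENNReal.ofReal (c.dens z)) := e1.trans (by gcongr)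
        _ = (κ : ℝ≥0∞) ^ (k + 1) * ∫⁻ z in A, ENNReal.ofReal (c.dens z) := by
          rw [pow_succ, mul_assoc]
        _ ≤ _ := by gcongr
    · calc _ ≤ κ * ((κ : ℝ≥0∞) ^ k * μHE[k] (c.γ '' A)) := e4.trans (by gcongr)
        _ = (κ : ℝ≥0∞) ^ (k + 1) * μHE[k] (c.γ '' A) := by rw [pow_succ', mul_assoc]
        _ ≤ _ := by gcongr
  have hν1 : ν₁.restrict c.V = ν₁ := by
    refine Measure.restrict_eq_self_of_ae_mem ?_
    refine (ae_map_iff (p := fun y => y ∈ c.V) c.e.tan.continuous.measurable.aemeasurable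
      c.isOpen_V.measurableSet).2 ?_
    filter_upwards [ae_restrict_mem c.measurableSet_inter] with q hq
    exact c.tan_mem q hq
  have hν2 : ν₂.restrict c.V = ν₂ := by
    rw [restrict_withDensity c.isOpen_V.measurableSet, Measure.restrict_restrict_of_subset le_rfl]
  rw [← hν1, key, hν2]

end GraphChart

end

/-! ### Fibre charts of the normal projection -/

section

namespace Split

variable {ℓ k : ℕ} (e : Split ℓ k)

theorem inner_eq (x y : Euc ℓ) :
    inner ℝ x y = inner ℝ (e.tan x) (e.tan y) + inner ℝ (e.nor x) (e.nor y) := by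
  conv_lhs => rw [← e.inT_tan_add_inN_nor x]
  rw [inner_add_left, e.inner_inT, e.inner_inN]

theorem volume_eq_lintegral {S : Set (Euc ℓ)} (hS : MeasurableSet S) :
    volume S = ∫⁻ y : Euc k, volume {z : Euc (ℓ - k) | e.inT y + e.inN z ∈ S} := by
  rw [← e.measurePreserving.measure_preimage hS.nullMeasurableSet,
    Measure.prod_apply (e.measurableEquiv.measurable hS)]
  simp only [preimage, measurableEquiv_apply, mem_ofPred_eq]

theorem measurable_volume_slice {S : Set (Euc ℓ)} (hS : MeasurableSet S) :
    Measurable fun y : Euc k => volume {z : Euc (ℓ - k) | e.inT y + e.inN z ∈ S} := by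
  have := measurable_measure_prodMk_left (ν := (volume : Measure (Euc (ℓ - k))))
    (e.measurableEquiv.measurable hS)
  simpa only [preimage, measurableEquiv_apply, mem_ofPred_eq] using this

end Split

namespace GraphChart

variable {ℓ k r : ℕ} {M : Set (Euc ℓ)} {p : Euc ℓ} (c : GraphChart k r M p)

/-- The parametrization of the normal space at `γ y` by the normal coordinate. -/
noncomputable def normalLift (y : Euc k) : Euc (ℓ - k) →L[ℝ] Euc ℓ :=
  c.e.inN.toContinuousLinearMap - c.e.inT.toContinuousLinearMap ∘L
    ContinuousLinearMap.adjoint (c.e.nor ∘L fderiv ℝ c.γ y)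

/-- Orthogonality of `n` to `Dγ w`, whose tangential coordinate is `w`, reads `⟨tan n, w⟩ + ⟨nor n,
nor (Dγ w)⟩ = 0`. So the normal coordinate of `n` determines its tangential one. -/
theorem normalLift_nor (hr : 1 ≤ r) {y : Euc k} (hy : y ∈ c.V) {n : Euc ℓ}
    (hn : n ∈ (tangentSubspace M (c.γ y))ᗮ) : c.normalLift y (c.e.nor n) = n := by
  have h1 : c.e.tan n = -ContinuousLinearMap.adjoint (c.e.nor ∘L fderiv ℝ c.γ y) (c.e.nor n) := by
    refine ext_inner_right ℝ fun w => ?_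
    rw [inner_neg_left, ContinuousLinearMap.adjoint_inner_left, eq_neg_iff_add_eq_zero]
    have h2 := Submodule.inner_left_of_mem_orthogonal (c.fderiv_mem_tangent hy w) hn
    rw [c.e.inner_eq, c.tan_fderiv hr hy] at h2
    exact h2
  conv_rhs => rw [← c.e.inT_tan_add_inN_nor n, h1]
  simp only [normalLift, sub_apply, ContinuousLinearMap.comp_apply, map_neg]
  exact sub_eq_neg_add _ _

theorem continuousOn_normalLift (hr : 1 ≤ r) : ContinuousOn c.normalLift c.V := by
  have h1 : ContinuousOn (fderiv ℝ c.γ) c.V :=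
    (c.contDiffOn_fderiv (m := 0) (by omega)).continuousOn
  exact continuousOn_const.sub (continuousOn_const.clm_comp
    ((ContinuousLinearMap.adjoint (𝕜 := ℝ)).continuous.comp_continuousOn
      (continuousOn_const.clm_comp h1)))

/-- The volume density of `normalLift`. -/
noncomputable def normalDens (y : Euc k) : ℝ :=
  (c.normalLift y : Euc (ℓ - k) →ₗ[ℝ] Euc ℓ).normDet

theorem continuousOn_normalDens (hr : 1 ≤ r) : ContinuousOn c.normalDens c.V :=
  continuous_normDet.comp_continuousOn (c.continuousOn_normalLift hr)

/-- At the base point the coordinates are adapted to the tangent space, so this density and, by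
`dens_base`, the area density both equal `1`. Close to the base point both can therefore be ignored
up to a factor near `1`, which spares an explicit computation of their product. -/
theorem normalDens_base (hr : 1 ≤ r) : c.normalDens (c.e.tan p) = 1 := by
  have h1 : c.normalLift (c.e.tan p) = c.e.inN.toContinuousLinearMap := by
    have h2 : c.e.nor ∘L fderiv ℝ c.γ (c.e.tan p) = 0 := by
      ext1 w
      rw [ContinuousLinearMap.comp_apply, c.fderiv_base hr, Split.nor_inT, zero_apply]
    rw [normalLift, h2, map_zero, ContinuousLinearMap.comp_zero, sub_zero]
  rw [normalDens, h1]
  exact c.e.inN.normDet_eq_one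

theorem dens_base (hr : 1 ≤ r) : c.dens (c.e.tan p) = 1 := by
  have h1 : fderiv ℝ c.γ (c.e.tan p) = c.e.inT.toContinuousLinearMap := by
    ext1 w
    exact c.fderiv_base hr w
  rw [dens, h1]
  exact c.e.inT.normDet_eq_one

end GraphChart

/-- Coordinates near `x₀` in which `φ` is the projection to the tangential coordinate. -/
structure FiberChart {ℓ : ℕ} (k r : ℕ) (M U : Set (Euc ℓ)) (φ : Euc ℓ → Euc ℓ) (x₀ : Euc ℓ) where
  /-- The chart of the submanifold at `φ x₀`. -/
  c : GraphChart k r M (φ x₀)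
  /-- The coordinate map. -/
  F : OpenPartialHomeomorph (Euc ℓ) (Euc ℓ)
  /-- The range of the tangential coordinate. -/
  A : Set (Euc k)
  /-- The range of the normal coordinate. -/
  Z : Set (Euc (ℓ - k))
  isOpen_A : IsOpen A
  isOpen_Z : IsOpen Z
  convex_Z : Convex ℝ Z
  mem : x₀ ∈ F.source
  source_subset : F.source ⊆ U
  proj_mem : ∀ x ∈ F.source, φ x ∈ M ∩ c.O
  apply : ∀ x, F x = c.e.inT (c.e.tan (φ x)) + c.e.inN (c.e.nor x)
  contDiffOn : ContDiffOn ℝ 1 F F.source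
  contDiffOn_symm : ContDiffOn ℝ 1 F.symm F.target
  target : F.target = c.e.box A Z

namespace IsNormalProjection

variable {ℓ k r : ℕ} {M U : Set (Euc ℓ)} {φ : Euc ℓ → Euc ℓ} (H : IsNormalProjection k r M U φ)
include H

theorem hasFDerivAt_fiberMap {x : Euc ℓ} (hx : x ∈ U) (e : Split ℓ k) :
    HasFDerivAt (fun x => e.inT (e.tan (φ x)) + e.inN (e.nor x))
      (e.inT.toContinuousLinearMap ∘L e.tan ∘L fderiv ℝ φ x +
        e.inN.toContinuousLinearMap ∘L e.nor) x :=
  ((e.inT.toContinuousLinearMap ∘L e.tan).hasFDerivAt.comp x (H.hasFDerivAt hx)).add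
    (e.inN.toContinuousLinearMap ∘L e.nor).hasFDerivAt

/-- At the base point of the chart the fibre coordinates have derivative exactly `regDeriv φ 0 x`.
This gives invertibility and identifies the Jacobian there with `J₀ x`. -/
theorem fiberMap_fderiv_eq_regDeriv {x : Euc ℓ} (hx : x ∈ U) (c : GraphChart k r M (φ x)) :
    c.e.inT.toContinuousLinearMap ∘L c.e.tan ∘L fderiv ℝ φ x +
      c.e.inN.toContinuousLinearMap ∘L c.e.nor = regDeriv φ 0 x := by
  ext1 v
  have hid : ∀ t ∈ tangentSubspace M (φ x), c.e.inT (c.e.tan t) = t := by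
    intro t ht
    conv_rhs => rw [← c.e.inT_tan_add_inN_nor t, (c.adapted t).1 ht, map_zero, add_zero]
  obtain ⟨t, ht, n, hn, rfl⟩ := exists_add_eq (tangentSubspace M (φ x)) v
  have e1 : c.e.nor t = 0 := (c.adapted t).1 ht
  have e2 : c.e.tan n = 0 := (Split.mem_orthogonal_iff c.adapted n).1 hn
  have e3 : c.e.inN (c.e.nor n) = n := by
    conv_rhs => rw [← c.e.inT_tan_add_inN_nor n, e2, map_zero, zero_add]
  have e4 : fderiv ℝ φ x n = 0 := (H.fderiv_eq_zero_iff hx n).2 hn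
  rw [map_add (regDeriv φ 0 x), H.regDeriv_apply_tangent hx 0 ht, H.regDeriv_apply_normal hx 0 hn]
  change c.e.inT (c.e.tan (fderiv ℝ φ x (t + n))) + c.e.inN (c.e.nor (t + n)) = _
  rw [map_add, e4, add_zero, hid _ (H.fderiv_mem hx t), map_add, e1, zero_add, e3]
  simp

theorem exists_fiberChart {x₀ : Euc ℓ} (hx : x₀ ∈ U) {S : Set (Euc ℓ)} (hS : S ∈ 𝓝 x₀) :
    ∃ f : FiberChart k r M U φ x₀, f.F.source ⊆ S := by
  obtain ⟨c⟩ := H.exists_chart hx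
  obtain ⟨B, hB⟩ := exists_equiv_of_injective (H.regDeriv_injective hx (ε := 0) (by simp))
  have hcd : ContDiffAt ℝ (1 : ℕ) (fun x => c.e.inT (c.e.tan (φ x)) + c.e.inN (c.e.nor x)) x₀ := by
    have h1 : ContDiffAt ℝ (1 : ℕ) φ x₀ := by exact_mod_cast H.contDiffAt hx
    exact (c.e.inT.contDiff.contDiffAt.comp x₀ (c.e.tan.contDiff.contDiffAt.comp x₀ h1)).add
      (c.e.inN.contDiff.comp c.e.nor.contDiff).contDiffAt
  have hder := H.hasFDerivAt_fiberMap hx c.e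
  rw [H.fiberMap_fderiv_eq_regDeriv hx c, ← hB] at hder
  obtain ⟨h, hxs, hsS, hh, h1, h2⟩ := exists_localDiffeo le_rfl hcd hder
    (inter_mem hS (H.eventually_mem_chart hx c))
  have hpt : Tendsto (fun w : Euc k × Euc (ℓ - k) => c.e.inT w.1 + c.e.inN w.2)
      (𝓝 (c.e.tan (φ x₀), c.e.nor x₀)) (𝓝 (h x₀)) := by
    rw [hh]
    exact ((c.e.inT.continuous.comp continuous_fst).add
      (c.e.inN.continuous.comp continuous_snd)).continuousAt
  have hpre := hpt (h.open_target.mem_nhds (h.map_source hxs))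
  rw [mem_map, nhds_prod_eq, (Metric.nhds_basis_ball.prod_same_index Metric.nhds_basis_ball
    (fun {i j} hi hj => ⟨min i j, lt_min hi hj, Metric.ball_subset_ball (min_le_left _ _),
      Metric.ball_subset_ball (min_le_right _ _)⟩)).mem_iff] at hpre
  obtain ⟨ρ, hρ, hρs⟩ := hpre
  -- The target is shrunk to a product of balls: slices in the normal direction must be convex for
  -- the translation argument.
  set A := Metric.ball (c.e.tan (φ x₀)) ρ
  set Z := Metric.ball (c.e.nor x₀) ρ
  have hbo : IsOpen (c.e.box A Z) := c.e.isOpen_box Metric.isOpen_ball Metric.isOpen_ball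
  have hbt : c.e.box A Z ⊆ h.target := by
    intro x hx
    rw [← c.e.inT_tan_add_inN_nor x]
    exact hρs (show (c.e.tan x, c.e.nor x) ∈ A ×ˢ Z from hx)
  set F := (h.symm.restrOpen (c.e.box A Z) hbo).symm with hF
  have hFt : F.target = c.e.box A Z := by
    rw [hF, OpenPartialHomeomorph.symm_target, OpenPartialHomeomorph.restrOpen_source]
    exact inter_eq_right.2 hbt
  have hFc : ⇑F = h := by
    rw [hF]
    rfl
  have hFsc : ⇑F.symm = h.symm := by
    rw [hF]
    rfl
  have hFs : F.source = h.source ∩ h ⁻¹' c.e.box A Z := by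
    rw [hF, OpenPartialHomeomorph.symm_source]
    ext x
    simp [OpenPartialHomeomorph.restrOpen]
  have hsub : F.source ⊆ h.source := by
    rw [hFs]
    exact inter_subset_left
  refine ⟨⟨c, F, A, Z, Metric.isOpen_ball, Metric.isOpen_ball, convex_ball _ _, ?_,
    fun x hx => (hsS (hsub hx)).2.1, fun x hx => (hsS (hsub hx)).2.2, fun x => ?_, ?_, ?_, hFt⟩,
    fun x hx => (hsS (hsub hx)).1⟩
  · rw [hFs]
    refine ⟨hxs, ?_⟩
    rw [mem_preimage, hh, c.e.mem_box]
    exact ⟨Metric.mem_ball_self hρ, Metric.mem_ball_self hρ⟩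
  · rw [hFc, hh]
  · rw [hFc, hh]
    exact_mod_cast h1.mono hsub
  · rw [hFsc, hFt]
    exact_mod_cast h2.mono hbt

theorem M_inter_eq : M ∩ U = {x ∈ U | φ x = x} := by
  ext x
  constructor
  · exact fun h => ⟨h.2, H.tub.fixed x h⟩
  · rintro ⟨h1, h2⟩
    exact ⟨h2 ▸ H.mem_M h1, h1⟩

/-- `M ∩ U` is the set of fixed points of `φ` in `U`, hence relatively closed there. -/
theorem measurableSet_M_inter : MeasurableSet (M ∩ U) := by
  have hc : ContinuousOn (fun x => φ x - x) U := H.continuousOn.sub continuousOn_id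
  have h2 := hc.isOpen_inter_preimage H.tub.isOpen (isOpen_compl_singleton (x := (0 : Euc ℓ)))
  have h3 : M ∩ U = U \ (U ∩ (fun x => φ x - x) ⁻¹' {0}ᶜ) := by
    rw [H.M_inter_eq]
    ext x
    simp [sub_eq_zero]
  rw [h3]
  exact H.tub.isOpen.measurableSet.diff h2.measurableSet

theorem measurableSet_inter_preimage {S : Set (Euc ℓ)} (hS : MeasurableSet S) :
    MeasurableSet (U ∩ φ ⁻¹' S) := by
  classical
  have h1 : Measurable (U.piecewise φ 0) :=
    ContinuousOn.measurable_piecewise H.continuousOn continuousOn_const H.tub.isOpen.measurableSet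
  have h2 : U ∩ φ ⁻¹' S = U ∩ U.piecewise φ 0 ⁻¹' S := by
    ext x
    constructor <;>
    · rintro ⟨hx, h⟩
      refine ⟨hx, ?_⟩
      simpa [hx] using h
  rw [h2]
  exact H.tub.isOpen.measurableSet.inter (h1 hS)

end IsNormalProjection

namespace FiberChart

variable {ℓ k r : ℕ} {M U : Set (Euc ℓ)} {φ : Euc ℓ → Euc ℓ} {x₀ : Euc ℓ}
  (f : FiberChart k r M U φ x₀)

theorem tan_F (x : Euc ℓ) : f.c.e.tan (f.F x) = f.c.e.tan (φ x) := by
  rw [f.apply]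
  simp

theorem nor_F (x : Euc ℓ) : f.c.e.nor (f.F x) = f.c.e.nor x := by
  rw [f.apply]
  simp

theorem tan_proj_mem {x : Euc ℓ} (hx : x ∈ f.F.source) : f.c.e.tan (φ x) ∈ f.A := by
  have h := f.F.map_source hx
  rw [f.target] at h
  rw [← f.tan_F]
  exact h.1

theorem nor_mem {x : Euc ℓ} (hx : x ∈ f.F.source) : f.c.e.nor x ∈ f.Z := by
  have h := f.F.map_source hx
  rw [f.target] at h
  rw [← f.nor_F]
  exact h.2

theorem γ_tan_proj {x : Euc ℓ} (hx : x ∈ f.F.source) : f.c.γ (f.c.e.tan (φ x)) = φ x :=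
  f.c.γ_tan _ (f.proj_mem x hx)

theorem A_subset : f.A ⊆ f.c.V := by
  intro y hy
  have h : f.c.e.inT y + f.c.e.inN (f.c.e.nor x₀) ∈ f.F.target := by
    rw [f.target, f.c.e.mem_box]
    exact ⟨hy, f.nor_mem f.mem⟩
  have h1 := f.c.tan_mem _ (f.proj_mem _ (f.F.map_target h))
  rw [← f.tan_F, f.F.right_inv h] at h1
  simpa using h1

/-- Points over `γ y` differ from it by normal vectors, which `normalLift` reconstructs from their
normal coordinates. The fibre is thus an affine image of a slice of the box, and its Hausdorff
measure is a multiple of the Lebesgue measure of the slice. -/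
theorem fiber_eq (H : IsNormalProjection k r M U φ) {B : Set (Euc ℓ)} (hB : B ⊆ f.F.source)
    {y : Euc k} (hy : y ∈ f.A) :
    B ∩ φ ⁻¹' {f.c.γ y} =
      (fun z => f.c.γ y + f.c.normalLift y (z - f.c.e.nor (f.c.γ y))) ''
        {z | f.c.e.inT y + f.c.e.inN z ∈ f.F '' B} := by
  have key : ∀ x ∈ B, φ x = f.c.γ y →
      f.c.γ y + f.c.normalLift y (f.c.e.nor x - f.c.e.nor (f.c.γ y)) = x := by
    intro x hx h
    have hn := H.tub.normal x (f.source_subset (hB hx))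
    rw [h] at hn
    rw [← map_sub, f.c.normalLift_nor H.one_le (f.A_subset hy) hn, add_sub_cancel]
  ext x
  constructor
  · rintro ⟨hx, hxy⟩
    have hxy' : φ x = f.c.γ y := hxy
    refine ⟨f.c.e.nor x, ⟨x, hx, ?_⟩, key x hx hxy'⟩
    rw [f.apply, hxy', f.c.tan_γ y (f.A_subset hy)]
  · rintro ⟨z, ⟨x', hx', hxz⟩, rfl⟩
    have h1 : f.c.e.tan (φ x') = y := by
      rw [← f.tan_F, hxz]
      simp
    have h2 : f.c.e.nor x' = z := by
      rw [← f.nor_F, hxz]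
      simp
    have h3 : φ x' = f.c.γ y := by rw [← h1, f.γ_tan_proj (hB hx')]
    have h4 := key x' hx' h3
    rw [h2] at h4
    simp only [h4]
    exact ⟨hx', h3⟩

theorem measure_fiber (H : IsNormalProjection k r M U φ) {B : Set (Euc ℓ)} (hB : B ⊆ f.F.source)
    {y : Euc k} (hy : y ∈ f.A) :
    μHE[ℓ - k] (B ∩ φ ⁻¹' {f.c.γ y}) = ENNReal.ofReal (f.c.normalDens y) *
      volume {z | f.c.e.inT y + f.c.e.inN z ∈ f.F '' B} := by
  have h1 : (fun z => f.c.γ y + f.c.normalLift y (z - f.c.e.nor (f.c.γ y))) =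
      (fun x => (f.c.γ y - f.c.normalLift y (f.c.e.nor (f.c.γ y))) + x) ∘ f.c.normalLift y := by
    funext z
    simp only [Function.comp_apply, map_sub]
    abel
  rw [f.fiber_eq H hB hy, h1, image_comp,
    Isometry.euclideanHausdorffMeasure_image (isometry_add_left _),
    euclideanHausdorffMeasure_image_linear]
  rfl

theorem fiber_eq_empty {B : Set (Euc ℓ)} (hB : B ⊆ f.F.source) {p : Euc ℓ}
    (hp : ¬(p ∈ M ∩ f.c.O ∧ f.c.e.tan p ∈ f.A)) : B ∩ φ ⁻¹' {p} = ∅ := by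
  rw [eq_empty_iff_forall_notMem]
  rintro x ⟨hx, rfl⟩
  exact hp ⟨f.proj_mem x (hB hx), f.tan_proj_mem (hB hx)⟩

theorem measurableSet_image {B : Set (Euc ℓ)} (hB : B ⊆ f.F.source) (hBm : MeasurableSet B) :
    MeasurableSet (f.F '' B) :=
  hBm.image_of_continuousOn_injOn (f.F.continuousOn.mono hB) (f.F.injOn.mono hB)

open Classical in
theorem measure_fiber_eq_indicator (H : IsNormalProjection k r M U φ) {B : Set (Euc ℓ)}
    (hB : B ⊆ f.F.source) (p : Euc ℓ) :
    μHE[ℓ - k] (B ∩ φ ⁻¹' {p}) = (M ∩ f.c.O).indicator (fun p => f.A.indicator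
      (fun y => ENNReal.ofReal (f.c.normalDens y) *
        volume {z | f.c.e.inT y + f.c.e.inN z ∈ f.F '' B}) (f.c.e.tan p)) p := by
  by_cases hp : p ∈ M ∩ f.c.O
  · rw [indicator_of_mem hp]
    by_cases hA : f.c.e.tan p ∈ f.A
    · rw [indicator_of_mem hA, ← f.measure_fiber H hB hA, f.c.γ_tan p hp]
    · rw [indicator_of_notMem hA, f.fiber_eq_empty hB fun h => hA h.2, measure_empty]
  · rw [indicator_of_notMem hp, f.fiber_eq_empty hB fun h => hp h.1, measure_empty]

theorem measurable_fiberDens (H : IsNormalProjection k r M U φ) {B : Set (Euc ℓ)}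
    (hB : B ⊆ f.F.source) (hBm : MeasurableSet B) :
    Measurable (f.A.indicator (fun y => ENNReal.ofReal (f.c.normalDens y) *
        volume {z | f.c.e.inT y + f.c.e.inN z ∈ f.F '' B})) := by
  classical
  have h1 : Measurable (f.A.piecewise f.c.normalDens 0) :=
    ContinuousOn.measurable_piecewise ((f.c.continuousOn_normalDens H.one_le).mono f.A_subset)
      continuousOn_const f.isOpen_A.measurableSet
  have h2 := (h1.ennreal_ofReal.mul
    (f.c.e.measurable_volume_slice (f.measurableSet_image hB hBm))).indicator
      f.isOpen_A.measurableSet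
  convert h2 using 1
  funext y
  by_cases hy : y ∈ f.A
  · simp [hy]
  · simp [hy]

theorem measurable_measure_fiber (H : IsNormalProjection k r M U φ) {B : Set (Euc ℓ)}
    (hB : B ⊆ f.F.source) (hBm : MeasurableSet B) :
    Measurable fun p => μHE[ℓ - k] (B ∩ φ ⁻¹' {p}) := by
  simp_rw [f.measure_fiber_eq_indicator H hB]
  exact ((f.measurable_fiberDens H hB hBm).comp f.c.e.tan.continuous.measurable).indicator
    f.c.measurableSet_inter

theorem lintegral_measure_fiber (H : IsNormalProjection k r M U φ) {B : Set (Euc ℓ)}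
    (hB : B ⊆ f.F.source) (hBm : MeasurableSet B) :
    ∫⁻ p, μHE[ℓ - k] (B ∩ φ ⁻¹' {p}) ∂(surf k (M ∩ U)) =
      ∫⁻ y in f.A, ENNReal.ofReal (f.c.dens y) * (ENNReal.ofReal (f.c.normalDens y) *
        volume {z | f.c.e.inT y + f.c.e.inN z ∈ f.F '' B}) := by
  have hMU := H.measurableSet_M_inter
  have e1 : ∫⁻ p, μHE[ℓ - k] (B ∩ φ ⁻¹' {p}) ∂(surf k (M ∩ U)) =
      ∫⁻ p, μHE[ℓ - k] (B ∩ φ ⁻¹' {p}) ∂(surf k (M ∩ f.c.O)) := by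
    rw [← lintegral_indicator hMU, ← lintegral_indicator f.c.measurableSet_inter]
    refine lintegral_congr fun p => ?_
    by_cases hp : ∃ x ∈ B, φ x = p
    · obtain ⟨x, hx, rfl⟩ := hp
      rw [indicator_of_mem (show φ x ∈ M ∩ U from ⟨H.mem_M (f.source_subset (hB hx)),
        H.proj_mem (f.source_subset (hB hx))⟩), indicator_of_mem (f.proj_mem x (hB hx))]
    · have h0 : B ∩ φ ⁻¹' {p} = ∅ := by
        rw [eq_empty_iff_forall_notMem]
        rintro x ⟨hx, hxp⟩
        exact hp ⟨x, hx, hxp⟩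
      simp [indicator, h0]
  have hm := f.measurable_fiberDens H hB hBm
  rw [e1]
  have e2 : ∫⁻ p, μHE[ℓ - k] (B ∩ φ ⁻¹' {p}) ∂(surf k (M ∩ f.c.O)) =
      ∫⁻ p, f.A.indicator (fun y => ENNReal.ofReal (f.c.normalDens y) *
        volume {z | f.c.e.inT y + f.c.e.inN z ∈ f.F '' B}) (f.c.e.tan p) ∂(surf k (M ∩ f.c.O)) := by
    refine setLIntegral_congr_fun f.c.measurableSet_inter fun p hp => ?_
    simp only [f.measure_fiber_eq_indicator H hB, indicator_of_mem hp]
  have hdm : AEMeasurable (fun y => ENNReal.ofReal (f.c.dens y)) (volume.restrict f.c.V) :=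
    ((f.c.continuousOn_dens H.one_le).aemeasurable f.c.isOpen_V.measurableSet).ennreal_ofReal
  rw [e2, ← lintegral_map hm f.c.e.tan.continuous.measurable, f.c.map_tan_surf H.one_le,
    lintegral_withDensity_eq_lintegral_mul₀ hdm hm.aemeasurable,
    ← lintegral_indicator f.c.isOpen_V.measurableSet, ← lintegral_indicator f.isOpen_A.measurableSet]
  refine lintegral_congr fun y => ?_
  by_cases hy : y ∈ f.A
  · rw [indicator_of_mem (f.A_subset hy), Pi.mul_apply, indicator_of_mem hy, indicator_of_mem hy]
  · rw [indicator_of_notMem hy]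
    by_cases hV : y ∈ f.c.V
    · rw [indicator_of_mem hV, Pi.mul_apply, indicator_of_notMem hy, mul_zero]
    · rw [indicator_of_notMem hV]

end FiberChart

end

/-! ### The coarea formula and its consequences for normal sections -/

section

/-- The Hausdorff measure on the fibre of `φ` over `p`. -/
noncomputable def fiberMeas {ℓ : ℕ} (k : ℕ) (U : Set (Euc ℓ)) (φ : Euc ℓ → Euc ℓ) (p : Euc ℓ) :
    Measure (Euc ℓ) := μHE[ℓ - k].restrict (U ∩ φ ⁻¹' {p})

theorem fiberMeas_apply {ℓ : ℕ} {k : ℕ} {U : Set (Euc ℓ)} {φ : Euc ℓ → Euc ℓ} {B : Set (Euc ℓ)}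
    (hB : MeasurableSet B) (hBU : B ⊆ U) (p : Euc ℓ) :
    fiberMeas k U φ p B = μHE[ℓ - k] (B ∩ φ ⁻¹' {p}) := by
  rw [fiberMeas, Measure.restrict_apply hB, ← inter_assoc, inter_eq_left.2 hBU]

theorem FiberChart.continuousAt_det {ℓ k r : ℕ} {M U : Set (Euc ℓ)} {φ : Euc ℓ → Euc ℓ}
    {x₀ : Euc ℓ} (f : FiberChart k r M U φ x₀) :
    ContinuousAt (fun x => |(fderiv ℝ f.F x).det|) x₀ :=
  ((ContinuousLinearMap.continuous_det.comp_continuousOn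
    (f.contDiffOn.continuousOn_fderiv_of_isOpen f.F.open_source le_rfl)).abs).continuousAt
      (f.F.open_source.mem_nhds f.mem)

namespace IsNormalProjection

variable {ℓ k r : ℕ} {M U : Set (Euc ℓ)} {φ : Euc ℓ → Euc ℓ} (H : IsNormalProjection k r M U φ)
include H

/-- Holds in each fibre chart by Fubini's theorem; in general `B` is split into countably many
disjoint pieces inside charts. It makes `fiberMeas` a measurable family of measures. -/
theorem measurable_measure_fiber {B : Set (Euc ℓ)} (hBU : B ⊆ U) (hB : MeasurableSet B) :
    Measurable fun p => μHE[ℓ - k] (B ∩ φ ⁻¹' {p}) := by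
  obtain ⟨N, hNo, hNP, hN⟩ := exists_seq_isOpen_cover (V := U)
    (P := fun N => ∀ B ⊆ N, MeasurableSet B → Measurable fun p => μHE[ℓ - k] (B ∩ φ ⁻¹' {p}))
    (fun B hB _ => by
      rw [subset_empty_iff] at hB
      simp [hB])
    (fun x hx => by
      obtain ⟨f, -⟩ := H.exists_fiberChart hx univ_mem
      exact ⟨f.F.source, f.F.open_source, f.mem, fun B hB hBm =>
        f.measurable_measure_fiber H hB hBm⟩)
  have hm : ∀ i, MeasurableSet (B ∩ disjointed N i) := fun i =>
    hB.inter (MeasurableSet.disjointed (fun i => (hNo i).measurableSet) i)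
  have hd : Pairwise (Function.onFun Disjoint fun i => B ∩ disjointed N i) := fun i j hij =>
    ((disjoint_disjointed N) hij).mono inter_subset_right inter_subset_right
  have hBu : B = ⋃ i, B ∩ disjointed N i := by
    rw [← inter_iUnion, iUnion_disjointed, inter_eq_left.2 (hBU.trans hN)]
  have e1 : ∀ p, μHE[ℓ - k] (B ∩ φ ⁻¹' {p}) =
      ∑' i, μHE[ℓ - k] ((B ∩ disjointed N i) ∩ φ ⁻¹' {p}) := by
    intro p
    rw [← fiberMeas_apply hB hBU]
    conv_lhs => rw [hBu]
    rw [measure_iUnion hd hm]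
    refine tsum_congr fun i => ?_
    rw [fiberMeas_apply (hm i) (inter_subset_left.trans hBU)]
  simp_rw [e1]
  exact Measurable.tsum fun i => hNP i _
    (inter_subset_right.trans (disjointed_subset N i)) (hm i)

theorem measurable_fiberMeas : Measurable (fiberMeas k U φ) := by
  refine Measure.measurable_of_measurable_coe _ fun S hS => ?_
  have e1 : ∀ p, fiberMeas k U φ p S = μHE[ℓ - k] ((S ∩ U) ∩ φ ⁻¹' {p}) := by
    intro p
    rw [fiberMeas, Measure.restrict_apply hS, inter_assoc]
  simp_rw [e1]
  exact H.measurable_measure_fiber inter_subset_right (hS.inter H.tub.isOpen.measurableSet)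

theorem fiberMap_fderiv {x₀ : Euc ℓ} (f : FiberChart k r M U φ x₀) {x : Euc ℓ} (hx : x ∈ U) :
    fderiv ℝ f.F x = f.c.e.inT.toContinuousLinearMap ∘L f.c.e.tan ∘L fderiv ℝ φ x +
        f.c.e.inN.toContinuousLinearMap ∘L f.c.e.nor := by
  rw [show ⇑f.F = fun x => f.c.e.inT (f.c.e.tan (φ x)) + f.c.e.inN (f.c.e.nor x) from
    funext f.apply]
  exact (H.hasFDerivAt_fiberMap hx f.c.e).fderiv

theorem abs_det_fiberMap {x₀ : Euc ℓ} (f : FiberChart k r M U φ x₀) :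
    |(fderiv ℝ f.F x₀).det| = J₀ M φ x₀ := by
  have hx := f.source_subset f.mem
  rw [H.fiberMap_fderiv f hx, H.fiberMap_fderiv_eq_regDeriv hx f.c, H.J₀_eq hx]

theorem bind_fiberMeas_apply {B : Set (Euc ℓ)} (hB : MeasurableSet B) (hBU : B ⊆ U) :
    (surf k (M ∩ U)).bind (fiberMeas k U φ) B =
      ∫⁻ p, μHE[ℓ - k] (B ∩ φ ⁻¹' {p}) ∂(surf k (M ∩ U)) := by
  rw [Measure.bind_apply hB H.measurable_fiberMeas.aemeasurable]
  exact lintegral_congr fun p => fiberMeas_apply hB hBU p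

/-- Fubini's theorem in the chart: only slices over points `tan (φ x)` with `x ∈ B` contribute, and
there the area density and the normal density are each within a factor `κ` of `1`. -/
theorem lintegral_fiber_bounds {x₀ : Euc ℓ} (f : FiberChart k r M U φ x₀) {κ : NNReal}
    {B : Set (Euc ℓ)} (hB : MeasurableSet B) (hBs : B ⊆ f.F.source)
    (hd : ∀ x ∈ B, ENNReal.ofReal (f.c.dens (f.c.e.tan (φ x))) ≤ κ ∧
      1 ≤ κ * ENNReal.ofReal (f.c.dens (f.c.e.tan (φ x))))
    (hn : ∀ x ∈ B, ENNReal.ofReal (f.c.normalDens (f.c.e.tan (φ x))) ≤ κ ∧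
      1 ≤ κ * ENNReal.ofReal (f.c.normalDens (f.c.e.tan (φ x)))) :
    ∫⁻ p, μHE[ℓ - k] (B ∩ φ ⁻¹' {p}) ∂(surf k (M ∩ U)) ≤ κ ^ 2 * volume (f.F '' B) ∧
    volume (f.F '' B) ≤ κ ^ 2 * ∫⁻ p, μHE[ℓ - k] (B ∩ φ ⁻¹' {p}) ∂(surf k (M ∩ U)) := by
  rw [f.lintegral_measure_fiber H hBs hB, f.c.e.volume_eq_lintegral (f.measurableSet_image hBs hB)]
  have hsl : ∀ y, {z | f.c.e.inT y + f.c.e.inN z ∈ f.F '' B} = ∅ ∨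
      ∃ x ∈ B, f.c.e.tan (φ x) = y := by
    intro y
    refine or_iff_not_imp_left.2 fun h => ?_
    obtain ⟨z, x, hx, hxz⟩ := nonempty_iff_ne_empty.2 h
    refine ⟨x, hx, ?_⟩
    rw [← f.tan_F, hxz]
    simp
  have hout : ∫⁻ y : Euc k, volume {z | f.c.e.inT y + f.c.e.inN z ∈ f.F '' B} =
      ∫⁻ y in f.A, volume {z | f.c.e.inT y + f.c.e.inN z ∈ f.F '' B} := by
    rw [← lintegral_indicator f.isOpen_A.measurableSet]
    refine lintegral_congr fun y => ?_
    by_cases hy : y ∈ f.A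
    · rw [indicator_of_mem hy]
    · rw [indicator_of_notMem hy]
      rcases hsl y with h | ⟨x, hx, rfl⟩
      · rw [h, measure_empty]
      · exact absurd (f.tan_proj_mem (hBs hx)) hy
  have hκ : ((κ : ℝ≥0∞) ^ 2) ≠ ⊤ := ENNReal.pow_ne_top ENNReal.coe_ne_top
  rw [hout, ← lintegral_const_mul' _ _ hκ, ← lintegral_const_mul' _ _ hκ]
  constructor <;> refine lintegral_mono fun y => ?_
  · rcases hsl y with h | ⟨x, hx, rfl⟩
    · rw [h, measure_empty, mul_zero, mul_zero, mul_zero]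
    · rw [pow_two, mul_assoc]
      exact mul_le_mul' (hd x hx).1 (mul_le_mul_left (hn x hx).1 _)
  · rcases hsl y with h | ⟨x, hx, rfl⟩
    · rw [h, measure_empty, mul_zero, mul_zero, mul_zero]
    · set a := ENNReal.ofReal (f.c.dens (f.c.e.tan (φ x)))
      set b := ENNReal.ofReal (f.c.normalDens (f.c.e.tan (φ x)))
      set v := volume {z | f.c.e.inT (f.c.e.tan (φ x)) + f.c.e.inN z ∈ f.F '' B}
      calc v = 1 * (1 * v) := by simp
        _ ≤ (κ * a) * ((κ * b) * v) :=
          mul_le_mul' (hd x hx).2 (mul_le_mul_left (hn x hx).2 _)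
        _ = κ ^ 2 * (a * (b * v)) := by ring

/-- The coarea formula for the normal projection. -/
theorem bind_fiberMeas : (surf k (M ∩ U)).bind (fiberMeas k U φ) =
    (volume.restrict U).withDensity fun x => ENNReal.ofReal (J₀ M φ x) := by
  have hUm := H.tub.isOpen.measurableSet
  set ν₁ := (surf k (M ∩ U)).bind (fiberMeas k U φ)
  set ν₂ := (volume.restrict U).withDensity fun x => ENNReal.ofReal (J₀ M φ x)
  have h1 : ν₁.restrict U = ν₁ := by
    refine Measure.restrict_eq_self_of_ae_mem ?_
    rw [ae_iff]
    change ν₁ Uᶜ = 0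
    rw [Measure.bind_apply hUm.compl H.measurable_fiberMeas.aemeasurable]
    refine (lintegral_congr fun p => ?_).trans lintegral_zero
    rw [fiberMeas, Measure.restrict_apply hUm.compl]
    rw [show Uᶜ ∩ (U ∩ φ ⁻¹' {p}) = ∅ by
      rw [← inter_assoc, compl_inter_self, empty_inter], measure_empty]
  have h2 : ν₂.restrict U = ν₂ := by
    rw [restrict_withDensity hUm, Measure.restrict_restrict_of_subset le_rfl]
  rw [← h1, ← h2]
  refine measure_eq_of_local_ratio hUm fun η hη x hx => ?_
  -- Two factors `κ` account for the two densities in the chart, the third for the comparison of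
  -- `J₀` with the Jacobian of the chart; all three comparisons are exact at `x`.
  obtain ⟨κ, hκ, hκη⟩ := exists_pow_lt_of_one_lt 3 hη
  have hκ' : (1 : ℝ) < κ := by exact_mod_cast hκ
  obtain ⟨f, -⟩ := H.exists_fiberChart hx univ_mem
  have hJ := H.J₀_pos hx
  have htan : ContinuousAt (fun x => f.c.e.tan (φ x)) x :=
    f.c.e.tan.continuous.continuousAt.comp (H.continuousAt hx)
  have hVn : f.c.V ∈ 𝓝 (f.c.e.tan (φ x)) := f.c.isOpen_V.mem_nhds f.c.tan_base_mem
  have near : ∀ {d : Euc k → ℝ}, ContinuousOn d f.c.V → d (f.c.e.tan (φ x)) = 1 →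
      ∀ᶠ z in 𝓝 x, ENNReal.ofReal (d (f.c.e.tan (φ z))) ≤ κ ∧
        1 ≤ κ * ENNReal.ofReal (d (f.c.e.tan (φ z))) := by
    intro d hd h1
    have hc : ContinuousAt (fun z => d (f.c.e.tan (φ z))) x :=
      ContinuousAt.comp (g := d) (hd.continuousAt hVn) htan
    filter_upwards [hc.eventually_lt_const (u := (κ : ℝ)) (by simpa only [h1] using hκ'),
      (continuousAt_const.mul hc).eventually_const_lt (u := 1)
        (show (1 : ℝ) < κ * d (f.c.e.tan (φ x)) by rwa [h1, mul_one])] with z hz1 hz2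
    constructor
    · rw [← ENNReal.ofReal_coe_nnreal]
      exact ENNReal.ofReal_le_ofReal hz1.le
    · rw [← ENNReal.ofReal_coe_nnreal, ← ENNReal.ofReal_mul κ.coe_nonneg, ← ENNReal.ofReal_one]
      exact ENNReal.ofReal_le_ofReal hz2.le
  have hJc : ContinuousAt (J₀ M φ) x := H.continuousOn_J₀.continuousAt (H.tub.isOpen.mem_nhds hx)
  have hDc := f.continuousAt_det
  have hD0 := H.abs_det_fiberMap f
  have nJ : ∀ᶠ z in 𝓝 x, J₀ M φ z ≤ κ * |(fderiv ℝ f.F z).det| ∧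
      |(fderiv ℝ f.F z).det| ≤ κ * J₀ M φ z := by
    have hlt : J₀ M φ x < κ * J₀ M φ x := by nlinarith
    filter_upwards [hJc.eventually_lt (continuousAt_const.mul hDc)
        (show J₀ M φ x < κ * |(fderiv ℝ f.F x).det| by rwa [hD0]),
      hDc.eventually_lt (continuousAt_const.mul hJc)
        (show |(fderiv ℝ f.F x).det| < κ * J₀ M φ x by rwa [hD0])] with z h1 h2
    exact ⟨h1.le, h2.le⟩
  refine ⟨_, inter_mem (inter_mem (f.F.open_source.mem_nhds f.mem) nJ)
    (inter_mem (near (f.c.continuousOn_dens H.one_le) (f.c.dens_base H.one_le))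
      (near (f.c.continuousOn_normalDens H.one_le) (f.c.normalDens_base H.one_le))),
    fun B hB hBm => ?_⟩
  have hBs : B ⊆ f.F.source := fun z hz => (hB hz).1.1.1
  have hBJ : ∀ z ∈ B, _ := fun z hz => (hB hz).1.1.2
  have hBU : B ⊆ U := fun z hz => (hB hz).2
  obtain ⟨b1, b2⟩ := H.lintegral_fiber_bounds f hBm hBs (fun z hz => (hB hz).1.2.1)
    fun z hz => (hB hz).1.2.2
  have hvol : volume (f.F '' B) = ∫⁻ z in B, ENNReal.ofReal |(fderiv ℝ f.F z).det| :=
    (lintegral_abs_det_fderiv_eq_addHaar_image volume hBm (fun z hz =>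
      ((f.contDiffOn.contDiffAt (f.F.open_source.mem_nhds (hBs hz))).differentiableAt
        one_ne_zero).hasFDerivAt.hasFDerivWithinAt) (f.F.injOn.mono hBs)).symm
  have hof : ∀ {s t : ℝ}, s ≤ κ * t → ENNReal.ofReal s ≤ κ * ENNReal.ofReal t := by
    intro s t h
    calc ENNReal.ofReal s ≤ ENNReal.ofReal (κ * t) := ENNReal.ofReal_le_ofReal h
      _ = κ * ENNReal.ofReal t := by
        rw [ENNReal.ofReal_mul κ.coe_nonneg, ENNReal.ofReal_coe_nnreal]
  have hν2 : ν₂ B = ∫⁻ z in B, ENNReal.ofReal (J₀ M φ z) := by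
    rw [withDensity_apply _ hBm, Measure.restrict_restrict hBm, inter_eq_left.2 hBU]
  have hκη' : (κ : ℝ≥0∞) ^ 3 ≤ η := by exact_mod_cast hκη
  have e3 : volume (f.F '' B) ≤ κ * ν₂ B := by
    rw [hvol, hν2, ← lintegral_const_mul' _ _ ENNReal.coe_ne_top]
    exact setLIntegral_mono' hBm fun z hz => hof (hBJ z hz).2
  have e4 : ν₂ B ≤ κ * volume (f.F '' B) := by
    rw [hvol, hν2, ← lintegral_const_mul' _ _ ENNReal.coe_ne_top]
    exact setLIntegral_mono' hBm fun z hz => hof (hBJ z hz).1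
  rw [← H.bind_fiberMeas_apply hBm hBU] at b1 b2
  constructor
  · calc ν₁ B ≤ κ ^ 2 * volume (f.F '' B) := b1
      _ ≤ κ ^ 2 * (κ * ν₂ B) := by gcongr
      _ = κ ^ 3 * ν₂ B := by ring
      _ ≤ η * ν₂ B := by gcongr
  · calc ν₂ B ≤ κ * volume (f.F '' B) := e4
      _ ≤ κ * (κ ^ 2 * ν₁ B) := by gcongr
      _ = κ ^ 3 * ν₁ B := by ring
      _ ≤ η * ν₁ B := by gcongr

theorem aemeasurable_proj {B : Set (Euc ℓ)} (hB : MeasurableSet B) (hBU : B ⊆ U) :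
    AEMeasurable φ (volume.restrict B) := (H.continuousOn.mono hBU).aemeasurable hB

/-- The push-forward of `J₀ dx` on `B` under the normal projection. -/
theorem map_proj {B : Set (Euc ℓ)} (hB : MeasurableSet B) (hBU : B ⊆ U) :
    Measure.map φ ((volume.restrict B).withDensity fun x => ENNReal.ofReal (J₀ M φ x)) =
      (surf k (M ∩ U)).withDensity fun p => μHE[ℓ - k] (B ∩ φ ⁻¹' {p}) := by
  have hm : AEMeasurable φ ((volume.restrict B).withDensity fun x => ENNReal.ofReal (J₀ M φ x)) :=
    (H.aemeasurable_proj hB hBU).mono_ac (withDensity_absolutelyContinuous _ _)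
  ext S hS
  have hBS : MeasurableSet (B ∩ φ ⁻¹' S) := by
    have h1 : B ∩ φ ⁻¹' S = B ∩ (U ∩ φ ⁻¹' S) := by rw [← inter_assoc, inter_eq_left.2 hBU]
    rw [h1]
    exact hB.inter (H.measurableSet_inter_preimage hS)
  -- The mass of `φ⁻¹ S` is that of `B ∩ φ⁻¹ S`, to which the coarea formula applies; its fibre over
  -- `p` is the fibre of `B` if `p ∈ S` and empty otherwise.
  have e1 : ((volume.restrict B).withDensity fun x => ENNReal.ofReal (J₀ M φ x)) (φ ⁻¹' S) =
      ((volume.restrict U).withDensity fun x => ENNReal.ofReal (J₀ M φ x)) (B ∩ φ ⁻¹' S) := by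
    have h1 : (volume.restrict B).withDensity (fun x => ENNReal.ofReal (J₀ M φ x)) =
        ((volume.restrict U).withDensity fun x => ENNReal.ofReal (J₀ M φ x)).restrict B := by
      rw [restrict_withDensity hB, Measure.restrict_restrict hB, inter_eq_left.2 hBU]
    rw [h1, Measure.restrict_apply' hB, inter_comm]
  rw [Measure.map_apply_of_aemeasurable hm hS, e1, ← H.bind_fiberMeas,
    H.bind_fiberMeas_apply hBS (inter_subset_left.trans hBU), withDensity_apply _ hS,
    ← lintegral_indicator hS]
  refine lintegral_congr fun p => ?_
  by_cases hp : p ∈ S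
  · rw [indicator_of_mem hp]
    congr 1
    ext x
    constructor
    · exact fun h => ⟨h.1.1, h.2⟩
    · rintro ⟨h1, rfl⟩
      exact ⟨⟨h1, hp⟩, rfl⟩
  · rw [indicator_of_notMem hp]
    have : B ∩ φ ⁻¹' S ∩ φ ⁻¹' {p} = ∅ := by
      rw [eq_empty_iff_forall_notMem]
      rintro x ⟨⟨-, h1⟩, rfl⟩
      exact hp h1
    rw [this, measure_empty]

/-- The fibre lies in an affine copy of `ℝ^(ℓ-k)`, the normal space at its base point, and is
bounded. -/
theorem measure_fiber_lt_top {B : Set (Euc ℓ)} (hBU : B ⊆ U) (hBb : Bornology.IsBounded B)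
    (p : Euc ℓ) : μHE[ℓ - k] (B ∩ φ ⁻¹' {p}) < ⊤ := by
  rcases (B ∩ φ ⁻¹' {p}).eq_empty_or_nonempty with h | ⟨x, hx, rfl⟩
  · rw [h, measure_empty]
    exact ENNReal.zero_lt_top
  · obtain ⟨c⟩ := H.exists_chart (hBU hx)
    obtain ⟨R, hR⟩ := (hBb.subset_closedBall (φ x))
    have hsub : B ∩ φ ⁻¹' {φ x} ⊆ (fun q => φ x + q) '' (c.e.inN ''
        Metric.closedBall (0 : Euc (ℓ - k)) R) := by
      rintro z ⟨hz, hzx⟩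
      have hzx' : φ z = φ x := hzx
      have hn := H.tub.normal z (hBU hz)
      rw [hzx', Split.mem_orthogonal_iff c.adapted] at hn
      refine ⟨z - φ x, ⟨c.e.nor (z - φ x), ?_, ?_⟩, by simp⟩
      · rw [mem_closedBall_zero_iff]
        refine (c.e.norm_nor_le _).trans ?_
        have := hR hz
        rwa [Metric.mem_closedBall, dist_eq_norm] at this
      · conv_rhs => rw [← c.e.inT_tan_add_inN_nor (z - φ x), hn, map_zero, zero_add]
    refine (measure_mono hsub).trans_lt ?_
    rw [Isometry.euclideanHausdorffMeasure_image (isometry_add_left _),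
      Isometry.euclideanHausdorffMeasure_image c.e.inN.isometry,
      EuclideanSpace.euclideanHausdorffMeasure_eq_volume]
    exact (isCompact_closedBall _ _).measure_lt_top

/-- The image of an open set is relatively open, with locally large sections. -/
theorem exists_measure_fiber_ge {Ω : Set (Euc ℓ)} (hΩ : IsOpen Ω) (hΩU : Ω ⊆ U) {p : Euc ℓ}
    (hp : p ∈ φ '' Ω) : ∃ O, IsOpen O ∧ p ∈ O ∧ M ∩ O ⊆ φ '' Ω ∧
      ∃ m : ℝ≥0∞, m ≠ 0 ∧ ∀ q ∈ M ∩ O, m ≤ μHE[ℓ - k] (Ω ∩ φ ⁻¹' {q}) := by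
  obtain ⟨x, hx, rfl⟩ := hp
  obtain ⟨f, hf⟩ := H.exists_fiberChart (hΩU hx) (hΩ.mem_nhds hx)
  have hnd := (f.c.continuousOn_normalDens H.one_le).mono f.A_subset
  have hNo : IsOpen (f.A ∩ f.c.normalDens ⁻¹' Ioi (1 / 2)) :=
    hnd.isOpen_inter_preimage f.isOpen_A isOpen_Ioi
  set O := f.c.O ∩ f.c.e.tan ⁻¹' (f.A ∩ f.c.normalDens ⁻¹' Ioi (1 / 2))
  -- Over every nearby point of `M` the section contains the lift of the entire slice `Z`, with
  -- normal density above `1/2`. The positive lower bound also shows that the section is nonempty,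
  -- whence relative openness of the image.
  have key : ∀ q ∈ M ∩ O, ENNReal.ofReal (1 / 2) * volume f.Z ≤ μHE[ℓ - k] (Ω ∩ φ ⁻¹' {q}) := by
    rintro q ⟨hqM, hqO, hqA, hqd⟩
    have h1 := f.measure_fiber H le_rfl hqA
    rw [f.c.γ_tan q ⟨hqM, hqO⟩, f.F.image_source_eq_target, f.target] at h1
    have h2 : {z | f.c.e.inT (f.c.e.tan q) + f.c.e.inN z ∈ f.c.e.box f.A f.Z} = f.Z := by
      ext z
      rw [mem_ofPred_eq, f.c.e.mem_box]
      exact and_iff_right hqA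
    rw [h2] at h1
    calc _ ≤ ENNReal.ofReal (f.c.normalDens (f.c.e.tan q)) * volume f.Z := by
          gcongr
          exact (le_of_lt hqd)
      _ = _ := h1.symm
      _ ≤ _ := measure_mono (inter_subset_inter_left _ hf)
  have hZ : volume f.Z ≠ 0 := (f.isOpen_Z.measure_pos volume ⟨_, f.nor_mem f.mem⟩).ne'
  have hm : ENNReal.ofReal (1 / 2) * volume f.Z ≠ 0 := mul_ne_zero (by simp) hZ
  refine ⟨O, f.c.isOpen_O.inter (hNo.preimage f.c.e.tan.continuous), ⟨f.c.mem,
    f.tan_proj_mem f.mem, ?_⟩, ?_, _, hm, key⟩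
  · rw [mem_preimage, f.c.normalDens_base H.one_le]
    norm_num
  · intro q hq
    have h3 : (Ω ∩ φ ⁻¹' {q}).Nonempty := by
      rw [nonempty_iff_ne_empty]
      intro h0
      have := key q hq
      rw [h0, measure_empty] at this
      exact hm (le_antisymm this zero_le)
    obtain ⟨z, hz, hzq⟩ := h3
    exact ⟨z, hz, hzq⟩

theorem isOpen_exists_image {Ω : Set (Euc ℓ)} (hΩ : IsOpen Ω) (hΩU : Ω ⊆ U) :
    ∃ Q, IsOpen Q ∧ φ '' Ω = M ∩ Q := by
  choose! O hO hpO hOs _ using fun p (hp : p ∈ φ '' Ω) => H.exists_measure_fiber_ge hΩ hΩU hp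
  refine ⟨⋃ p ∈ φ '' Ω, O p, isOpen_biUnion hO, ?_⟩
  ext q
  constructor
  · intro hq
    refine ⟨?_, mem_biUnion hq (hpO q hq)⟩
    obtain ⟨x, hx, rfl⟩ := hq
    exact H.mem_M (hΩU hx)
  · rintro ⟨hqM, hq⟩
    obtain ⟨p, hp, hqp⟩ := mem_iUnion₂.1 hq
    exact hOs p hp ⟨hqM, hqp⟩

end IsNormalProjection

theorem GraphChart.exists_finite_nhds {ℓ k r : ℕ} {M : Set (Euc ℓ)} {p : Euc ℓ}
    (c : GraphChart k r M p) (hr : 1 ≤ r) : ∃ O, IsOpen O ∧ p ∈ O ∧ μHE[k] (M ∩ O) < ⊤ := by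
  set d := c.dens (c.e.tan p)
  set N := Metric.ball (c.e.tan p) 1 ∩ (c.V ∩ c.dens ⁻¹' Iio (d + 1))
  have hVo := (c.continuousOn_dens hr).isOpen_inter_preimage c.isOpen_V (isOpen_Iio (a := d + 1))
  have hN : IsOpen N := Metric.isOpen_ball.inter hVo
  refine ⟨c.O ∩ c.e.tan ⁻¹' N, c.isOpen_O.inter (hN.preimage c.e.tan.continuous),
    ⟨c.mem, Metric.mem_ball_self one_pos, c.tan_base_mem, by simp [d]⟩, ?_⟩
  have h1 : μHE[k] (M ∩ (c.O ∩ c.e.tan ⁻¹' N)) = Measure.map c.e.tan (surf k (M ∩ c.O)) N := by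
    rw [Measure.map_apply c.e.tan.continuous.measurable hN.measurableSet,
      Measure.restrict_apply (c.e.tan.continuous.measurable hN.measurableSet), ← inter_assoc,
      inter_comm]
  rw [h1, c.map_tan_surf hr, withDensity_apply _ hN.measurableSet,
    Measure.restrict_restrict hN.measurableSet]
  calc _ ≤ ∫⁻ y in N ∩ c.V, ENNReal.ofReal (d + 1) :=
        setLIntegral_mono' (hN.inter c.isOpen_V).measurableSet fun y hy =>
          ENNReal.ofReal_le_ofReal (le_of_lt hy.1.2.2)
    _ = ENNReal.ofReal (d + 1) * volume (N ∩ c.V) := setLIntegral_const _ _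
    _ < ⊤ := by
        refine ENNReal.mul_lt_top ENNReal.ofReal_lt_top ?_
        exact (measure_mono (inter_subset_left.trans inter_subset_left)).trans_lt
          (Metric.isBounded_ball.measure_lt_top)

/-- Makes square integrability on compact subsets imply integrability, so that `L²_loc` functions
can be tested. -/
theorem IsEmbeddedSubmanifold.measure_lt_top {ℓ k r : ℕ} {M : Set (Euc ℓ)}
    (hM : IsEmbeddedSubmanifold k r M) (hr : 1 ≤ r) {K : Set (Euc ℓ)} (hK : IsCompact K)
    (hKM : K ⊆ M) : μHE[k] K < ⊤ := by
  refine hK.measure_lt_top_of_nhdsWithin fun p hp => ?_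
  obtain ⟨c⟩ := hM.exists_graphChart hr (hKM hp)
  obtain ⟨O, hO, hpO, hfin⟩ := c.exists_finite_nhds hr
  exact ⟨M ∩ O, mem_nhdsWithin.2 ⟨O, hO, hpO, fun x hx => ⟨hKM hx.2, hx.1⟩⟩, hfin⟩

end

section

/-! ### The derivative of the determinant -/

theorem contDiff_det {n : ℕ} {m : WithTop ℕ∞} : ContDiff ℝ m fun L : Euc n →L[ℝ] Euc n => L.det := by
  let b := (EuclideanSpace.basisFun (Fin n) ℝ).toBasis
  have h : (fun L : Euc n →L[ℝ] Euc n => L.det) = fun L => ∑ σ : Equiv.Perm (Fin n),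
      Equiv.Perm.sign σ • ∏ i, (L (b i)) (σ i) := by
    funext L
    rw [ContinuousLinearMap.det, ← LinearMap.det_toMatrix b, Matrix.det_apply]
    simp [b, LinearMap.toMatrix_apply]
  rw [h]
  refine ContDiff.sum fun σ _ => ?_
  have : ContDiff ℝ m fun L : Euc n →L[ℝ] Euc n => ∏ i, (L (b i)) (σ i) := by
    refine contDiff_prod fun i _ => ?_
    exact ((EuclideanSpace.proj (σ i) : Euc n →L[ℝ] ℝ) ∘L
      ContinuousLinearMap.apply ℝ (Euc n) (b i)).contDiff
  exact this.const_smul ((Equiv.Perm.sign σ : ℤˣ) : ℤ)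

/-- Along the line `1 + t H` the determinant is the polynomial `1 + t tr H + O(t²)`. -/
theorem fderiv_det_id {n : ℕ} (H : Euc n →L[ℝ] Euc n) :
    fderiv ℝ (fun L : Euc n →L[ℝ] Euc n => L.det) (ContinuousLinearMap.id ℝ (Euc n)) H =
      traceCLM n H := by
  let b := (EuclideanSpace.basisFun (Fin n) ℝ).toBasis
  have hd : DifferentiableAt ℝ (fun L : Euc n →L[ℝ] Euc n => L.det)
      (ContinuousLinearMap.id ℝ (Euc n)) :=
    (contDiff_det (m := 1)).differentiable one_ne_zero _
  have h1 : HasDerivAt (fun t : ℝ => (ContinuousLinearMap.id ℝ (Euc n) + t • H).det)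
      (fderiv ℝ (fun L : Euc n →L[ℝ] Euc n => L.det) (ContinuousLinearMap.id ℝ (Euc n)) H) 0 := by
    have hl : HasDerivAt (fun t : ℝ => ContinuousLinearMap.id ℝ (Euc n) + t • H) H 0 := by
      simpa using ((hasDerivAt_id (0 : ℝ)).smul_const H).const_add (ContinuousLinearMap.id ℝ (Euc n))
    have hd' : HasFDerivAt (fun L : Euc n →L[ℝ] Euc n => L.det)
      (fderiv ℝ (fun L : Euc n →L[ℝ] Euc n => L.det) (ContinuousLinearMap.id ℝ (Euc n)))
      (ContinuousLinearMap.id ℝ (Euc n) + (0 : ℝ) • H) := by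
      have e0 : ContinuousLinearMap.id ℝ (Euc n) + (0 : ℝ) • H = ContinuousLinearMap.id ℝ (Euc n) := by
        ext1 w
        simp
      rw [e0]
      exact hd.hasFDerivAt
    exact hd'.comp_hasDerivAt 0 hl
  set A := LinearMap.toMatrix b b (H : Euc n →ₗ[ℝ] Euc n)
  obtain ⟨p, hp⟩ : ∃ p : Polynomial ℝ, ∀ t : ℝ, (ContinuousLinearMap.id ℝ (Euc n) + t • H).det =
      1 + A.trace * t + p.eval t * t ^ 2 := by
    refine ⟨(Matrix.det (1 + (Polynomial.X : Polynomial ℝ) • A.map Polynomial.C)).divX.divX,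
      fun t => ?_⟩
    rw [← Matrix.det_one_add_smul, ContinuousLinearMap.det, ← LinearMap.det_toMatrix b]
    congr 1
    have : ((ContinuousLinearMap.id ℝ (Euc n) + t • H : Euc n →L[ℝ] Euc n) : Euc n →ₗ[ℝ] Euc n) =
      LinearMap.id + t • (H : Euc n →ₗ[ℝ] Euc n) := rfl
    rw [this, map_add, map_smul, LinearMap.toMatrix_id]
  have h2 : HasDerivAt (fun t : ℝ => (ContinuousLinearMap.id ℝ (Euc n) + t • H).det) A.trace 0 := by
    have e := (((hasDerivAt_id (0 : ℝ)).const_mul A.trace).const_add 1).add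
      ((p.hasDerivAt 0).mul ((hasDerivAt_id (0 : ℝ)).pow 2))
    refine (e.congr_deriv (by simp)).congr_of_eventuallyEq (Eventually.of_forall fun t => ?_)
    simp [hp t]
  rw [h1.unique h2, traceCLM_apply, LinearMap.trace_eq_matrix_trace ℝ b]

/-- Jacobi's formula, reduced to the identity by `det L = det A · det (B L)` with `B = A⁻¹`. -/
theorem fderiv_det {n : ℕ} {A B : Euc n →L[ℝ] Euc n} (h : B ∘L A = ContinuousLinearMap.id ℝ _)
    (H : Euc n →L[ℝ] Euc n) :
    fderiv ℝ (fun L : Euc n →L[ℝ] Euc n => L.det) A H = A.det * traceCLM n (B ∘L H) := by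
  have hd : A.det * B.det = 1 := by
    have := congrArg ContinuousLinearMap.det h
    rw [mul_comm]
    simpa [ContinuousLinearMap.det, LinearMap.det_comp] using this
  have e : (fun L : Euc n →L[ℝ] Euc n => L.det) = fun L => A.det * (B ∘L L).det := by
    funext L
    have : (B ∘L L).det = B.det * L.det := LinearMap.det_comp _ _
    rw [this, ← mul_assoc, hd, one_mul]
  have h1 : HasFDerivAt (fun L : Euc n →L[ℝ] Euc n => B ∘L L)
    (ContinuousLinearMap.compL ℝ (Euc n) (Euc n) (Euc n) B) A :=
    (ContinuousLinearMap.compL ℝ (Euc n) (Euc n) (Euc n) B).hasFDerivAt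
  have h2 : HasFDerivAt (fun L : Euc n →L[ℝ] Euc n => L.det)
      (fderiv ℝ (fun L : Euc n →L[ℝ] Euc n => L.det) (ContinuousLinearMap.id ℝ _)) (B ∘L A) := by
    rw [h]
    exact ((contDiff_det (m := 1)).differentiable one_ne_zero _).hasFDerivAt
  have h3 := ((h2.comp A h1).const_mul A.det).fderiv
  rw [e]
  have h4 := DFunLike.congr_fun h3 H
  refine h4.trans ?_
  simp [fderiv_det_id]

/-! ### The surface divergence in a graph chart -/

theorem surfaceDiv_eq_trace {ℓ : ℕ} {M : Set (Euc ℓ)} (Ψ : Euc ℓ → Euc ℓ) (p : Euc ℓ) :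
    surfaceDiv M Ψ p =
      traceCLM ℓ (fderiv ℝ Ψ p ∘L (tangentSubspace M p).starProjection) := by
  rw [surfaceDiv, traceCLM_apply]
  have h2 : ((fderiv ℝ Ψ p ∘L (tangentSubspace M p).starProjection : Euc ℓ →L[ℝ] Euc ℓ) :
      Euc ℓ →ₗ[ℝ] Euc ℓ) = ((fderiv ℝ Ψ p ∘L (tangentSubspace M p).subtypeL :
        tangentSubspace M p →L[ℝ] Euc ℓ) : tangentSubspace M p →ₗ[ℝ] Euc ℓ) ∘ₗ
        ((tangentSubspace M p).orthogonalProjectionOnto : Euc ℓ →ₗ[ℝ] tangentSubspace M p) := rfl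
  rw [h2, ← LinearMap.trace_comp_comm']
  rfl

namespace GraphChart

variable {ℓ k r : ℕ} {M : Set (Euc ℓ)} {p : Euc ℓ} (c : GraphChart k r M p)

/-- The metric tensor of the parametrization. -/
noncomputable def gram (y : Euc k) : Euc k →L[ℝ] Euc k :=
  ContinuousLinearMap.adjoint (fderiv ℝ c.γ y) ∘L fderiv ℝ c.γ y

theorem dens_eq_sqrt (y : Euc k) : c.dens y = √(c.gram y).det := by
  have := (fderiv ℝ c.γ y).normDet_sq
  rw [gram, ← this]
  exact (Real.sqrt_sq (LinearMap.normDet_nonneg _)).symm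

theorem det_gram_pos (hr : 1 ≤ r) {y : Euc k} (hy : y ∈ c.V) : 0 < (c.gram y).det :=
  Real.sqrt_pos.1 (c.dens_eq_sqrt y ▸ c.dens_pos hr hy)

theorem contDiffOn_gram {m : ℕ} (hm : m + 1 ≤ r) : ContDiffOn ℝ m c.gram c.V :=
  ((ContinuousLinearMap.adjoint (𝕜 := ℝ) (E := Euc k) (F := Euc ℓ)).toContinuousLinearEquiv
    |>.contDiff.comp_contDiffOn (c.contDiffOn_fderiv hm)).clm_comp (c.contDiffOn_fderiv hm)

theorem contDiffOn_dens {m : ℕ} (hm : m + 1 ≤ r) : ContDiffOn ℝ m c.dens c.V := by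
  have h : c.dens = fun y => √(c.gram y).det := funext c.dens_eq_sqrt
  rw [h]
  exact (contDiff_det.comp_contDiffOn (c.contDiffOn_gram hm)).sqrt fun y hy =>
    (c.det_gram_pos (by omega) hy).ne'

theorem exists_gram_inverse (hr : 1 ≤ r) {y : Euc k} (hy : y ∈ c.V) :
    ∃ B : Euc k →L[ℝ] Euc k, B ∘L c.gram y = ContinuousLinearMap.id ℝ _ ∧
      c.gram y ∘L B = ContinuousLinearMap.id ℝ _ ∧ ContinuousLinearMap.adjoint B = B := by
  have hdet : LinearMap.det (c.gram y : Euc k →ₗ[ℝ] Euc k) ≠ 0 := (c.det_gram_pos hr hy).ne'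
  let E := LinearEquiv.ofIsUnitDet (f := (c.gram y : Euc k →ₗ[ℝ] Euc k))
    (v := (EuclideanSpace.basisFun (Fin k) ℝ).toBasis) (v' := (EuclideanSpace.basisFun (Fin k) ℝ).toBasis)
    (by rw [LinearMap.det_toMatrix]; exact hdet.isUnit)
  let B : Euc k →L[ℝ] Euc k := (E.symm : Euc k →ₗ[ℝ] Euc k).toContinuousLinearMap
  have h1 : B ∘L c.gram y = ContinuousLinearMap.id ℝ _ := by
    ext1 w
    exact E.symm_apply_apply w
  have h2 : c.gram y ∘L B = ContinuousLinearMap.id ℝ _ := by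
    ext1 w
    exact E.apply_symm_apply w
  have hG : ContinuousLinearMap.adjoint (c.gram y) = c.gram y := by
    rw [gram, ContinuousLinearMap.adjoint_comp, ContinuousLinearMap.adjoint_adjoint]
  refine ⟨B, h1, h2, ?_⟩
  have h3 : ContinuousLinearMap.adjoint B ∘L c.gram y = ContinuousLinearMap.id ℝ _ := by
    have := congrArg ContinuousLinearMap.adjoint h2
    rw [ContinuousLinearMap.adjoint_comp, hG] at this
    rw [this]
    ext1 w
    refine ext_inner_left ℝ fun z => ?_
    rw [ContinuousLinearMap.adjoint_inner_right]
    rfl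
  calc ContinuousLinearMap.adjoint B = ContinuousLinearMap.adjoint B ∘L (c.gram y ∘L B) := by
        rw [h2]; rfl
    _ = (ContinuousLinearMap.adjoint B ∘L c.gram y) ∘L B := rfl
    _ = B := by rw [h3]; rfl

theorem traceCLM_comp_comm {m n : ℕ} (A : Euc m →L[ℝ] Euc n) (B : Euc n →L[ℝ] Euc m) :
    traceCLM n (A ∘L B) = traceCLM m (B ∘L A) := by
  rw [traceCLM_apply, traceCLM_apply]
  exact LinearMap.trace_comp_comm' (B : Euc n →ₗ[ℝ] Euc m) (A : Euc m →ₗ[ℝ] Euc n)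

theorem traceCLM_adjoint {n : ℕ} (A : Euc n →L[ℝ] Euc n) :
    traceCLM n (ContinuousLinearMap.adjoint A) = traceCLM n A := by
  rw [traceCLM_apply, traceCLM_apply,
    LinearMap.trace_eq_sum_inner _ (EuclideanSpace.basisFun (Fin n) ℝ),
    LinearMap.trace_eq_sum_inner _ (EuclideanSpace.basisFun (Fin n) ℝ)]
  refine Finset.sum_congr rfl fun i _ => ?_
  rw [ContinuousLinearMap.coe_coe, ContinuousLinearMap.coe_coe,
    ContinuousLinearMap.adjoint_inner_right, real_inner_comm]

/-- The derivative of the area density. -/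
theorem fderiv_dens (hr : 2 ≤ r) {y : Euc k} (hy : y ∈ c.V) {B : Euc k →L[ℝ] Euc k}
    (h1 : B ∘L c.gram y = ContinuousLinearMap.id ℝ _) (h2 : ContinuousLinearMap.adjoint B = B)
    (w : Euc k) : fderiv ℝ c.dens y w = c.dens y * traceCLM k (B ∘L
      ContinuousLinearMap.adjoint (fderiv ℝ c.γ y) ∘L fderiv ℝ (fderiv ℝ c.γ) y w) := by
  set L := fderiv ℝ c.γ y with hL
  set N := fderiv ℝ (fderiv ℝ c.γ) y w with hN
  have hd : HasFDerivAt (fderiv ℝ c.γ) (fderiv ℝ (fderiv ℝ c.γ) y) y :=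
    (((c.contDiffOn_fderiv (m := 1) hr).contDiffAt (c.isOpen_V.mem_nhds hy)).differentiableAt
      one_ne_zero).hasFDerivAt
  have hg : HasFDerivAt c.gram (fderiv ℝ c.gram y) y :=
    (((c.contDiffOn_gram (m := 1) hr).contDiffAt (c.isOpen_V.mem_nhds hy)).differentiableAt
      one_ne_zero).hasFDerivAt
  have hg' : fderiv ℝ c.gram y w = ContinuousLinearMap.adjoint N ∘L L +
      ContinuousLinearMap.adjoint L ∘L N := by
    let Ad := (ContinuousLinearMap.adjoint (𝕜 := ℝ) (E := Euc k)
      (F := Euc ℓ)).toContinuousLinearEquiv.toContinuousLinearMap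
    have ha : HasFDerivAt (fun y => ContinuousLinearMap.adjoint (fderiv ℝ c.γ y))
      (Ad ∘L fderiv ℝ (fderiv ℝ c.γ) y) y := Ad.hasFDerivAt.comp y hd
    have := hg.unique (ha.clm_comp hd)
    rw [this]
    exact add_comm (ContinuousLinearMap.adjoint L ∘L N) (ContinuousLinearMap.adjoint N ∘L L)
  have hdet : HasFDerivAt (fun L : Euc k →L[ℝ] Euc k => L.det)
      (fderiv ℝ (fun L : Euc k →L[ℝ] Euc k => L.det) (c.gram y)) (c.gram y) :=
    ((contDiff_det (m := 1)).differentiable one_ne_zero _).hasFDerivAt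
  have hpos := c.det_gram_pos (by omega) hy
  have hs := ((hdet.comp y hg).sqrt hpos.ne').fderiv
  have h : c.dens = fun y => √(c.gram y).det := funext c.dens_eq_sqrt
  have hs' : fderiv ℝ c.dens y w = 1 / (2 * √(c.gram y).det) *
      ((c.gram y).det * traceCLM k (B ∘L fderiv ℝ c.gram y w)) := by
    rw [h, ← fderiv_det h1]
    exact DFunLike.congr_fun hs w
  have ht : traceCLM k (B ∘L fderiv ℝ c.gram y w) =
      2 * traceCLM k (B ∘L ContinuousLinearMap.adjoint L ∘L N) := by
    rw [hg', ContinuousLinearMap.comp_add, map_add, two_mul]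
    congr 1
    -- The two terms of the derivative of `LᵀL` have equal traces against `B`: one is the adjoint of
    -- the other up to cyclic order, since `B` is self-adjoint.
    rw [← traceCLM_adjoint, ContinuousLinearMap.adjoint_comp, ContinuousLinearMap.adjoint_comp, h2,
      ContinuousLinearMap.adjoint_adjoint, traceCLM_comp_comm]
  rw [hs', ht, c.dens_eq_sqrt]
  have hq := Real.sqrt_pos.2 hpos
  field_simp
  rw [Real.sq_sqrt hpos.le]

/-- The surface divergence in the coordinates of a graph chart. -/
theorem dens_mul_surfaceDiv (hr : 2 ≤ r) {y : Euc k} (hy : y ∈ c.V) {Ψ : Euc ℓ → Euc ℓ}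
    (hΨ : DifferentiableAt ℝ Ψ (c.γ y))
    (ht : ∀ᶠ z in 𝓝 y, Ψ (c.γ z) ∈ tangentSubspace M (c.γ z)) :
    c.dens y * surfaceDiv M Ψ (c.γ y) =
      divergence (fun z => c.dens z • c.e.tan (Ψ (c.γ z))) y := by
  have hr1 : 1 ≤ r := by omega
  obtain ⟨B, hB1, hB2, hB3⟩ := c.exists_gram_inverse hr1 hy
  set L := fderiv ℝ c.γ y with hL
  set X : Euc k → Euc k := fun z => c.e.tan (Ψ (c.γ z)) with hX
  have hγ := c.hasFDerivAt hr1 hy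
  have hXd : HasFDerivAt X (c.e.tan ∘L fderiv ℝ Ψ (c.γ y) ∘L L) y :=
    c.e.tan.hasFDerivAt.comp y (hΨ.hasFDerivAt.comp y hγ)
  have hd : HasFDerivAt (fderiv ℝ c.γ) (fderiv ℝ (fderiv ℝ c.γ) y) y :=
    (((c.contDiffOn_fderiv (m := 1) hr).contDiffAt (c.isOpen_V.mem_nhds hy)).differentiableAt
      one_ne_zero).hasFDerivAt
  -- `R = (LᵀL)⁻¹ Lᵀ` is the left inverse of `L` for which `L R` is the orthogonal projection onto
  -- the tangent space.
  set R : Euc ℓ →L[ℝ] Euc k := B ∘L ContinuousLinearMap.adjoint L with hR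
  have hRL : R ∘L L = ContinuousLinearMap.id ℝ _ := hB1
  have hLR : L ∘L R = (tangentSubspace M (c.γ y)).starProjection := by
    ext1 v
    refine Eq.symm (Submodule.eq_starProjection_of_mem_orthogonal
      (c.fderiv_mem_tangent hy (R v)) ?_)
    rw [c.tangent y hy]
    rintro _ ⟨w, rfl⟩
    rw [ContinuousLinearMap.coe_coe, inner_sub_right, sub_eq_zero,
      ← ContinuousLinearMap.adjoint_inner_right, ← ContinuousLinearMap.adjoint_inner_right]
    have := DFunLike.congr_fun hB2 (ContinuousLinearMap.adjoint L v)
    exact congrArg (inner ℝ w) this.symm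
  -- Tangency gives `Ψ ∘ γ = Dγ · X`, and this is differentiated. Symmetry of `D²γ` moves `X y` into
  -- the slot of the direction, so that the first term becomes the logarithmic derivative of the
  -- density along `X`.
  have hdd : fderiv ℝ Ψ (c.γ y) ∘L L = fderiv ℝ (fderiv ℝ c.γ) y (X y) + L ∘L fderiv ℝ X y := by
    have e1 : HasFDerivAt (fun z => Ψ (c.γ z)) (fderiv ℝ Ψ (c.γ y) ∘L L) y :=
      hΨ.hasFDerivAt.comp y hγ
    have e2 := (hd.clm_apply hXd).congr_of_eventuallyEq (f₁ := fun z => Ψ (c.γ z)) (by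
      filter_upwards [ht, c.isOpen_V.mem_nhds hy] with z hz hzV
      have := c.fderiv_tan_of_mem hr1 (c.γ_mem z hzV) hz
      rw [c.tan_γ z hzV] at this
      exact this.symm)
    rw [e1.unique e2, hXd.fderiv]
    ext1 w
    have hs : fderiv ℝ (fderiv ℝ c.γ) y (X y) w = fderiv ℝ (fderiv ℝ c.γ) y w (X y) := by
      have h2 : ContDiffAt ℝ 2 c.γ y :=
        (c.contDiffOn.contDiffAt (c.isOpen_V.mem_nhds hy)).of_le (by exact_mod_cast hr)
      exact h2.isSymmSndFDerivAt (by simp) (X y) w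
    simp only [add_apply, ContinuousLinearMap.comp_apply,
      ContinuousLinearMap.flip_apply, hs]
    exact add_comm _ _
  have hsd : surfaceDiv M Ψ (c.γ y) = traceCLM k (R ∘L fderiv ℝ (fderiv ℝ c.γ) y (X y)) +
      divergence X y := by
    rw [surfaceDiv_eq_trace, ← hLR, ← ContinuousLinearMap.comp_assoc, traceCLM_comp_comm, hdd,
      ContinuousLinearMap.comp_add, map_add, ← ContinuousLinearMap.comp_assoc, hRL,
      divergence_eq_traceCLM]
    rfl
  have hdens : DifferentiableAt ℝ c.dens y :=
    ((c.contDiffOn_dens (m := 1) hr).contDiffAt (c.isOpen_V.mem_nhds hy)).differentiableAt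
      one_ne_zero
  rw [divergence_smul hdens hXd.differentiableAt, c.fderiv_dens hr hy hB1 hB3, hsd, mul_add,
    add_comm]
  rfl

end GraphChart

end

section

namespace GraphChart

variable {ℓ k r : ℕ} {M : Set (Euc ℓ)} {p : Euc ℓ} (c : GraphChart k r M p)

/-! ### Integration in a graph chart -/

section Transfer

variable {A : Set (Euc k)}

theorem image_eq (hAV : A ⊆ c.V) : c.γ '' A = M ∩ c.O ∩ c.e.tan ⁻¹' A := by
  ext q
  constructor
  · rintro ⟨y, hy, rfl⟩
    exact ⟨c.γ_mem y (hAV hy), by rw [mem_preimage, c.tan_γ y (hAV hy)]; exact hy⟩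
  · exact fun hq => ⟨c.e.tan q, hq.2, c.γ_tan q hq.1⟩

theorem measurableSet_image (hA : MeasurableSet A) (hAV : A ⊆ c.V) : MeasurableSet (c.γ '' A) := by
  rw [c.image_eq hAV]
  exact c.measurableSet_inter.inter (c.e.tan.continuous.measurable hA)

theorem map_tan_surf_image (hr : 1 ≤ r) (hA : MeasurableSet A) (hAV : A ⊆ c.V) :
    Measure.map c.e.tan (surf k (c.γ '' A)) =
      (volume.restrict A).withDensity fun y => ENNReal.ofReal (c.dens y) := by
  have h1 : surf k (c.γ '' A) = (surf k (M ∩ c.O)).restrict (c.e.tan ⁻¹' A) := by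
    rw [Measure.restrict_restrict (c.e.tan.continuous.measurable hA), inter_comm, ← c.image_eq hAV]
  rw [h1, ← Measure.restrict_map c.e.tan.continuous.measurable hA, c.map_tan_surf hr,
    restrict_withDensity hA, Measure.restrict_restrict hA, inter_eq_left.2 hAV]

theorem aemeasurable_γ (hA : MeasurableSet A) (hAV : A ⊆ c.V) :
    AEMeasurable c.γ (volume.restrict A) :=
  (c.continuousOn_γ.mono hAV).aemeasurable hA

theorem aemeasurable_dens (hr : 1 ≤ r) (hA : MeasurableSet A) (hAV : A ⊆ c.V) :
    AEMeasurable c.dens (volume.restrict A) :=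
  ((c.continuousOn_dens hr).mono hAV).aemeasurable hA

theorem ae_γ_tan (hA : MeasurableSet A) (hAV : A ⊆ c.V) :
    ∀ᵐ q ∂(surf k (c.γ '' A)), c.γ (c.e.tan q) = q := by
  filter_upwards [ae_restrict_mem (c.measurableSet_image hA hAV)] with q hq
  rw [c.image_eq hAV] at hq
  exact c.γ_tan q hq.1

/-- The area formula pushed back by `γ`, which inverts the tangential coordinate almost everywhere
on the image. -/
theorem map_γ (hr : 1 ≤ r) (hA : MeasurableSet A) (hAV : A ⊆ c.V) :
    Measure.map c.γ ((volume.restrict A).withDensity fun y => ENNReal.ofReal (c.dens y)) =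
      surf k (c.γ '' A) := by
  have h1 : AEMeasurable c.γ (Measure.map c.e.tan (surf k (c.γ '' A))) := by
    rw [c.map_tan_surf_image hr hA hAV]
    exact (c.aemeasurable_γ hA hAV).mono_ac (withDensity_absolutelyContinuous _ _)
  rw [← c.map_tan_surf_image hr hA hAV,
    AEMeasurable.map_map_of_aemeasurable h1 c.e.tan.continuous.aemeasurable]
  conv_rhs => rw [← Measure.map_id (μ := surf k (c.γ '' A))]
  exact Measure.map_congr (c.ae_γ_tan hA hAV)

theorem ae_withDensity_dens_iff (hr : 1 ≤ r) (hA : MeasurableSet A) (hAV : A ⊆ c.V)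
    {Q : Euc k → Prop} :
    (∀ᵐ y ∂((volume.restrict A).withDensity fun y => ENNReal.ofReal (c.dens y)), Q y) ↔
      ∀ᵐ y ∂(volume.restrict A), Q y := by
  rw [ae_withDensity_iff' (c.aemeasurable_dens hr hA hAV).ennreal_ofReal]
  refine ⟨fun h => ?_, fun h => h.mono fun _ h _ => h⟩
  filter_upwards [h, ae_restrict_mem hA] with y hy hyA
  exact hy (ENNReal.ofReal_pos.2 (c.dens_pos hr (hAV hyA))).ne'

theorem ae_surf_iff (hr : 1 ≤ r) (hA : MeasurableSet A) (hAV : A ⊆ c.V) {Q : Euc ℓ → Prop} :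
    (∀ᵐ q ∂(surf k (c.γ '' A)), Q q) ↔ ∀ᵐ y ∂(volume.restrict A), Q (c.γ y) := by
  rw [← c.ae_withDensity_dens_iff hr hA hAV]
  constructor
  · intro h
    rw [← c.map_γ hr hA hAV] at h
    exact ae_of_ae_map ((c.aemeasurable_γ hA hAV).mono_ac (withDensity_absolutelyContinuous _ _)) h
  · intro h
    rw [← c.map_tan_surf_image hr hA hAV] at h
    filter_upwards [ae_of_ae_map c.e.tan.continuous.aemeasurable h, c.ae_γ_tan hA hAV] with q hq hq'
    rwa [hq'] at hq

variable {E : Type*} [NormedAddCommGroup E]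

theorem aestronglyMeasurable_iff (hr : 1 ≤ r) (hA : MeasurableSet A) (hAV : A ⊆ c.V)
    {f : Euc ℓ → E} : AEStronglyMeasurable f (surf k (c.γ '' A)) ↔
      AEStronglyMeasurable (fun y => f (c.γ y)) (volume.restrict A) := by
  have hac : volume.restrict A ≪
      (volume.restrict A).withDensity fun y => ENNReal.ofReal (c.dens y) :=
    Measure.AbsolutelyContinuous.mk fun s _ hs => by
      have := (c.ae_withDensity_dens_iff hr hA hAV (Q := fun y => y ∉ s)).1
        (measure_eq_zero_iff_ae_notMem.1 hs)
      exact measure_eq_zero_iff_ae_notMem.2 this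
  constructor
  · intro h
    rw [← c.map_γ hr hA hAV] at h
    exact (h.comp_aemeasurable ((c.aemeasurable_γ hA hAV).mono_ac
      (withDensity_absolutelyContinuous _ _))).mono_ac hac
  · intro h
    have h1 : AEStronglyMeasurable (fun y => f (c.γ y))
        (Measure.map c.e.tan (surf k (c.γ '' A))) := by
      rw [c.map_tan_surf_image hr hA hAV]
      exact h.mono_ac (withDensity_absolutelyContinuous _ _)
    refine (h1.comp_aemeasurable c.e.tan.continuous.aemeasurable).congr ?_
    filter_upwards [c.ae_γ_tan hA hAV] with q hq
    rw [Function.comp_apply, hq]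

variable [NormedSpace ℝ E]

theorem toReal_ofReal_dens (y : Euc k) : (ENNReal.ofReal (c.dens y)).toReal = c.dens y :=
  ENNReal.toReal_ofReal (LinearMap.normDet_nonneg _)

theorem integral_surf_image (hr : 1 ≤ r) (hA : MeasurableSet A) (hAV : A ⊆ c.V) {f : Euc ℓ → E}
    (hf : AEStronglyMeasurable f (surf k (c.γ '' A))) :
    ∫ q, f q ∂(surf k (c.γ '' A)) = ∫ y in A, c.dens y • f (c.γ y) := by
  rw [← c.map_γ hr hA hAV] at hf ⊢
  rw [integral_map ((c.aemeasurable_γ hA hAV).mono_ac (withDensity_absolutelyContinuous _ _)) hf,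
    integral_withDensity_eq_integral_toReal_smul₀
      (c.aemeasurable_dens hr hA hAV).ennreal_ofReal (by simp)]
  simp_rw [c.toReal_ofReal_dens]

theorem integrable_surf_image_iff (hr : 1 ≤ r) (hA : MeasurableSet A) (hAV : A ⊆ c.V)
    {f : Euc ℓ → E} (hf : AEStronglyMeasurable f (surf k (c.γ '' A))) :
    Integrable f (surf k (c.γ '' A)) ↔ IntegrableOn (fun y => c.dens y • f (c.γ y)) A := by
  rw [← c.map_γ hr hA hAV] at hf ⊢
  rw [integrable_map_measure hf
    ((c.aemeasurable_γ hA hAV).mono_ac (withDensity_absolutelyContinuous _ _)),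
    integrable_withDensity_iff_integrable_smul₀' 
      (c.aemeasurable_dens hr hA hAV).ennreal_ofReal (by simp)]
  simp_rw [c.toReal_ofReal_dens]
  rfl

/-- The area density is continuous and positive, so on compact sets it can be divided out. -/
theorem locallyIntegrableOn_comp_γ (hr : 1 ≤ r) (hA : IsOpen A) (hAV : A ⊆ c.V) {f : Euc ℓ → E}
    (hf : ∀ K ⊆ c.γ '' A, IsCompact K → Integrable f (surf k K)) :
    LocallyIntegrableOn (fun y => f (c.γ y)) A := by
  rw [locallyIntegrableOn_iff hA.isLocallyClosed]
  intro C hC hCc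
  have h1 := hf (c.γ '' C) (image_mono hC) (hCc.image_of_continuousOn
    (c.continuousOn_γ.mono (hC.trans hAV)))
  rw [c.integrable_surf_image_iff hr hCc.measurableSet (hC.trans hAV) h1.1] at h1
  have h2 : ContinuousOn (fun y => (c.dens y)⁻¹) C :=
    ((c.continuousOn_dens hr).mono (hC.trans hAV)).inv₀ fun y hy => (c.dens_pos hr (hAV (hC hy))).ne'
  refine (h1.continuousOn_smul h2 hCc).congr_fun (fun y hy => ?_) hCc.measurableSet
  exact inv_smul_smul₀ (c.dens_pos hr (hAV (hC hy))).ne' _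

end Transfer

end GraphChart

/-! ### Dependence of the surface divergence on the field -/

/-- `surfaceDiv` differentiates an extension of the field, but in a chart it is the divergence of
`dens • tan (Ψ ∘ γ)` up to a positive factor, and this sees only values on `M`. For tangent fields
the choice of the extension is therefore immaterial. -/
theorem surfaceDiv_congr {ℓ k r : ℕ} {M : Set (Euc ℓ)} (hM : IsEmbeddedSubmanifold k r M)
    (hr : 2 ≤ r) {p : Euc ℓ} (hp : p ∈ M) {Ψ Ψ' : Euc ℓ → Euc ℓ} (hΨ : DifferentiableAt ℝ Ψ p)
    (hΨ' : DifferentiableAt ℝ Ψ' p) (ht : ∀ᶠ q in 𝓝[M] p, Ψ q ∈ tangentSubspace M q)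
    (he : ∀ᶠ q in 𝓝[M] p, Ψ q = Ψ' q) : surfaceDiv M Ψ p = surfaceDiv M Ψ' p := by
  obtain ⟨c⟩ := hM.exists_graphChart (by omega) hp
  have hy := c.tan_base_mem
  have hg := c.γ_tan_base
  have hγ : Tendsto c.γ (𝓝 (c.e.tan p)) (𝓝[M] p) := by
    refine tendsto_nhdsWithin_iff.2 ⟨?_, ?_⟩
    · have := (c.continuousOn_γ.continuousAt (c.isOpen_V.mem_nhds hy)).tendsto
      rwa [hg] at this
    · filter_upwards [c.isOpen_V.mem_nhds hy] with y hy using (c.γ_mem y hy).1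
  have h1 := c.dens_mul_surfaceDiv hr hy (by rwa [hg]) (hγ.eventually ht)
  have h2 := c.dens_mul_surfaceDiv hr hy (Ψ := Ψ') (by rwa [hg]) (by
    filter_upwards [hγ.eventually ht, hγ.eventually he] with y h h'
    rwa [← h'])
  have h3 : (fun z => c.dens z • c.e.tan (Ψ (c.γ z))) =ᶠ[𝓝 (c.e.tan p)]
      fun z => c.dens z • c.e.tan (Ψ' (c.γ z)) := by
    filter_upwards [hγ.eventually he] with y h
    rw [h]
  rw [divergence, h3.fderiv_eq, ← divergence, ← h2, hg] at h1
  exact mul_left_cancel₀ (c.dens_pos (by omega) hy).ne' h1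

end

/-! ### Surface gradients and weak gradients in a graph chart -/

section

/-- Certifies that the classical divergence of a `C¹` field is a weak divergence in the form
required by `IsWeakGradient.integral_field`. -/
theorem integral_divergence_mul {n : ℕ} {X : Euc n → Euc n} (hX : ContDiff ℝ 1 X)
    (hXc : HasCompactSupport X) {ψ : Euc n → ℝ} (hψ : ContDiff ℝ 1 ψ) :
    ∫ x, divergence X x * ψ x = -∫ x, fderiv ℝ ψ x (X x) := by
  have hD : HasCompactSupport (divergence X) := by
    refine (hXc.fderiv (𝕜 := ℝ)).comp_left (g := traceCLM n) (map_zero _)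
  have h1 : Integrable fun x => divergence X x * ψ x :=
    ((continuous_divergence hX).mul hψ.continuous).integrable_of_hasCompactSupport hD.mul_right
  have h2 : Integrable fun x => fderiv ℝ ψ x (X x) := by
    refine ((hψ.continuous_fderiv one_ne_zero).clm_apply
      hX.continuous).integrable_of_hasCompactSupport ?_
    refine hXc.mono fun x hx => ?_
    contrapose! hx
    rw [Function.notMem_support] at hx ⊢
    rw [hx, map_zero]
  have h3 := integral_divergence_eq_zero (hψ.smul hX) hXc.smul_left
  rw [eq_neg_iff_add_eq_zero, ← integral_add h1 h2, ← h3]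
  congr 1
  funext x
  have := divergence_smul (hψ.differentiable one_ne_zero x) (hX.differentiable one_ne_zero x)
  rw [mul_comm]
  exact this.symm

section TestField

variable {ℓ k r : ℕ} {M S : Set (Euc ℓ)}

theorem mem_nhdsWithin_of_eq_inter {Q : Set (Euc ℓ)} (hQ : IsOpen Q) (hS : S = M ∩ Q) {p : Euc ℓ}
    (hp : p ∈ S) : S ∈ 𝓝[M] p := by
  rw [hS] at hp ⊢
  exact inter_mem_nhdsWithin _ (hQ.mem_nhds hp.2)

theorem one_le_cast_sub_one (hr : 2 ≤ r) : (1 : WithTop ℕ∞) ≤ ((r - 1 : ℕ) : ℕ∞) := by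
  exact_mod_cast (by omega : 1 ≤ r - 1)

theorem surfaceDiv_eq_zero (hM : IsEmbeddedSubmanifold k r M) (hr : 2 ≤ r) {Q : Set (Euc ℓ)}
    (hQ : IsOpen Q) (hS : S = M ∩ Q) {Ψ : Euc ℓ → Euc ℓ} (hΨ : ContDiff ℝ 1 Ψ) {K : Set (Euc ℓ)}
    (hK : IsClosed K) (h0 : ∀ p ∈ S \ K, Ψ p = 0) {p : Euc ℓ} (hp : p ∈ S \ K) :
    surfaceDiv M Ψ p = 0 := by
  have hpM : p ∈ M := by have := hp.1; rw [hS] at this; exact this.1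
  have hev : ∀ᶠ q in 𝓝[M] p, Ψ q = 0 := by
    filter_upwards [mem_nhdsWithin_of_eq_inter hQ hS hp.1,
      mem_nhdsWithin_of_mem_nhds (hK.isOpen_compl.mem_nhds hp.2)] with q h1 h2
    exact h0 q ⟨h1, h2⟩
  rw [surfaceDiv_congr hM hr hpM (Ψ' := fun _ => 0) (hΨ.differentiable one_ne_zero p)
    (differentiableAt_const _) (hev.mono fun q hq => by rw [hq]; exact Submodule.zero_mem _) hev,
    surfaceDiv_eq_trace]
  simp

theorem IsTestField.contDiff_one (hr : 2 ≤ r) {Ψ : Euc ℓ → Euc ℓ} (h : IsTestField r M S Ψ) :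
    ContDiff ℝ 1 Ψ := h.contDiff.of_le (one_le_cast_sub_one hr)

end TestField

namespace GraphChart

variable {ℓ k r : ℕ} {M S : Set (Euc ℓ)} {p : Euc ℓ} (c : GraphChart k r M p) {A : Set (Euc k)}

/-- A weak gradient in the coordinates of a chart yields the surface gradient, tested against
fields supported in the chart. -/
theorem integral_mul_surfaceDiv (hM : IsEmbeddedSubmanifold k r M) (hr : 2 ≤ r) {Q : Set (Euc ℓ)}
    (hQ : IsOpen Q) (hS : S = M ∩ Q) (hSm : MeasurableSet S) (hA : IsOpen A) (hAV : A ⊆ c.V)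
    (hAS : c.γ '' A ⊆ S) {v : Euc ℓ → ℝ} {V : Euc ℓ → Euc ℓ} {h : Euc k → Euc k}
    (hw : LocallyIntegrableOn (fun y => v (c.γ y)) A) (hh : LocallyIntegrableOn h A)
    (hwh : IsWeakGradient A (fun y => v (c.γ y)) h)
    (hVt : ∀ᵐ y ∂(volume.restrict A), V (c.γ y) ∈ tangentSubspace M (c.γ y))
    (hV : ∀ᵐ y ∂(volume.restrict A),
      ContinuousLinearMap.adjoint (fderiv ℝ c.γ y) (V (c.γ y)) = h y)
    {Ψ : Euc ℓ → Euc ℓ} (hΨ : ContDiff ℝ 1 Ψ) (hΨt : ∀ q ∈ S, Ψ q ∈ tangentSubspace M q)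
    {K : Set (Euc ℓ)} (hK : IsCompact K) (hKA : K ⊆ c.γ '' A) (h0 : ∀ q ∈ S \ K, Ψ q = 0)
    (hm1 : AEStronglyMeasurable (fun q => v q * surfaceDiv M Ψ q) (surf k S))
    (hm2 : AEStronglyMeasurable (fun q => inner ℝ (V q) (Ψ q)) (surf k S)) :
    ∫ q, v q * surfaceDiv M Ψ q ∂(surf k S) = -∫ q, inner ℝ (V q) (Ψ q) ∂(surf k S) := by
  classical
  have hr1 : 1 ≤ r := by omega
  have e1 : ∀ f : Euc ℓ → ℝ, (∀ q ∈ S \ K, f q = 0) →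
      ∫ q, f q ∂(surf k S) = ∫ q, f q ∂(surf k (c.γ '' A)) := fun f hf =>
    setIntegral_eq_of_subset_of_forall_sdiff_eq_zero hSm hAS
      fun q hq => hf q ⟨hq.1, fun h => hq.2 (hKA h)⟩
  have hle : surf k (c.γ '' A) ≤ surf k S := Measure.restrict_mono hAS le_rfl
  have hnear : ∀ y ∈ A, ∀ᶠ z in 𝓝 y, z ∈ A := fun y hy => hA.mem_nhds hy
  rw [e1 _ fun q hq => by rw [surfaceDiv_eq_zero hM hr hQ hS hΨ hK.isClosed h0 hq, mul_zero],
    e1 _ fun q hq => by rw [h0 q hq, inner_zero_right],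
    c.integral_surf_image hr1 hA.measurableSet hAV (hm1.mono_measure hle),
    c.integral_surf_image hr1 hA.measurableSet hAV (hm2.mono_measure hle)]
  set C := c.e.tan '' K with hC
  have hCc : IsCompact C := hK.image c.e.tan.continuous
  have hCA : C ⊆ A := by
    rintro _ ⟨q, hq, rfl⟩
    obtain ⟨y, hy, rfl⟩ := hKA hq
    rwa [c.tan_γ y (hAV hy)]
  -- The test field in coordinates, multiplied by the area density so that surface divergence
  -- becomes divergence. It vanishes off a compact subset of `A`, so extension by zero keeps it
  -- `C¹`.
  set X : Euc k → Euc k := A.indicator fun z => c.dens z • c.e.tan (Ψ (c.γ z)) with hX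
  have hX0 : ∀ z ∉ C, X z = 0 := by
    intro z hz
    by_cases hzA : z ∈ A
    · rw [hX, indicator_of_mem hzA, h0 (c.γ z) ⟨hAS ⟨z, hzA, rfl⟩, fun hzK =>
        hz ⟨_, hzK, c.tan_γ z (hAV hzA)⟩⟩, map_zero, smul_zero]
    · exact indicator_of_notMem hzA _
  have hXc : HasCompactSupport X := HasCompactSupport.intro hCc hX0
  have hXs : tsupport X ⊆ C := closure_minimal (fun z hz => by
    by_contra h
    exact hz (hX0 z h)) hCc.isClosed
  have hXA : ∀ y ∈ A, X =ᶠ[𝓝 y] fun z => c.dens z • c.e.tan (Ψ (c.γ z)) := fun y hy => by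
    filter_upwards [hA.mem_nhds hy] with z hz
    exact indicator_of_mem hz _
  have hX1 : ContDiff ℝ 1 X := by
    rw [contDiff_iff_contDiffAt]
    intro y
    by_cases hy : y ∈ A
    · have hyV := c.isOpen_V.mem_nhds (hAV hy)
      have h1 : ContDiffAt ℝ 1 c.dens y := (c.contDiffOn_dens (m := 1) hr).contDiffAt hyV
      have h2 : ContDiffAt ℝ 1 c.γ y := (c.contDiffOn.contDiffAt hyV).of_le (by exact_mod_cast hr1)
      refine ContDiffAt.congr_of_eventuallyEq ?_ (hXA y hy)
      exact h1.smul (c.e.tan.contDiff.contDiffAt.comp y (hΨ.contDiffAt.comp y h2))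
    · refine (contDiffAt_const (c := (0 : Euc k))).congr_of_eventuallyEq ?_
      filter_upwards [hCc.isClosed.isOpen_compl.mem_nhds fun h => hy (hCA h)] with z hz
      exact hX0 z hz
  have hdv : ∀ y ∈ A, c.dens y * surfaceDiv M Ψ (c.γ y) = divergence X y := by
    intro y hy
    rw [c.dens_mul_surfaceDiv hr (hAV hy) (hΨ.differentiable one_ne_zero _), divergence, divergence,
      (hXA y hy).fderiv_eq]
    filter_upwards [hA.mem_nhds hy] with z hz
    exact hΨt _ (hAS ⟨z, hz, rfl⟩)
  have hDs : tsupport (divergence X) ⊆ C := by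
    refine (closure_mono fun y hy => ?_).trans ((tsupport_fderiv_subset ℝ (f := X)).trans hXs)
    contrapose! hy
    rw [Function.notMem_support] at hy ⊢
    rw [divergence, hy]
    simp
  have key := hwh.integral_field hA hw hh hX1.continuous (continuous_divergence hX1) hXc
    (hCc.of_isClosed_subset (isClosed_tsupport _) hDs) (hXs.trans hCA) (hDs.trans hCA)
    fun ψ hψ _ => integral_divergence_mul hX1 hXc (hψ.of_le (by simp))
  have f1 : ∫ y in A, c.dens y • (v (c.γ y) * surfaceDiv M Ψ (c.γ y)) =
      ∫ y in A, v (c.γ y) * divergence X y := by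
    refine setIntegral_congr_fun hA.measurableSet fun y hy => ?_
    simp only [← hdv y hy, smul_eq_mul]
    ring
  -- Since `Ψ = Dγ (tan Ψ)` on `M`, pairing `V` with `Ψ` is pairing `Dγᵀ V = h` with `tan Ψ`.
  have f2 : ∫ y in A, c.dens y • inner ℝ (V (c.γ y)) (Ψ (c.γ y)) =
      ∫ y in A, inner ℝ (h y) (X y) := by
    refine integral_congr_ae ?_
    filter_upwards [hVt, hV, ae_restrict_mem hA.measurableSet] with y h1 h2 hy
    have h3 := c.fderiv_tan_of_mem hr1 (c.γ_mem y (hAV hy)) (hΨt _ (hAS ⟨y, hy, rfl⟩))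
    rw [c.tan_γ y (hAV hy)] at h3
    rw [← h2, ContinuousLinearMap.adjoint_inner_left, hX, indicator_of_mem hy, map_smul, h3,
      real_inner_smul_right, smul_eq_mul]
  rw [f1, f2, key]

/-- A surface gradient gives a weak gradient in the coordinates of a chart. -/
theorem isWeakGradient_of_surfaceGradient (hM : IsEmbeddedSubmanifold k r M) (hr : 2 ≤ r)
    {Q : Set (Euc ℓ)}
    (hQ : IsOpen Q) (hS : S = M ∩ Q) (hSm : MeasurableSet S) (hA : IsOpen A) (hAV : A ⊆ c.V)
    (hAS : c.γ '' A ⊆ S) {v : Euc ℓ → ℝ} {V : Euc ℓ → Euc ℓ} (h : IsSurfaceGradient k r M S v V) :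
    IsWeakGradient A (fun y => v (c.γ y))
      fun y => ContinuousLinearMap.adjoint (fderiv ℝ c.γ y) (V (c.γ y)) := by
  intro ψ hψ hψc hψs e
  have hr1 : 1 ≤ r := by omega
  set C := tsupport ψ with hC
  set K := c.γ '' C with hKdef
  have hKc : IsCompact K := hψc.isCompact.image_of_continuousOn
    (c.continuousOn_γ.mono (hψs.trans hAV))
  have hKO : K ⊆ c.O := by
    rintro _ ⟨y, hy, rfl⟩
    exact (c.γ_mem y (hAV (hψs hy))).2
  -- The cutoff is `1` near the support on `M` and lets the field, defined through the chart, extend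
  -- to all of `ℝ^ℓ`.
  obtain ⟨ζ, hζ, hζc, hζs, hζ1⟩ := exists_cutoff hKc c.isOpen_O hKO
  -- Division by the density is arranged so that `dens • tan (Ψ ∘ γ) = ψ e`, whose divergence is the
  -- directional derivative of `ψ` along `e`.
  set a : Euc k → Euc ℓ := fun y => (ψ y * (c.dens y)⁻¹) • fderiv ℝ c.γ y e with ha
  have ha0 : ∀ y ∉ C, a y = 0 := fun y hy => by
    simp only [ha, image_eq_zero_of_notMem_tsupport hy, zero_mul, zero_smul]
  have haC : ContDiff ℝ ((r - 1 : ℕ) : ℕ∞) a := by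
    rw [contDiff_iff_contDiffAt]
    intro y
    by_cases hy : y ∈ C
    · have hyV := c.isOpen_V.mem_nhds (hAV (hψs hy))
      have h1 : ContDiffAt ℝ ((r - 1 : ℕ) : ℕ∞) c.dens y :=
        (c.contDiffOn_dens (m := r - 1) (by omega)).contDiffAt hyV
      have h2 : ContDiffAt ℝ ((r - 1 : ℕ) : ℕ∞) (fderiv ℝ c.γ) y :=
        (c.contDiffOn_fderiv (m := r - 1) (by omega)).contDiffAt hyV
      have h3 : ContDiffAt ℝ ((r - 1 : ℕ) : ℕ∞) ψ y :=
        hψ.contDiffAt.of_le (by exact_mod_cast le_top)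
      exact (h3.mul (h1.inv (c.dens_pos hr1 (hAV (hψs hy))).ne')).smul
        (h2.clm_apply contDiffAt_const)
    · refine (contDiffAt_const (c := (0 : Euc ℓ))).congr_of_eventuallyEq ?_
      filter_upwards [(isClosed_tsupport ψ).isOpen_compl.mem_nhds hy] with z hz
      exact ha0 z hz
  set Ψ : Euc ℓ → Euc ℓ := fun x => ζ x • a (c.e.tan x) with hΨdef
  have hΨC : ContDiff ℝ ((r - 1 : ℕ) : ℕ∞) Ψ :=
    (hζ.of_le (by exact_mod_cast le_top)).smul (haC.comp c.e.tan.contDiff)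
  have hζO : ∀ q ∉ c.O, ζ q = 0 := fun q hq =>
    image_eq_zero_of_notMem_tsupport fun h => hq (hζs h)
  have hSM : S ⊆ M := by rw [hS]; exact inter_subset_left
  have h0 : ∀ q ∈ S \ K, Ψ q = 0 := by
    intro q hq
    by_cases hqO : q ∈ c.O
    · have : c.e.tan q ∉ C := fun hqC => hq.2 ⟨_, hqC, c.γ_tan q ⟨hSM hq.1, hqO⟩⟩
      simp only [hΨdef, ha0 _ this, smul_zero]
    · simp only [hΨdef, hζO q hqO, zero_smul]
  have hΨ : IsTestField r M S Ψ := by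
    refine ⟨hΨC, fun q hq => ?_, K, (image_mono hψs).trans hAS, hKc, h0⟩
    by_cases hqO : q ∈ c.O
    · have := c.fderiv_mem_tangent (c.tan_mem q ⟨hSM hq, hqO⟩) e
      rw [c.γ_tan q ⟨hSM hq, hqO⟩] at this
      exact Submodule.smul_mem _ _ (Submodule.smul_mem _ _ this)
    · simp only [hΨdef, hζO q hqO, zero_smul]
      exact Submodule.zero_mem _
  have hΨγ : ∀ y ∈ A, Ψ (c.γ y) = (ψ y * (c.dens y)⁻¹) • fderiv ℝ c.γ y e := by
    intro y hy
    simp only [hΨdef, c.tan_γ y (hAV hy)]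
    by_cases hyC : y ∈ C
    · rw [hζ1.self_of_nhdsSet _ ⟨y, hyC, rfl⟩, one_smul]
    · rw [ha0 y hyC, smul_zero, image_eq_zero_of_notMem_tsupport hyC, zero_mul, zero_smul]
  have hΨ1 := hΨ.contDiff_one hr
  have hdv : ∀ y ∈ A, c.dens y * surfaceDiv M Ψ (c.γ y) = fderiv ℝ ψ y e := by
    intro y hy
    have h1 : (fun z => c.dens z • c.e.tan (Ψ (c.γ z))) =ᶠ[𝓝 y] fun z => ψ z • e := by
      filter_upwards [hA.mem_nhds hy] with z hz
      rw [hΨγ z hz, map_smul, c.tan_fderiv hr1 (hAV hz), smul_smul, mul_left_comm,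
        mul_inv_cancel₀ (c.dens_pos hr1 (hAV hz)).ne', mul_one]
    rw [c.dens_mul_surfaceDiv hr (hAV hy) (hΨ1.differentiable one_ne_zero _), divergence,
      h1.fderiv_eq, ← divergence, divergence_smul (hψ.differentiable (by simp) y)
        (differentiableAt_const e), divergence]
    · simp
    · filter_upwards [hA.mem_nhds hy] with z hz
      exact hΨ.tangent _ (hAS ⟨z, hz, rfl⟩)
  have e1 : ∀ f : Euc ℓ → ℝ, (∀ q ∈ S \ K, f q = 0) →
      ∫ q, f q ∂(surf k S) = ∫ q, f q ∂(surf k (c.γ '' A)) := fun f hf =>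
    setIntegral_eq_of_subset_of_forall_sdiff_eq_zero hSm hAS
      fun q hq => hf q ⟨hq.1, fun h => hq.2 (image_mono hψs h)⟩
  have hle : surf k (c.γ '' A) ≤ surf k S := Measure.restrict_mono hAS le_rfl
  have key := h.integral_eq Ψ hΨ
  rw [e1 _ fun q hq => by rw [surfaceDiv_eq_zero hM hr hQ hS hΨ1 hKc.isClosed h0 hq, mul_zero],
    e1 _ fun q hq => by rw [h0 q hq, inner_zero_right],
    c.integral_surf_image hr1 hA.measurableSet hAV ((h.integrable_div Ψ hΨ).1.mono_measure hle),
    c.integral_surf_image hr1 hA.measurableSet hAV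
      ((h.integrable_inner Ψ hΨ).1.mono_measure hle)] at key
  have f1 : ∫ y in A, c.dens y • (v (c.γ y) * surfaceDiv M Ψ (c.γ y)) =
      ∫ y in A, v (c.γ y) * fderiv ℝ ψ y e := by
    refine setIntegral_congr_fun hA.measurableSet fun y hy => ?_
    simp only [← hdv y hy, smul_eq_mul]
    ring
  have f2 : ∫ y in A, c.dens y • inner ℝ (V (c.γ y)) (Ψ (c.γ y)) =
      ∫ y in A, ψ y * inner ℝ (ContinuousLinearMap.adjoint (fderiv ℝ c.γ y) (V (c.γ y))) e := by
    refine setIntegral_congr_fun hA.measurableSet fun y hy => ?_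
    simp only [hΨγ y hy, real_inner_smul_right, smul_eq_mul,
      ContinuousLinearMap.adjoint_inner_left]
    rw [← mul_assoc, mul_left_comm, mul_inv_cancel₀ (c.dens_pos hr1 (hAV hy)).ne', mul_one]
  rw [← f1, ← f2, key]

end GraphChart

end

section

theorem locallyIntegrableOn_clm_apply {m n₁ n₂ : ℕ} {A : Set (Euc m)} (hA : IsOpen A)
    {L : Euc m → Euc n₁ →L[ℝ] Euc n₂} (hL : ContinuousOn L A) {g : Euc m → Euc n₁}
    (hg : LocallyIntegrableOn g A) : LocallyIntegrableOn (fun y => L y (g y)) A := by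
  rw [locallyIntegrableOn_iff hA.isLocallyClosed] at hg ⊢
  intro K hK hKc
  obtain ⟨C, hC⟩ := hKc.exists_bound_of_continuousOn (hL.mono hK)
  refine ((hg K hK hKc).norm.const_mul C).mono' ?_ ?_
  · exact ContinuousLinearMap.aestronglyMeasurable_comp₂ (ContinuousLinearMap.id ℝ _)
      ((hL.mono hK).aestronglyMeasurable hKc.measurableSet) (hg K hK hKc).1
  · filter_upwards [ae_restrict_mem hKc.measurableSet] with w hw
    exact (ContinuousLinearMap.le_opNorm _ _).trans
      (mul_le_mul_of_nonneg_right (hC w hw) (norm_nonneg _))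

theorem IsL2Loc.integrable {ℓ k r : ℕ} {M S : Set (Euc ℓ)} (hM : IsEmbeddedSubmanifold k r M)
    (hr : 1 ≤ r) (hSM : S ⊆ M) {E : Type*} [NormedAddCommGroup E] {v : Euc ℓ → E}
    (h : IsL2Loc k S v) {K : Set (Euc ℓ)} (hK : K ⊆ S) (hKc : IsCompact K) :
    Integrable v (surf k K) := by
  have : IsFiniteMeasure (surf k K) := ⟨by
    rw [Measure.restrict_apply_univ]
    exact hM.measure_lt_top hr hKc (hK.trans hSM)⟩
  exact (h.2 K hK hKc).integrable one_le_two

/-! ### Null sets and measurability under a diffeomorphism -/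

section Diffeo

variable {n : ℕ} {F : OpenPartialHomeomorph (Euc n) (Euc n)}

/-- The inverse is differentiable and hence maps null sets to null sets. -/
theorem ae_source_of_ae_target (h2 : ContDiffOn ℝ 1 F.symm F.target) {Q : Euc n → Prop}
    (h : ∀ᵐ w ∂(volume.restrict F.target), Q w) :
    ∀ᵐ x ∂(volume.restrict F.source), Q (F x) := by
  rw [ae_restrict_iff' F.open_source.measurableSet, ae_iff]
  rw [ae_restrict_iff' F.open_target.measurableSet, ae_iff] at h
  have h3 : DifferentiableOn ℝ F.symm {w | ¬(w ∈ F.target → Q w)} :=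
    (h2.differentiableOn one_ne_zero).mono fun w hw => by
      by_contra hn
      exact hw fun h => absurd h hn
  refine measure_mono_null ?_
    (addHaar_image_eq_zero_of_differentiableOn_of_addHaar_eq_zero volume h3 h)
  intro x hx
  have hx' : ¬(x ∈ F.source → Q (F x)) := hx
  push Not at hx'
  refine ⟨F x, ?_, F.left_inv hx'.1⟩
  exact fun hq => hx'.2 (hq (F.map_source hx'.1))

theorem ae_source_iff (h1 : ContDiffOn ℝ 1 F F.source) (h2 : ContDiffOn ℝ 1 F.symm F.target)
    {Q : Euc n → Prop} : (∀ᵐ x ∂(volume.restrict F.source), Q (F x)) ↔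
      ∀ᵐ w ∂(volume.restrict F.target), Q w := by
  refine ⟨fun h => ?_, ae_source_of_ae_target h2⟩
  have h' := ae_source_of_ae_target (F := F.symm) (by simpa using h1)
    (Q := fun x => Q (F x)) (by simpa using h)
  have h'' : ∀ᵐ w ∂(volume.restrict F.target), Q (F (F.symm w)) := by simpa using h'
  filter_upwards [h'', ae_restrict_mem F.open_target.measurableSet] with w hw hwt
  rwa [F.right_inv hwt] at hw

theorem aestronglyMeasurable_comp_source {E : Type*} [NormedAddCommGroup E]
    (h2 : ContDiffOn ℝ 1 F.symm F.target) {f : Euc n → E}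
    (h : AEStronglyMeasurable f (volume.restrict F.target)) :
    AEStronglyMeasurable (fun x => f (F x)) (volume.restrict F.source) := by
  have hF : AEMeasurable F (volume.restrict F.source) :=
    F.continuousOn.aemeasurable F.open_source.measurableSet
  refine (h.mono_ac (Measure.AbsolutelyContinuous.mk fun s hs h0 => ?_)).comp_aemeasurable hF
  rw [Measure.map_apply_of_aemeasurable hF hs]
  exact measure_eq_zero_iff_ae_notMem.2
    (ae_source_of_ae_target h2 (measure_eq_zero_iff_ae_notMem.1 h0))

end Diffeo

namespace Split

variable {ℓ k : ℕ} (e : Split ℓ k) {A : Set (Euc k)} {Z : Set (Euc (ℓ - k))}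

theorem measurePreserving_box (hA : IsOpen A) (hZ : IsOpen Z) :
    MeasurePreserving e.measurableEquiv ((volume.restrict A).prod (volume.restrict Z))
      (volume.restrict (e.box A Z)) := by
  have h := e.measurePreserving.restrict_preimage (e.isOpen_box hA hZ).measurableSet
  have hs : e.measurableEquiv ⁻¹' e.box A Z = A ×ˢ Z := by
    ext q
    rw [mem_preimage, measurableEquiv_apply, e.mem_box, mem_prod]
  rwa [hs, ← Measure.prod_restrict] at h

theorem tan_measurableEquiv (w : Euc k × Euc (ℓ - k)) : e.tan (e.measurableEquiv w) = w.1 := by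
  rw [measurableEquiv_apply]
  simp

theorem restrict_ne_zero (hZ : IsOpen Z) (hne : Z.Nonempty) :
    (volume.restrict Z : Measure (Euc (ℓ - k))) ≠ 0 := by
  rw [Ne, Measure.restrict_eq_zero]
  exact (hZ.measure_pos volume hne).ne'

/-- A set `N × Z` is null exactly if `N` is, because the nonempty open set `Z` has positive measure.
-/
theorem ae_box_iff (hA : IsOpen A) (hZ : IsOpen Z) (hne : Z.Nonempty) {Q : Euc k → Prop} :
    (∀ᵐ x ∂(volume.restrict (e.box A Z)), Q (e.tan x)) ↔ ∀ᵐ y ∂(volume.restrict A), Q y := by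
  have hmp := e.measurePreserving_box hA hZ
  have h1 : (∀ᵐ x ∂(volume.restrict (e.box A Z)), Q (e.tan x)) ↔
      ∀ᵐ w ∂((volume.restrict A).prod (volume.restrict Z)), Q w.1 := by
    rw [← hmp.map_eq, e.measurableEquiv.measurableEmbedding.ae_map_iff]
    simp_rw [e.tan_measurableEquiv]
  have h2 : {w : Euc k × Euc (ℓ - k) | ¬Q w.1} = {y | ¬Q y} ×ˢ univ := by
    ext w
    simp
  rw [h1, ae_iff, ae_iff, h2, Measure.prod_prod, mul_eq_zero]
  refine ⟨fun h => h.resolve_right fun h => restrict_ne_zero hZ hne ?_, fun h => Or.inl h⟩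
  exact Measure.measure_univ_eq_zero.1 h

theorem aestronglyMeasurable_comp_tan_iff {E : Type*} [NormedAddCommGroup E] (hA : IsOpen A)
    (hZ : IsOpen Z) (hne : Z.Nonempty) {w : Euc k → E} :
    AEStronglyMeasurable (fun x => w (e.tan x)) (volume.restrict (e.box A Z)) ↔
      AEStronglyMeasurable w (volume.restrict A) := by
  rw [← (e.measurePreserving_box hA hZ).aestronglyMeasurable_comp_iff
    e.measurableEquiv.measurableEmbedding]
  have : (fun x => w (e.tan x)) ∘ e.measurableEquiv = fun q => w q.1 :=
    funext fun q => by rw [Function.comp_apply, e.tan_measurableEquiv]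
  rw [this]
  exact ⟨fun h => AEStronglyMeasurable.of_comp_fst h (restrict_ne_zero hZ hne),
    fun h => AEStronglyMeasurable.comp_fst h⟩

end Split

/-! ### Functions of the projection in a fibre chart -/

namespace FiberChart

variable {ℓ k r : ℕ} {M U : Set (Euc ℓ)} {φ : Euc ℓ → Euc ℓ} {x₀ : Euc ℓ}
  (f : FiberChart k r M U φ x₀)

theorem nonempty_Z : f.Z.Nonempty := ⟨_, f.nor_mem f.mem⟩

theorem ae_source_iff {Q : Euc k → Prop} :
    (∀ᵐ x ∂(volume.restrict f.F.source), Q (f.c.e.tan (φ x))) ↔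
      ∀ᵐ y ∂(volume.restrict f.A), Q y := by
  rw [← f.c.e.ae_box_iff f.isOpen_A f.isOpen_Z f.nonempty_Z, ← f.target,
    ← CurvedThin.ae_source_iff f.contDiffOn f.contDiffOn_symm]
  simp_rw [f.tan_F]

theorem aestronglyMeasurable_source_iff {E : Type*} [NormedAddCommGroup E] {w : Euc k → E} :
    AEStronglyMeasurable (fun x => w (f.c.e.tan (φ x))) (volume.restrict f.F.source) ↔
      AEStronglyMeasurable w (volume.restrict f.A) := by
  rw [← f.c.e.aestronglyMeasurable_comp_tan_iff f.isOpen_A f.isOpen_Z f.nonempty_Z, ← f.target]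
  constructor
  · intro h
    have h' := aestronglyMeasurable_comp_source (F := f.F.symm) (by simpa using f.contDiffOn)
      (by simpa using h)
    refine AEStronglyMeasurable.congr (by simpa using h') ?_
    filter_upwards [ae_restrict_mem f.F.open_target.measurableSet] with w hw
    rw [← f.tan_F, f.F.right_inv hw]
  · intro h
    have h' := aestronglyMeasurable_comp_source f.contDiffOn_symm h
    simpa only [f.tan_F] using h'

theorem image_γ : f.c.γ '' f.A = φ '' f.F.source := by
  ext q
  constructor
  · rintro ⟨y, hy, rfl⟩
    have h : f.c.e.inT y + f.c.e.inN (f.c.e.nor x₀) ∈ f.F.target := by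
      rw [f.target, f.c.e.mem_box]
      exact ⟨hy, f.nor_mem f.mem⟩
    refine ⟨_, f.F.map_target h, ?_⟩
    rw [← f.γ_tan_proj (f.F.map_target h), ← f.tan_F, f.F.right_inv h]
    simp
  · rintro ⟨x, hx, rfl⟩
    exact ⟨_, f.tan_proj_mem hx, f.γ_tan_proj hx⟩

/-- In the chart `φ` is the projection of a box onto `A`, followed by a parametrization with
positive area density; both steps preserve and reflect null sets. This makes composition with `φ`
injective on almost-everywhere classes. -/
theorem ae_comp_proj_iff (hr : 1 ≤ r) {Q : Euc ℓ → Prop} :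
    (∀ᵐ x ∂(volume.restrict f.F.source), Q (φ x)) ↔
      ∀ᵐ p ∂(surf k (φ '' f.F.source)), Q p := by
  rw [← f.image_γ, f.c.ae_surf_iff hr f.isOpen_A.measurableSet f.A_subset, ← f.ae_source_iff]
  refine eventually_congr ?_
  filter_upwards [ae_restrict_mem f.F.open_source.measurableSet] with x hx
  rw [f.γ_tan_proj hx]

theorem aestronglyMeasurable_comp_proj_iff (hr : 1 ≤ r) {E : Type*} [NormedAddCommGroup E]
    {v : Euc ℓ → E} : AEStronglyMeasurable (fun x => v (φ x)) (volume.restrict f.F.source) ↔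
      AEStronglyMeasurable v (surf k (φ '' f.F.source)) := by
  rw [← f.image_γ, f.c.aestronglyMeasurable_iff hr f.isOpen_A.measurableSet f.A_subset,
    ← f.aestronglyMeasurable_source_iff]
  refine aestronglyMeasurable_congr ?_
  filter_upwards [ae_restrict_mem f.F.open_source.measurableSet] with x hx
  rw [f.γ_tan_proj hx]

variable (H : IsNormalProjection k r M U φ)
include H

theorem hasFDerivAt_F {x : Euc ℓ} (hx : x ∈ f.F.source) :
    HasFDerivAt f.F (f.c.e.inT.toContinuousLinearMap ∘L f.c.e.tan ∘L fderiv ℝ φ x +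
        f.c.e.inN.toContinuousLinearMap ∘L f.c.e.nor) x := by
  have h := H.hasFDerivAt_fiberMap (f.source_subset hx) f.c.e
  rwa [← show ⇑f.F = _ from funext f.apply] at h

theorem adjoint_fderiv_inT {x : Euc ℓ} (hx : x ∈ f.F.source) (h : Euc k) :
    ContinuousLinearMap.adjoint (fderiv ℝ f.F x) (f.c.e.inT h) =
      ContinuousLinearMap.adjoint (fderiv ℝ φ x) (f.c.e.inT h) := by
  refine ext_inner_right ℝ fun v => ?_
  rw [ContinuousLinearMap.adjoint_inner_left, ContinuousLinearMap.adjoint_inner_left,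
    (f.hasFDerivAt_F H hx).fderiv, f.c.e.inner_inT, f.c.e.inner_inT]
  congr 1
  simp

/-- The preimage of a normal coordinate direction is normal to the submanifold. -/
theorem fderiv_symm_inN {x : Euc ℓ} (hx : x ∈ f.F.source) (z : Euc (ℓ - k)) :
    fderiv ℝ f.F.symm (f.F x) (f.c.e.inN z) ∈ (tangentSubspace M (φ x))ᗮ := by
  have hxU := f.source_subset hx
  set ξ := fderiv ℝ f.F.symm (f.F x) (f.c.e.inN z)
  have h1 : fderiv ℝ f.F x ξ = f.c.e.inN z :=
    DFunLike.congr_fun (fderiv_comp_symm f.contDiffOn f.contDiffOn_symm hx) (f.c.e.inN z)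
  have h2 : f.c.e.tan (fderiv ℝ φ x ξ) = 0 := by
    have := congrArg f.c.e.tan h1
    rw [(f.hasFDerivAt_F H hx).fderiv] at this
    simpa using this
  rw [← H.fderiv_eq_zero_iff hxU, ← f.c.fderiv_tan_of_mem H.one_le (f.proj_mem x hx)
    (H.fderiv_mem hxU ξ), h2, map_zero]

/-- A function whose weak gradient is tangential depends locally on the projection only. -/
theorem exists_of_normalProj_eq_zero {u : Euc ℓ → ℝ} {g : Euc ℓ → Euc ℓ}
    (hu : LocallyIntegrableOn u f.F.source) (hg : LocallyIntegrableOn g f.F.source)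
    (h : IsWeakGradient f.F.source u g)
    (hn : ∀ᵐ x ∂(volume.restrict f.F.source), normalProj M φ x (g x) = 0) :
    ∃ (w : Euc k → ℝ) (v : Euc k → Euc k), LocallyIntegrableOn w f.A ∧ LocallyIntegrableOn v f.A ∧
      IsWeakGradient f.A w v ∧
      (∀ᵐ x ∂(volume.restrict f.F.source), u x = w (f.c.e.tan (φ x))) ∧
      ∀ᵐ x ∂(volume.restrict f.F.source), ContinuousLinearMap.adjoint (S₀ M U φ x) (g x) =
        (tangentSubspace M (φ x)).starProjection (f.c.e.inT (v (f.c.e.tan (φ x)))) := by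
  have hd : ∀ x ∈ f.F.source,
      fderiv ℝ f.F.symm (f.F x) ∘L fderiv ℝ f.F x = ContinuousLinearMap.id ℝ _ :=
    fun x hx => fderiv_symm_comp f.contDiffOn f.contDiffOn_symm hx
  set g' : Euc ℓ → Euc ℓ := fun w =>
    ContinuousLinearMap.adjoint (fderiv ℝ f.F.symm w) (g (f.F.symm w)) with hg'
  have h' : IsWeakGradient (f.c.e.box f.A f.Z) (u ∘ f.F.symm) g' := by
    rw [← f.target]
    exact h.comp_symm f.contDiffOn f.contDiffOn_symm hu hg
  have hu' : LocallyIntegrableOn (u ∘ f.F.symm) (f.c.e.box f.A f.Z) := by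
    rw [← f.target]
    exact locallyIntegrableOn_comp_symm f.contDiffOn hu
  have hgl : LocallyIntegrableOn g' (f.c.e.box f.A f.Z) := by
    rw [← f.target]
    have h3 : LocallyIntegrableOn (g ∘ f.F.symm) f.F.target :=
      locallyIntegrableOn_comp_symm f.contDiffOn hg
    have h4 : ContinuousOn (fun w => ContinuousLinearMap.adjoint (fderiv ℝ f.F.symm w))
        f.F.target :=
      (ContinuousLinearMap.adjoint (𝕜 := ℝ) (E := Euc ℓ) (F := Euc ℓ)).continuous.comp_continuousOn
        (f.contDiffOn_symm.continuousOn_fderiv_of_isOpen f.F.open_target le_rfl)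
    exact locallyIntegrableOn_clm_apply f.F.open_target h4 h3
  -- The coordinate directions of `Z` correspond to vectors normal to `M`, against which the
  -- tangential field `g` vanishes.
  have hn' : ∀ᵐ w ∂(volume.restrict (f.c.e.box f.A f.Z)), f.c.e.nor (g' w) = 0 := by
    rw [← f.target, ← CurvedThin.ae_source_iff f.contDiffOn f.contDiffOn_symm]
    filter_upwards [hn, ae_restrict_mem f.F.open_source.measurableSet] with x hx hxs
    refine ext_inner_left ℝ fun z => ?_
    rw [← f.c.e.inner_inN, ContinuousLinearMap.adjoint_inner_right, f.F.left_inv hxs,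
      inner_zero_right, real_inner_comm]
    exact (Submodule.mem_orthogonal _ _).1 (f.fderiv_symm_inN H hxs z) _
      (IsNormalProjection.normalProj_eq_zero_iff.1 hx)
  obtain ⟨w, v, hw, hv, hwv, h5, h6⟩ := f.c.e.exists_of_nor_eq_zero f.isOpen_A f.isOpen_Z
    f.convex_Z f.nonempty_Z hu' hgl h' hn'
  rw [← f.target] at h5 h6
  refine ⟨w, v, hw, hv, hwv, ?_, ?_⟩
  · filter_upwards [ae_source_of_ae_target f.contDiffOn_symm h5,
      ae_restrict_mem f.F.open_source.measurableSet] with x hx hxs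
    rwa [Function.comp_apply, f.F.left_inv hxs, f.tan_F] at hx
  · filter_upwards [ae_source_of_ae_target f.contDiffOn_symm h6,
      ae_restrict_mem f.F.open_source.measurableSet] with x hx hxs
    -- Undoing the coordinate change: `g = DFᵀ (g' ∘ F)` with `g'` in the tangential coordinate
    -- plane, where `DFᵀ` agrees with `Dφᵀ`.
    have h7 : g x = ContinuousLinearMap.adjoint (fderiv ℝ f.F x) (g' (f.F x)) := by
      refine ext_inner_right ℝ fun a => ?_
      rw [ContinuousLinearMap.adjoint_inner_left, ContinuousLinearMap.adjoint_inner_left,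
        f.F.left_inv hxs]
      exact congrArg (inner ℝ (g x)) (DFunLike.congr_fun (hd x hxs) a).symm
    have hxU := f.source_subset hxs
    rw [h7, hx, f.tan_F, f.adjoint_fderiv_inT H hxs]
    set b := f.c.e.inT (v (f.c.e.tan (φ x)))
    -- `Dφ` takes values in the tangent space, so only the tangential part of `b` matters; on that
    -- part `S₀ᵀ` cancels `Dφᵀ`.
    have h8 : ContinuousLinearMap.adjoint (fderiv ℝ φ x) b =
        ContinuousLinearMap.adjoint (fderiv ℝ φ x)
          ((tangentSubspace M (φ x)).starProjection b) := by
      refine ext_inner_right ℝ fun a => ?_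
      rw [ContinuousLinearMap.adjoint_inner_left, ContinuousLinearMap.adjoint_inner_left,
        Submodule.inner_starProjection_left_eq_right,
        Submodule.starProjection_eq_self_iff.2 (H.fderiv_mem hxU a)]
    rw [h8, H.adjoint_S₀_adjoint_fderiv hxU (Submodule.starProjection_apply_mem _ _)]

/-- The composition of a function on the submanifold with the projection. -/
theorem isWeakGradient_comp_proj {S Q : Set (Euc ℓ)} (hQ : IsOpen Q) (hS : S = M ∩ Q)
    (hSm : MeasurableSet S) (hfS : φ '' f.F.source ⊆ S) {v : Euc ℓ → ℝ} {V : Euc ℓ → Euc ℓ}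
    (h : IsSurfaceGradient k r M S v V) (hv : IsL2Loc k S v) :
    IsWeakGradient f.F.source (fun x => v (φ x))
      fun x => ContinuousLinearMap.adjoint (fderiv ℝ φ x) (V (φ x)) := by
  have hSM : S ⊆ M := by rw [hS]; exact inter_subset_left
  have hAS : f.c.γ '' f.A ⊆ S := by rwa [f.image_γ]
  have hw := f.c.isWeakGradient_of_surfaceGradient H.emb H.two_le hQ hS hSm f.isOpen_A f.A_subset
    hAS h
  set w : Euc k → ℝ := fun y => v (f.c.γ y) with hwdef
  set g : Euc k → Euc k := fun y =>
    ContinuousLinearMap.adjoint (fderiv ℝ f.c.γ y) (V (f.c.γ y)) with hg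
  have h1 : LocallyIntegrableOn w f.A :=
    f.c.locallyIntegrableOn_comp_γ H.one_le f.isOpen_A f.A_subset fun K hK hKc =>
      hv.integrable H.emb H.one_le hSM (hK.trans hAS) hKc
  have h2 : LocallyIntegrableOn g f.A := by
    refine locallyIntegrableOn_clm_apply f.isOpen_A ?_
      (f.c.locallyIntegrableOn_comp_γ H.one_le f.isOpen_A f.A_subset fun K hK hKc =>
        h.isL2Loc.integrable H.emb H.one_le hSM (hK.trans hAS) hKc)
    exact (ContinuousLinearMap.adjoint (𝕜 := ℝ) (E := Euc k)
      (F := Euc ℓ)).continuous.comp_continuousOn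
      ((f.c.contDiffOn_fderiv (m := 0) H.one_le).continuousOn.mono f.A_subset)
  have hbox : f.F.target ⊆ f.c.e.box f.A univ := by
    rw [f.target]
    exact fun x hx => ⟨hx.1, trivial⟩
  have h3 : IsWeakGradient f.F.target (fun x => w (f.c.e.tan x))
      fun x => f.c.e.inT (g (f.c.e.tan x)) :=
    (f.c.e.isWeakGradient_comp_tan f.isOpen_A h1 h2 hw).mono hbox
  have h4 : LocallyIntegrableOn (fun x => w (f.c.e.tan x)) f.F.target :=
    (f.c.e.locallyIntegrableOn_comp_tan f.isOpen_A h1).mono_set hbox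
  have h5 : LocallyIntegrableOn (fun x => f.c.e.inT (g (f.c.e.tan x))) f.F.target := by
    have := (f.c.e.locallyIntegrableOn_comp_tan f.isOpen_A h2).mono_set hbox
    intro x hx
    obtain ⟨s, hs, hi⟩ := this x hx
    exact ⟨s, hs, f.c.e.inT.toContinuousLinearMap.integrable_comp hi⟩
  have h6 := IsWeakGradient.comp_symm (F := f.F.symm) f.contDiffOn_symm
    (by simpa using f.contDiffOn) h3 h4 h5
  -- In fibre coordinates the function depends on the tangential coordinate only, and its gradient
  -- is transported back by the chain rule.
  refine IsWeakGradient.congr_ae (Ω := f.F.source) h6 ?_ ?_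
  · filter_upwards [ae_restrict_mem f.F.open_source.measurableSet] with x hx
    rw [Function.comp_apply, OpenPartialHomeomorph.symm_symm, f.tan_F, hwdef]
    simp only [f.γ_tan_proj hx]
  · filter_upwards [ae_restrict_mem f.F.open_source.measurableSet] with x hx
    rw [OpenPartialHomeomorph.symm_symm, f.tan_F, f.adjoint_fderiv_inT H hx]
    refine ext_inner_right ℝ fun a => ?_
    rw [ContinuousLinearMap.adjoint_inner_left, ContinuousLinearMap.adjoint_inner_left,
      f.c.e.inner_inT, hg]
    simp only [ContinuousLinearMap.adjoint_inner_left]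
    rw [f.γ_tan_proj hx, f.c.fderiv_tan_of_mem H.one_le (f.proj_mem x hx)
      (H.fderiv_mem (f.source_subset hx) a)]

end FiberChart

end

section

namespace IsNormalProjection

variable {ℓ k r : ℕ} {M U : Set (Euc ℓ)} {φ : Euc ℓ → Euc ℓ} (H : IsNormalProjection k r M U φ)
include H

/-! ### Functions of the projection -/

theorem exists_seq_fiberChart {W : Set (Euc ℓ)} (hW : IsOpen W) (hWU : W ⊆ U) :
    ∃ N : ℕ → Set (Euc ℓ), (⋃ i, N i) = W ∧
      ∀ i, N i = ∅ ∨ ∃ (x₀ : Euc ℓ) (f : FiberChart k r M U φ x₀), f.F.source = N i := by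
  obtain ⟨N, -, hN, hWN⟩ := exists_seq_isOpen_cover (V := W) (P := fun N => N ⊆ W ∧
      (N = ∅ ∨ ∃ (x₀ : Euc ℓ) (f : FiberChart k r M U φ x₀), f.F.source = N))
    ⟨empty_subset _, Or.inl rfl⟩ fun x hx => by
      obtain ⟨f, hf⟩ := H.exists_fiberChart (hWU hx) (hW.mem_nhds hx)
      exact ⟨f.F.source, f.F.open_source, f.mem, hf, Or.inr ⟨x, f, rfl⟩⟩
  exact ⟨N, (iUnion_subset fun i => (hN i).1).antisymm hWN, fun i => (hN i).2⟩

theorem ae_comp_proj_iff {W : Set (Euc ℓ)} (hW : IsOpen W) (hWU : W ⊆ U) {Q : Euc ℓ → Prop} :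
    (∀ᵐ x ∂(volume.restrict W), Q (φ x)) ↔ ∀ᵐ p ∂(surf k (φ '' W)), Q p := by
  obtain ⟨N, rfl, hN⟩ := H.exists_seq_fiberChart hW hWU
  rw [image_iUnion, ae_restrict_iUnion_iff, ae_restrict_iUnion_iff]
  refine forall_congr' fun i => ?_
  rcases hN i with h | ⟨x₀, f, h⟩
  · simp [h]
  · rw [← h]
    exact f.ae_comp_proj_iff H.one_le

theorem aestronglyMeasurable_comp_proj_iff {W : Set (Euc ℓ)} (hW : IsOpen W) (hWU : W ⊆ U)
    {E : Type*} [NormedAddCommGroup E] {v : Euc ℓ → E} :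
    AEStronglyMeasurable (fun x => v (φ x)) (volume.restrict W) ↔
      AEStronglyMeasurable v (surf k (φ '' W)) := by
  obtain ⟨N, rfl, hN⟩ := H.exists_seq_fiberChart hW hWU
  rw [image_iUnion, aestronglyMeasurable_iUnion_iff, aestronglyMeasurable_iUnion_iff]
  refine forall_congr' fun i => ?_
  rcases hN i with h | ⟨x₀, f, h⟩
  · simp [h]
  · rw [← h]
    exact f.aestronglyMeasurable_comp_proj_iff H.one_le

theorem measurableSet_image_proj {W : Set (Euc ℓ)} (hW : IsOpen W) (hWU : W ⊆ U) :
    MeasurableSet (φ '' W) := by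
  obtain ⟨Q, hQ, h⟩ := H.isOpen_exists_image hW hWU
  have : φ '' W = (M ∩ U) ∩ Q := by
    refine Subset.antisymm ?_ ?_
    · rintro _ ⟨x, hx, rfl⟩
      have h2 : φ x ∈ M ∩ Q := h ▸ ⟨x, hx, rfl⟩
      exact ⟨⟨h2.1, H.proj_mem (hWU hx)⟩, h2.2⟩
    · rintro p ⟨⟨hp, -⟩, hpQ⟩
      rw [h]
      exact ⟨hp, hpQ⟩
  rw [this]
  exact H.measurableSet_M_inter.inter hQ.measurableSet

/-- If the normal sections are connected, a function that locally depends on the projection only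
depends on the projection only. -/
theorem exists_comp_proj {Ω : Set (Euc ℓ)} (hΩ : IsOpen Ω) (hΩU : Ω ⊆ U)
    (hsec : HasConnectedNormalSections M φ Ω) {E : Type*} [Zero E] {f : Euc ℓ → E}
    (hloc : ∀ x ∈ Ω, ∃ N, IsOpen N ∧ x ∈ N ∧ N ⊆ Ω ∧
      ∃ h : Euc ℓ → E, ∀ᵐ x ∂(volume.restrict N), f x = h (φ x)) :
    ∃ v : Euc ℓ → E, ∀ᵐ x ∂(volume.restrict Ω), f x = v (φ x) := by
  classical
  obtain ⟨N, hNo, hN, hΩN⟩ := exists_seq_isOpen_cover (V := Ω) (P := fun N => N ⊆ Ω ∧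
      ∃ h : Euc ℓ → E, ∀ᵐ x ∂(volume.restrict N), f x = h (φ x))
    ⟨empty_subset _, fun _ => 0, by simp⟩ hloc
  have hNΩ := fun i => (hN i).1
  choose h hh using fun i => (hN i).2
  have hUN : (⋃ i, N i) = Ω := (iUnion_subset hNΩ).antisymm hΩN
  have hij : ∀ i j, IsOpen (N i ∩ N j) ∧ N i ∩ N j ⊆ U := fun i j =>
    ⟨(hNo i).inter (hNo j), inter_subset_left.trans ((hNΩ i).trans hΩU)⟩
  -- Outside one null set of base points, all local representatives agree at `p` whenever their
  -- neighbourhoods overlap over `p`.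
  have h1 : ∀ᵐ p ∂(μHE[k] : Measure (Euc ℓ)), ∀ i j, p ∈ φ '' (N i ∩ N j) → h i p = h j p := by
    rw [ae_all_iff]
    intro i
    rw [ae_all_iff]
    intro j
    obtain ⟨ho, hU⟩ := hij i j
    rw [← ae_restrict_iff' (H.measurableSet_image_proj ho hU)]
    rw [← H.ae_comp_proj_iff ho hU]
    filter_upwards [ae_restrict_of_ae_restrict_of_subset inter_subset_left (hh i),
      ae_restrict_of_ae_restrict_of_subset inter_subset_right (hh j)] with x hi hj
    rw [← hi, ← hj]
  have h2 := (H.ae_comp_proj_iff hΩ hΩU).2 (ae_restrict_of_ae h1)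
  have h3 : ∀ᵐ x ∂(volume.restrict Ω), ∀ i, x ∈ N i → f x = h i (φ x) := by
    rw [ae_all_iff]
    intro i
    have := (ae_restrict_iff' (hNo i).measurableSet).1 (hh i)
    exact ae_restrict_of_ae this
  let v : Euc ℓ → E := fun p => if hp : ∃ i, p ∈ φ '' N i then h hp.choose p else 0
  refine ⟨v, ?_⟩
  filter_upwards [h2, h3, ae_restrict_mem hΩ.measurableSet] with x hx1 hx2 hx
  obtain ⟨i, hi⟩ := mem_iUnion.1 (hΩN hx)
  have hp : ∃ i, φ x ∈ φ '' N i := ⟨i, x, hi, rfl⟩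
  obtain ⟨y, hy, hyx⟩ := hp.choose_spec
  have hv : v (φ x) = h hp.choose (φ x) := dif_pos hp
  rw [hx2 i hi, hv]
  set j := hp.choose
  by_contra hne
  -- Over a good base point the neighbourhoods whose representative has the value of `h i` there,
  -- and those with another value, form two open sets covering the section. If both met it,
  -- connectedness would give a common point, where two overlapping representatives disagree.
  obtain ⟨z, hz, hzu, hzv⟩ := hsec (φ x) (H.mem_M (hΩU hx))
    (⋃ m ∈ {m | h m (φ x) = h i (φ x)}, N m) (⋃ m ∈ {m | h m (φ x) ≠ h i (φ x)}, N m)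
    (isOpen_biUnion fun m _ => hNo m) (isOpen_biUnion fun m _ => hNo m)
    (fun z hz => by
      obtain ⟨m, hm⟩ := mem_iUnion.1 (hΩN hz.1)
      by_cases hmi : h m (φ x) = h i (φ x)
      · exact Or.inl (mem_biUnion (x := m) hmi hm)
      · exact Or.inr (mem_biUnion (x := m) hmi hm))
    ⟨x, ⟨hx, rfl⟩, mem_biUnion (x := i) rfl hi⟩
    ⟨y, ⟨hNΩ j hy, hyx⟩, mem_biUnion (x := j) (fun h => hne h.symm) hy⟩
  obtain ⟨m, hm, hzm⟩ := mem_iUnion₂.1 hzu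
  obtain ⟨m', hm', hzm'⟩ := mem_iUnion₂.1 hzv
  have hzx : φ z = φ x := hz.2
  exact hm' ((hx1 m m' ⟨z, ⟨hzm, hzm'⟩, hzx⟩).symm.trans hm)

end IsNormalProjection

/-! ### Domains with connected normal sections -/

/-- A bounded open set with connected normal sections whose closure is contained in the domain of
the normal projection. -/
structure IsTubularDomain {ℓ : ℕ} (k r : ℕ) (M U : Set (Euc ℓ)) (φ : Euc ℓ → Euc ℓ)
    (Ω : Set (Euc ℓ)) : Prop where
  proj : IsNormalProjection k r M U φ
  isOpen : IsOpen Ω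
  bounded : Bornology.IsBounded Ω
  closure_subset : closure Ω ⊆ U
  sections : HasConnectedNormalSections M φ Ω

theorem secMeas_nonneg {ℓ k : ℕ} {φ : Euc ℓ → Euc ℓ} {Ω : Set (Euc ℓ)} (p : Euc ℓ) :
    0 ≤ secMeas k φ Ω p := ENNReal.toReal_nonneg

namespace IsTubularDomain

variable {ℓ k r : ℕ} {M U Ω : Set (Euc ℓ)} {φ : Euc ℓ → Euc ℓ}
  (D : IsTubularDomain k r M U φ Ω)
include D

theorem subset : Ω ⊆ U := subset_closure.trans D.closure_subset

theorem ae_mem : ∀ᵐ x ∂(volume.restrict Ω), x ∈ Ω := ae_restrict_mem D.isOpen.measurableSet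

theorem isCompact_closure : IsCompact (closure Ω) := D.bounded.isCompact_closure

theorem image_subset : φ '' Ω ⊆ M ∩ U := by
  rintro _ ⟨x, hx, rfl⟩
  exact ⟨D.proj.mem_M (D.subset hx), D.proj.proj_mem (D.subset hx)⟩

theorem measurableSet_image : MeasurableSet (φ '' Ω) :=
  D.proj.measurableSet_image_proj D.isOpen D.subset

theorem ofReal_secMeas (p : Euc ℓ) :
    ENNReal.ofReal (secMeas k φ Ω p) = μHE[ℓ - k] (Ω ∩ φ ⁻¹' {p}) :=
  ENNReal.ofReal_toReal (D.proj.measure_fiber_lt_top D.subset D.bounded p).ne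

theorem measurable_secMeas : Measurable (secMeas k φ Ω) :=
  (D.proj.measurable_measure_fiber D.subset D.isOpen.measurableSet).ennreal_toReal

/-- `J₀ dx` on `Ω`. -/
theorem map_proj : Measure.map φ ((volume.restrict Ω).withDensity fun x =>
    ENNReal.ofReal (J₀ M φ x)) =
      (surf k (φ '' Ω)).withDensity fun p => ENNReal.ofReal (secMeas k φ Ω p) := by
  simp_rw [D.ofReal_secMeas]
  rw [D.proj.map_proj D.isOpen.measurableSet D.subset]
  have h1 : surf k (φ '' Ω) = (surf k (M ∩ U)).restrict (φ '' Ω) := by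
    rw [Measure.restrict_restrict D.measurableSet_image, inter_eq_left.2 D.image_subset]
  have h2 : (fun p => μHE[ℓ - k] (Ω ∩ φ ⁻¹' {p})) =
      (φ '' Ω).indicator fun p => μHE[ℓ - k] (Ω ∩ φ ⁻¹' {p}) := by
    funext p
    by_cases hp : p ∈ φ '' Ω
    · rw [indicator_of_mem hp]
    · rw [indicator_of_notMem hp]
      have : Ω ∩ φ ⁻¹' {p} = ∅ := by
        rw [eq_empty_iff_forall_notMem]
        rintro x ⟨hx, hxp⟩
        exact hp ⟨x, hx, hxp⟩
      rw [this, measure_empty]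
  rw [h1, ← withDensity_indicator D.measurableSet_image, ← h2]

theorem aemeasurable_J₀ : AEMeasurable (J₀ M φ) (volume.restrict Ω) :=
  (D.proj.continuousOn_J₀.mono D.subset).aemeasurable D.isOpen.measurableSet

theorem aemeasurable_proj : AEMeasurable φ (volume.restrict Ω) :=
  D.proj.aemeasurable_proj D.isOpen.measurableSet D.subset

theorem ae_comp_iff {Q : Euc ℓ → Prop} :
    (∀ᵐ x ∂(volume.restrict Ω), Q (φ x)) ↔ ∀ᵐ p ∂(surf k (φ '' Ω)), Q p :=
  D.proj.ae_comp_proj_iff D.isOpen D.subset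

theorem aestronglyMeasurable_comp_iff {E : Type*} [NormedAddCommGroup E] {v : Euc ℓ → E} :
    AEStronglyMeasurable (fun x => v (φ x)) (volume.restrict Ω) ↔
      AEStronglyMeasurable v (surf k (φ '' Ω)) :=
  D.proj.aestronglyMeasurable_comp_proj_iff D.isOpen D.subset

theorem aestronglyMeasurable_map {v : Euc ℓ → ℝ}
    (hv : AEStronglyMeasurable v (surf k (φ '' Ω))) :
    AEStronglyMeasurable v (Measure.map φ ((volume.restrict Ω).withDensity fun x =>
      ENNReal.ofReal (J₀ M φ x))) := by
  rw [D.map_proj]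
  exact hv.mono_ac (withDensity_absolutelyContinuous _ _)

theorem aemeasurable_proj_withDensity : AEMeasurable φ ((volume.restrict Ω).withDensity fun x =>
    ENNReal.ofReal (J₀ M φ x)) :=
  D.aemeasurable_proj.mono_ac (withDensity_absolutelyContinuous _ _)

theorem integrable_iff {v : Euc ℓ → ℝ} (hv : AEStronglyMeasurable v (surf k (φ '' Ω))) :
    Integrable (fun p => secMeas k φ Ω p * v p) (surf k (φ '' Ω)) ↔
      Integrable (fun x => J₀ M φ x * v (φ x)) (volume.restrict Ω) := by
  have h1 := integrable_map_measure (D.aestronglyMeasurable_map hv) D.aemeasurable_proj_withDensity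
  rw [D.map_proj, integrable_withDensity_iff_integrable_smul₀'
      D.measurable_secMeas.ennreal_ofReal.aemeasurable (by simp),
    integrable_withDensity_iff_integrable_smul₀' D.aemeasurable_J₀.ennreal_ofReal (by simp)] at h1
  simp_rw [ENNReal.toReal_ofReal (secMeas_nonneg _)] at h1
  refine h1.trans (integrable_congr ?_)
  filter_upwards [D.ae_mem] with x hx
  rw [ENNReal.toReal_ofReal (D.proj.J₀_pos (D.subset hx)).le]
  rfl

/-- Both sides integrate `v` against one measure on the submanifold, in its two descriptions given
by the coarea formula. This is the source of all isometry statements. -/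
theorem integral_eq {v : Euc ℓ → ℝ} (hv : AEStronglyMeasurable v (surf k (φ '' Ω))) :
    ∫ p, secMeas k φ Ω p * v p ∂(surf k (φ '' Ω)) = ∫ x in Ω, J₀ M φ x * v (φ x) := by
  have h1 := integral_map D.aemeasurable_proj_withDensity (D.aestronglyMeasurable_map hv)
  rw [D.map_proj, integral_withDensity_eq_integral_toReal_smul₀
      D.measurable_secMeas.ennreal_ofReal.aemeasurable (by simp),
    integral_withDensity_eq_integral_toReal_smul₀ D.aemeasurable_J₀.ennreal_ofReal (by simp)] at h1
  simp_rw [ENNReal.toReal_ofReal (secMeas_nonneg _)] at h1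
  refine h1.trans (integral_congr_ae ?_)
  filter_upwards [D.ae_mem] with x hx
  rw [ENNReal.toReal_ofReal (D.proj.J₀_pos (D.subset hx)).le]
  rfl

/-- `J₀` is continuous and positive on the compact closure of `Ω`, so the weight may be inserted or
dropped in integrability questions. -/
theorem exists_J₀_bounds : ∃ a b : ℝ, 0 < a ∧ ∀ x ∈ Ω, a ≤ J₀ M φ x ∧ J₀ M φ x ≤ b := by
  have hc := D.proj.continuousOn_J₀.mono D.closure_subset
  rcases (closure Ω).eq_empty_or_nonempty with h | h
  · exact ⟨1, 1, one_pos, fun x hx => absurd (subset_closure hx) (by simp [h])⟩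
  · obtain ⟨y, hy, hmin⟩ := D.isCompact_closure.exists_isMinOn h hc
    obtain ⟨z, hz, hmax⟩ := D.isCompact_closure.exists_isMaxOn h hc
    exact ⟨_, _, D.proj.J₀_pos (D.closure_subset hy), fun x hx =>
      ⟨hmin (subset_closure hx), hmax (subset_closure hx)⟩⟩

theorem integrable_J₀_mul_iff {f : Euc ℓ → ℝ} :
    Integrable (fun x => J₀ M φ x * f x) (volume.restrict Ω) ↔
      Integrable f (volume.restrict Ω) := by
  obtain ⟨a, b, ha, hab⟩ := D.exists_J₀_bounds
  have hm := D.aemeasurable_J₀.aestronglyMeasurable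
  constructor
  · intro h
    have h1 : Integrable (fun x => (J₀ M φ x)⁻¹ * (J₀ M φ x * f x)) (volume.restrict Ω) := by
      refine h.bdd_mul (c := a⁻¹) D.aemeasurable_J₀.inv.aestronglyMeasurable ?_
      filter_upwards [D.ae_mem] with x hx
      rw [norm_inv, Real.norm_of_nonneg (ha.le.trans (hab x hx).1)]
      exact inv_anti₀ ha (hab x hx).1
    refine h1.congr ?_
    filter_upwards [D.ae_mem] with x hx
    exact inv_mul_cancel_left₀ (D.proj.J₀_pos (D.subset hx)).ne' _
  · intro h
    refine h.bdd_mul (c := b) hm ?_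
    filter_upwards [D.ae_mem] with x hx
    rw [Real.norm_of_nonneg (ha.le.trans (hab x hx).1)]
    exact (hab x hx).2

theorem memLp_iff {E : Type*} [NormedAddCommGroup E] [NormedSpace ℝ E] {v : Euc ℓ → E}
    (hv : AEStronglyMeasurable v (surf k (φ '' Ω))) :
    MemLp (fun p => √(secMeas k φ Ω p) • v p) 2 (surf k (φ '' Ω)) ↔
      MemLp (fun x => v (φ x)) 2 (volume.restrict Ω) := by
  have hs : AEStronglyMeasurable (fun p => √(secMeas k φ Ω p) • v p) (surf k (φ '' Ω)) :=
    D.measurable_secMeas.sqrt.aestronglyMeasurable.smul hv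
  rw [memLp_two_iff_integrable_sq_norm (D.aestronglyMeasurable_comp_iff.2 hv),
    memLp_two_iff_integrable_sq_norm hs,
    ← D.integrable_J₀_mul_iff, ← D.integrable_iff (v := fun p => ‖v p‖ ^ 2) (hv.norm.pow 2)]
  simp_rw [norm_smul, mul_pow, Real.norm_of_nonneg (Real.sqrt_nonneg _),
    Real.sq_sqrt (secMeas_nonneg _)]

theorem exists_secMeas_ge {p : Euc ℓ} (hp : p ∈ φ '' Ω) : ∃ O, IsOpen O ∧ p ∈ O ∧
    ∃ m : ℝ, 0 < m ∧ ∀ q ∈ M ∩ O, m ≤ secMeas k φ Ω q := by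
  obtain ⟨O, hO, hpO, -, m, hm, h⟩ := D.proj.exists_measure_fiber_ge D.isOpen D.subset hp
  have hpM := (D.image_subset hp).1
  have hfin := fun q => (D.proj.measure_fiber_lt_top D.subset D.bounded q).ne
  have hmt : m ≠ ⊤ := ne_top_of_le_ne_top (hfin p) (h p ⟨hpM, hpO⟩)
  exact ⟨O, hO, hpO, m.toReal, ENNReal.toReal_pos hm hmt, fun q hq =>
    ENNReal.toReal_mono (hfin q) (h q hq)⟩

/-- `μ` is locally bounded away from zero on `φ(Ω)`, hence on its compact subsets. So the weighted
condition together with measurability already contains the local one. -/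
theorem isL2Loc {E : Type*} [NormedAddCommGroup E] [NormedSpace ℝ E] {v : Euc ℓ → E}
    (hv : AEStronglyMeasurable v (surf k (φ '' Ω)))
    (h : MemLp (fun p => √(secMeas k φ Ω p) • v p) 2 (surf k (φ '' Ω))) :
    IsL2Loc k (φ '' Ω) v := by
  refine ⟨hv, fun K hK hKc => ?_⟩
  obtain ⟨m, hm, hmK⟩ : ∃ m : ℝ, 0 < m ∧ ∀ q ∈ K, m ≤ secMeas k φ Ω q := by
    refine hKc.induction_on (p := fun s => ∃ m : ℝ, 0 < m ∧ ∀ q ∈ s, m ≤ secMeas k φ Ω q)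
      ⟨1, one_pos, by simp⟩ (fun s t hst ⟨m, hm, h⟩ => ⟨m, hm, fun q hq => h q (hst hq)⟩)
      (fun s t ⟨m, hm, h⟩ ⟨m', hm', h'⟩ => ⟨min m m', lt_min hm hm', fun q hq =>
        hq.elim (fun hq => (min_le_left _ _).trans (h q hq))
          fun hq => (min_le_right _ _).trans (h' q hq)⟩) fun q hq => ?_
    obtain ⟨O, hO, hqO, m, hm, h⟩ := D.exists_secMeas_ge (hK hq)
    exact ⟨K ∩ O, inter_mem_nhdsWithin _ (hO.mem_nhds hqO), m, hm, fun q hq =>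
      h q ⟨(D.image_subset (hK hq.1)).1, hq.2⟩⟩
  have hle : surf k K ≤ surf k (φ '' Ω) := Measure.restrict_mono hK le_rfl
  refine (h.mono_measure hle).of_le_mul (c := (√m)⁻¹) (hv.mono_measure hle) ?_
  filter_upwards [ae_restrict_mem hKc.measurableSet] with q hq
  have h1 : 0 < √m := Real.sqrt_pos.2 hm
  rw [norm_smul, Real.norm_of_nonneg (Real.sqrt_nonneg _), ← mul_assoc]
  have h2 : 1 ≤ (√m)⁻¹ * √(secMeas k φ Ω q) := by
    rw [inv_mul_eq_div, one_le_div h1]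
    exact Real.sqrt_le_sqrt (hmK q hq)
  nlinarith [norm_nonneg (v q)]

end IsTubularDomain

end

section

/-! ### Passage between Sobolev functions on the domain and on the submanifold -/

theorem FiberChart.locallyIntegrableOn_comp_proj {ℓ k r : ℕ} {M U S : Set (Euc ℓ)}
    {φ : Euc ℓ → Euc ℓ} {x₀ : Euc ℓ} (f : FiberChart k r M U φ x₀)
    (H : IsNormalProjection k r M U φ) (hSM : S ⊆ M) (hfS : φ '' f.F.source ⊆ S) {n : ℕ}
    {v : Euc ℓ → Euc n} (hv : IsL2Loc k S v) :
    LocallyIntegrableOn (fun x => v (φ x)) f.F.source := by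
  have hAS : f.c.γ '' f.A ⊆ S := by rwa [f.image_γ]
  have h1 : LocallyIntegrableOn (fun y => v (f.c.γ y)) f.A :=
    f.c.locallyIntegrableOn_comp_γ H.one_le f.isOpen_A f.A_subset fun K hK hKc =>
      hv.integrable H.emb H.one_le hSM (hK.trans hAS) hKc
  have hbox : f.F.target ⊆ f.c.e.box f.A univ := by
    rw [f.target]
    exact fun x hx => ⟨hx.1, trivial⟩
  have h4 := (f.c.e.locallyIntegrableOn_comp_tan f.isOpen_A h1).mono_set hbox
  have h5 : LocallyIntegrableOn _ f.F.source :=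
    locallyIntegrableOn_comp_symm (F := f.F.symm) f.contDiffOn_symm h4
  have h6 : IsLocallyClosed f.F.source := f.F.open_source.isLocallyClosed
  rw [locallyIntegrableOn_iff h6] at h5 ⊢
  intro K hK hKc
  refine (h5 K hK hKc).congr_fun (fun x hx => ?_) hKc.measurableSet
  rw [Function.comp_apply, OpenPartialHomeomorph.symm_symm, f.tan_F, f.γ_tan_proj (hK hx)]

theorem integrableOn_inner_continuousOn {ℓ : ℕ} {ν : Measure (Euc ℓ)} {K : Set (Euc ℓ)}
    (hK : IsCompact K) {V Ψ : Euc ℓ → Euc ℓ} (hV : IntegrableOn V K ν) (hΨ : Continuous Ψ) :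
    IntegrableOn (fun q => inner ℝ (V q) (Ψ q)) K ν := by
  obtain ⟨C, hC⟩ := hK.exists_bound_of_continuousOn hΨ.continuousOn
  refine (hV.norm.mul_const C).mono' (hV.1.inner hΨ.aestronglyMeasurable) ?_
  filter_upwards [ae_restrict_mem hK.measurableSet] with q hq
  exact (norm_inner_le_norm _ _).trans (mul_le_mul_of_nonneg_left (hC q hq) (norm_nonneg _))

theorem surfaceDiv_sum {ℓ : ℕ} {M : Set (Euc ℓ)} {ι : Type*} {t : Finset ι}
    {Ψ : ι → Euc ℓ → Euc ℓ} {p : Euc ℓ} (h : ∀ i ∈ t, DifferentiableAt ℝ (Ψ i) p) :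
    surfaceDiv M (fun q => ∑ i ∈ t, Ψ i q) p = ∑ i ∈ t, surfaceDiv M (Ψ i) p := by
  simp_rw [surfaceDiv_eq_trace]
  rw [fderiv_fun_sum h, ContinuousLinearMap.finsetSum_comp, map_sum]

theorem continuousOn_adjoint {ℓ : ℕ} {U : Set (Euc ℓ)} {L : Euc ℓ → Euc ℓ →L[ℝ] Euc ℓ}
    (hL : ContinuousOn L U) : ContinuousOn (fun x => ContinuousLinearMap.adjoint (L x)) U :=
  (ContinuousLinearMap.adjoint (𝕜 := ℝ) (E := Euc ℓ) (F := Euc ℓ)).continuous.comp_continuousOn hL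

theorem locallyIntegrableOn_of_memLp {ℓ : ℕ} {Ω : Set (Euc ℓ)} {E : Type*}
    [NormedAddCommGroup E] {f : Euc ℓ → E} (hf : MemLp f 2 (volume.restrict Ω)) :
    LocallyIntegrableOn f Ω := by
  intro x hx
  refine ⟨Ω ∩ Metric.ball x 1, inter_mem_nhdsWithin _ (Metric.ball_mem_nhds x one_pos), ?_⟩
  have : IsFiniteMeasure (volume.restrict (Ω ∩ Metric.ball x 1)) := ⟨by
    rw [Measure.restrict_apply_univ]
    exact (measure_mono inter_subset_right).trans_lt measure_ball_lt_top⟩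
  exact (hf.mono_measure (Measure.restrict_mono inter_subset_left le_rfl)).integrable one_le_two

namespace IsTubularDomain

variable {ℓ k r : ℕ} {M U Ω : Set (Euc ℓ)} {φ : Euc ℓ → Euc ℓ}
  (D : IsTubularDomain k r M U φ Ω)
include D

theorem exists_image_eq : ∃ Q, IsOpen Q ∧ φ '' Ω = M ∩ Q :=
  D.proj.isOpen_exists_image D.isOpen D.subset

theorem image_subset_M : φ '' Ω ⊆ M := D.image_subset.trans inter_subset_left

theorem integrable_mul_surfaceDiv {v : Euc ℓ → ℝ} (hv : IsL2Loc k (φ '' Ω) v)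
    {Ψ : Euc ℓ → Euc ℓ} (hΨ : ContDiff ℝ 1 Ψ) {K : Set (Euc ℓ)} (hK : IsCompact K)
    (hKG : K ⊆ φ '' Ω) (h0 : ∀ q ∈ φ '' Ω \ K, Ψ q = 0) :
    Integrable (fun q => v q * surfaceDiv M Ψ q) (surf k (φ '' Ω)) := by
  obtain ⟨Q, hQ, hG⟩ := D.exists_image_eq
  have h1 : IntegrableOn v K μHE[k] :=
    hv.integrable D.proj.emb D.proj.one_le D.image_subset_M hKG hK
  have h2 : IntegrableOn (fun q => v q * surfaceDiv M Ψ q) K μHE[k] :=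
    h1.mul_continuousOn ((D.proj.continuousOn_surfaceDiv hΨ).mono (hKG.trans D.image_subset)) hK
  refine h2.of_forall_sdiff_eq_zero D.measurableSet_image fun q hq => ?_
  rw [surfaceDiv_eq_zero D.proj.emb D.proj.two_le hQ hG hΨ hK.isClosed h0 hq, mul_zero]

theorem integrable_inner {V : Euc ℓ → Euc ℓ} (hV : IsL2Loc k (φ '' Ω) V)
    {Ψ : Euc ℓ → Euc ℓ} (hΨ : Continuous Ψ) {K : Set (Euc ℓ)} (hK : IsCompact K)
    (hKG : K ⊆ φ '' Ω) (h0 : ∀ q ∈ φ '' Ω \ K, Ψ q = 0) :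
    Integrable (fun q => inner ℝ (V q) (Ψ q)) (surf k (φ '' Ω)) := by
  have h1 : IntegrableOn V K μHE[k] :=
    hV.integrable D.proj.emb D.proj.one_le D.image_subset_M hKG hK
  refine (integrableOn_inner_continuousOn hK h1 hΨ).of_forall_sdiff_eq_zero D.measurableSet_image
    fun q hq => ?_
  rw [h0 q hq, inner_zero_right]

/-- Being the surface gradient is a local property. -/
theorem isSurfaceGradient_of_local {v : Euc ℓ → ℝ} {V : Euc ℓ → Euc ℓ}
    (hv : IsL2Loc k (φ '' Ω) v) (hV : IsL2Loc k (φ '' Ω) V)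
    (hVt : ∀ᵐ p ∂(surf k (φ '' Ω)), V p ∈ tangentSubspace M p)
    (hloc : ∀ p ∈ φ '' Ω, ∃ O, IsOpen O ∧ p ∈ O ∧ ∀ Ψ : Euc ℓ → Euc ℓ, ContDiff ℝ 1 Ψ →
      (∀ q ∈ φ '' Ω, Ψ q ∈ tangentSubspace M q) → ∀ K ⊆ φ '' Ω ∩ O, IsCompact K →
      (∀ q ∈ φ '' Ω \ K, Ψ q = 0) →
      ∫ q, v q * surfaceDiv M Ψ q ∂(surf k (φ '' Ω)) =
        -∫ q, inner ℝ (V q) (Ψ q) ∂(surf k (φ '' Ω))) :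
    IsSurfaceGradient k r M (φ '' Ω) v V := by
  have hr := D.proj.two_le
  obtain ⟨Q, hQ, hG⟩ := D.exists_image_eq
  refine ⟨hV, hVt, fun Ψ hΨ => ?_, fun Ψ hΨ => ?_, fun Ψ hΨ => ?_⟩
  · obtain ⟨K, hKG, hK, h0⟩ := hΨ.compact
    exact D.integrable_mul_surfaceDiv hv (hΨ.contDiff_one hr) hK hKG h0
  · obtain ⟨K, hKG, hK, h0⟩ := hΨ.compact
    exact D.integrable_inner hV hΨ.contDiff.continuous hK hKG h0
  · obtain ⟨K, hKG, hK, h0⟩ := hΨ.compact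
    have hΨ1 := hΨ.contDiff_one hr
    choose! O hO hpO hloc using hloc
    obtain ⟨t, ζ, htK, hζ, hζs, hsum⟩ := exists_partition hK O (fun p hp => hO p (hKG hp))
      fun p hp => hpO p (hKG hp)
    have hζΨ : ∀ i ∈ t, ContDiff ℝ 1 fun q => ζ i q • Ψ q := fun i hi =>
      ((hζ i hi).of_le (by simp)).smul hΨ1
    have hKi : ∀ i, IsCompact (K ∩ tsupport (ζ i)) := fun i => hK.inter_right (isClosed_tsupport _)
    have h0i : ∀ i, ∀ q ∈ φ '' Ω \ (K ∩ tsupport (ζ i)), ζ i q • Ψ q = 0 := fun i q hq => by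
      by_cases hqK : q ∈ K
      · rw [image_eq_zero_of_notMem_tsupport fun h => hq.2 ⟨hqK, h⟩, zero_smul]
      · rw [h0 q ⟨hq.1, hqK⟩, smul_zero]
    have hsumG : ∀ q ∈ φ '' Ω, ∑ i ∈ t, ζ i q • Ψ q = Ψ q := fun q hq => by
      by_cases hqK : q ∈ K
      · rw [← Finset.sum_smul, hsum q hqK, one_smul]
      · simp [h0 q ⟨hq, hqK⟩]
    have key : ∀ i ∈ t, ∫ q, v q * surfaceDiv M (fun q => ζ i q • Ψ q) q ∂(surf k (φ '' Ω)) =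
        -∫ q, inner ℝ (V q) (ζ i q • Ψ q) ∂(surf k (φ '' Ω)) := fun i hi =>
      hloc i (hKG (htK i hi)) _ (hζΨ i hi)
        (fun q hq => Submodule.smul_mem _ _ (hΨ.tangent q hq)) _
        (fun q hq => ⟨hKG hq.1, hζs i hi hq.2⟩) (hKi i) (h0i i)
    -- The localized fields add up to `Ψ` only on `φ(Ω)`, which suffices because the surface
    -- divergence of a tangent field is determined by its values on `M`.
    have e1 : ∀ q ∈ φ '' Ω, surfaceDiv M Ψ q =
        ∑ i ∈ t, surfaceDiv M (fun q => ζ i q • Ψ q) q := by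
      intro q hq
      have hd : ∀ i ∈ t, DifferentiableAt ℝ (fun q => ζ i q • Ψ q) q := fun i hi =>
        (hζΨ i hi).differentiable one_ne_zero q
      rw [← surfaceDiv_sum hd]
      have hnh := mem_nhdsWithin_of_eq_inter hQ hG hq
      refine surfaceDiv_congr D.proj.emb hr (D.image_subset_M hq)
        (hΨ1.differentiable one_ne_zero q) (DifferentiableAt.fun_sum hd) ?_ ?_
      · filter_upwards [hnh] with z hz using hΨ.tangent z hz
      · filter_upwards [hnh] with z hz using (hsumG z hz).symm
    have e2 : ∫ q, v q * surfaceDiv M Ψ q ∂(surf k (φ '' Ω)) =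
        ∑ i ∈ t, ∫ q, v q * surfaceDiv M (fun q => ζ i q • Ψ q) q ∂(surf k (φ '' Ω)) := by
      rw [← integral_finsetSum _ fun i hi => D.integrable_mul_surfaceDiv hv (hζΨ i hi) (hKi i)
        (fun q hq => hKG hq.1) (h0i i)]
      refine setIntegral_congr_fun D.measurableSet_image fun q hq => ?_
      simp only [e1 q hq, Finset.mul_sum]
    have e3 : ∫ q, inner ℝ (V q) (Ψ q) ∂(surf k (φ '' Ω)) =
        ∑ i ∈ t, ∫ q, inner ℝ (V q) (ζ i q • Ψ q) ∂(surf k (φ '' Ω)) := by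
      rw [← integral_finsetSum _ fun i hi => D.integrable_inner hV (hζΨ i hi).continuous (hKi i)
        (fun q hq => hKG hq.1) (h0i i)]
      refine setIntegral_congr_fun D.measurableSet_image fun q hq => ?_
      simp only [← inner_sum, hsumG q hq]
    rw [e2, e3, ← Finset.sum_neg_distrib]
    exact Finset.sum_congr rfl key

theorem memLp_clm_apply {L : Euc ℓ → Euc ℓ →L[ℝ] Euc ℓ} (hL : ContinuousOn L U)
    {g : Euc ℓ → Euc ℓ} (hg : MemLp g 2 (volume.restrict Ω)) :
    MemLp (fun x => L x (g x)) 2 (volume.restrict Ω) := by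
  obtain ⟨C, hC⟩ := D.isCompact_closure.exists_bound_of_continuousOn (hL.mono D.closure_subset)
  refine hg.of_le_mul (c := C) ?_ ?_
  · exact ContinuousLinearMap.aestronglyMeasurable_comp₂ (ContinuousLinearMap.id ℝ _)
      ((hL.mono D.subset).aestronglyMeasurable D.isOpen.measurableSet) hg.1
  · filter_upwards [D.ae_mem] with x hx
    exact (ContinuousLinearMap.le_opNorm _ _).trans
      (mul_le_mul_of_nonneg_right (hC x (subset_closure hx)) (norm_nonneg _))

/-- A Sobolev function with tangential gradient comes from a Sobolev function on the
submanifold. -/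
theorem exists_surfaceGradient {u : Euc ℓ → ℝ} {g : Euc ℓ → Euc ℓ}
    (hu : MemLp u 2 (volume.restrict Ω)) (hg : MemLp g 2 (volume.restrict Ω))
    (h : IsWeakGradient Ω u g) (hn : ∀ᵐ x ∂(volume.restrict Ω), normalProj M φ x (g x) = 0) :
    ∃ (v : Euc ℓ → ℝ) (V : Euc ℓ → Euc ℓ), IsSurfaceGradient k r M (φ '' Ω) v V ∧
      IsL2Loc k (φ '' Ω) v ∧ (∀ᵐ x ∂(volume.restrict Ω), u x = v (φ x)) ∧
      ∀ᵐ x ∂(volume.restrict Ω), ContinuousLinearMap.adjoint (S₀ M U φ x) (g x) = V (φ x) := by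
  have hul := locallyIntegrableOn_of_memLp hu
  have hgl := locallyIntegrableOn_of_memLp hg
  have hloc : ∀ x ∈ Ω, ∃ f : FiberChart k r M U φ x, f.F.source ⊆ Ω ∧
      ∃ (w : Euc k → ℝ) (b : Euc k → Euc k), LocallyIntegrableOn w f.A ∧
      LocallyIntegrableOn b f.A ∧ IsWeakGradient f.A w b ∧
      (∀ᵐ x ∂(volume.restrict f.F.source), u x = w (f.c.e.tan (φ x))) ∧
      ∀ᵐ x ∂(volume.restrict f.F.source), ContinuousLinearMap.adjoint (S₀ M U φ x) (g x) =
        (tangentSubspace M (φ x)).starProjection (f.c.e.inT (b (f.c.e.tan (φ x)))) := by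
    intro x hx
    obtain ⟨f, hf⟩ := D.proj.exists_fiberChart (D.subset hx) (D.isOpen.mem_nhds hx)
    exact ⟨f, hf, f.exists_of_normalProj_eq_zero D.proj (hul.mono_set hf) (hgl.mono_set hf)
      (h.mono hf) (ae_restrict_of_ae_restrict_of_subset hf hn)⟩
  obtain ⟨v, hv⟩ := D.proj.exists_comp_proj D.isOpen D.subset D.sections (f := u) fun x hx => by
    obtain ⟨f, hf, w, b, -, -, -, h1, -⟩ := hloc x hx
    exact ⟨f.F.source, f.F.open_source, f.mem, hf, fun p => w (f.c.e.tan p), h1⟩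
  -- The gluing argument is used a second time, for the vector field `S₀ᵀ g`: locally it too is a
  -- function of the projection, and the global function becomes the surface gradient.
  obtain ⟨V, hV⟩ := D.proj.exists_comp_proj D.isOpen D.subset D.sections
    (f := fun x => ContinuousLinearMap.adjoint (S₀ M U φ x) (g x)) fun x hx => by
    obtain ⟨f, hf, w, b, -, -, -, -, h1⟩ := hloc x hx
    exact ⟨f.F.source, f.F.open_source, f.mem, hf,
      fun p => (tangentSubspace M p).starProjection (f.c.e.inT (b (f.c.e.tan p))), h1⟩
  have hSg := D.memLp_clm_apply (continuousOn_adjoint D.proj.continuousOn_S₀) hg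
  have hvφ : MemLp (fun x => v (φ x)) 2 (volume.restrict Ω) := (memLp_congr_ae hv).1 hu
  have hVφ : MemLp (fun x => V (φ x)) 2 (volume.restrict Ω) := (memLp_congr_ae hV).1 hSg
  have hvm := D.aestronglyMeasurable_comp_iff.1 hvφ.1
  have hVm := D.aestronglyMeasurable_comp_iff.1 hVφ.1
  have hvL := D.isL2Loc hvm ((D.memLp_iff hvm).2 hvφ)
  have hVL := D.isL2Loc hVm ((D.memLp_iff hVm).2 hVφ)
  have hVt : ∀ᵐ p ∂(surf k (φ '' Ω)), V p ∈ tangentSubspace M p := by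
    rw [← D.ae_comp_iff]
    filter_upwards [hV, D.ae_mem] with x hx hxΩ
    rw [← hx]
    exact D.proj.adjoint_S₀_mem (D.subset hxΩ) _
  refine ⟨v, V, D.isSurfaceGradient_of_local hvL hVL hVt ?_, hvL, hv, hV⟩
  rintro _ ⟨x, hx, rfl⟩
  obtain ⟨f, hf, w, b, hw, hb, hwb, h1, h2⟩ := hloc x hx
  obtain ⟨Q, hQ, hG⟩ := D.exists_image_eq
  obtain ⟨O, hO, hfO⟩ := D.proj.isOpen_exists_image f.F.open_source f.source_subset
  have hAG : f.c.γ '' f.A ⊆ φ '' Ω := by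
    rw [f.image_γ]
    exact image_mono hf
  refine ⟨O, hO, ?_, fun Ψ hΨ hΨt K hK hKc h0 => ?_⟩
  · have : φ x ∈ M ∩ O := hfO ▸ ⟨x, f.mem, rfl⟩
    exact this.2
  have hvw : w =ᵐ[volume.restrict f.A] fun y => v (f.c.γ y) := by
    refine f.ae_source_iff.1 ?_
    filter_upwards [h1, ae_restrict_of_ae_restrict_of_subset hf hv,
      ae_restrict_mem f.F.open_source.measurableSet] with x h1 h2 hxs
    rw [f.γ_tan_proj hxs, ← h1, h2]
  have hVb : ∀ᵐ y ∂(volume.restrict f.A), V (f.c.γ y) =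
      (tangentSubspace M (f.c.γ y)).starProjection (f.c.e.inT (b y)) := by
    refine f.ae_source_iff.1 ?_
    filter_upwards [h2, ae_restrict_of_ae_restrict_of_subset hf hV,
      ae_restrict_mem f.F.open_source.measurableSet] with x h1 h2 hxs
    rw [f.γ_tan_proj hxs, ← h1, h2]
  refine f.c.integral_mul_surfaceDiv D.proj.emb D.proj.two_le hQ hG D.measurableSet_image
    f.isOpen_A f.A_subset hAG (h := b) ?_ hb (hwb.congr_ae hvw (ae_eq_refl b)) ?_ ?_ hΨ hΨt hKc
    ?_ h0 (D.integrable_mul_surfaceDiv hvL hΨ hKc (fun q hq => (hK hq).1) h0).1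
    (D.integrable_inner hVL hΨ.continuous hKc (fun q hq => (hK hq).1) h0).1
  · exact f.c.locallyIntegrableOn_comp_γ D.proj.one_le f.isOpen_A f.A_subset fun K hK hKc =>
      hvL.integrable D.proj.emb D.proj.one_le D.image_subset_M (hK.trans hAG) hKc
  · filter_upwards [hVb] with y hy
    rw [hy]
    exact Submodule.starProjection_apply_mem _ _
  -- `Dγᵀ V = b`, because `Dγ a` is tangent and has tangential coordinate `a`.
  · filter_upwards [hVb, ae_restrict_mem f.isOpen_A.measurableSet] with y hy hyA
    refine ext_inner_right ℝ fun a => ?_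
    rw [ContinuousLinearMap.adjoint_inner_left, hy, Submodule.inner_starProjection_left_eq_right,
      Submodule.starProjection_eq_self_iff.2 (f.c.fderiv_mem_tangent (f.A_subset hyA) a),
      f.c.e.inner_inT, f.c.tan_fderiv D.proj.one_le (f.A_subset hyA)]
  · intro q hq
    rw [f.image_γ, hfO]
    exact ⟨D.image_subset_M (hK hq).1, (hK hq).2⟩

/-- The composition of a Sobolev function on the submanifold with the projection. -/
theorem isWeakGradient_comp {v : Euc ℓ → ℝ} {V : Euc ℓ → Euc ℓ}
    (h : IsSurfaceGradient k r M (φ '' Ω) v V) (hv : IsL2Loc k (φ '' Ω) v)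
    (hvl : LocallyIntegrableOn (fun x => v (φ x)) Ω) :
    LocallyIntegrableOn (fun x => ContinuousLinearMap.adjoint (fderiv ℝ φ x) (V (φ x))) Ω ∧
    IsWeakGradient Ω (fun x => v (φ x))
      fun x => ContinuousLinearMap.adjoint (fderiv ℝ φ x) (V (φ x)) := by
  obtain ⟨Q, hQ, hG⟩ := D.exists_image_eq
  have hV : LocallyIntegrableOn (fun x => V (φ x)) Ω := fun x hx => by
    obtain ⟨f, hf⟩ := D.proj.exists_fiberChart (D.subset hx) (D.isOpen.mem_nhds hx)
    obtain ⟨s, hs, hi⟩ := f.locallyIntegrableOn_comp_proj D.proj D.image_subset_M (image_mono hf)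
      h.isL2Loc x f.mem
    refine ⟨s, mem_nhdsWithin_of_mem_nhds ?_, hi⟩
    rwa [f.F.open_source.nhdsWithin_eq f.mem] at hs
  have hgl := locallyIntegrableOn_clm_apply D.isOpen
    ((continuousOn_adjoint D.proj.continuousOn_fderiv).mono D.subset) hV
  refine ⟨hgl, IsWeakGradient.of_local hvl hgl fun x hx => ?_⟩
  obtain ⟨f, hf⟩ := D.proj.exists_fiberChart (D.subset hx) (D.isOpen.mem_nhds hx)
  refine ⟨f.F.source, f.F.open_source, f.mem, ?_⟩
  exact (f.isWeakGradient_comp_proj D.proj hQ hG D.measurableSet_image (image_mono hf) h hv).mono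
    inter_subset_left

end IsTubularDomain

end

section

/-! ### Hilbert products and operators generated by forms -/

section Hilbert

theorem IsHilbertProduct.of_equiv {V W : Type*} [AddCommGroup V] [Module ℝ V] [AddCommGroup W]
    [Module ℝ W] {b : V → V → ℝ} {b' : W → W → ℝ} (hb : IsHilbertProduct b) (e : W ≃ₗ[ℝ] V)
    (h : ∀ v w, b' v w = b (e v) (e w)) : IsHilbertProduct b' := by
  obtain ⟨c, hc, hcomp⟩ := hb
  let c' : InnerProductSpace.Core ℝ W :=
    { inner := fun v w => c.inner (e v) (e w)
      conj_inner_symm := fun v w => c.conj_inner_symm _ _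
      re_inner_nonneg := fun v => c.re_inner_nonneg _
      add_left := fun v w z => by
        rw [map_add]
        exact c.add_left _ _ _
      smul_left := fun v w z => by
        rw [map_smul]
        exact c.smul_left _ _ _
      definite := fun v hv => by
        have := c.definite _ hv
        exact (LinearEquiv.map_eq_zero_iff e).1 this }
  refine ⟨c', fun v w => ((h v w).trans (hc _ _).symm).symm, ?_⟩
  let nV : NormedAddCommGroup V := c.toNormedAddCommGroup
  let nW : NormedAddCommGroup W := c'.toNormedAddCommGroup
  have hn : ∀ v : W, ‖e v‖ = ‖v‖ := fun v => rfl
  have hiso : Isometry e := AddMonoidHomClass.isometry_of_norm e hn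
  exact (completeSpace_congr (e := e.toEquiv) hiso.isUniformEmbedding).2 hcomp

theorem isHilbertProduct_of_injective {V H : Type*} [AddCommGroup V] [Module ℝ V]
    [NormedAddCommGroup H] [InnerProductSpace ℝ H] [CompleteSpace H] (T : V →ₗ[ℝ] H)
    (hT : Function.Injective T) (hc : IsClosed (range T)) {b : V → V → ℝ}
    (h : ∀ v w, b v w = inner ℝ (T v) (T w)) : IsHilbertProduct b := by
  let c : InnerProductSpace.Core ℝ V :=
    { inner := fun v w => inner ℝ (T v) (T w)
      conj_inner_symm := fun v w => by simp [real_inner_comm]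
      re_inner_nonneg := fun v => by simp
      add_left := fun v w z => by simp [inner_add_left]
      smul_left := fun v w z => by simp [real_inner_smul_left]
      definite := fun v hv => by
        have : T v = 0 := inner_self_eq_zero.1 hv
        exact (map_eq_zero_iff T hT).1 this }
  refine ⟨c, fun v w => (h v w).symm, ?_⟩
  let nV : NormedAddCommGroup V := c.toNormedAddCommGroup
  have hn : ∀ v : V, ‖T v‖ = ‖v‖ := fun v => by
    rw [norm_eq_sqrt_real_inner (T v)]
    rfl
  have hiso : Isometry T := AddMonoidHomClass.isometry_of_norm T hn
  exact (completeSpace_iff_isComplete_range hiso.isUniformInducing).2 hc.isComplete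

/-- A bounded left inverse on the closed subspace `R` makes `E` injective there with closed image,
so the pulled back product is complete. It is used with `E` a multiplication operator involving
`√J₀`. -/
theorem isHilbertProduct_submodule {H : Type*} [NormedAddCommGroup H] [InnerProductSpace ℝ H]
    [CompleteSpace H] {R : Submodule ℝ H} (hR : IsClosed (R : Set H)) {E E' : H →L[ℝ] H}
    (hE : ∀ x ∈ R, E' (E x) = x) {b : R → R → ℝ}
    (h : ∀ v w : R, b v w = inner ℝ (E v) (E w)) : IsHilbertProduct b := by
  refine isHilbertProduct_of_injective (E.toLinearMap ∘ₗ R.subtype) ?_ ?_ h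
  · intro x y hxy
    have := congrArg E' hxy
    exact Subtype.ext (((hE x x.2).symm.trans this).trans (hE y y.2))
  · rw [← isSeqClosed_iff_isClosed]
    intro y z hy hz
    choose x hx using hy
    have h1 : Tendsto (fun n => (x n : H)) atTop (𝓝 (E' z)) := by
      have h2 := (E'.continuous.tendsto z).comp hz
      refine h2.congr fun n => ?_
      rw [Function.comp_apply, ← hx n]
      exact hE _ (x n).2
    have h3 : E' z ∈ R := hR.mem_of_tendsto h1 (Eventually.of_forall fun n => (x n).2)
    refine ⟨⟨E' z, h3⟩, ?_⟩
    have h4 := (E.continuous.tendsto (E' z)).comp h1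
    refine tendsto_nhds_unique h4 (hz.congr fun n => ?_)
    exact (hx n).symm

/-- Let `K = ι ι*`, a bounded symmetric operator; it is injective with dense range because `ι` has
dense range. The relation `⟨x, y⟩ = ⟨u + w, ι y⟩` for all `y` means `x = ι* (u + w)`, so the graph
is given by `K (u + w) = u`. Thus `A = K⁻¹ - 1`, and the inverse of an injective bounded symmetric
operator is self-adjoint. -/
theorem exists_generated_aux {V W : Type*} [NormedAddCommGroup V] [InnerProductSpace ℝ V]
    [CompleteSpace V] [NormedAddCommGroup W] [InnerProductSpace ℝ W] [CompleteSpace W]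
    (ι : W →L[ℝ] V) (hd : DenseRange ι) :
    ∃ A : V →ₗ.[ℝ] V, (∀ u w : V, (u, w) ∈ A.graph ↔
      ∃ x : W, ι x = u ∧ ∀ y : W, inner ℝ x y = inner ℝ (u + w) (ι y)) ∧
      (∀ v : V, ∀ δ > 0, ∃ d ∈ A.domain, inner ℝ (v - d) (v - d) < δ) ∧
      ∀ v w : V, (v, w) ∈ A.graph ↔ ∀ x : A.domain, inner ℝ (A x) v = inner ℝ (x : V) w := by
  set K : V →L[ℝ] V := ι ∘L ContinuousLinearMap.adjoint ι with hK
  have hKs : ∀ f g : V, inner ℝ (K f) g = inner ℝ f (K g) := fun f g => by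
    rw [hK, ContinuousLinearMap.comp_apply, ContinuousLinearMap.comp_apply,
      ← ContinuousLinearMap.adjoint_inner_right, ContinuousLinearMap.adjoint_inner_left]
  have hK0 : ∀ f : V, K f = 0 → f = 0 := by
    intro f hf
    have h1 : ContinuousLinearMap.adjoint ι f = 0 := by
      rw [← inner_self_eq_zero (𝕜 := ℝ), ContinuousLinearMap.adjoint_inner_left]
      have : ι (ContinuousLinearMap.adjoint ι f) = 0 := hf
      rw [this, inner_zero_right]
    refine hd.eq_zero_of_inner_left ℝ (x := f) fun y => ?_
    rw [← ContinuousLinearMap.adjoint_inner_left, h1, inner_zero_left]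
  let g : Submodule ℝ (V × V) :=
    LinearMap.ker ((K : V →ₗ[ℝ] V) ∘ₗ (LinearMap.fst ℝ V V + LinearMap.snd ℝ V V) -
      LinearMap.fst ℝ V V)
  have hg : ∀ u w, (u, w) ∈ g ↔ K (u + w) = u := fun u w => by
    rw [LinearMap.mem_ker, LinearMap.sub_apply, sub_eq_zero]
    rfl
  have hg0 : ∀ x ∈ g, x.1 = 0 → x.2 = 0 := by
    rintro ⟨u, w⟩ hx hu
    change u = 0 at hu
    rw [hg, hu, zero_add] at hx
    exact hK0 w hx
  have hgr : g.toLinearPMap.graph = g := g.toLinearPMap_graph_eq hg0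
  have hmem : ∀ x : g.toLinearPMap.domain, K (x + g.toLinearPMap x) = x := fun x => by
    exact (hg _ _).1 (hgr.le (LinearPMap.mem_graph _ x))
  have hdom : ∀ f : V, ∃ x : g.toLinearPMap.domain, (x : V) = K f ∧
      g.toLinearPMap x = f - K f := fun f => by
    have : (K f, f - K f) ∈ g.toLinearPMap.graph := by
      rw [hgr, hg, add_sub_cancel]
    obtain ⟨x, h1, h2⟩ := (LinearPMap.mem_graph_iff _).1 this
    exact ⟨x, h1, h2⟩
  refine ⟨g.toLinearPMap, fun u w => ?_, ?_, fun v w => ?_⟩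
  · rw [hgr, hg]
    constructor
    · intro h
      refine ⟨ContinuousLinearMap.adjoint ι (u + w), h, fun y => ?_⟩
      rw [ContinuousLinearMap.adjoint_inner_left]
    · rintro ⟨x, rfl, hx⟩
      have : ContinuousLinearMap.adjoint ι (ι x + w) = x := by
        refine ext_inner_right ℝ fun y => ?_
        rw [ContinuousLinearMap.adjoint_inner_left, hx]
      rw [hK, ContinuousLinearMap.comp_apply, this]
  · intro v δ hδ
    have hdense : DenseRange K := by
      -- By symmetry the orthogonal complement of the range of `K` is its kernel.
      have h1 : (LinearMap.range (K : V →ₗ[ℝ] V))ᗮ = ⊥ := by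
        rw [Submodule.eq_bot_iff]
        intro f hf
        refine hK0 f (inner_self_eq_zero (𝕜 := ℝ).1 ?_)
        rw [hKs]
        rw [real_inner_comm]
        exact (Submodule.mem_orthogonal _ _).1 hf _ ⟨K f, rfl⟩
      have h2 := (Submodule.topologicalClosure_eq_top_iff).2 h1
      have h3 := (Submodule.dense_iff_topologicalClosure_eq_top).2 h2
      exact h3
    obtain ⟨f, hf⟩ := hdense.exists_dist_lt v (Real.sqrt_pos.2 hδ)
    obtain ⟨x, hx, -⟩ := hdom f
    refine ⟨x, x.2, ?_⟩
    rw [real_inner_self_eq_norm_sq, hx, ← dist_eq_norm]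
    calc dist v (K f) ^ 2 < √δ ^ 2 := by gcongr
      _ = δ := Real.sq_sqrt hδ.le
  · rw [hgr, hg]
    constructor
    · intro h x
      have h1 := hmem x
      have h2 : inner ℝ (K (x + g.toLinearPMap x)) (v + w) =
          inner ℝ ((x : V) + g.toLinearPMap x) v := by rw [hKs, h]
      rw [h1, inner_add_right, inner_add_left] at h2
      linarith
    · intro h
      refine ext_inner_left ℝ fun f => ?_
      obtain ⟨x, h1, h2⟩ := hdom f
      have := h x
      rw [h1, h2, inner_sub_left] at this
      rw [← hKs, inner_add_right]
      linarith

/-- The operator generated by a pair of forms is self-adjoint. -/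
theorem exists_generated {V W : Type*} [AddCommGroup V] [Module ℝ V] [AddCommGroup W]
    [Module ℝ W] {b : V → V → ℝ} (hb : IsHilbertProduct b) {q : W → W → ℝ}
    (hq : IsHilbertProduct q) (ι : W →ₗ[ℝ] V) (hle : ∀ w, b (ι w) (ι w) ≤ q w w)
    (hd : ∀ v, ∀ δ > 0, ∃ w, b (v - ι w) (v - ι w) < δ) :
    ∃ A : V →ₗ.[ℝ] V, (∀ u w : V, (u, w) ∈ A.graph ↔
      ∃ x : W, ι x = u ∧ ∀ y : W, q x y = b (u + w) (ι y)) ∧ IsSelfAdjointFor b A := by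
  obtain ⟨c, hc, hcomp⟩ := hb
  obtain ⟨c', hc', hcomp'⟩ := hq
  let nV : NormedAddCommGroup V := c.toNormedAddCommGroup
  let iV : InnerProductSpace ℝ V := InnerProductSpace.ofCore c.toCore
  let nW : NormedAddCommGroup W := c'.toNormedAddCommGroup
  let iW : InnerProductSpace ℝ W := InnerProductSpace.ofCore c'.toCore
  have hbi : ∀ v w : V, b v w = inner ℝ v w := fun v w => (hc v w).symm
  have hqi : ∀ v w : W, q v w = inner ℝ v w := fun v w => (hc' v w).symm
  let ι' : W →L[ℝ] V := ι.mkContinuous 1 fun w => by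
    have := hle w
    rw [hbi, hqi, real_inner_self_eq_norm_sq, real_inner_self_eq_norm_sq] at this
    rw [one_mul]
    exact (sq_le_sq₀ (norm_nonneg _) (norm_nonneg _)).1 this
  have hd' : DenseRange ι' := by
    intro v
    rw [Metric.mem_closure_range_iff]
    intro ε hε
    obtain ⟨w, hw⟩ := hd v (ε ^ 2) (by positivity)
    refine ⟨w, ?_⟩
    rw [hbi, real_inner_self_eq_norm_sq] at hw
    rw [dist_eq_norm]
    exact (sq_lt_sq₀ (norm_nonneg _) hε.le).1 hw
  obtain ⟨A, h1, h2, h3⟩ := exists_generated_aux ι' hd'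
  refine ⟨A, fun u w => ?_, ?_, fun v w => ?_⟩
  · rw [h1]
    simp_rw [hbi, hqi]
    rfl
  · simp_rw [hbi]
    exact h2
  · rw [h3]
    simp_rw [hbi]

end Hilbert

end

/-! ### Gradients of functions of the projection, and descriptions of `H¹_s(Ω)` and `L²_s(Ω)` -/

section

section Classical

variable {ℓ : ℕ} {Ω : Set (Euc ℓ)}

/-- `weakGradient` is an arbitrary choice; this allows it to be replaced by any explicit weak
gradient. -/
theorem weakGradient_ae_eq (hΩ : IsOpen Ω) {u : Euc ℓ → ℝ} {g : Euc ℓ → Euc ℓ}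
    (hg : MemLp g 2 (volume.restrict Ω)) (h : IsWeakGradient Ω u g) :
    weakGradient Ω u =ᵐ[volume.restrict Ω] g := by
  have hex : ∃ g : Euc ℓ → Euc ℓ, MemLp g 2 (volume.restrict Ω) ∧ IsWeakGradient Ω u g := ⟨g, hg, h⟩
  have he : weakGradient Ω u = hex.choose := dif_pos hex
  rw [he]
  exact hex.choose_spec.2.ae_eq hΩ h (locallyIntegrableOn_of_memLp hex.choose_spec.1)
    (locallyIntegrableOn_of_memLp hg)

/-- The gradient of a function of class `C¹` is its weak gradient. -/
theorem isWeakGradient_of_contDiffOn (hΩ : IsOpen Ω) {f : Euc ℓ → ℝ} (hf : ContDiffOn ℝ 1 f Ω) :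
    IsWeakGradient Ω f fun x => (InnerProductSpace.toDual ℝ (Euc ℓ)).symm (fderiv ℝ f x) := by
  intro ψ hψ hψc hψs a
  have hψ1 : ContDiff ℝ 1 ψ := hψ.of_le (by simp)
  have h0 : ∀ x ∉ tsupport ψ, ∀ᶠ z in 𝓝 x, ψ z = 0 := fun x hx => by
    filter_upwards [(isClosed_tsupport ψ).isOpen_compl.mem_nhds hx] with z hz
    exact image_eq_zero_of_notMem_tsupport hz
  set P : Euc ℓ → ℝ := fun x => ψ x * f x with hP
  have hP1 : ContDiff ℝ 1 P := by
    rw [contDiff_iff_contDiffAt]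
    intro x
    by_cases hx : x ∈ tsupport ψ
    · exact hψ1.contDiffAt.mul (hf.contDiffAt (hΩ.mem_nhds (hψs hx)))
    · refine (contDiffAt_const (c := (0 : ℝ))).congr_of_eventuallyEq ?_
      filter_upwards [h0 x hx] with z hz
      rw [hP]
      simp only [hz, zero_mul]
  have hPc : HasCompactSupport fun x => P x • a := (hψc.mul_right).smul_right
  have hdiv : ∀ x, divergence (fun x => P x • a) x = fderiv ℝ P x a := fun x => by
    rw [divergence_smul (hP1.differentiable one_ne_zero x) (differentiableAt_const a), divergence]
    simp
  have hD : ∀ x ∈ Ω, fderiv ℝ P x a = ψ x * fderiv ℝ f x a + f x * fderiv ℝ ψ x a := by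
    intro x hx
    have h1 : HasFDerivAt P (ψ x • fderiv ℝ f x + f x • fderiv ℝ ψ x) x :=
      (hψ1.differentiable one_ne_zero x).hasFDerivAt.mul
        ((hf.contDiffAt (hΩ.mem_nhds hx)).differentiableAt one_ne_zero).hasFDerivAt
    rw [h1.fderiv]
    rfl
  have key : ∫ x, fderiv ℝ P x a = 0 := by
    have := integral_divergence_eq_zero (X := fun x => P x • a) (hP1.smul contDiff_const) hPc
    simpa only [hdiv] using this
  have hs : ∫ x in Ω, fderiv ℝ P x a = 0 := by
    rw [setIntegral_eq_integral_of_tsupport hψs, key]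
    intro x hx
    have : P =ᶠ[𝓝 x] fun _ => 0 := by
      filter_upwards [h0 x hx] with z hz
      rw [hP]
      simp only [hz, zero_mul]
    rw [this.fderiv_eq]
    simp
  rw [setIntegral_congr_fun hΩ.measurableSet hD] at hs
  have hi1 : IntegrableOn (fun x => f x * fderiv ℝ ψ x a) Ω :=
    (integrable_mul_of_locallyIntegrableOn (hf.continuousOn.locallyIntegrableOn hΩ.measurableSet)
      ((hψ1.continuous_fderiv one_ne_zero).clm_apply continuous_const)
      (hψc.fderiv_apply (𝕜 := ℝ) a) ((tsupport_fderiv_apply_subset ℝ a).trans hψs)).integrableOn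
  have hi2 : IntegrableOn (fun x => ψ x * fderiv ℝ f x a) Ω := by
    have h1 : ContinuousOn (fun x => fderiv ℝ f x a) Ω :=
      (hf.continuousOn_fderiv_of_isOpen hΩ le_rfl).clm_apply continuousOn_const
    have := integrable_mul_of_locallyIntegrableOn (h1.locallyIntegrableOn hΩ.measurableSet)
      hψ1.continuous hψc hψs
    refine this.integrableOn.congr_fun (fun x _ => mul_comm _ _) hΩ.measurableSet
  rw [integral_add hi2 hi1] at hs
  simp_rw [InnerProductSpace.toDual_symm_apply]
  linarith

end Classical

namespace IsTubularDomain

variable {ℓ k r : ℕ} {M U Ω : Set (Euc ℓ)} {φ : Euc ℓ → Euc ℓ}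
  (D : IsTubularDomain k r M U φ Ω)
include D

theorem isFiniteMeasure : IsFiniteMeasure (volume.restrict Ω) := ⟨by
  rw [Measure.restrict_apply_univ]
  exact D.bounded.measure_lt_top⟩

theorem memLp_of_continuousOn {E : Type*} [NormedAddCommGroup E] {f : Euc ℓ → E}
    (hf : ContinuousOn f U) [SecondCountableTopology E] : MemLp f 2 (volume.restrict Ω) := by
  have := D.isFiniteMeasure
  obtain ⟨C, hC⟩ := D.isCompact_closure.exists_bound_of_continuousOn (hf.mono D.closure_subset)
  refine MemLp.of_bound ((hf.mono D.subset).aestronglyMeasurable D.isOpen.measurableSet) C ?_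
  filter_upwards [D.ae_mem] with x hx
  exact hC x (subset_closure hx)

/-- The surface gradient is unique. -/
theorem surfaceGradient_ae_eq {v : Euc ℓ → ℝ} {V : Euc ℓ → Euc ℓ}
    (h : IsSurfaceGradient k r M (φ '' Ω) v V) (hv : IsL2Loc k (φ '' Ω) v)
    (hvl : LocallyIntegrableOn (fun x => v (φ x)) Ω) :
    surfaceGradient k r M (φ '' Ω) v =ᵐ[surf k (φ '' Ω)] V := by
  have hex : ∃ V : Euc ℓ → Euc ℓ, IsSurfaceGradient k r M (φ '' Ω) v V := ⟨V, h⟩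
  have he : surfaceGradient k r M (φ '' Ω) v = hex.choose := dif_pos hex
  rw [he]
  have h' := hex.choose_spec
  set V' := hex.choose
  -- Two surface gradients of `v` lift to weak gradients of `v ∘ φ` on `Ω`, which agree almost
  -- everywhere; applying `S₀ᵀ` recovers the original fields.
  obtain ⟨h1, h2⟩ := D.isWeakGradient_comp h hv hvl
  obtain ⟨h3, h4⟩ := D.isWeakGradient_comp h' hv hvl
  refine D.ae_comp_iff.1 ?_
  filter_upwards [h4.ae_eq D.isOpen h2 h3 h1, D.ae_comp_iff.2 h.tangent, D.ae_comp_iff.2 h'.tangent,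
    D.ae_mem] with x hx ht ht' hxΩ
  have := congrArg (ContinuousLinearMap.adjoint (S₀ M U φ x)) hx
  rwa [D.proj.adjoint_S₀_adjoint_fderiv (D.subset hxΩ) ht,
    D.proj.adjoint_S₀_adjoint_fderiv (D.subset hxΩ) ht'] at this

/-- The weak gradient of a function on `Ω` that comes from a function on the submanifold. -/
theorem weakGradient_comp_ae_eq {u v : Euc ℓ → ℝ} {V : Euc ℓ → Euc ℓ}
    (hu : MemLp u 2 (volume.restrict Ω)) (huv : ∀ᵐ x ∂(volume.restrict Ω), u x = v (φ x))
    (h : IsSurfaceGradient k r M (φ '' Ω) v V) (hv : IsL2Loc k (φ '' Ω) v)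
    (hV : MemLp (fun x => V (φ x)) 2 (volume.restrict Ω)) :
    MemLp (fun x => ContinuousLinearMap.adjoint (fderiv ℝ φ x) (V (φ x))) 2 (volume.restrict Ω) ∧
    IsWeakGradient Ω u (fun x => ContinuousLinearMap.adjoint (fderiv ℝ φ x) (V (φ x))) ∧
    (∀ᵐ x ∂(volume.restrict Ω), ContinuousLinearMap.adjoint (S₀ M U φ x) (weakGradient Ω u x) =
      surfaceGradient k r M (φ '' Ω) v (φ x)) := by
  have hvφ : MemLp (fun x => v (φ x)) 2 (volume.restrict Ω) := (memLp_congr_ae huv).1 hu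
  have hvl := locallyIntegrableOn_of_memLp hvφ
  have h1 := D.memLp_clm_apply (continuousOn_adjoint D.proj.continuousOn_fderiv) hV
  have h2 := (D.isWeakGradient_comp h hv hvl).2
  have h3 := h2.congr_ae (EventuallyEq.symm huv) (ae_eq_refl _)
  refine ⟨h1, h3, ?_⟩
  filter_upwards [weakGradient_ae_eq D.isOpen h1 h3, D.ae_comp_iff.2 h.tangent,
    D.ae_comp_iff.2 (D.surfaceGradient_ae_eq h hv hvl), D.ae_mem] with x hx ht hs hxΩ
  rw [hx, hs, D.proj.adjoint_S₀_adjoint_fderiv (D.subset hxΩ) ht]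

/-- The dictionary between the two Sobolev spaces: from `g` on `Ω` the field `S₀ᵀ g` descends to the
submanifold, and from `V` there one obtains `g = Dφᵀ (V ∘ φ)`. Both multipliers are bounded on `Ω`,
so square integrability is kept. -/
theorem mem_H1s_iff {u : Lp ℝ 2 (volume.restrict Ω : Measure (Euc ℓ))} {v : Euc ℓ → ℝ}
    (huv : ∀ᵐ x ∂(volume.restrict Ω), u x = v (φ x)) :
    u ∈ H1s M φ Ω ↔ ∃ V : Euc ℓ → Euc ℓ, IsSurfaceGradient k r M (φ '' Ω) v V ∧
      MemLp (fun p => √(secMeas k φ Ω p) • V p) 2 (surf k (φ '' Ω)) := by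
  have hvφ : MemLp (fun x => v (φ x)) 2 (volume.restrict Ω) := (memLp_congr_ae huv).1 (Lp.memLp u)
  have hvm := D.aestronglyMeasurable_comp_iff.1 hvφ.1
  have hvL := D.isL2Loc hvm ((D.memLp_iff hvm).2 hvφ)
  constructor
  · rintro ⟨g, hg, hug, hgP⟩
    obtain ⟨w, V, h1, h2, h3, h4⟩ := D.exists_surfaceGradient (Lp.memLp u) hg hug hgP
    have hwv : w =ᵐ[surf k (φ '' Ω)] v := by
      refine D.ae_comp_iff.1 ?_
      filter_upwards [h3, huv] with x hx hx'
      rw [← hx, hx']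
    refine ⟨V, h1.congr hwv, ?_⟩
    rw [D.memLp_iff h1.isL2Loc.1]
    exact (memLp_congr_ae h4).1
      (D.memLp_clm_apply (continuousOn_adjoint D.proj.continuousOn_S₀) hg)
  · rintro ⟨V, hV, hV2⟩
    rw [D.memLp_iff hV.isL2Loc.1] at hV2
    obtain ⟨h1, h2, -⟩ := D.weakGradient_comp_ae_eq (Lp.memLp u) huv hV hvL hV2
    refine ⟨_, h1, h2, ?_⟩
    filter_upwards [D.ae_mem] with x hx
    exact IsNormalProjection.normalProj_eq_zero_iff.2 (D.proj.adjoint_fderiv_mem (D.subset hx) _)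

theorem exists_comp_of_mem_H1s {u : Lp ℝ 2 (volume.restrict Ω : Measure (Euc ℓ))}
    (hu : u ∈ H1s M φ Ω) : ∃ v : Euc ℓ → ℝ, ∀ᵐ x ∂(volume.restrict Ω), u x = v (φ x) := by
  obtain ⟨g, hg, hug, hgP⟩ := hu
  obtain ⟨w, V, -, -, h3, -⟩ := D.exists_surfaceGradient (Lp.memLp u) hg hug hgP
  exact ⟨w, h3⟩

/-- Supplies enough elements of `H¹_s(Ω)` for density. The gradient of `f ∘ φ` is tangential since
`Dφ` kills normal vectors, and it is bounded on `Ω` since the closure of `Ω` is compact in `U`. -/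
theorem toLp_comp_mem_H1s {f : Euc ℓ → ℝ} (hf : ContDiff ℝ 1 f) :
    ∃ h : MemLp (fun x => f (φ x)) 2 (volume.restrict Ω), h.toLp ∈ H1s M φ Ω := by
  have hfφ : ContDiffOn ℝ 1 (fun x => f (φ x)) U := hf.comp_contDiffOn D.proj.contDiffOn
  have h1 := D.memLp_of_continuousOn hfφ.continuousOn
  have hg : ContinuousOn (fun x => (InnerProductSpace.toDual ℝ (Euc ℓ)).symm
      (fderiv ℝ (fun x => f (φ x)) x)) U :=
    (InnerProductSpace.toDual ℝ (Euc ℓ)).symm.continuous.comp_continuousOn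
      (hfφ.continuousOn_fderiv_of_isOpen D.proj.tub.isOpen le_rfl)
  refine ⟨h1, _, D.memLp_of_continuousOn hg,
    (isWeakGradient_of_contDiffOn D.isOpen (hfφ.mono D.subset)).congr_ae h1.coeFn_toLp.symm
      (ae_eq_refl _), ?_⟩
  filter_upwards [D.ae_mem] with x hx
  have hxU := D.subset hx
  rw [IsNormalProjection.normalProj_eq_zero_iff,
    ← Submodule.orthogonal_orthogonal (tangentSubspace M (φ x))]
  refine (Submodule.mem_orthogonal _ _).2 fun n hn => ?_
  have hd : HasFDerivAt (fun x => f (φ x)) (fderiv ℝ f (φ x) ∘L fderiv ℝ φ x) x :=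
    (hf.differentiable one_ne_zero _).hasFDerivAt.comp x (D.proj.hasFDerivAt hxU)
  rw [real_inner_comm, InnerProductSpace.toDual_symm_apply, hd.fderiv,
    ContinuousLinearMap.comp_apply, (D.proj.fderiv_eq_zero_iff hxU n).2 hn, map_zero]

/-- The space `L²_s(Ω)` consists of the functions of the projection. -/
theorem mem_L2s_iff {u : Lp ℝ 2 (volume.restrict Ω : Measure (Euc ℓ))} :
    u ∈ L2s M φ Ω ↔ ∃ v : Euc ℓ → ℝ, ∀ᵐ x ∂(volume.restrict Ω), u x = v (φ x) := by
  constructor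
  · intro hu
    have hu' : u ∈ closure (H1s M φ Ω : Set (Lp ℝ 2 (volume.restrict Ω : Measure (Euc ℓ)))) := hu
    obtain ⟨w, hw, hwu⟩ := mem_closure_iff_seq_limit.1 hu'
    choose v hv using fun n => D.exists_comp_of_mem_H1s (hw n)
    -- An `L²`-convergent sequence of functions of the projection has an almost everywhere
    -- convergent subsequence, and the pointwise limit again factors through `φ`.
    obtain ⟨ns, -, hns⟩ := (tendstoInMeasure_of_tendsto_Lp hwu).exists_seq_tendsto_ae
    refine ⟨fun p => limUnder atTop fun i => v (ns i) p, ?_⟩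
    filter_upwards [hns, ae_all_iff.2 hv] with x h1 h2
    refine Eq.symm (Tendsto.limUnder_eq ?_)
    simpa only [h2] using h1
  · rintro ⟨v, hv⟩
    have hvφ : MemLp (fun x => v (φ x)) 2 (volume.restrict Ω) :=
      (memLp_congr_ae hv).1 (Lp.memLp u)
    have hvm := D.aestronglyMeasurable_comp_iff.1 hvφ.1
    have hfin := D.isFiniteMeasure
    -- Distances in `L²(Ω)` between functions of the projection are distances in `L²(ν)`, in which
    -- smooth compactly supported functions are dense because `ν` is finite.
    set ν := Measure.map φ (volume.restrict Ω) with hν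
    have hνfin : IsFiniteMeasure ν := Measure.isFiniteMeasure_map _ _
    have hac : ν ≪ surf k (φ '' Ω) := Measure.AbsolutelyContinuous.mk fun s hs h0 => by
      rw [hν, Measure.map_apply_of_aemeasurable D.aemeasurable_proj hs]
      exact measure_eq_zero_iff_ae_notMem.2
        (D.ae_comp_iff.2 (measure_eq_zero_iff_ae_notMem.1 h0))
    have hvν : MemLp v 2 ν := (memLp_map_measure_iff (hvm.mono_ac hac) D.aemeasurable_proj).2 hvφ
    have hmem : u ∈ closure (H1s M φ Ω : Set (Lp ℝ 2 (volume.restrict Ω : Measure (Euc ℓ)))) := by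
      rw [EMetric.mem_closure_iff]
      intro ε hε
      obtain ⟨δ, hδ, hδε⟩ : ∃ δ : ℝ, 0 < δ ∧ ENNReal.ofReal δ < ε := by
        obtain ⟨q, hq, hqε⟩ := ENNReal.lt_iff_exists_nnreal_btwn.1 hε
        exact ⟨q, by exact_mod_cast hq, by simpa using hqε⟩
      obtain ⟨f, hfc, hf, hfε⟩ := hvν.exist_eLpNorm_sub_le (by simp) one_le_two hδ
      obtain ⟨h1, h2⟩ := D.toLp_comp_mem_H1s (f := f) (hf.of_le (by simp))
      refine ⟨_, h2, ?_⟩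
      have hu' : u = hvφ.toLp := Lp.ext
        ((show (u : Euc ℓ → ℝ) =ᵐ[volume.restrict Ω] fun x => v (φ x) from hv).trans
          hvφ.coeFn_toLp.symm)
      rw [hu', Lp.edist_toLp_toLp]
      refine lt_of_le_of_lt ?_ hδε
      rw [hν, eLpNorm_map_measure ((hvm.mono_ac hac).sub hf.continuous.aestronglyMeasurable)
        D.aemeasurable_proj] at hfε
      exact hfε
    exact hmem

end IsTubularDomain

end

/-! ### Operators generated by forms, and completeness of the spaces on the domain -/

section

section Abstract

/-- Subtracting `b u ·` from the relation for `a + b` leaves `a u · = b w ·`; nonnegativity of `a`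
makes the embedding `ι` contractive. -/
theorem exists_generatedByForms {V W : Type*} [AddCommGroup V] [Module ℝ V] [AddCommGroup W]
    [Module ℝ W] {a b : V → V → ℝ} (hb : IsHilbertProduct b) (ι : W →ₗ[ℝ] V) {D : Set V}
    (hD : D = range ι) (hq : IsHilbertProduct fun x y => a (ι x) (ι y) + b (ι x) (ι y))
    (ha : ∀ x, 0 ≤ a (ι x) (ι x)) (hd : ∀ v, ∀ δ > 0, ∃ w, b (v - ι w) (v - ι w) < δ) :
    ∃ A : V →ₗ.[ℝ] V, IsGeneratedByForms D a b A ∧ IsSelfAdjointFor b A := by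
  obtain ⟨A, h1, h2⟩ := exists_generated hb hq ι (fun w => by linarith [ha w]) hd
  refine ⟨A, fun u w => ?_, h2⟩
  obtain ⟨c, hc, -⟩ := hb
  have hadd : ∀ x y z, b (x + y) z = b x z + b y z := fun x y z => by
    rw [← hc, ← hc, ← hc]
    exact c.add_left x y z
  rw [h1, hD]
  constructor
  · rintro ⟨x, rfl, hx⟩
    refine ⟨⟨x, rfl⟩, ?_⟩
    rintro _ ⟨y, rfl⟩
    have := hx y
    rw [hadd] at this
    linarith
  · rintro ⟨⟨x, rfl⟩, hx⟩
    refine ⟨x, rfl, fun y => ?_⟩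
    rw [hadd, hx _ ⟨y, rfl⟩]
    ring

/-- An isometry of pairs of forms conjugates the generated operators. -/
theorem IsGeneratedByForms.conj {V V' : Type*} [AddCommGroup V] [Module ℝ V] [AddCommGroup V']
    [Module ℝ V'] {a b : V → V → ℝ} {a' b' : V' → V' → ℝ} {D : Set V} {D' : Set V'}
    {A : V →ₗ.[ℝ] V} {A' : V' →ₗ.[ℝ] V'} (h : IsGeneratedByForms D a b A)
    (h' : IsGeneratedByForms D' a' b' A') (j : V ≃ₗ[ℝ] V') (hD : ∀ u, j u ∈ D' ↔ u ∈ D)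
    (ha : ∀ u ∈ D, ∀ w ∈ D, a' (j u) (j w) = a u w) (hb : ∀ u w, b' (j u) (j w) = b u w) :
    A.domain.map j.toLinearMap = A'.domain ∧
      ∀ (u : A.domain) (hu : j u ∈ A'.domain), A u = j.symm (A' ⟨j u, hu⟩) := by
  have hg : ∀ u w, (j u, j w) ∈ A'.graph ↔ (u, w) ∈ A.graph := fun u w => by
    rw [h, h', hD]
    refine and_congr_right fun hu => ⟨fun hx v hv => ?_, fun hx v hv => ?_⟩
    · rw [← ha u hu v hv, hx _ ((hD v).2 hv), hb]
    · obtain ⟨v, rfl⟩ := j.surjective v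
      rw [hD] at hv
      rw [ha u hu v hv, hx v hv, hb]
  refine ⟨?_, fun u hu => ?_⟩
  · ext v
    obtain ⟨u, rfl⟩ := j.surjective v
    rw [LinearPMap.mem_domain_iff]
    constructor
    · rintro ⟨x, hx, hxu⟩
      obtain rfl : x = u := j.injective hxu
      obtain ⟨y, hy⟩ := LinearPMap.mem_domain_iff.1 hx
      exact ⟨j y, (hg _ _).2 hy⟩
    · rintro ⟨y, hy⟩
      obtain ⟨y, rfl⟩ := j.surjective y
      exact ⟨u, LinearPMap.mem_domain_iff.2 ⟨y, (hg _ _).1 hy⟩, rfl⟩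
  · rw [LinearEquiv.eq_symm_apply]
    have h1 := (hg _ _).2 (A.mem_graph u)
    obtain ⟨y, hy, hy'⟩ := (LinearPMap.mem_graph_iff _).1 h1
    obtain rfl : y = ⟨j u, hu⟩ := Subtype.ext hy
    exact hy'.symm

theorem exists_withLp_prodMap {H₁ H₂ : Type*} [NormedAddCommGroup H₁] [InnerProductSpace ℝ H₁]
    [NormedAddCommGroup H₂] [InnerProductSpace ℝ H₂] (E : H₁ →L[ℝ] H₁) (F : H₂ →L[ℝ] H₂) :
    ∃ T : WithLp 2 (H₁ × H₂) →L[ℝ] WithLp 2 (H₁ × H₂),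
      (∀ x, (T x).fst = E x.fst ∧ (T x).snd = F x.snd) ∧
      ∀ x y, inner ℝ (T x) (T y) = inner ℝ (E x.fst) (E y.fst) + inner ℝ (F x.snd) (F y.snd) :=
  ⟨(WithLp.prodContinuousLinearEquiv 2 ℝ H₁ H₂).symm.toContinuousLinearMap ∘L (E.prodMap F) ∘L
    (WithLp.prodContinuousLinearEquiv 2 ℝ H₁ H₂).toContinuousLinearMap, fun _ => ⟨rfl, rfl⟩,
    fun _ _ => WithLp.prod_inner_apply _ _⟩

theorem withLp_prod_ext {H₁ H₂ : Type*} {x y : WithLp 2 (H₁ × H₂)} (h₁ : x.fst = y.fst)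
    (h₂ : x.snd = y.snd) : x = y :=
  (WithLp.equiv 2 (H₁ × H₂)).injective (Prod.ext h₁ h₂)

end Abstract

namespace IsTubularDomain

variable {ℓ k r : ℕ} {M U Ω : Set (Euc ℓ)} {φ : Euc ℓ → Euc ℓ}
  (D : IsTubularDomain k r M U φ Ω)
include D

/-- Multiplication by an operator-valued function, as a bounded operator. -/
theorem exists_multiplication {E F : Type*} [NormedAddCommGroup E] [NormedSpace ℝ E]
    [NormedAddCommGroup F] [NormedSpace ℝ F] [SecondCountableTopology (E →L[ℝ] F)]
    {L : Euc ℓ → E →L[ℝ] F} (hL : ContinuousOn L U) :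
    ∃ T : Lp E 2 (volume.restrict Ω : Measure (Euc ℓ)) →L[ℝ] Lp F 2 (volume.restrict Ω),
      ∀ f, ∀ᵐ x ∂(volume.restrict Ω), T f x = L x (f x) := by
  obtain ⟨C, hC⟩ := D.isCompact_closure.exists_bound_of_continuousOn (hL.mono D.closure_subset)
  have hm : MemLp L ⊤ (volume.restrict Ω) := by
    refine memLp_top_of_bound
      ((hL.mono D.subset).aestronglyMeasurable D.isOpen.measurableSet) C ?_
    filter_upwards [D.ae_mem] with x hx
    exact hC x (subset_closure hx)
  refine ⟨(ContinuousLinearMap.id ℝ (E →L[ℝ] F)).holderL (volume.restrict Ω) ⊤ 2 2 hm.toLp,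
    fun f => ?_⟩
  filter_upwards [(ContinuousLinearMap.id ℝ (E →L[ℝ] F)).coeFn_holder (r := 2) hm.toLp f,
    hm.coeFn_toLp] with x hx hx'
  rw [ContinuousLinearMap.holderL_apply_apply, hx, hx']
  rfl

/-- The graph of the weak gradient on `H¹_s(Ω)` is a closed subspace. -/
theorem exists_gradientGraph :
    ∃ R : Submodule ℝ (WithLp 2 (Lp ℝ 2 (volume.restrict Ω : Measure (Euc ℓ)) ×
      Lp (Euc ℓ) 2 (volume.restrict Ω : Measure (Euc ℓ)))), IsClosed R.carrier ∧
      ∀ x, x ∈ R ↔ IsWeakGradient Ω x.fst x.snd ∧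
        ∀ᵐ z ∂(volume.restrict Ω), normalProj M φ z (x.snd z) = 0 := by
  obtain ⟨T, hT⟩ := D.exists_multiplication (D.proj.continuousOn_normalProj)
  -- The weak gradient relation says that the pair `(u, g)` is orthogonal in `L² × L²` to every
  -- `(∂_h ψ, ψ h)`. The graph is therefore an orthogonal complement intersected with the kernel of
  -- multiplication by `P`, hence closed.
  set S : Set (WithLp 2 (Lp ℝ 2 (volume.restrict Ω : Measure (Euc ℓ)) ×
      Lp (Euc ℓ) 2 (volume.restrict Ω : Measure (Euc ℓ)))) :=
    {s | ∃ ψ : Euc ℓ → ℝ, ContDiff ℝ ∞ ψ ∧ HasCompactSupport ψ ∧ tsupport ψ ⊆ Ω ∧ ∃ h : Euc ℓ,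
      (∀ᵐ x ∂(volume.restrict Ω), s.fst x = fderiv ℝ ψ x h) ∧
      ∀ᵐ x ∂(volume.restrict Ω), s.snd x = ψ x • h} with hS
  have hpair : ∀ {ψ : Euc ℓ → ℝ}, ContDiff ℝ ∞ ψ → HasCompactSupport ψ → ∀ (h : Euc ℓ)
      (s x : WithLp 2 (Lp ℝ 2 (volume.restrict Ω : Measure (Euc ℓ)) ×
        Lp (Euc ℓ) 2 (volume.restrict Ω : Measure (Euc ℓ)))),
      (∀ᵐ z ∂(volume.restrict Ω), s.fst z = fderiv ℝ ψ z h) →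
      (∀ᵐ z ∂(volume.restrict Ω), s.snd z = ψ z • h) →
      inner ℝ s x = (∫ z in Ω, x.fst z * fderiv ℝ ψ z h) + ∫ z in Ω, ψ z * inner ℝ (x.snd z) h := by
    intro ψ h1 h2 h s x hs1 hs2
    rw [WithLp.prod_inner_apply, L2.inner_def, L2.inner_def]
    refine congrArg₂ _ (integral_congr_ae ?_) (integral_congr_ae ?_)
    · filter_upwards [hs1] with z hz
      have : s.ofLp.1 z = fderiv ℝ ψ z h := hz
      rw [this]
      rfl
    · filter_upwards [hs2] with z hz
      have : s.ofLp.2 z = ψ z • h := hz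
      rw [this, real_inner_smul_left, real_inner_comm]
      rfl
  refine ⟨(Submodule.span ℝ S)ᗮ ⊓ LinearMap.ker (T ∘L WithLp.sndL 2 ℝ _ _).toLinearMap,
    (Submodule.isClosed_orthogonal _).inter (ContinuousLinearMap.isClosed_ker _), fun x => ?_⟩
  rw [Submodule.mem_inf, LinearMap.mem_ker]
  refine and_congr ⟨fun hx => ?_, fun hx => ?_⟩ ?_
  · intro ψ h1 h2 h3 h
    have m1 : MemLp (fun x => fderiv ℝ ψ x h) 2 (volume.restrict Ω) :=
      ((h1.continuous_fderiv (by simp)).clm_apply continuous_const).memLp_of_hasCompactSupport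
        (h2.fderiv_apply (𝕜 := ℝ) h)
    have m2 : MemLp (fun x => ψ x • h) 2 (volume.restrict Ω) :=
      (h1.continuous.smul continuous_const).memLp_of_hasCompactSupport h2.smul_right
    have hs := (Submodule.mem_orthogonal _ _).1 hx (WithLp.toLp 2 (m1.toLp, m2.toLp))
      (Submodule.subset_span ⟨ψ, h1, h2, h3, h, m1.coeFn_toLp, m2.coeFn_toLp⟩)
    rw [hpair h1 h2 h (WithLp.toLp 2 (m1.toLp, m2.toLp)) x m1.coeFn_toLp m2.coeFn_toLp] at hs
    linarith
  · refine (Submodule.mem_orthogonal _ _).2 fun s hs => ?_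
    induction hs using Submodule.span_induction with
    | mem s hs =>
      obtain ⟨ψ, h1, h2, h3, h, h4, h5⟩ := hs
      rw [hpair h1 h2 h s x h4 h5, hx ψ h1 h2 h3 h, neg_add_cancel]
    | zero => exact inner_zero_left _
    | add y z _ _ hy hz => rw [inner_add_left, hy, hz, add_zero]
    | smul c y _ hy => rw [real_inner_smul_left, hy, mul_zero]
  · have h1 := hT x.snd
    have h2 : ((T ∘L WithLp.sndL 2 ℝ _ _).toLinearMap x) = T x.snd := rfl
    rw [h2, Lp.eq_zero_iff_ae_eq_zero]
    constructor
    · intro h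
      filter_upwards [h1, h] with z hz hz'
      rw [← hz, hz', Pi.zero_apply]
    · intro h
      filter_upwards [h1, h] with z hz hz'
      rw [hz, hz', Pi.zero_apply]

theorem continuousOn_sqrt_J₀ : ContinuousOn (fun x => √(J₀ M φ x)) U :=
  D.proj.continuousOn_J₀.sqrt

theorem continuousOn_inv_sqrt_J₀ : ContinuousOn (fun x => (√(J₀ M φ x))⁻¹) U :=
  D.continuousOn_sqrt_J₀.inv₀ fun _ hx => (Real.sqrt_pos.2 (D.proj.J₀_pos hx)).ne'

theorem exists_smul {c : Euc ℓ → ℝ} (hc : ContinuousOn c U) :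
    ∃ T : Lp ℝ 2 (volume.restrict Ω : Measure (Euc ℓ)) →L[ℝ] Lp ℝ 2 (volume.restrict Ω),
      ∀ f, ∀ᵐ x ∂(volume.restrict Ω), T f x = c x * f x := by
  have h : ContinuousOn (fun x => c x • ContinuousLinearMap.id ℝ ℝ) U :=
    hc.smul continuousOn_const
  exact D.exists_multiplication h

/-- The space `L²_s(Ω)` is a Hilbert space. -/
theorem isHilbertProduct_L2s : IsHilbertProduct fun u w : L2s M φ Ω => b₀ M φ Ω u w := by
  obtain ⟨E, hE⟩ := D.exists_smul D.continuousOn_sqrt_J₀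
  obtain ⟨E', hE'⟩ := D.exists_smul D.continuousOn_inv_sqrt_J₀
  refine isHilbertProduct_submodule (E := E) (E' := E') (Submodule.isClosed_topologicalClosure _)
    (fun x _ => ?_) fun u w => ?_
  · refine Lp.ext ?_
    filter_upwards [hE x, hE' (E x), D.ae_mem] with z h1 h2 hz
    rw [h2, h1]
    exact inv_mul_cancel_left₀ (Real.sqrt_pos.2 (D.proj.J₀_pos (D.subset hz))).ne' _
  · rw [L2.inner_def]
    refine integral_congr_ae ?_
    filter_upwards [hE u, hE w, D.ae_mem] with z h1 h2 hz
    rw [h1, h2]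
    simp only [RCLike.inner_apply, conj_trivial]
    have := Real.mul_self_sqrt (D.proj.J₀_pos (D.subset hz)).le
    linear_combination (-(u : Euc ℓ → ℝ) z * (w : Euc ℓ → ℝ) z) * this

set_option maxHeartbeats 1000000 in
/-- The space `H¹_s(Ω)` is a Hilbert space. -/
theorem isHilbertProduct_H1s :
    IsHilbertProduct fun u w : H1s M φ Ω => a₀ M U φ Ω u w + b₀ M φ Ω u w := by
  have hJ : ∀ {x}, x ∈ Ω → √(J₀ M φ x) ≠ 0 := fun hx =>
    (Real.sqrt_pos.2 (D.proj.J₀_pos (D.subset hx))).ne'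
  obtain ⟨R, hRc, hR⟩ := D.exists_gradientGraph
  obtain ⟨E, hE⟩ := D.exists_smul D.continuousOn_sqrt_J₀
  obtain ⟨E', hE'⟩ := D.exists_smul D.continuousOn_inv_sqrt_J₀
  -- `√J₀ S₀ᵀ` turns `a₀` into an `L²` product, and `(√J₀)⁻¹ Dφᵀ` undoes it on tangential gradients;
  -- both are bounded multipliers on `Ω`.
  have c1 : ContinuousOn (fun x => √(J₀ M φ x) • ContinuousLinearMap.adjoint (S₀ M U φ x)) U :=
    D.continuousOn_sqrt_J₀.smul (continuousOn_adjoint D.proj.continuousOn_S₀)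
  have c2 : ContinuousOn
      (fun x => (√(J₀ M φ x))⁻¹ • ContinuousLinearMap.adjoint (fderiv ℝ φ x)) U :=
    D.continuousOn_inv_sqrt_J₀.smul (continuousOn_adjoint D.proj.continuousOn_fderiv)
  obtain ⟨F, hF⟩ := D.exists_multiplication c1
  obtain ⟨F', hF'⟩ := D.exists_multiplication c2
  obtain ⟨T, hT, hTi⟩ := exists_withLp_prodMap E F
  obtain ⟨T', hT', -⟩ := exists_withLp_prodMap E' F'
  have hmem : ∀ x ∈ R, x.fst ∈ H1s M φ Ω := fun x hx =>
    ⟨x.snd, Lp.memLp _, ((hR x).1 hx).1, ((hR x).1 hx).2⟩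
  obtain ⟨f, hf⟩ : ∃ f : R →ₗ[ℝ] H1s M φ Ω, ∀ x : R,
      (f x : Lp ℝ 2 (volume.restrict Ω : Measure (Euc ℓ))) = x.1.fst :=
    ⟨((WithLp.fstL 2 ℝ _ _).toLinearMap ∘ₗ R.subtype).codRestrict _ fun x => hmem x x.2,
      fun x => rfl⟩
  have hgrad : ∀ x : R, weakGradient Ω (f x : Lp ℝ 2 (volume.restrict Ω : Measure (Euc ℓ)))
      =ᵐ[volume.restrict Ω] x.1.snd := fun x => by
    rw [hf]
    exact weakGradient_ae_eq D.isOpen (Lp.memLp _) ((hR x).1 x.2).1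
  -- The graph is identified with `H¹_s(Ω)` by its first component; injectivity is uniqueness of the
  -- weak gradient.
  have hbij : Function.Bijective f := by
    constructor
    · intro x y hxy
      have h1 := hgrad x
      rw [hxy] at h1
      have h2 : x.1.snd = y.1.snd :=
        Lp.ext (h1.symm.trans (hgrad y))
      have h3 : x.1.fst = y.1.fst := by
        rw [← hf, ← hf, hxy]
      exact Subtype.ext (withLp_prod_ext h3 h2)
    · rintro ⟨u, hu⟩
      obtain ⟨g, hg, hug, hgP⟩ := id hu
      have hx : WithLp.toLp 2 (u, hg.toLp) ∈ R := by
        rw [hR]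
        refine ⟨hug.congr_ae (ae_eq_refl _) hg.coeFn_toLp.symm, ?_⟩
        filter_upwards [hgP, hg.coeFn_toLp] with z h1 h2
        exact (congrArg _ h2).trans h1
      exact ⟨⟨_, hx⟩, Subtype.ext (hf _)⟩
  let eq := LinearEquiv.ofBijective f hbij
  have hbE : ∀ x y : R, b₀ M φ Ω (f x) (f y) = inner ℝ (E x.1.fst) (E y.1.fst) := fun x y => by
    rw [L2.inner_def]
    refine integral_congr_ae ?_
    filter_upwards [hE x.1.fst, hE y.1.fst, D.ae_mem] with z h1 h2 hz
    rw [h1, h2, hf, hf]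
    simp only [RCLike.inner_apply, conj_trivial]
    have := Real.mul_self_sqrt (D.proj.J₀_pos (D.subset hz)).le
    linear_combination (-(x.1.fst : Euc ℓ → ℝ) z * (y.1.fst : Euc ℓ → ℝ) z) * this
  have haF : ∀ x y : R, a₀ M U φ Ω (f x) (f y) = inner ℝ (F x.1.snd) (F y.1.snd) := fun x y => by
    rw [L2.inner_def]
    refine integral_congr_ae ?_
    filter_upwards [hF x.1.snd, hF y.1.snd, hgrad x, hgrad y, D.ae_mem] with z h1 h2 h3 h4 hz
    rw [h1, h2, h3, h4, smul_apply, smul_apply, real_inner_smul_left, real_inner_smul_right,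
      ← mul_assoc, Real.mul_self_sqrt (D.proj.J₀_pos (D.subset hz)).le]
  have key : IsHilbertProduct fun x y : R => a₀ M U φ Ω (f x) (f y) + b₀ M φ Ω (f x) (f y) := by
    refine isHilbertProduct_submodule (E := T) (E' := T') hRc (fun x hx => ?_) fun x y => ?_
    · refine withLp_prod_ext ?_ ?_
      · rw [(hT' _).1, (hT _).1]
        refine Lp.ext ?_
        filter_upwards [hE x.fst, hE' (E x.fst), D.ae_mem] with z h1 h2 hz
        rw [h2, h1, inv_mul_cancel_left₀ (hJ hz)]
      · rw [(hT' _).2, (hT _).2]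
        refine Lp.ext ?_
        filter_upwards [hF x.snd, hF' (F x.snd), D.ae_mem, ((hR x).1 hx).2] with z h1 h2 hz h3
        rw [h2, h1, smul_apply, smul_apply, map_smul, inv_smul_smul₀ (hJ hz),
          D.proj.adjoint_fderiv_adjoint_S₀ (D.subset hz)
            (IsNormalProjection.normalProj_eq_zero_iff.1 h3)]
    · refine Eq.trans ?_ (hTi x y).symm
      rw [add_comm, hbE, haF]
  refine key.of_equiv eq.symm fun u w => ?_
  have h1 : ∀ u, f (eq.symm u) = u := fun u => eq.apply_symm_apply u
  rw [h1, h1]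

end IsTubularDomain

end

/-! ### The isometry between domain and submanifold -/

section

namespace IsTubularDomain

variable {ℓ k r : ℕ} {M U Ω : Set (Euc ℓ)} {φ : Euc ℓ → Euc ℓ}
  (D : IsTubularDomain k r M U φ Ω)
include D

theorem mem_L2w_iff {v : Euc ℓ →ₘ[surf k (φ '' Ω)] ℝ} :
    v ∈ L2w k (secMeas k φ Ω) (φ '' Ω) ↔ MemLp (fun x => v (φ x)) 2 (volume.restrict Ω) := by
  have hv := AEEqFun.aestronglyMeasurable v
  rw [← D.memLp_iff hv]
  exact ⟨fun h => h.2, fun h => ⟨D.isL2Loc hv h, h⟩⟩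

/-- The identification of `L²_s(Ω)` with `L²(μ, φ(Ω))`. -/
theorem exists_equiv : ∃ j : L2s M φ Ω ≃ₗ[ℝ] L2w k (secMeas k φ Ω) (φ '' Ω),
    ∀ u v, j u = v ↔
      ∀ᵐ x ∂(volume.restrict Ω), (u : Euc ℓ → ℝ) x = (v : Euc ℓ → ℝ) (φ x) := by
  have hm : ∀ v : L2w k (secMeas k φ Ω) (φ '' Ω),
      MemLp (fun x => (v : Euc ℓ → ℝ) (φ x)) 2 (volume.restrict Ω) := fun v =>
    D.mem_L2w_iff.1 v.2
  -- The explicit direction is `v ↦ v ∘ φ`; `j` is its inverse.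
  let f : L2w k (secMeas k φ Ω) (φ '' Ω) →ₗ[ℝ] L2s M φ Ω :=
    { toFun := fun v => ⟨(hm v).toLp, D.mem_L2s_iff.2 ⟨_, (hm v).coeFn_toLp⟩⟩
      map_add' := fun v w => by
        refine Subtype.ext (Lp.ext ?_)
        refine (hm (v + w)).coeFn_toLp.trans (EventuallyEq.trans ?_ (Lp.coeFn_add _ _).symm)
        filter_upwards [(hm v).coeFn_toLp, (hm w).coeFn_toLp, D.ae_comp_iff.2
          (AEEqFun.coeFn_add (v : Euc ℓ →ₘ[surf k (φ '' Ω)] ℝ) w)] with x h1 h2 h3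
        rw [Pi.add_apply, h1, h2]
        exact h3
      map_smul' := fun c v => by
        refine Subtype.ext (Lp.ext ?_)
        refine (hm (c • v)).coeFn_toLp.trans (EventuallyEq.trans ?_ (Lp.coeFn_smul _ _).symm)
        filter_upwards [(hm v).coeFn_toLp, D.ae_comp_iff.2
          (AEEqFun.coeFn_smul c (v : Euc ℓ →ₘ[surf k (φ '' Ω)] ℝ))] with x h1 h2
        rw [Pi.smul_apply, h1]
        exact h2 }
  have hf : ∀ v u, f v = u ↔
      ∀ᵐ x ∂(volume.restrict Ω), (u : Euc ℓ → ℝ) x = (v : Euc ℓ → ℝ) (φ x) := fun v u => by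
    constructor
    · rintro rfl
      exact (hm v).coeFn_toLp
    · intro h
      exact Subtype.ext (Lp.ext ((hm v).coeFn_toLp.trans (EventuallyEq.symm h)))
  have hbij : Function.Bijective f := by
    refine ⟨fun v w hvw => ?_, fun u => ?_⟩
    · refine Subtype.ext (AEEqFun.ext (D.ae_comp_iff.1 ?_))
      filter_upwards [(hf v _).1 rfl, (hf w _).1 hvw.symm] with x h1 h2
      rw [← h1, ← h2]
    · obtain ⟨v, hv⟩ := D.mem_L2s_iff.1 u.2
      have hvφ : MemLp (fun x => v (φ x)) 2 (volume.restrict Ω) :=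
        (memLp_congr_ae hv).1 (Lp.memLp _)
      have hvm := D.aestronglyMeasurable_comp_iff.1 hvφ.1
      have hae := D.ae_comp_iff.2 (AEEqFun.coeFn_mk v hvm)
      have hmem : AEEqFun.mk v hvm ∈ L2w k (secMeas k φ Ω) (φ '' Ω) :=
        D.mem_L2w_iff.2 ((memLp_congr_ae hae).2 hvφ)
      refine ⟨⟨_, hmem⟩, (hf _ _).2 ?_⟩
      filter_upwards [hv, hae] with x h1 h2
      rw [h1, h2]
  refine ⟨(LinearEquiv.ofBijective f hbij).symm, fun u v => ?_⟩
  rw [← hf, LinearEquiv.symm_apply_eq, eq_comm]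
  rfl

/-- The coarea formula applied to the product `v v'`. -/
theorem bw_eq {u u' v v' : Euc ℓ → ℝ} (hv : AEStronglyMeasurable v (surf k (φ '' Ω)))
    (hv' : AEStronglyMeasurable v' (surf k (φ '' Ω)))
    (h : ∀ᵐ x ∂(volume.restrict Ω), u x = v (φ x))
    (h' : ∀ᵐ x ∂(volume.restrict Ω), u' x = v' (φ x)) :
    bw k (secMeas k φ Ω) (φ '' Ω) v v' = b₀ M φ Ω u u' := by
  have := D.integral_eq (hv.mul hv')
  simp only [Pi.mul_apply, ← mul_assoc] at this
  refine this.trans (integral_congr_ae ?_)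
  filter_upwards [h, h'] with x h1 h2
  rw [h1, h2]

/-- The coarea formula applied to `⟨∇v, ∇v'⟩`, whose composition with `φ` is `⟨S₀ᵀ ∇u, S₀ᵀ ∇u'⟩`. -/
theorem aw_eq {u u' : Lp ℝ 2 (volume.restrict Ω : Measure (Euc ℓ))} {v v' : Euc ℓ → ℝ}
    (hu : u ∈ H1s M φ Ω) (hu' : u' ∈ H1s M φ Ω) (h : ∀ᵐ x ∂(volume.restrict Ω), u x = v (φ x))
    (h' : ∀ᵐ x ∂(volume.restrict Ω), u' x = v' (φ x)) :
    aw k r M (secMeas k φ Ω) (φ '' Ω) v v' = a₀ M U φ Ω u u' := by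
  have key : ∀ {u : Lp ℝ 2 (volume.restrict Ω : Measure (Euc ℓ))} {v : Euc ℓ → ℝ},
      u ∈ H1s M φ Ω → (∀ᵐ x ∂(volume.restrict Ω), u x = v (φ x)) →
      AEStronglyMeasurable (surfaceGradient k r M (φ '' Ω) v) (surf k (φ '' Ω)) ∧
      ∀ᵐ x ∂(volume.restrict Ω), ContinuousLinearMap.adjoint (S₀ M U φ x) (weakGradient Ω u x) =
        surfaceGradient k r M (φ '' Ω) v (φ x) := by
    intro u v hu h
    obtain ⟨V, hV, hV2⟩ := (D.mem_H1s_iff h).1 hu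
    rw [D.memLp_iff hV.isL2Loc.1] at hV2
    have hvφ : MemLp (fun x => v (φ x)) 2 (volume.restrict Ω) := (memLp_congr_ae h).1 (Lp.memLp u)
    have hvm := D.aestronglyMeasurable_comp_iff.1 hvφ.1
    have hvL := D.isL2Loc hvm ((D.memLp_iff hvm).2 hvφ)
    exact ⟨hV.isL2Loc.1.congr
      (D.surfaceGradient_ae_eq hV hvL (locallyIntegrableOn_of_memLp hvφ)).symm,
      (D.weakGradient_comp_ae_eq (Lp.memLp u) h hV hvL hV2).2.2⟩
  obtain ⟨m1, e1⟩ := key hu h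
  obtain ⟨m2, e2⟩ := key hu' h'
  refine (D.integral_eq (m1.inner (𝕜 := ℝ) m2)).trans (integral_congr_ae ?_)
  filter_upwards [e1, e2] with x h1 h2
  rw [h1, h2]

theorem mem_H1w_iff {u : Lp ℝ 2 (volume.restrict Ω : Measure (Euc ℓ))}
    {v : Euc ℓ →ₘ[surf k (φ '' Ω)] ℝ} (h : ∀ᵐ x ∂(volume.restrict Ω), u x = v (φ x)) :
    v ∈ H1w k r M (secMeas k φ Ω) (φ '' Ω) ↔ u ∈ H1s M φ Ω := by
  rw [D.mem_H1s_iff h]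
  exact ⟨fun hv => hv.2, fun hv => ⟨D.mem_L2w_iff.2 ((memLp_congr_ae h).1 (Lp.memLp u)), hv⟩⟩

omit D in
theorem a₀_self_nonneg (u : Euc ℓ → ℝ) : 0 ≤ a₀ M U φ Ω u u :=
  integral_nonneg fun _ => mul_nonneg (abs_nonneg _) real_inner_self_nonneg

omit D in
theorem H1s_le_L2s : H1s M φ Ω ≤ L2s M φ Ω := Submodule.le_topologicalClosure _

/-- The space `H¹_s(Ω)` is dense in `L²_s(Ω)`. -/
theorem exists_b₀_sub_lt (v : L2s M φ Ω) {δ : ℝ} (hδ : 0 < δ) :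
    ∃ w : H1s M φ Ω, b₀ M φ Ω (v - Submodule.inclusion H1s_le_L2s w : L2s M φ Ω)
      (v - Submodule.inclusion H1s_le_L2s w : L2s M φ Ω) < δ := by
  obtain ⟨E, hE⟩ := D.exists_smul D.continuousOn_sqrt_J₀
  have hb : ∀ u : Lp ℝ 2 (volume.restrict Ω : Measure (Euc ℓ)), b₀ M φ Ω u u = ‖E u‖ ^ 2 := by
    intro u
    rw [← real_inner_self_eq_norm_sq, L2.inner_def]
    refine integral_congr_ae ?_
    filter_upwards [hE u, D.ae_mem] with z h1 hz
    rw [h1]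
    simp only [RCLike.inner_apply, conj_trivial]
    have := Real.mul_self_sqrt (D.proj.J₀_pos (D.subset hz)).le
    linear_combination (-(u : Euc ℓ → ℝ) z * (u : Euc ℓ → ℝ) z) * this
  have hcont : Continuous fun w : Lp ℝ 2 (volume.restrict Ω : Measure (Euc ℓ)) =>
      ‖E (v - w)‖ ^ 2 := by fun_prop
  have hopen : IsOpen {w : Lp ℝ 2 (volume.restrict Ω : Measure (Euc ℓ)) | ‖E (v - w)‖ ^ 2 < δ} :=
    isOpen_lt hcont continuous_const
  have hv : (v : Lp ℝ 2 (volume.restrict Ω : Measure (Euc ℓ))) ∈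
      closure (H1s M φ Ω : Set (Lp ℝ 2 (volume.restrict Ω : Measure (Euc ℓ)))) := v.2
  obtain ⟨w, hw, hw'⟩ := mem_closure_iff.1 hv _ hopen (by simpa using hδ)
  refine ⟨⟨w, hw'⟩, ?_⟩
  have h1 := hb (v - Submodule.inclusion H1s_le_L2s ⟨w, hw'⟩ : L2s M φ Ω)
  exact h1.trans_lt hw

/-- The identification of `L²_s(Ω)` with `L²(μ, φ(Ω))` is compatible with the forms. -/
theorem exists_isometry : ∃ j : L2s M φ Ω ≃ₗ[ℝ] L2w k (secMeas k φ Ω) (φ '' Ω),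
    (∀ u v, j u = v ↔
      ∀ᵐ x ∂(volume.restrict Ω), (u : Euc ℓ → ℝ) x = (v : Euc ℓ → ℝ) (φ x)) ∧
    (∀ u w, bw k (secMeas k φ Ω) (φ '' Ω) (j u) (j w) = b₀ M φ Ω u w) ∧
    (∀ u w : L2s M φ Ω, (u : Lp ℝ 2 (volume.restrict Ω)) ∈ H1s M φ Ω →
      (w : Lp ℝ 2 (volume.restrict Ω)) ∈ H1s M φ Ω →
      aw k r M (secMeas k φ Ω) (φ '' Ω) (j u) (j w) = a₀ M U φ Ω u w) ∧
    ∀ u : L2s M φ Ω, (j u : Euc ℓ →ₘ[surf k (φ '' Ω)] ℝ) ∈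
      H1w k r M (secMeas k φ Ω) (φ '' Ω) ↔ (u : Lp ℝ 2 (volume.restrict Ω)) ∈ H1s M φ Ω := by
  obtain ⟨j, hj⟩ := D.exists_equiv
  have hjae : ∀ u : L2s M φ Ω, ∀ᵐ x ∂(volume.restrict Ω),
      (u : Euc ℓ → ℝ) x = (j u : Euc ℓ → ℝ) (φ x) := fun u => (hj u _).1 rfl
  exact ⟨j, hj, fun u w => D.bw_eq (AEEqFun.aestronglyMeasurable _)
    (AEEqFun.aestronglyMeasurable _) (hjae u) (hjae w),
    fun u w hu hw => D.aw_eq hu hw (hjae u) (hjae w), fun u => D.mem_H1w_iff (hjae u)⟩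

omit D in
theorem exists_equiv_H1w {G : Set (Euc ℓ)} {μ : Euc ℓ → ℝ} (j : L2s M φ Ω ≃ₗ[ℝ] L2w k μ G)
    (hj : ∀ u : L2s M φ Ω, (j u : Euc ℓ →ₘ[surf k G] ℝ) ∈ H1w k r M μ G ↔
      (u : Lp ℝ 2 (volume.restrict Ω)) ∈ H1s M φ Ω) :
    ∃ e : H1s M φ Ω ≃ₗ[ℝ] H1w k r M μ G, ∀ u, (e u : Euc ℓ →ₘ[surf k G] ℝ) =
      j (Submodule.inclusion H1s_le_L2s u) := by
  let f : H1s M φ Ω →ₗ[ℝ] H1w k r M μ G :=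
    (Submodule.subtype _ ∘ₗ j.toLinearMap ∘ₗ
      Submodule.inclusion H1s_le_L2s).codRestrict _ fun u => (hj _).2 u.2
  have hf : ∀ u, (f u : Euc ℓ →ₘ[surf k G] ℝ) = j (Submodule.inclusion H1s_le_L2s u) :=
    fun u => rfl
  refine ⟨LinearEquiv.ofBijective f ⟨fun u w huw => ?_, fun v => ?_⟩, hf⟩
  · have h1 : j (Submodule.inclusion H1s_le_L2s u) = j (Submodule.inclusion H1s_le_L2s w) :=
      Subtype.ext (by rw [← hf, ← hf, huw])
    exact Submodule.inclusion_injective _ (j.injective h1)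
  · have h1 : j (j.symm ⟨v, v.2.1⟩) = ⟨v, v.2.1⟩ := j.apply_symm_apply _
    have h2 := (hj (j.symm ⟨v, v.2.1⟩)).1 (by rw [h1]; exact v.2)
    exact ⟨⟨_, h2⟩, Subtype.ext ((hf _).trans (congrArg Subtype.val h1))⟩

/-- The self-adjoint operator generated by `a₀` and `b₀`. -/
theorem exists_operator : ∃ A : L2s M φ Ω →ₗ.[ℝ] L2s M φ Ω,
    IsGeneratedByForms {u : L2s M φ Ω | (u : Lp ℝ 2 (volume.restrict Ω)) ∈ H1s M φ Ω}
      (fun u w => a₀ M U φ Ω u w) (fun u w => b₀ M φ Ω u w) A ∧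
    IsSelfAdjointFor (fun u w : L2s M φ Ω => b₀ M φ Ω u w) A :=
  exists_generatedByForms (a := fun u w : L2s M φ Ω => a₀ M U φ Ω u w) D.isHilbertProduct_L2s
    (Submodule.inclusion H1s_le_L2s)
    (Set.ext fun u => ⟨fun hu => ⟨⟨_, hu⟩, rfl⟩, by rintro ⟨w, rfl⟩; exact w.2⟩)
    D.isHilbertProduct_H1s (fun u => a₀_self_nonneg _) fun v _ hδ => D.exists_b₀_sub_lt v hδ

/-- The self-adjoint operator generated by weighted forms on the submanifold. -/
theorem exists_weighted_operator {G : Set (Euc ℓ)} {μ : Euc ℓ → ℝ}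
    (j : L2s M φ Ω ≃ₗ[ℝ] L2w k μ G) (hb : ∀ u w, bw k μ G (j u) (j w) = b₀ M φ Ω u w)
    (ha : ∀ u w : L2s M φ Ω, (u : Lp ℝ 2 (volume.restrict Ω)) ∈ H1s M φ Ω →
      (w : Lp ℝ 2 (volume.restrict Ω)) ∈ H1s M φ Ω →
      aw k r M μ G (j u) (j w) = a₀ M U φ Ω u w)
    (hj : ∀ u : L2s M φ Ω, (j u : Euc ℓ →ₘ[surf k G] ℝ) ∈ H1w k r M μ G ↔
      (u : Lp ℝ 2 (volume.restrict Ω)) ∈ H1s M φ Ω)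
    (hL : IsHilbertProduct fun v w : L2w k μ G => bw k μ G v w) :
    ∃ B : L2w k μ G →ₗ.[ℝ] L2w k μ G,
      IsGeneratedByForms {v : L2w k μ G | (v : Euc ℓ →ₘ[surf k G] ℝ) ∈ H1w k r M μ G}
        (fun v w => aw k r M μ G v w) (fun v w => bw k μ G v w) B ∧
      IsSelfAdjointFor (fun v w : L2w k μ G => bw k μ G v w) B := by
  refine exists_generatedByForms (a := fun v w : L2w k μ G => aw k r M μ G v w) hL
    (j.toLinearMap ∘ₗ Submodule.inclusion H1s_le_L2s) ?_ ?_ (fun u => ?_) fun v δ hδ => ?_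
  · ext v
    obtain ⟨u, rfl⟩ := j.surjective v
    refine (hj u).trans ⟨fun hu => ⟨⟨_, hu⟩, rfl⟩, ?_⟩
    rintro ⟨w, hw⟩
    rw [← j.injective hw]
    exact w.2
  · have h := D.isHilbertProduct_H1s
    refine h.of_equiv (LinearEquiv.refl ℝ _) fun u w => ?_
    exact congrArg₂ _ (ha _ _ u.2 w.2) (hb _ _)
  · exact (a₀_self_nonneg _).trans_eq (ha _ _ u.2 u.2).symm
  · obtain ⟨w, hw⟩ := D.exists_b₀_sub_lt (j.symm v) hδ
    refine ⟨w, ?_⟩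
    rw [← hb, map_sub, j.apply_symm_apply] at hw
    exact hw

end IsTubularDomain

end

end CurvedThin

/-! ### The theorem -/

set_option maxHeartbeats 1000000 in
theorem theorem3p4 (ℓ k r : ℕ) (hℓ : 2 ≤ ℓ) (hk : 0 < k) (hkℓ : k < ℓ) (hr : 2 ≤ r)
    (M U Ω : Set (Euc ℓ)) (φ : Euc ℓ → Euc ℓ)
    (hM : IsEmbeddedSubmanifold k r M) (hφ : IsTubularNbhd r M U φ)
    (hΩ_open : IsOpen Ω) (hΩ_conn : IsConnected Ω) (hΩ_bdd : Bornology.IsBounded Ω)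
    (hΩ_U : closure Ω ⊆ U) (hΩ_sec : HasConnectedNormalSections M φ Ω)
    (G : Set (Euc ℓ)) (hG : G = φ '' Ω)
    (μ : Euc ℓ → ℝ) (hμ : μ = secMeas k φ Ω) :
    -- the four spaces are Hilbert spaces
    IsHilbertProduct (fun v w : L2w k μ G => bw k μ G v w) ∧
    IsHilbertProduct (fun v w : H1w k r M μ G => aw k r M μ G v w + bw k μ G v w) ∧
    IsHilbertProduct (fun u w : L2s M φ Ω => b₀ M φ Ω u w) ∧
    IsHilbertProduct (fun u w : H1s M φ Ω => a₀ M U φ Ω u w + b₀ M φ Ω u w) ∧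
    -- the map `j : u ↦ v`, where `u = v ∘ φ` almost everywhere in `Ω`
    ∃ j : L2s M φ Ω ≃ₗ[ℝ] L2w k μ G,
      (∀ (u : L2s M φ Ω) (v : L2w k μ G), j u = v ↔
        ∀ᵐ x ∂(volume.restrict Ω), (u : Euc ℓ → ℝ) x = (v : Euc ℓ → ℝ) (φ x)) ∧
      -- `j` is isometric from `L²_s(Ω)` onto `L²(μ, G)`
      (∀ u w : L2s M φ Ω, bw k μ G (j u) (j w) = b₀ M φ Ω u w) ∧
      -- `j` restricts to an isometric map from `H¹_s(Ω)` onto `H¹(μ, G)`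
      (∀ v : Euc ℓ →ₘ[surf k G] ℝ, v ∈ H1w k r M μ G ↔
        ∃ u : L2s M φ Ω, (u : Lp ℝ 2 (volume.restrict Ω)) ∈ H1s M φ Ω ∧ j u = v) ∧
      (∀ u w : L2s M φ Ω, (u : Lp ℝ 2 (volume.restrict Ω)) ∈ H1s M φ Ω →
        (w : Lp ℝ 2 (volume.restrict Ω)) ∈ H1s M φ Ω →
        aw k r M μ G (j u) (j w) + bw k μ G (j u) (j w) =
          a₀ M U φ Ω u w + b₀ M φ Ω u w) ∧
      -- the self-adjoint operators `A₀` and `A_μ` exist, and `j` conjugates them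
      ∃ (A₀ : L2s M φ Ω →ₗ.[ℝ] L2s M φ Ω) (Aμ : L2w k μ G →ₗ.[ℝ] L2w k μ G),
        IsGeneratedByForms {u : L2s M φ Ω | (u : Lp ℝ 2 (volume.restrict Ω)) ∈ H1s M φ Ω}
          (fun u w => a₀ M U φ Ω u w) (fun u w => b₀ M φ Ω u w) A₀ ∧
        IsSelfAdjointFor (fun u w : L2s M φ Ω => b₀ M φ Ω u w) A₀ ∧
        IsGeneratedByForms {v : L2w k μ G | (v : Euc ℓ →ₘ[surf k G] ℝ) ∈ H1w k r M μ G}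
          (fun v w => aw k r M μ G v w) (fun v w => bw k μ G v w) Aμ ∧
        IsSelfAdjointFor (fun v w : L2w k μ G => bw k μ G v w) Aμ ∧
        A₀.domain.map j.toLinearMap = Aμ.domain ∧
        ∀ (u : A₀.domain) (hu : j u ∈ Aμ.domain), A₀ u = j.symm (Aμ ⟨j u, hu⟩) := by
  subst hG hμ
  have D : IsTubularDomain k r M U φ Ω :=
    ⟨⟨hr, hM, hφ⟩, hΩ_open, hΩ_bdd, hΩ_U, hΩ_sec⟩
  obtain ⟨j, hj, hb, ha, hmem⟩ := D.exists_isometry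
  have hL := D.isHilbertProduct_L2s
  have hH := D.isHilbertProduct_H1s
  -- Completeness of the weighted spaces on the submanifold is inherited from the spaces on `Ω`
  -- through the isometry.
  have hLw : IsHilbertProduct fun v w : L2w k (secMeas k φ Ω) (φ '' Ω) =>
      bw k (secMeas k φ Ω) (φ '' Ω) v w :=
    hL.of_equiv j.symm fun v w => by rw [← hb, j.apply_symm_apply, j.apply_symm_apply]
  obtain ⟨f, hf⟩ := IsTubularDomain.exists_equiv_H1w j hmem
  have hHw : IsHilbertProduct fun v w : H1w k r M (secMeas k φ Ω) (φ '' Ω) =>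
      aw k r M (secMeas k φ Ω) (φ '' Ω) v w + bw k (secMeas k φ Ω) (φ '' Ω) v w := by
    refine hH.of_equiv f.symm fun v w => ?_
    obtain ⟨u, rfl⟩ := f.surjective v
    obtain ⟨w, rfl⟩ := f.surjective w
    rw [f.symm_apply_apply, f.symm_apply_apply, hf, hf, ha _ _ u.2 w.2, hb]
    rfl
  refine ⟨hLw, hHw, hL, hH, j, hj, hb, fun v => ⟨fun hv => ?_, ?_⟩, fun u w hu hw => ?_, ?_⟩
  · obtain ⟨u, hu⟩ := f.surjective ⟨v, hv⟩
    exact ⟨Submodule.inclusion IsTubularDomain.H1s_le_L2s u, u.2, by rw [← hf, hu]⟩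
  · rintro ⟨u, hu, rfl⟩
    exact (hmem u).2 hu
  · rw [ha u w hu hw, hb]
  · obtain ⟨A, hA, hAs⟩ := D.exists_operator
    obtain ⟨B, hB, hBs⟩ := D.exists_weighted_operator j hb ha hmem hLw
    obtain ⟨h1, h2⟩ := hA.conj hB j hmem (fun u hu w hw => ha u w hu hw) hb
    exact ⟨A, B, hA, hAs, hB, hBs, h1, h2⟩
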